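/- Let $-\frac12<s<0$, and let $\|q\|_{H^s}^2=\int(4+\xi^2)^s|\hat q(\xi)|^2\,d\xi$ with $\hat q(\xi)=\frac1{\sqrt{2\pi}}\int e^{-i\xi x}q(x)\,dx$. Fix a sign $\pm$ and set $r=\pm\bar q$. For real $|\kappa|\ge1$ let $$L_0(\kappa)=\begin{bmatrix}\kappa-\partial&0\\0&\kappa+\partial\end{bmatrix},\qquad L(\kappa)=L_0(\kappa)+\begin{bmatrix}0&q\\-r&0\end{bmatrix},\qquad R_0=L_0^{-1},\qquad R=L^{-1}=\sqrt{R_0}\bigl(1+\sqrt{R_0}(L-L_0)\sqrt{R_0}\bigr)^{-1}\sqrt{R_0},$$ with $z^{-1/2}$ the principal branch in the Fourier multiplier $\sqrt{R_0}$, and let $G$, $G_0$ be the integral kernels of $R$, $R_0$. When $G-G_0$ is continuous put $$g_{12}(x;\kappa)=\mathrm{sgn}(\kappa)(G-G_0)_{12}(x,x),\quad g_{21}(x;\kappa)=\mathrm{sgn}(\kappa)(G-G_0)_{21}(x,x),\quad \gamma(x;\kappa)=\mathrm{sgn}(\kappa)\bigl[(G-G_0)_{11}+(G-G_0)_{22}\bigr](x,x),$$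 $$\rho(\kappa)=\frac{q\,g_{21}(\kappa)-r\,g_{12}(\kappa)}{2+\gamma(\kappa)},\qquad A(\kappa;q)=\mathrm{sgn}(\kappa)\sum_{m\ge1}\frac{(-1)^{m-1}}m\,\mathrm{tr}\{(\Lambda\Gamma)^m\},$$ where $\Lambda=(\kappa-\partial)^{-1/2}q(\kappa+\partial)^{-1/2}$ and $\Gamma=(\kappa+\partial)^{-1/2}r(\kappa-\partial)^{-1/2}$ on $L^2(\mathbb R)$. There is $\delta>0$, depending only on $s$, such that the following hold for either sign. 1. Let $q\in H^s(\mathbb R)$ with $\|q\|_{H^s}\le\delta$ and let $\kappa\in\mathbb R$ with $|\kappa|\ge1$. Then $1+\sqrt{R_0}(L-L_0)\sqrt{R_0}$ is invertible on $L^2(\mathbb R;\mathbb C^2)$, $G-G_0$ exists and is continuous, $2+\gamma(\kappa)$ has no zeros, the operators $(\Lambda\Gamma)^m$, $m\geq 1$, are of trace class, the series defining $A(\kappa;q)$ converges absolutely, $\frac{g_{21}(\kappa)}{2+\gamma(\kappa)}$ and $\frac{g_{12}(\kappa)}{2+\gamma(\kappa)}$ belong to $L^2\cap H^{-s}$, and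 $$A(\kappa;q)=\int\rho(x;\kappa)\,dx,$$ where the integral is the sum $\bigl\langle q,\frac{g_{21}}{2+\gamma}\bigr\rangle-\bigl\langle r,\frac{g_{12}}{2+\gamma}\bigr\rangle$ of bilinear pairings of $H^s$ with $H^{-s}$; if $q$ is a Schwartz function then $\rho(\kappa)$ is integrable and this is a classical integral. 2. Let $q(t)$ be a solution in Schwartz space, on an open interval containing $0$, with $\|q(0)\|_{H^s}\le\delta$, of one of the equations $$\text{(NLS)}\quad i\tfrac{d}{dt}q=-q''+2q^2r,\qquad\qquad\text{(mKdV)}\quad \tfrac{d}{dt}q=-q'''+6qrq',$$ $$\text{(NLS-diff)}\quad i\tfrac d{dt}q=-q''+2q^2r-4\kappa^3\bigl(g_{12}(\kappa)-g_{12}(-\kappa)\bigr)-4\kappa^2q,$$ $$\text{(mKdV-diff)}\quad \tfrac d{dt}q=-q'''+6qrq'-8\kappa^4\bigl(g_{12}(\kappa)+g_{12}(-\kappa)\bigr)-4\kappa^2q',$$ where $\kappa\ge1$. Let $\varkappa\ge1$, with $\varkappa\ne\kappa$ for the difference flows. Then at all times of the interval the Green's functions at spectral parameter $\varkappa$ (and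 at $\pm\kappa$ for the difference flows) exist as above, $2+\gamma(\varkappa)$ has no zeros, and $\rho(\varkappa)$ and $j_\star$ are differentiable in $t$ and in $x$, respectively, with $$\partial_t\rho(\varkappa)+\partial_xj_\star=0$$ at every point $(t,x)$, where for the respective flows $$j_{\mathrm{NLS}}(\varkappa)=-i\Bigl(\frac{q'g_{21}(\varkappa)+r'g_{12}(\varkappa)}{2+\gamma(\varkappa)}-qr+2\varkappa\rho(\varkappa)\Bigr),$$ $$j_{\mathrm{mKdV}}(\varkappa)=\frac{(q''-2q^2r)g_{21}(\varkappa)-(r''-2r^2q)g_{12}(\varkappa)}{2+\gamma(\varkappa)}-q'r+qr'+2i\varkappa j_{\mathrm{NLS}}(\varkappa),$$ $$j_{\mathrm{NLS}}^{\mathrm{diff}}(\varkappa,\kappa)=j_{\mathrm{NLS}}(\varkappa)+4\kappa^3\bigl(j(\varkappa,\kappa)-j(\varkappa,-\kappa)\bigr),$$ $$j_{\mathrm{mKdV}}^{\mathrm{diff}}(\varkappa,\kappa)=j_{\mathrm{mKdV}}(\varkappa)+8i\kappa^4\bigl(j(\varkappa,\kappa)+j(\varkappa,-\kappa)\bigr)+4\kappa^2\rho(\varkappa),$$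 $$j(\varkappa,\kappa)=-i\,\frac{g_{12}(\kappa)g_{21}(\varkappa)+g_{21}(\kappa)g_{12}(\varkappa)}{2(\kappa-\varkappa)(2+\gamma(\varkappa))}+i\,\frac{\gamma(\kappa)}{4(\kappa-\varkappa)}.$$ -/

import Mathlib

open MeasureTheory Filter Topology Complex
open scoped FourierTransform SchwartzMap ENNReal ComplexConjugate

noncomputable section

namespace AKNS

/-! ### Sobolev norms

Mathlib's Fourier transform is `𝓕 f ξ = ∫ exp (-2πi x ξ) f x dx`, so that `∂` is the Fourier multiplier
`2πiξ`, multiplication becomes convolution without constants, and the norm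
`(∫ (4 + ζ²)^s |q̂ ζ|² dζ)^(1/2)` in the unitary normalization with angular frequency `ζ = 2πξ`
is `(∫ (4 + (2πξ)²)^s |𝓕 q ξ|² dξ)^(1/2)`. -/

/-- The Fourier transform of the tempered distribution `q` is the measurable function `h`. -/
def IsFourierFun (q : 𝓢'(ℝ, ℂ)) (h : ℝ → ℂ) : Prop :=
  AEStronglyMeasurable h volume ∧
    ∀ φ : 𝓢(ℝ, ℂ), Integrable (fun ξ => φ ξ * h ξ) ∧ 𝓕 q φ = ∫ ξ, φ ξ * h ξ

open Classical in
/-- The Fourier transform of `q` as a function, determined up to null sets (zero if there is none). -/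
def fourierFun (q : 𝓢'(ℝ, ℂ)) : ℝ → ℂ :=
  if h : ∃ f, IsFourierFun q f then h.choose else 0

open Classical in
/-- The norm of `H^s(ℝ)`; it is `⊤` outside `H^s(ℝ)`. -/
def sobolevNorm (s : ℝ) (q : 𝓢'(ℝ, ℂ)) : ℝ≥0∞ :=
  if ∃ f, IsFourierFun q f then
    (∫⁻ ξ, ENNReal.ofReal ((4 + (2 * Real.pi * ξ) ^ 2) ^ s) * ‖fourierFun q ξ‖ₑ ^ 2) ^ (1 / 2 : ℝ)
  else ⊤

open Classical in
/-- The tempered distribution given by a square integrable function. -/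
def ofL2 (F : ℝ → ℂ) : 𝓢'(ℝ, ℂ) :=
  if hF : MemLp F 2 (volume : Measure ℝ) then
    ((hF.toLp F : Lp ℂ 2 (volume : Measure ℝ)) : 𝓢'(ℝ, ℂ))
  else 0

/-- The bilinear duality pairing of `H^s` and `H^(-s)`, i.e. the continuous extension of `∫ q F dx`;
the integral converges absolutely by the Cauchy-Schwarz inequality. -/
def dualPair (q F : 𝓢'(ℝ, ℂ)) : ℂ := ∫ ξ, fourierFun q ξ * fourierFun F (-ξ)

/-- The Fourier transform of `r = σ q̄`, where `σ = 1` (defocusing) or `σ = -1` (focusing). -/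
def fourierFunR (σ : ℝ) (q : 𝓢'(ℝ, ℂ)) (ξ : ℝ) : ℂ := σ * conj (fourierFun q (-ξ))

/-- The pairing of `r = σ q̄` with `F`. -/
def dualPairR (σ : ℝ) (q F : 𝓢'(ℝ, ℂ)) : ℂ := ∫ ξ, fourierFunR σ q ξ * fourierFun F (-ξ)

/-! ### The operators -/

/-- The Hilbert space `L²(ℝ)`. -/
abbrev L2 : Type := Lp ℂ 2 (volume : Measure ℝ)

/-- The symbol of `(κ + ε ∂)^(-1/2)`, with the principal branch of the power. -/
def sqrtSym (κ ε ξ : ℝ) : ℂ := ((κ : ℂ) + ε * (2 * Real.pi * ξ) * I) ^ (-(1 / 2) : ℂ)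

open Classical in
/-- Multiplication by the bounded function `m` on `L²`. -/
def mulOp (m : ℝ → ℂ) : L2 →L[ℂ] L2 :=
  if hm : MemLp m ∞ (volume : Measure ℝ) then
    (ContinuousLinearMap.mul ℂ ℂ).holderL (volume : Measure ℝ) ∞ 2 2 (hm.toLp m)
  else 0

/-- The Fourier multiplier with symbol `m`, as an operator on `L²`. -/
def fourierMul (m : ℝ → ℂ) : L2 →L[ℂ] L2 :=
  ((Lp.fourierTransformₗᵢ ℝ ℂ).symm.toContinuousLinearEquiv : L2 →L[ℂ] L2) ∘L mulOp m ∘L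
    ((Lp.fourierTransformₗᵢ ℝ ℂ).toContinuousLinearEquiv : L2 →L[ℂ] L2)

/-- `T` is the bounded operator `a(∂) q b(∂)` on `L²`, where `a` and `b` are the symbols of two
Fourier multipliers and `q` acts as a multiplication operator (on the Fourier side: as the
convolution with its Fourier transform `h`). -/
def IsSandwich (a h b : ℝ → ℂ) (T : L2 →L[ℂ] L2) : Prop :=
  ∀ f : L2, ∀ᵐ ξ : ℝ, (𝓕 (T f) : L2) ξ = a ξ * ∫ η, h (ξ - η) * (b η * (𝓕 f : L2) η)

open Classical in
/-- The bounded operator `a(∂) q b(∂)` (zero if there is none). -/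
def sandwich (a h b : ℝ → ℂ) : L2 →L[ℂ] L2 :=
  if hT : ∃ T, IsSandwich a h b T then hT.choose else 0

/-- `Λ = (κ - ∂)^(-1/2) q (κ + ∂)^(-1/2)`. -/
def opLambda (q : 𝓢'(ℝ, ℂ)) (κ : ℝ) : L2 →L[ℂ] L2 :=
  sandwich (sqrtSym κ (-1)) (fourierFun q) (sqrtSym κ 1)

/-- `Γ = (κ + ∂)^(-1/2) r (κ - ∂)^(-1/2)` with `r = σ q̄`. -/
def opGamma (σ : ℝ) (q : 𝓢'(ℝ, ℂ)) (κ : ℝ) : L2 →L[ℂ] L2 :=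
  sandwich (sqrtSym κ 1) (fourierFunR σ q) (sqrtSym κ (-1))

/-- `√R₀`, where `R₀ = L₀⁻¹` and `L₀ = diag (κ - ∂, κ + ∂)`. -/
def sqrtR0 (κ : ℝ) : Matrix (Fin 2) (Fin 2) (L2 →L[ℂ] L2) :=
  !![fourierMul (sqrtSym κ (-1)), 0; 0, fourierMul (sqrtSym κ 1)]

/-- `1 + √R₀ (L - L₀) √R₀` for the Lax operator `L = L₀ + [0, q; -r, 0]`, so that formally
`L = (√R₀)⁻¹ (1 + √R₀ (L - L₀) √R₀) (√R₀)⁻¹`. -/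
def laxCore (σ : ℝ) (q : 𝓢'(ℝ, ℂ)) (κ : ℝ) : Matrix (Fin 2) (Fin 2) (L2 →L[ℂ] L2) :=
  1 + !![0, opLambda q κ; -opGamma σ q κ, 0]

/-- `R - R₀`, where `R = L⁻¹ = √R₀ (1 + √R₀ (L - L₀) √R₀)⁻¹ √R₀`. -/
def resolventDiff (σ : ℝ) (q : 𝓢'(ℝ, ℂ)) (κ : ℝ) : Matrix (Fin 2) (Fin 2) (L2 →L[ℂ] L2) :=
  sqrtR0 κ * Ring.inverse (laxCore σ q κ) * sqrtR0 κ - sqrtR0 κ * sqrtR0 κ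

/-! ### The diagonal Green's functions -/

/-- `K` is the continuous integral kernel `G - G₀` of `R - R₀`. -/
def IsGreenDiff (σ : ℝ) (q : 𝓢'(ℝ, ℂ)) (κ : ℝ) (K : ℝ → ℝ → Matrix (Fin 2) (Fin 2) ℂ) : Prop :=
  Continuous (fun p : ℝ × ℝ => K p.1 p.2) ∧
    ∀ (i j : Fin 2) (φ ψ : 𝓢(ℝ, ℂ)), HasCompactSupport φ → HasCompactSupport ψ →
      ∫ x, φ x * (resolventDiff σ q κ i j (ψ.toLp 2) : L2) x = ∫ x, ∫ y, φ x * K x y i j * ψ y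

open Classical in
/-- `G - G₀`. -/
def greenDiff (σ : ℝ) (q : 𝓢'(ℝ, ℂ)) (κ : ℝ) : ℝ → ℝ → Matrix (Fin 2) (Fin 2) ℂ :=
  if hK : ∃ K, IsGreenDiff σ q κ K then hK.choose else 0

/-- The Lax operator `L` is invertible and its Green's function `G` exists, `G - G₀` being continuous.
This says that none of the preceding definitions takes its default value. -/
def HasGreen (σ : ℝ) (q : 𝓢'(ℝ, ℂ)) (κ : ℝ) : Prop :=
  IsSandwich (sqrtSym κ (-1)) (fourierFun q) (sqrtSym κ 1) (opLambda q κ) ∧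
  IsSandwich (sqrtSym κ 1) (fourierFunR σ q) (sqrtSym κ (-1)) (opGamma σ q κ) ∧
  IsUnit (laxCore σ q κ) ∧ IsGreenDiff σ q κ (greenDiff σ q κ)

/-- `g₁₂(x; κ) = sgn κ · G₁₂(x, x; κ)`; note that `G₀` is diagonal. -/
def g12 (σ : ℝ) (q : 𝓢'(ℝ, ℂ)) (κ x : ℝ) : ℂ := Real.sign κ * greenDiff σ q κ x x 0 1

/-- `g₂₁(x; κ) = sgn κ · G₂₁(x, x; κ)`. -/
def g21 (σ : ℝ) (q : 𝓢'(ℝ, ℂ)) (κ x : ℝ) : ℂ := Real.sign κ * greenDiff σ q κ x x 1 0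

/-- `γ(x; κ) = sgn κ · (G₁₁ + G₂₂)(x, x; κ) - 1`, where the trace of
`G₀ = sgn κ · exp (-|κ| |x - y|) · diag (1_{κ x < κ y}, 1_{κ y < κ x})` contributes `sgn κ` on the
diagonal (by continuity), which is the term that `- 1` removes. -/
def gam (σ : ℝ) (q : 𝓢'(ℝ, ℂ)) (κ x : ℝ) : ℂ :=
  Real.sign κ * (greenDiff σ q κ x x 0 0 + greenDiff σ q κ x x 1 1)

/-! ### The logarithmic perturbation determinant -/

/-- `T` is of trace class with trace `a`: the series of the diagonal matrix elements of `T` converges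
(unconditionally) to `a` in every orthonormal basis. -/
def HasOpTrace (T : L2 →L[ℂ] L2) (a : ℂ) : Prop :=
  ∀ (ι : Type) (b : HilbertBasis ι ℂ L2), HasSum (fun i => inner ℂ (b i) (T (b i))) a

open Classical in
/-- The trace of a trace class operator (zero for other operators). -/
def opTrace (T : L2 →L[ℂ] L2) : ℂ := if h : ∃ a, HasOpTrace T a then h.choose else 0

/-- The terms `(-1)^(m-1) / m · tr ((ΛΓ)^m)`, `m ≥ 1`, here with `m + 1` in place of `m`. -/
def logDetTerm (σ : ℝ) (q : 𝓢'(ℝ, ℂ)) (κ : ℝ) (m : ℕ) : ℂ :=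
  (-1) ^ m / (m + 1) * opTrace ((opLambda q κ * opGamma σ q κ) ^ (m + 1))

/-- The logarithmic perturbation determinant `A(κ; q)`. -/
def logDet (σ : ℝ) (q : 𝓢'(ℝ, ℂ)) (κ : ℝ) : ℂ := Real.sign κ * ∑' m, logDetTerm σ q κ m

/-! ### Density and currents, for Schwartz functions `q` -/

/-- `r = σ q̄`. -/
def rFun (σ : ℝ) (q : 𝓢(ℝ, ℂ)) (x : ℝ) : ℂ := σ * conj (q x)

/-- `ρ(ϰ) = (q g₂₁(ϰ) - r g₁₂(ϰ)) / (2 + γ(ϰ))`. -/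
def rho (σ : ℝ) (q : 𝓢(ℝ, ℂ)) (ϰ x : ℝ) : ℂ :=
  (q x * g21 σ q ϰ x - rFun σ q x * g12 σ q ϰ x) / (2 + gam σ q ϰ x)

/-- The current `j(ϰ, κ)` for the flow of `A(κ)`, `κ ≠ ϰ`. -/
def jA (σ : ℝ) (q : 𝓢(ℝ, ℂ)) (ϰ κ x : ℝ) : ℂ :=
  -I * ((g12 σ q κ x * g21 σ q ϰ x + g21 σ q κ x * g12 σ q ϰ x) /
      (2 * (κ - ϰ) * (2 + gam σ q ϰ x)))
    + I * (gam σ q κ x / (4 * (κ - ϰ)))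

/-- The current `j_NLS(ϰ)`. -/
def jNLS (σ : ℝ) (q : 𝓢(ℝ, ℂ)) (ϰ x : ℝ) : ℂ :=
  -I * ((deriv q x * g21 σ q ϰ x + deriv (rFun σ q) x * g12 σ q ϰ x) / (2 + gam σ q ϰ x)
    - q x * rFun σ q x + 2 * ϰ * rho σ q ϰ x)

/-- The current `j_mKdV(ϰ)`. -/
def jMKdV (σ : ℝ) (q : 𝓢(ℝ, ℂ)) (ϰ x : ℝ) : ℂ :=
  ((iteratedDeriv 2 q x - 2 * q x ^ 2 * rFun σ q x) * g21 σ q ϰ x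
      - (iteratedDeriv 2 (rFun σ q) x - 2 * rFun σ q x ^ 2 * q x) * g12 σ q ϰ x) / (2 + gam σ q ϰ x)
    - deriv q x * rFun σ q x + q x * deriv (rFun σ q) x + 2 * I * ϰ * jNLS σ q ϰ x

/-- The current `j_NLS^diff(ϰ, κ)`. -/
def jNLSdiff (σ : ℝ) (q : 𝓢(ℝ, ℂ)) (ϰ κ x : ℝ) : ℂ :=
  jNLS σ q ϰ x + 4 * κ ^ 3 * (jA σ q ϰ κ x - jA σ q ϰ (-κ) x)

/-- The current `j_mKdV^diff(ϰ, κ)`. -/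
def jMKdVdiff (σ : ℝ) (q : 𝓢(ℝ, ℂ)) (ϰ κ x : ℝ) : ℂ :=
  jMKdV σ q ϰ x + 8 * I * κ ^ 4 * (jA σ q ϰ κ x + jA σ q ϰ (-κ) x) + 4 * κ ^ 2 * rho σ q ϰ x

/-! ### The flows, written as `dq/dt = V(q)` -/

/-- NLS: `i dq/dt = - q'' + 2 q² r`. -/
def fieldNLS (σ : ℝ) (q : 𝓢(ℝ, ℂ)) (x : ℝ) : ℂ :=
  -I * (-iteratedDeriv 2 q x + 2 * q x ^ 2 * rFun σ q x)

/-- mKdV: `dq/dt = - q''' + 6 q r q'`. -/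
def fieldMKdV (σ : ℝ) (q : 𝓢(ℝ, ℂ)) (x : ℝ) : ℂ :=
  -iteratedDeriv 3 q x + 6 * q x * rFun σ q x * deriv q x

/-- NLS difference flow:
`i dq/dt = - q'' + 2 q² r - 4 κ³ (g₁₂(κ) - g₁₂(-κ)) - 4 κ² q`. -/
def fieldNLSdiff (σ κ : ℝ) (q : 𝓢(ℝ, ℂ)) (x : ℝ) : ℂ :=
  -I * (-iteratedDeriv 2 q x + 2 * q x ^ 2 * rFun σ q x
    - 4 * κ ^ 3 * (g12 σ q κ x - g12 σ q (-κ) x) - 4 * κ ^ 2 * q x)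

/-- mKdV difference flow:
`dq/dt = - q''' + 6 q r q' - 8 κ⁴ (g₁₂(κ) + g₁₂(-κ)) - 4 κ² q'`. -/
def fieldMKdVdiff (σ κ : ℝ) (q : 𝓢(ℝ, ℂ)) (x : ℝ) : ℂ :=
  -iteratedDeriv 3 q x + 6 * q x * rFun σ q x * deriv q x
    - 8 * κ ^ 4 * (g12 σ q κ x + g12 σ q (-κ) x) - 4 * κ ^ 2 * deriv q x

/-- `q` is a solution of `dq/dt = V(q)` on `J` in Schwartz space: a differentiable curve, in the
topology of `𝓢(ℝ, ℂ)`, whose derivative is given by `V`. -/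
def IsSchwartzSolution (V : 𝓢(ℝ, ℂ) → ℝ → ℂ) (J : Set ℝ) (q : ℝ → 𝓢(ℝ, ℂ)) : Prop :=
  ∀ t ∈ J, ∃ v : 𝓢(ℝ, ℂ), Tendsto (slope q t) (𝓝[≠] t) (𝓝 v) ∧ ∀ x, v x = V (q t) x

/-- `∂ₜ d + ∂ₓ j = 0` at `(t, x)`, for a density `d` and a current `j` as functions of time and space. -/
def ConservationLawAt (d j : ℝ → ℝ → ℂ) (t x : ℝ) : Prop :=
  DifferentiableAt ℝ (fun τ => d τ x) t ∧ DifferentiableAt ℝ (j t) x ∧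
    deriv (fun τ => d τ x) t + deriv (j t) x = 0

/-- The Green's function exists and the denominator `2 + γ` of the density does not vanish. -/
def DensityDefined (σ : ℝ) (q : 𝓢'(ℝ, ℂ)) (κ : ℝ) : Prop :=
  HasGreen σ q κ ∧ ∀ x, 2 + gam σ q κ x ≠ 0

end AKNS

end

/-! Everything reduces to two scalar functions. The quotients F₁ = g₂₁/(2+γ) and F₂ = g₁₂/(2+γ)
solve Riccati equations: F₁' = -2κF₁ + r/2 - 2qF₁², and the same for F₂ with (κ, q, r) replaced by
(-κ, r, q). Conversely g₂₁ = 2F₁/(1-4F₁F₂), g₁₂ = 2F₂/(1-4F₁F₂) and 2+γ = 2/(1-4F₁F₂), so the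
density is ρ = qF₁ - rF₂.

Construction. Fix -s < b < 1/2 and describe q, r by p, R in L², their Fourier transforms divided by
the weight `jb 1 ^ b`. In H^(1-b) the Riccati equation is a cubic fixed point problem that contracts
for small data (`cubFix`, `norm_ricT_le`); its solution is differentiable along curves of data.
Independently, Λ = WΛ''W and Γ = WΓ''W with a smoothing multiplier W and Hilbert-Schmidt Λ'', Γ''.
Hence the inverse of the Lax core is 1 + WNW with N bounded, and since W√R₀ takes delta functions
into L² (`memLp_um`), R - R₀ has the continuous kernel `grK`. Both objects depend continuously on
(p, R).

Identification. For Schwartz potentials the substitution u = (v + 2F₂w, 2F₁v + w) decouples Lu = f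
into two first order scalar equations, solved by variation of constants (`RicPair.exists_sol`).
Comparing with the solution given by the kernel yields the formulas for the diagonal Green's
functions (`Adm.grK_diag_schwartz`), and density of Schwartz functions extends them
(`Adm.grK_diag`).

Determinant. Along the ray (τq, τr), the operator τ d/dτ takes log det(1+ΛΓ) to 2 tr(ΛΓ(1+ΛΓ)⁻¹),
and this trace is the integral of τq times the kernel entry (G-G₀)₂₁(x,x) (`Adm.trace_formula`). It
takes ∫ qF₁ to ∫ qg₂₁, up to an exact derivative (`RicPair.integral_tangent`). Both quantities
vanish at τ = 0, so A = 2∫ qF₁. Since qF₁ + rF₂ is the derivative of -½ log(1-4F₁F₂), also ∫ qF₁ =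
-∫ rF₂, whence A = ∫ ρ (`Adm.ld_eq`).

Conservation laws. If the flow has a Lax pair with time components A, B, C, then 2∂ₜF₁ and C - 4AF₁
- 4BF₁² solve the same linear equation, which has at most one bounded solution; so they agree and
∂ₜ(qF₁) = ∂ₓ(A/2 + BF₁) (`Lax.tangent`, `Lax.hasDerivAt_flux`). Exchanging the roles of q and r
treats rF₂. The difference flows are sums of NLS or mKdV, flows of the determinant at ±κ
(`RicPair.lax`) and a phase rotation or translation, and Lax pairs add up.

All times. The law needs smallness at every time. The conserved quantity ∫ qF₁ at parameter k has
the real part ±½∫ 2k|q̂|²/(4k²+ξ²) dξ, up to a quartic error of size k^(4b-2). Summing over dyadic k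
recovers the H^(-b) norm from the H^s norm of the initial data, since -s < b, and a continuity
argument keeps the solution in the small ball (`Adm.apriori`). -/

noncomputable section

namespace AKNS

/-! ### The weight -/

/-- The modulus of `2 κ + ∂` on the Fourier side. -/
def jb (κ ξ : ℝ) : ℝ := Real.sqrt (4 * κ ^ 2 + (2 * Real.pi * ξ) ^ 2)

lemma jb_sq (κ ξ : ℝ) : jb κ ξ ^ 2 = 4 * κ ^ 2 + (2 * Real.pi * ξ) ^ 2 :=
  Real.sq_sqrt (by positivity)

lemma jb_nonneg (κ ξ : ℝ) : 0 ≤ jb κ ξ := Real.sqrt_nonneg _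

lemma two_abs_le_jb (κ ξ : ℝ) : 2 * |κ| ≤ jb κ ξ := by
  apply Real.le_sqrt_of_sq_le
  rw [mul_pow, sq_abs]; nlinarith [sq_nonneg (2 * Real.pi * ξ)]

lemma abs_le_jb (κ ξ : ℝ) : |κ| ≤ jb κ ξ := by
  linarith [two_abs_le_jb κ ξ, abs_nonneg κ]

lemma two_le_jb {κ : ℝ} (hκ : 1 ≤ |κ|) (ξ : ℝ) : 2 ≤ jb κ ξ := by
  linarith [two_abs_le_jb κ ξ]

lemma jb_pos {κ : ℝ} (hκ : 1 ≤ |κ|) (ξ : ℝ) : 0 < jb κ ξ := by linarith [two_le_jb hκ ξ]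

lemma one_le_jb {κ : ℝ} (hκ : 1 ≤ |κ|) (ξ : ℝ) : 1 ≤ jb κ ξ := by linarith [two_le_jb hκ ξ]

lemma one_le_abs_one : (1 : ℝ) ≤ |1| := by simp

lemma jb_neg (κ ξ : ℝ) : jb κ (-ξ) = jb κ ξ := by simp [jb]

lemma jb_one_le {κ : ℝ} (hκ : 1 ≤ |κ|) (ξ : ℝ) : jb 1 ξ ≤ jb κ ξ := by
  apply Real.sqrt_le_sqrt
  have : 1 ≤ κ ^ 2 := by rw [← sq_abs]; nlinarith
  nlinarith

lemma continuous_jb (κ : ℝ) : Continuous (jb κ) := by unfold jb; fun_prop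

@[fun_prop]
lemma measurable_jb (κ : ℝ) : Measurable (jb κ) := (continuous_jb κ).measurable

lemma continuous_jb_rpow {κ : ℝ} (hκ : 1 ≤ |κ|) (a : ℝ) : Continuous (fun ξ => jb κ ξ ^ a) :=
  (continuous_jb κ).rpow_const fun ξ => Or.inl (jb_pos hκ ξ).ne'

lemma norm_two_mul_add (κ ξ : ℝ) : ‖(2 * κ : ℂ) + 2 * Real.pi * ξ * I‖ = jb κ ξ := by
  have h : (2 * κ : ℂ) + 2 * Real.pi * ξ * I = ((2 * κ : ℝ) : ℂ) + ((2 * Real.pi * ξ : ℝ) : ℂ) * I := by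
    push_cast; ring
  rw [h, Complex.norm_add_mul_I, jb]; congr 1; ring

/-- `jb κ ξ` is the length of the vector (2κ, 2πξ), so this is a triangle inequality with the first
coordinate counted twice on the right. -/
lemma jb_le_add (κ ξ η : ℝ) : jb κ ξ ≤ jb κ (ξ - η) + jb κ η := by
  rcases eq_or_ne κ 0 with rfl | hκ
  · have h : ∀ x, jb 0 x = |2 * Real.pi * x| := fun x => by
      simp only [jb]; rw [← Real.sqrt_sq_eq_abs]; congr 1; ring
    rw [h, h, h]
    calc |2 * Real.pi * ξ| = |2 * Real.pi * (ξ - η) + 2 * Real.pi * η| := by congr 1; ring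
      _ ≤ _ := abs_add_le _ _
  have hp : 0 ≤ jb κ (ξ - η) + jb κ η := add_nonneg (jb_nonneg _ _) (jb_nonneg _ _)
  rw [jb, Real.sqrt_le_left hp, add_sq, jb_sq, jb_sq]
  have h1' : |2 * Real.pi * (ξ - η)| ≤ jb κ (ξ - η) := by
    rw [jb, ← Real.sqrt_sq_eq_abs]; exact Real.sqrt_le_sqrt (by nlinarith [sq_nonneg κ])
  have h2 : |2 * Real.pi * η| ≤ jb κ η := by
    rw [jb, ← Real.sqrt_sq_eq_abs]; exact Real.sqrt_le_sqrt (by nlinarith [sq_nonneg κ])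
  have h3 : (2 * Real.pi * (ξ - η)) * (2 * Real.pi * η) ≤ jb κ (ξ - η) * jb κ η :=
    (le_abs_self _).trans (by rw [abs_mul]; exact mul_le_mul h1' h2 (abs_nonneg _) (jb_nonneg _ _))
  nlinarith [sq_nonneg κ]

/-- Homogeneity of the weight; it produces the power of `|κ|` in `integral_jb_rpow`. -/
lemma jb_abs_mul (κ u : ℝ) : jb κ (|κ| * u) = |κ| * jb 1 u := by
  unfold jb
  rw [← Real.sqrt_sq (abs_nonneg κ), ← Real.sqrt_mul (sq_nonneg _),
    Real.sqrt_sq (abs_nonneg κ), sq_abs]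
  congr 1
  rw [mul_pow, mul_pow |κ| u, sq_abs]; ring

lemma integrable_jb_one_rpow {p : ℝ} (hp : 1 < p) : Integrable fun ξ => jb 1 ξ ^ (-p) := by
  have h := integrable_rpow_neg_one_add_norm_sq (E := ℝ) (μ := volume) (r := p) (by simpa using hp)
  refine h.mono' (continuous_jb_rpow one_le_abs_one _).aestronglyMeasurable (ae_of_all _ fun ξ => ?_)
  rw [Real.norm_of_nonneg (Real.rpow_nonneg (jb_nonneg _ _) _), jb, Real.sqrt_eq_rpow,
    ← Real.rpow_mul (by positivity)]
  have : (1 / 2 * -p : ℝ) = -p / 2 := by ring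
  rw [this]
  apply Real.rpow_le_rpow_of_nonpos (by positivity)
  · have : ‖ξ‖ ^ 2 = ξ ^ 2 := by simp
    rw [this, mul_pow]
    have : 1 ≤ (2 * Real.pi) ^ 2 := by nlinarith [Real.pi_gt_three]
    nlinarith [sq_nonneg ξ]
  · linarith

lemma integrable_jb_rpow {κ : ℝ} (hκ : 1 ≤ |κ|) {p : ℝ} (hp : 1 < p) :
    Integrable fun ξ => jb κ ξ ^ (-p) := by
  refine (integrable_jb_one_rpow hp).mono' (continuous_jb_rpow hκ _).aestronglyMeasurable
    (ae_of_all _ fun ξ => ?_)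
  rw [Real.norm_of_nonneg (Real.rpow_nonneg (jb_nonneg _ _) _)]
  exact Real.rpow_le_rpow_of_nonpos (jb_pos one_le_abs_one ξ) (jb_one_le hκ ξ) (by linarith)

/-- `∫ jb 1 ^ (-p)`. -/
def jbC (p : ℝ) : ℝ := ∫ ξ, jb 1 ξ ^ (-p)

lemma jbC_nonneg (p : ℝ) : 0 ≤ jbC p :=
  integral_nonneg fun _ => Real.rpow_nonneg (jb_nonneg _ _) _

lemma integral_jb_rpow {κ : ℝ} (hκ : 1 ≤ |κ|) (p : ℝ) :
    ∫ ξ, jb κ ξ ^ (-p) = |κ| ^ (1 - p) * jbC p := by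
  have h0 : 0 < |κ| := by linarith
  have h := Measure.integral_comp_mul_left (fun ξ => jb κ ξ ^ (-p)) |κ|
  simp only [jb_abs_mul, Real.mul_rpow h0.le (jb_nonneg _ _)] at h
  rw [integral_const_mul, abs_inv, abs_abs, smul_eq_mul] at h
  rw [jbC, Real.rpow_sub h0, Real.rpow_one, div_eq_mul_inv, ← Real.rpow_neg h0.le, mul_assoc, h]
  field_simp

/-- The larger of `A`, `B` is at least `Z / 2`, so the part `μ` of its exponent pays for the factor
`Z ^ (-μ)`; what is left of its exponent is transferred to the smaller one. -/
lemma jb_product_le {A B Z μ α β : ℝ} (hA : 0 < A) (hB : 0 < B) (hZ : 0 < Z) (hZAB : Z ≤ A + B)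
    (hμ : 0 ≤ μ) (hα : μ ≤ α) (hβ : μ ≤ β) :
    A ^ (-α) * B ^ (-β) ≤ 2 ^ μ * (A ^ (-(α + β - μ)) + B ^ (-(α + β - μ))) * Z ^ (-μ) := by
  have key : ∀ {A B α β : ℝ}, 0 < A → 0 < B → Z ≤ A + B → μ ≤ α → μ ≤ β → A ≤ B →
      A ^ (-α) * B ^ (-β) ≤ 2 ^ μ * A ^ (-(α + β - μ)) * Z ^ (-μ) := by
    intro A B α β hA hB hZAB hα hβ h
    have h1 : B ^ (-μ) ≤ 2 ^ μ * Z ^ (-μ) := by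
      have : Z ≤ 2 * B := by linarith
      have h3 := Real.rpow_le_rpow_of_nonpos hZ this (neg_nonpos.2 hμ)
      rw [Real.mul_rpow (by norm_num) hB.le, Real.rpow_neg (by norm_num : (0:ℝ) ≤ 2)] at h3
      have h4 : (0 : ℝ) < 2 ^ μ := by positivity
      calc B ^ (-μ) = 2 ^ μ * ((2 ^ μ)⁻¹ * B ^ (-μ)) := by field_simp
        _ ≤ _ := by gcongr
    have h2 : B ^ (-(β - μ)) ≤ A ^ (-(β - μ)) := Real.rpow_le_rpow_of_nonpos hA h (by linarith)
    calc A ^ (-α) * B ^ (-β) = A ^ (-α) * (B ^ (-(β - μ)) * B ^ (-μ)) := by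
          rw [← Real.rpow_add hB]; congr 2; ring
      _ ≤ A ^ (-α) * (A ^ (-(β - μ)) * (2 ^ μ * Z ^ (-μ))) := by gcongr
      _ = 2 ^ μ * (A ^ (-α) * A ^ (-(β - μ))) * Z ^ (-μ) := by ring
      _ = _ := by rw [← Real.rpow_add hA]; congr 3; ring
  have hA' : 0 ≤ A ^ (-(α + β - μ)) := Real.rpow_nonneg hA.le _
  have hB' : 0 ≤ B ^ (-(α + β - μ)) := Real.rpow_nonneg hB.le _
  have hZ' : 0 ≤ Z ^ (-μ) := Real.rpow_nonneg hZ.le _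
  have h2 : (0 : ℝ) ≤ 2 ^ μ := by positivity
  rcases le_total A B with h | h
  · refine (key hA hB hZAB hα hβ h).trans ?_
    gcongr; linarith
  · have := key hB hA (by linarith) hβ hα h
    rw [mul_comm, add_comm β α] at this
    refine this.trans ?_
    gcongr; linarith

/-- Integrated form of `jb_product_le`: decay `μ` survives the convolution, and the remaining
exponent `α + β - μ > 1` is integrable and yields the power of `|κ|` by scaling. -/
lemma lintegral_jb_mul_jb_le {κ : ℝ} (hκ : 1 ≤ |κ|) {μ α β : ℝ} (hμ : 0 ≤ μ) (hα : μ ≤ α)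
    (hβ : μ ≤ β) (hp : 1 < α + β - μ) (ξ : ℝ) :
    ∫⁻ η, ENNReal.ofReal (jb κ (ξ - η) ^ (-α) * jb κ η ^ (-β)) ≤
      ENNReal.ofReal (2 ^ μ * (2 * (|κ| ^ (1 - (α + β - μ)) * jbC (α + β - μ))) * jb κ ξ ^ (-μ)) := by
  have hi := integrable_jb_rpow hκ hp
  have hi' : Integrable fun η => jb κ (ξ - η) ^ (-(α + β - μ)) := hi.comp_sub_left ξ
  have hint : Integrable fun η => 2 ^ μ *
      (jb κ (ξ - η) ^ (-(α + β - μ)) + jb κ η ^ (-(α + β - μ))) * jb κ ξ ^ (-μ) :=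
    ((hi'.add hi).const_mul _).mul_const _
  calc _ ≤ ∫⁻ η, ENNReal.ofReal (2 ^ μ *
      (jb κ (ξ - η) ^ (-(α + β - μ)) + jb κ η ^ (-(α + β - μ))) * jb κ ξ ^ (-μ)) := by
        refine lintegral_mono fun η => ENNReal.ofReal_le_ofReal ?_
        exact jb_product_le (jb_pos hκ _) (jb_pos hκ _) (jb_pos hκ _) (jb_le_add _ _ _) hμ hα hβ
    _ = ENNReal.ofReal (∫ η, 2 ^ μ *
      (jb κ (ξ - η) ^ (-(α + β - μ)) + jb κ η ^ (-(α + β - μ))) * jb κ ξ ^ (-μ)) := by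
        refine (ofReal_integral_eq_lintegral_ofReal hint (ae_of_all _ fun η => ?_)).symm
        have := jb_nonneg κ (ξ - η); have := jb_nonneg κ η; have := jb_nonneg κ ξ
        positivity
    _ = _ := by
        rw [integral_mul_const, integral_const_mul, integral_add hi' hi,
          integral_sub_left_eq_self (fun η => jb κ η ^ (-(α + β - μ))), integral_jb_rpow hκ]
        congr 3; ring

/-! ### Bilinear operators on `L²` with a kernel -/

lemma lintegral_mul_sq_le {α : Type*} [MeasurableSpace α] {μ : Measure α} {f g : α → ℝ≥0∞}
    (hf : AEMeasurable f μ) (hg : AEMeasurable g μ) :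
    (∫⁻ x, f x * g x ∂μ) ^ 2 ≤ (∫⁻ x, f x ^ 2 ∂μ) * ∫⁻ x, g x ^ 2 ∂μ := by
  have h := ENNReal.lintegral_mul_le_Lp_mul_Lq μ Real.HolderConjugate.two_two hf hg
  have h2 : ∀ a : ℝ≥0∞, (a ^ (1 / (2 : ℝ))) ^ 2 = a := fun a => by
    rw [← ENNReal.rpow_natCast, ← ENNReal.rpow_mul]; simp
  calc _ ≤ ((∫⁻ a, f a ^ (2 : ℝ) ∂μ) ^ (1 / (2 : ℝ)) * (∫⁻ a, g a ^ (2 : ℝ) ∂μ) ^ (1 / (2 : ℝ))) ^ 2 := by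
        gcongr; exact h
    _ = _ := by simp only [mul_pow, h2, ENNReal.rpow_ofNat]

/-- The quadratic bounds under which `(p, g) ↦ ∫ k(ξ, η) p(ξ - η) g(η) dη` is bounded on `L²`. -/
structure KerBound (k : ℝ → ℝ → ℂ) (C : ℝ) : Prop where
  meas : Measurable (Function.uncurry k)
  nonneg : 0 ≤ C
  bound : (∀ ξ, ∫⁻ η, ‖k ξ η‖ₑ ^ 2 ≤ ENNReal.ofReal (C ^ 2)) ∨
    (∀ ζ, ∫⁻ η, ‖k (ζ + η) η‖ₑ ^ 2 ≤ ENNReal.ofReal (C ^ 2))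

lemma lintegral_enorm_sq_eq (f : L2) : ∫⁻ x, ‖f x‖ₑ ^ 2 = ENNReal.ofReal (‖f‖ ^ 2) := by
  rw [Lp.norm_def, ← ENNReal.toReal_pow, ENNReal.ofReal_toReal (by simp [Lp.eLpNorm_ne_top f]),
    eLpNorm_eq_lintegral_rpow_enorm_toReal (by simp) (by simp)]
  simp only [ENNReal.toReal_ofNat, ENNReal.rpow_ofNat]
  rw [← ENNReal.rpow_natCast, ← ENNReal.rpow_mul]; simp

lemma norm_le_of_lintegral_enorm_sq_le {f : L2} {C : ℝ} (hC : 0 ≤ C)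
    (h : ∫⁻ x, ‖f x‖ₑ ^ 2 ≤ ENNReal.ofReal (C ^ 2)) : ‖f‖ ≤ C := by
  rw [lintegral_enorm_sq_eq, ENNReal.ofReal_le_ofReal_iff (by positivity)] at h
  exact abs_le_of_sq_le_sq h hC |>.trans' (le_abs_self _)

/-- Cauchy-Schwarz in `η` with two different groupings. Under the first bound the kernel stands
alone, and Fubini with a translation gives the product of the norms of `p` and `g`. Under the second
the kernel is grouped with `p`, and the substitution `ξ = ζ + η` makes the argument of `p`
independent of `η`. -/
lemma KerBound.lintegral_le {k : ℝ → ℝ → ℂ} {C : ℝ} (hk : KerBound k C) {p g : ℝ → ℂ}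
    (hp : Measurable p) (hg : Measurable g) :
    ∫⁻ ξ, (∫⁻ η, ‖k ξ η * (p (ξ - η) * g η)‖ₑ) ^ 2 ≤
      ENNReal.ofReal (C ^ 2) * ((∫⁻ x, ‖p x‖ₑ ^ 2) * ∫⁻ x, ‖g x‖ₑ ^ 2) := by
  have hm := hk.meas
  have hk1 : ∀ ξ, Measurable (k ξ) := fun ξ => hm.comp measurable_prodMk_left
  have hpp : Measurable fun x : ℝ × ℝ => p (x.1 - x.2) := hp.comp (by fun_prop)
  rcases hk.bound with h | h
  · calc _ ≤ ∫⁻ ξ, ENNReal.ofReal (C ^ 2) * ∫⁻ η, (‖p (ξ - η)‖ₑ * ‖g η‖ₑ) ^ 2 := by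
          refine lintegral_mono fun ξ => ?_
          simp only [enorm_mul]
          have h1 := lintegral_mul_sq_le (μ := volume) (f := fun η => ‖k ξ η‖ₑ)
            (g := fun η => ‖p (ξ - η)‖ₑ * ‖g η‖ₑ)
            (hk1 ξ).enorm.aemeasurable ((by fun_prop : Measurable fun η => ‖p (ξ - η)‖ₑ * ‖g η‖ₑ)).aemeasurable
          exact h1.trans (by gcongr; exact h ξ)
      _ = ENNReal.ofReal (C ^ 2) * ∫⁻ ξ, ∫⁻ η, ‖p (ξ - η)‖ₑ ^ 2 * ‖g η‖ₑ ^ 2 := by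
          simp only [mul_pow]
          rw [lintegral_const_mul']
          exact ENNReal.ofReal_ne_top
      _ = ENNReal.ofReal (C ^ 2) * ∫⁻ η, ∫⁻ ξ, ‖p (ξ - η)‖ₑ ^ 2 * ‖g η‖ₑ ^ 2 := by
          rw [lintegral_lintegral_swap]
          apply Measurable.aemeasurable
          fun_prop
      _ = _ := by
          congr 1
          rw [← lintegral_const_mul _ (by fun_prop)]
          refine lintegral_congr fun η => ?_
          rw [lintegral_mul_const _ (by fun_prop),
            lintegral_sub_right_eq_self (fun ξ => ‖p ξ‖ₑ ^ 2) η]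
  · have hk2 : Measurable fun x : ℝ × ℝ => k (x.1 + x.2) x.2 :=
      hm.comp ((measurable_fst.add measurable_snd).prodMk measurable_snd)
    calc _ ≤ ∫⁻ ξ, (∫⁻ η, (‖k ξ η‖ₑ * ‖p (ξ - η)‖ₑ) ^ 2) * ∫⁻ x, ‖g x‖ₑ ^ 2 := by
          refine lintegral_mono fun ξ => ?_
          simp only [enorm_mul, ← mul_assoc]
          exact lintegral_mul_sq_le (μ := volume) (f := fun η => ‖k ξ η‖ₑ * ‖p (ξ - η)‖ₑ)
            (g := fun η => ‖g η‖ₑ)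
            ((hk1 ξ).enorm.mul (hpp.comp measurable_prodMk_left).enorm).aemeasurable
            hg.enorm.aemeasurable
      _ = (∫⁻ ξ, ∫⁻ η, ‖k ξ η‖ₑ ^ 2 * ‖p (ξ - η)‖ₑ ^ 2) * ∫⁻ x, ‖g x‖ₑ ^ 2 := by
          simp only [mul_pow]
          rw [lintegral_mul_const]
          refine Measurable.lintegral_prod_right' (f := fun x : ℝ × ℝ => ‖k x.1 x.2‖ₑ ^ 2 * ‖p (x.1 - x.2)‖ₑ ^ 2) ?_
          exact (hm.enorm.pow_const 2).mul (hpp.enorm.pow_const 2)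
      _ = (∫⁻ ζ, (∫⁻ η, ‖k (ζ + η) η‖ₑ ^ 2) * ‖p ζ‖ₑ ^ 2) * ∫⁻ x, ‖g x‖ₑ ^ 2 := by
          congr 1
          rw [lintegral_lintegral_swap ((hm.enorm.pow_const 2).mul (hpp.enorm.pow_const 2)).aemeasurable]
          have : ∀ η, ∫⁻ ξ, ‖k ξ η‖ₑ ^ 2 * ‖p (ξ - η)‖ₑ ^ 2
              = ∫⁻ ζ, ‖k (ζ + η) η‖ₑ ^ 2 * ‖p ζ‖ₑ ^ 2 := fun η => by
            rw [← lintegral_add_right_eq_self (fun ξ => ‖k ξ η‖ₑ ^ 2 * ‖p (ξ - η)‖ₑ ^ 2) η]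
            simp
          simp only [this]
          rw [lintegral_lintegral_swap]
          · refine lintegral_congr fun ζ => ?_
            rw [lintegral_mul_const]
            exact (hk2.comp measurable_prodMk_left).enorm.pow_const 2
          · exact (((hk2.comp measurable_swap).enorm.pow_const 2).mul
              ((hp.comp measurable_snd).enorm.pow_const 2)).aemeasurable
      _ ≤ (∫⁻ ζ, ENNReal.ofReal (C ^ 2) * ‖p ζ‖ₑ ^ 2) * ∫⁻ x, ‖g x‖ₑ ^ 2 := by
          gcongr with ζ; exact h ζ
      _ = _ := by rw [lintegral_const_mul _ (by fun_prop), mul_assoc]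

/-- `B` is the bilinear operator with kernel `k`. -/
def IsBilin (k : ℝ → ℝ → ℂ) (B : L2 →L[ℂ] L2 →L[ℂ] L2) : Prop :=
  ∀ p g : L2, (∀ᵐ ξ : ℝ, Integrable fun η => k ξ η * (p (ξ - η) * g η)) ∧
    (B p g : L2) =ᵐ[volume] fun ξ => ∫ η, k ξ η * (p (ξ - η) * g η)

open Classical in
/-- The bilinear operator `(p, g) ↦ ∫ k(ξ, η) p(ξ - η) g(η) dη`. -/
def bilin (k : ℝ → ℝ → ℂ) : L2 →L[ℂ] L2 →L[ℂ] L2 :=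
  if h : ∃ B, IsBilin k B then h.choose else 0

lemma KerBound.ae_integrable {k : ℝ → ℝ → ℂ} {C : ℝ} (hk : KerBound k C) (p g : L2) :
    ∀ᵐ ξ : ℝ, Integrable fun η => k ξ η * (p (ξ - η) * g η) := by
  have hp := (Lp.stronglyMeasurable p).measurable
  have hg := (Lp.stronglyMeasurable g).measurable
  have hm := hk.meas
  have h := hk.lintegral_le hp hg
  rw [lintegral_enorm_sq_eq, lintegral_enorm_sq_eq] at h
  have hmeas : Measurable (fun x : ℝ × ℝ => k x.1 x.2 * (p (x.1 - x.2) * g x.2)) := by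
    apply Measurable.mul hm
    fun_prop
  have h2 := ae_lt_top (Measurable.pow_const (Measurable.lintegral_prod_right' hmeas.enorm) 2)
    (h.trans_lt (by finiteness)).ne
  filter_upwards [h2] with ξ hξ
  refine ⟨(hmeas.comp measurable_prodMk_left).aestronglyMeasurable, ?_⟩
  rw [hasFiniteIntegral_iff_enorm]
  by_contra hcon
  rw [not_lt_top_iff] at hcon
  rw [hcon] at hξ
  simp at hξ

lemma ae_comp_sub {P : ℝ → Prop} (h : ∀ᵐ x : ℝ, P x) (ξ : ℝ) : ∀ᵐ η : ℝ, P (ξ - η) :=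
  (quasiMeasurePreserving_sub_left volume ξ).ae h

lemma KerBound.memLp {k : ℝ → ℝ → ℂ} {C : ℝ} (hk : KerBound k C) (p g : L2) :
    MemLp (fun ξ => ∫ η, k ξ η * (p (ξ - η) * g η)) 2 volume ∧
    ∫⁻ ξ, ‖∫ η, k ξ η * (p (ξ - η) * g η)‖ₑ ^ 2 ≤ ENNReal.ofReal ((C * ‖p‖ * ‖g‖) ^ 2) := by
  have hp := (Lp.stronglyMeasurable p).measurable
  have hg := (Lp.stronglyMeasurable g).measurable
  have hm := hk.meas
  have h := hk.lintegral_le hp hg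
  rw [lintegral_enorm_sq_eq, lintegral_enorm_sq_eq] at h
  have hmeas : Measurable (fun x : ℝ × ℝ => k x.1 x.2 * (p (x.1 - x.2) * g x.2)) := by
    apply Measurable.mul hm
    fun_prop
  have h3 : ∫⁻ ξ, ‖∫ η, k ξ η * (p (ξ - η) * g η)‖ₑ ^ 2 ≤ ENNReal.ofReal ((C * ‖p‖ * ‖g‖) ^ 2) := by
    calc _ ≤ ∫⁻ ξ, (∫⁻ η, ‖k ξ η * (p (ξ - η) * g η)‖ₑ) ^ 2 := by
          gcongr with ξ; exact enorm_integral_le_lintegral_enorm _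
      _ ≤ _ := h
      _ = _ := by
          rw [← ENNReal.ofReal_mul (by positivity), ← ENNReal.ofReal_mul (by positivity)]
          congr 1; ring
  refine ⟨⟨hmeas.stronglyMeasurable.integral_prod_right'.aestronglyMeasurable, ?_⟩, h3⟩
  rw [eLpNorm_lt_top_iff_lintegral_rpow_enorm_lt_top (by simp) (by simp)]
  simp only [ENNReal.toReal_ofNat, ENNReal.rpow_ofNat]
  exact h3.trans_lt ENNReal.ofReal_lt_top

lemma KerBound.exists_isBilin {k : ℝ → ℝ → ℂ} {C : ℝ} (hk : KerBound k C) :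
    ∃ B, IsBilin k B := by
  refine ⟨LinearMap.mkContinuous₂ (LinearMap.mk₂ ℂ (fun p g => (hk.memLp p g).1.toLp) ?_ ?_ ?_ ?_) C ?_,
    fun p g => ⟨hk.ae_integrable p g, ?_⟩⟩
  · intro p p' g
    rw [← MemLp.toLp_add]
    apply MemLp.toLp_congr
    filter_upwards [hk.ae_integrable p g, hk.ae_integrable p' g] with ξ h1 h2
    simp only [Pi.add_apply]
    rw [← integral_add h1 h2]
    refine integral_congr_ae ?_
    filter_upwards [ae_comp_sub (Lp.coeFn_add p p') ξ] with η hη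
    rw [hη]; simp only [Pi.add_apply]; ring
  · intro c p g
    rw [← MemLp.toLp_const_smul]
    apply MemLp.toLp_congr
    filter_upwards with ξ
    simp only [Pi.smul_apply, smul_eq_mul]
    rw [← integral_const_mul]
    refine integral_congr_ae ?_
    filter_upwards [ae_comp_sub (Lp.coeFn_smul c p) ξ] with η hη
    rw [hη]; simp only [Pi.smul_apply, smul_eq_mul]; ring
  · intro p g g'
    rw [← MemLp.toLp_add]
    apply MemLp.toLp_congr
    filter_upwards [hk.ae_integrable p g, hk.ae_integrable p g'] with ξ h1 h2
    simp only [Pi.add_apply]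
    rw [← integral_add h1 h2]
    refine integral_congr_ae ?_
    filter_upwards [Lp.coeFn_add g g'] with η hη
    rw [hη]; simp only [Pi.add_apply]; ring
  · intro c p g
    rw [← MemLp.toLp_const_smul]
    apply MemLp.toLp_congr
    filter_upwards with ξ
    simp only [Pi.smul_apply, smul_eq_mul]
    rw [← integral_const_mul]
    refine integral_congr_ae ?_
    filter_upwards [Lp.coeFn_smul c g] with η hη
    rw [hη]; simp only [Pi.smul_apply, smul_eq_mul]; ring
  · intro p g
    have := hk.nonneg
    apply norm_le_of_lintegral_enorm_sq_le (by positivity)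
    refine (lintegral_congr_ae ?_).trans_le (hk.memLp p g).2
    filter_upwards [(hk.memLp p g).1.coeFn_toLp] with ξ hξ
    simp only [LinearMap.mk₂_apply, hξ]
  · exact (hk.memLp p g).1.coeFn_toLp

lemma KerBound.isBilin {k : ℝ → ℝ → ℂ} {C : ℝ} (hk : KerBound k C) : IsBilin k (bilin k) := by
  have h := hk.exists_isBilin
  rw [bilin, dif_pos h]; exact h.choose_spec

lemma KerBound.bilin_ae {k : ℝ → ℝ → ℂ} {C : ℝ} (hk : KerBound k C) (p g : L2) :
    (bilin k p g : L2) =ᵐ[volume] fun ξ => ∫ η, k ξ η * (p (ξ - η) * g η) := (hk.isBilin p g).2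

lemma KerBound.norm_bilin_le {k : ℝ → ℝ → ℂ} {C : ℝ} (hk : KerBound k C) (p g : L2) :
    ‖bilin k p g‖ ≤ C * ‖p‖ * ‖g‖ := by
  have := hk.nonneg
  apply norm_le_of_lintegral_enorm_sq_le (by positivity)
  refine (lintegral_congr_ae ?_).trans_le (hk.memLp p g).2
  filter_upwards [hk.bilin_ae p g] with ξ hξ
  rw [hξ]

/-! ### Hilbert-Schmidt operators and traces -/

section HilbertSchmidt

set_option linter.unusedSectionVars false

variable {H : Type} [NormedAddCommGroup H] [InnerProductSpace ℂ H] [CompleteSpace H]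

/-- The Hilbert-Schmidt norm of `T` is at most `c`. -/
def HSle (T : H →L[ℂ] H) (c : ℝ) : Prop :=
  0 ≤ c ∧ ∀ (ι : Type) (b : HilbertBasis ι ℂ H) (s : Finset ι), ∑ i ∈ s, ‖T (b i)‖ ^ 2 ≤ c ^ 2

lemma HSle.summable {T : H →L[ℂ] H} {c : ℝ} (h : HSle T c) {ι : Type} (b : HilbertBasis ι ℂ H) :
    Summable fun i => ‖T (b i)‖ ^ 2 :=
  summable_of_sum_le (fun _ => by positivity) (h.2 ι b)

lemma HSle.tsum_le {T : H →L[ℂ] H} {c : ℝ} (h : HSle T c) {ι : Type} (b : HilbertBasis ι ℂ H) :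
    ∑' i, ‖T (b i)‖ ^ 2 ≤ c ^ 2 :=
  (h.summable b).tsum_le_of_sum_le (h.2 ι b)

lemma HSle.mono {T : H →L[ℂ] H} {c d : ℝ} (h : HSle T c) (hcd : c ≤ d) : HSle T d :=
  ⟨h.1.trans hcd, fun ι b s => (h.2 ι b s).trans (by have := h.1; gcongr)⟩

lemma hasSum_norm_inner_sq {ι : Type} (b : HilbertBasis ι ℂ H) (x : H) :
    HasSum (fun i => ‖inner ℂ (b i) x‖ ^ 2) (‖x‖ ^ 2) := by
  have h := (b.hasSum_inner_mul_inner x x).mapL Complex.reCLM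
  have e : Complex.reCLM (inner ℂ x x) = ‖x‖ ^ 2 := by
    rw [inner_self_eq_norm_sq_to_K]; norm_cast
  rw [e] at h
  convert h using 2 with i
  rw [← inner_conj_symm x (b i), Complex.conj_mul']
  norm_cast

/-- Both sides are double sums of the squared matrix elements. The sum over the finite set is
estimated by Bessel's inequality for each `T (b j)`, after the order of summation is exchanged. -/
lemma HSle.adjoint {T : H →L[ℂ] H} {c : ℝ} (h : HSle T c) :
    HSle (ContinuousLinearMap.adjoint T) c := by
  refine ⟨h.1, fun ι b s => ?_⟩
  have h1 : ∀ i ∈ s, HasSum (fun j => ‖inner ℂ (b i) (T (b j))‖ ^ 2)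
      (‖ContinuousLinearMap.adjoint T (b i)‖ ^ 2) := fun i _ => by
    convert hasSum_norm_inner_sq b (ContinuousLinearMap.adjoint T (b i)) using 3 with j
    rw [ContinuousLinearMap.adjoint_inner_right, ← inner_conj_symm, RCLike.norm_conj]
  have h2 := hasSum_sum h1
  rw [← h2.tsum_eq]
  refine (h2.summable.tsum_le_tsum (fun j => ?_) (h.summable b)).trans (h.tsum_le b)
  exact b.orthonormal.sum_inner_products_le (T (b j))

lemma HSle.mul_left {T : H →L[ℂ] H} {c : ℝ} (h : HSle T c) (X : H →L[ℂ] H) :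
    HSle (X * T) (‖X‖ * c) := by
  refine ⟨mul_nonneg (norm_nonneg _) h.1, fun ι b s => ?_⟩
  calc _ ≤ ∑ i ∈ s, ‖X‖ ^ 2 * ‖T (b i)‖ ^ 2 := by
        refine Finset.sum_le_sum fun i _ => ?_
        rw [← mul_pow]; gcongr; exact X.le_opNorm _
    _ ≤ _ := by rw [← Finset.mul_sum, mul_pow]; gcongr; exact h.2 ι b s

/-- `X` does not preserve orthonormal bases, so the factor is moved to the left by taking adjoints.
-/
lemma HSle.mul_right {T : H →L[ℂ] H} {c : ℝ} (h : HSle T c) (X : H →L[ℂ] H) :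
    HSle (T * X) (c * ‖X‖) := by
  have h1 := (h.adjoint.mul_left (ContinuousLinearMap.adjoint X)).adjoint
  rw [LinearIsometryEquiv.norm_map, mul_comm] at h1
  convert h1 using 1
  rw [ContinuousLinearMap.mul_def, ContinuousLinearMap.mul_def, ContinuousLinearMap.adjoint_comp,
    ContinuousLinearMap.adjoint_adjoint, ContinuousLinearMap.adjoint_adjoint]

lemma HSle.add {T S : H →L[ℂ] H} {c d : ℝ} (hT : HSle T c) (hS : HSle S d) :
    HSle (T + S) (c + d) := by
  refine ⟨add_nonneg hT.1 hS.1, fun ι b s => ?_⟩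
  have hc := hT.1
  have hd := hS.1
  have h1 := hT.2 ι b s
  have h2 := hS.2 ι b s
  have h3 : ∑ i ∈ s, ‖T (b i)‖ * ‖S (b i)‖ ≤ c * d := by
    apply abs_le_of_sq_le_sq _ (by positivity) |>.trans' (le_abs_self _)
    refine (Finset.sum_mul_sq_le_sq_mul_sq s _ _).trans ?_
    rw [mul_pow]; gcongr
  calc _ ≤ ∑ i ∈ s, (‖T (b i)‖ ^ 2 + 2 * (‖T (b i)‖ * ‖S (b i)‖) + ‖S (b i)‖ ^ 2) := by
        refine Finset.sum_le_sum fun i _ => ?_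
        have := norm_add_le (T (b i)) (S (b i))
        calc _ ≤ (‖T (b i)‖ + ‖S (b i)‖) ^ 2 := by
              simp only [add_apply]; gcongr
          _ = _ := by ring
    _ ≤ _ := by
        rw [Finset.sum_add_distrib, Finset.sum_add_distrib, ← Finset.mul_sum]; nlinarith

lemma HSle.neg {T : H →L[ℂ] H} {c : ℝ} (hT : HSle T c) : HSle (-T) c :=
  ⟨hT.1, fun ι b s => by simpa using hT.2 ι b s⟩

lemma HSle.sub {T S : H →L[ℂ] H} {c d : ℝ} (hT : HSle T c) (hS : HSle S d) :
    HSle (T - S) (c + d) := by rw [sub_eq_add_neg]; exact hT.add hS.neg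

lemma HSle.opNorm_le {T : H →L[ℂ] H} {c : ℝ} (h : HSle T c) : ‖T‖ ≤ c := by
  refine ContinuousLinearMap.opNorm_le_bound _ h.1 fun x => ?_
  obtain ⟨w, b, -⟩ := exists_hilbertBasis ℂ H
  have hc := h.1
  have h1 := hasSum_norm_inner_sq b (T x)
  apply abs_le_of_sq_le_sq _ (by positivity) |>.trans' (le_abs_self _)
  rw [← h1.tsum_eq]
  have h2 : ∀ i, ‖inner ℂ (b i) (T x)‖ ^ 2 ≤ ‖ContinuousLinearMap.adjoint T (b i)‖ ^ 2 * ‖x‖ ^ 2 :=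
    fun i => by
      rw [← ContinuousLinearMap.adjoint_inner_left, ← mul_pow]
      gcongr; exact norm_inner_le_norm _ _
  refine (h1.summable.tsum_le_tsum h2 ((h.adjoint.summable b).mul_right _)).trans ?_
  rw [tsum_mul_right, mul_pow]
  gcongr; exact h.adjoint.tsum_le b

/-- Both traces are iterated sums, in the two possible orders, of one absolutely summable family `⟪b
i, A (e j)⟫ ⟪e j, B (b i)⟫`. Using two unrelated bases gives cyclicity and independence of the basis
at once. -/
lemma HSle.hasSum_inner_mul {A B : H →L[ℂ] H} {c d : ℝ} (hA : HSle A c) (hB : HSle B d)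
    {ι κ : Type} (b : HilbertBasis ι ℂ H) (e : HilbertBasis κ ℂ H) :
    ∃ t : ℂ, HasSum (fun i => inner ℂ (b i) ((A * B) (b i))) t ∧
      HasSum (fun j => inner ℂ (e j) ((B * A) (e j))) t := by
  let f : ι × κ → ℂ := fun x => inner ℂ (b x.1) (A (e x.2)) * inner ℂ (e x.2) (B (b x.1))
  have s1 : Summable fun x : ι × κ => ‖inner ℂ (e x.2) (B (b x.1))‖ ^ 2 := by
    refine (summable_prod_of_nonneg (f := fun x : ι × κ => ‖inner ℂ (e x.2) (B (b x.1))‖ ^ 2)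
      fun x => sq_nonneg _).mpr ⟨fun i => (hasSum_norm_inner_sq e (B (b i))).summable, ?_⟩
    exact (hB.summable b).congr fun i => (hasSum_norm_inner_sq e (B (b i))).tsum_eq.symm
  have s2 : Summable fun x : ι × κ => ‖inner ℂ (b x.1) (A (e x.2))‖ ^ 2 := by
    have e1 : ∀ i j, ‖inner ℂ (b i) (A (e j))‖ = ‖inner ℂ (e j) (ContinuousLinearMap.adjoint A (b i))‖ :=
      fun i j => by
        rw [ContinuousLinearMap.adjoint_inner_right, ← inner_conj_symm, RCLike.norm_conj]
    simp only [e1]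
    refine (summable_prod_of_nonneg
      (f := fun x : ι × κ => ‖inner ℂ (e x.2) (ContinuousLinearMap.adjoint A (b x.1))‖ ^ 2)
      fun x => sq_nonneg _).mpr ⟨fun i => (hasSum_norm_inner_sq e (ContinuousLinearMap.adjoint A (b i))).summable, ?_⟩
    exact (hA.adjoint.summable b).congr fun i => (hasSum_norm_inner_sq e (ContinuousLinearMap.adjoint A (b i))).tsum_eq.symm
  have sf : Summable f := by
    refine Summable.of_norm_bounded (g := fun x : ι × κ => ‖inner ℂ (e x.2) (B (b x.1))‖ ^ 2 +
      ‖inner ℂ (b x.1) (A (e x.2))‖ ^ 2) (s1.add s2) fun x => ?_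
    rw [norm_mul]
    generalize ‖inner ℂ (b x.1) (A (e x.2))‖ = u
    generalize ‖inner ℂ (e x.2) (B (b x.1))‖ = v
    nlinarith [sq_nonneg (u - v), sq_nonneg u, sq_nonneg v]
  refine ⟨∑' x, f x, ?_, ?_⟩
  · refine sf.hasSum.prod_fiberwise fun i => ?_
    have := e.hasSum_inner_mul_inner (ContinuousLinearMap.adjoint A (b i)) (B (b i))
    simp only [ContinuousLinearMap.adjoint_inner_left] at this
    exact this
  · have sw := (Equiv.prodComm κ ι).hasSum_iff.mpr sf.hasSum
    refine sw.prod_fiberwise fun j => ?_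
    have := b.hasSum_inner_mul_inner (ContinuousLinearMap.adjoint B (e j)) (A (e j))
    simp only [ContinuousLinearMap.adjoint_inner_left] at this
    have h : (fun i => inner ℂ (e j) (B (b i)) * inner ℂ (b i) (A (e j))) =
        fun i => inner ℂ (b i) (A (e j)) * inner ℂ (e j) (B (b i)) := funext fun i => mul_comm _ _
    rw [h] at this
    exact this

lemma HSle.norm_le_of_hasSum {A B : H →L[ℂ] H} {c d : ℝ} (hA : HSle A c) (hB : HSle B d)
    {ι : Type} (b : HilbertBasis ι ℂ H) {t : ℂ}
    (h : HasSum (fun i => inner ℂ (b i) ((A * B) (b i))) t) : ‖t‖ ≤ c * d := by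
  have hc := hA.1
  have hd := hB.1
  refine le_of_tendsto h.norm (Eventually.of_forall fun s => ?_)
  calc _ ≤ ∑ i ∈ s, ‖ContinuousLinearMap.adjoint A (b i)‖ * ‖B (b i)‖ := by
        refine norm_sum_le_of_le _ fun i _ => ?_
        rw [mul_apply_eq_comp, ← ContinuousLinearMap.adjoint_inner_left]
        exact norm_inner_le_norm _ _
    _ ≤ _ := by
        apply abs_le_of_sq_le_sq _ (by positivity) |>.trans' (le_abs_self _)
        refine (Finset.sum_mul_sq_le_sq_mul_sq s _ _).trans ?_
        rw [mul_pow]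
        gcongr
        · exact hA.adjoint.2 ι b s
        · exact hB.2 ι b s

end HilbertSchmidt

lemma HasOpTrace.unique {T : L2 →L[ℂ] L2} {a a' : ℂ} (h : HasOpTrace T a) (h' : HasOpTrace T a') :
    a = a' := by
  obtain ⟨w, b, -⟩ := exists_hilbertBasis ℂ L2
  exact (h w b).unique (h' w b)

lemma HasOpTrace.opTrace_eq {T : L2 →L[ℂ] L2} {a : ℂ} (h : HasOpTrace T a) : opTrace T = a := by
  have h' : ∃ a, HasOpTrace T a := ⟨a, h⟩
  rw [opTrace, dif_pos h']
  exact h'.choose_spec.unique h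

/-- A fixed basis `e` serves as intermediary: the trace of `A * B` in any basis equals the trace of
`B * A` in `e`, and likewise with the two factors exchanged. -/
lemma HSle.exists_hasOpTrace {A B : L2 →L[ℂ] L2} {c d : ℝ} (hA : HSle A c) (hB : HSle B d) :
    ∃ t, HasOpTrace (A * B) t ∧ HasOpTrace (B * A) t := by
  obtain ⟨w, e, -⟩ := exists_hilbertBasis ℂ L2
  obtain ⟨t, h1, h2⟩ := hA.hasSum_inner_mul hB e e
  refine ⟨t, fun ι b => ?_, fun ι b => ?_⟩
  · obtain ⟨t', h1', h2'⟩ := hA.hasSum_inner_mul hB b e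
    rwa [h2'.unique h2] at h1'
  · obtain ⟨t', h1', h2'⟩ := hA.hasSum_inner_mul hB e b
    rwa [h1'.unique h1] at h2'

lemma HSle.hasOpTrace {A B : L2 →L[ℂ] L2} {c d : ℝ} (hA : HSle A c) (hB : HSle B d) :
    HasOpTrace (A * B) (opTrace (A * B)) := by
  obtain ⟨t, h1, -⟩ := hA.exists_hasOpTrace hB
  rwa [h1.opTrace_eq]

lemma HSle.opTrace_mul_comm {A B : L2 →L[ℂ] L2} {c d : ℝ} (hA : HSle A c) (hB : HSle B d) :
    opTrace (A * B) = opTrace (B * A) := by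
  obtain ⟨t, h1, h2⟩ := hA.exists_hasOpTrace hB
  rw [h1.opTrace_eq, h2.opTrace_eq]

lemma HSle.norm_opTrace_le {A B : L2 →L[ℂ] L2} {c d : ℝ} (hA : HSle A c) (hB : HSle B d) :
    ‖opTrace (A * B)‖ ≤ c * d := by
  obtain ⟨w, b, -⟩ := exists_hilbertBasis ℂ L2
  exact hA.norm_le_of_hasSum hB b (hA.hasOpTrace hB w b)

lemma HasOpTrace.add {S T : L2 →L[ℂ] L2} {a a' : ℂ} (h : HasOpTrace S a) (h' : HasOpTrace T a') :
    HasOpTrace (S + T) (a + a') := fun ι b => by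
  simpa [inner_add_right] using (h ι b).add (h' ι b)

lemma HasOpTrace.sub {S T : L2 →L[ℂ] L2} {a a' : ℂ} (h : HasOpTrace S a) (h' : HasOpTrace T a') :
    HasOpTrace (S - T) (a - a') := fun ι b => by
  simpa [inner_sub_right] using (h ι b).sub (h' ι b)

lemma HasOpTrace.smul {T : L2 →L[ℂ] L2} {a : ℂ} (h : HasOpTrace T a) (c : ℂ) :
    HasOpTrace (c • T) (c * a) := fun ι b => by
  simpa [inner_smul_right] using (h ι b).mul_left c

/-- `‖tr (A B) - tr (A' B')‖` in terms of the Hilbert-Schmidt norms of the differences. -/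
lemma norm_opTrace_sub_le {A B A' B' : L2 →L[ℂ] L2} {c d' e f : ℝ} (hB : HSle B c)
    (hA' : HSle A' d') (hA : HSle (A - A') e) (hBB : HSle (B - B') f) :
    ‖opTrace (A * B) - opTrace (A' * B')‖ ≤ e * c + d' * f := by
  have hA1 : HSle A (e + d') := by simpa using hA.add hA'
  have hB1 : HSle B' (c + f) := by simpa using hB.sub hBB
  have h1 := hA.hasOpTrace hB
  have h2 := hA'.hasOpTrace hBB
  have h3 : HasOpTrace (A * B - A' * B') (opTrace ((A - A') * B) + opTrace (A' * (B - B'))) := by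
    have := h1.add h2
    convert this using 1
    noncomm_ring
  rw [((hA1.hasOpTrace hB).sub (hA'.hasOpTrace hB1)).unique h3]
  exact (norm_add_le _ _).trans (add_le_add (hA.norm_opTrace_le hB) (hA'.norm_opTrace_le hBB))

/-- Index sets of Hilbert bases of a separable space are countable. -/
lemma countable_of_hilbertBasis {ι : Type} (b : HilbertBasis ι ℂ L2) : Countable ι := by
  have : Fact ((2 : ℝ≥0∞) ≠ ⊤) := ⟨by simp⟩
  have : SecondCountableTopology L2 := inferInstance
  have hdist : ∀ i j, i ≠ j → (1 : ℝ) ≤ dist (b i) (b j) := fun i j hij => by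
    have h0 : inner ℂ (b i) (b j) = 0 := b.orthonormal.2 hij
    have h1 := norm_sub_sq_real (b i) (b j)
    have h2 := @norm_sub_sq ℂ _ _ _ _ (b i) (b j)
    rw [h0, b.orthonormal.1, b.orthonormal.1] at h2
    rw [dist_eq_norm]
    simp at h2
    nlinarith [norm_nonneg (b i - b j)]
  have hd : (Set.univ : Set ι).PairwiseDisjoint fun i => Metric.ball (b i) (1 / 2) := by
    intro i _ j _ hij
    refine Metric.ball_disjoint_ball ?_
    linarith [hdist i j hij]
  have := hd.countable_of_isOpen (fun i _ => Metric.isOpen_ball)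
    (fun i _ => ⟨b i, Metric.mem_ball_self (by norm_num)⟩)
  exact Set.countable_univ_iff.mp this

/-! ### Bilinear operators with Hilbert-Schmidt kernels -/

lemma inner_L2 (f g : L2) : inner ℂ f g = ∫ x, conj (f x) * g x := by
  rw [MeasureTheory.L2.inner_def]
  simp [mul_comm]

/-- Bessel's inequality for the conjugate of `h`. No integrability is assumed, so it applies to
every slice of a kernel. -/
lemma sum_norm_integral_sq_le {ι : Type} (b : HilbertBasis ι ℂ L2) (s : Finset ι) {h : ℝ → ℂ}
    (hm : Measurable h) :
    ∑ i ∈ s, ‖∫ η, h η * (b i) η‖ₑ ^ 2 ≤ ∫⁻ η, ‖h η‖ₑ ^ 2 := by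
  by_cases hfin : ∫⁻ η, ‖h η‖ₑ ^ 2 = ⊤
  · simp [hfin]
  have hL : MemLp (fun η => conj (h η)) 2 volume := by
    refine ⟨(by fun_prop : Measurable fun η => conj (h η)).aestronglyMeasurable, ?_⟩
    rw [eLpNorm_lt_top_iff_lintegral_rpow_enorm_lt_top (by simp) (by simp)]
    simpa [lt_top_iff_ne_top] using hfin
  have h1 : ∀ i, ∫ η, h η * (b i) η = inner ℂ hL.toLp (b i) := fun i => by
    rw [inner_L2]
    refine integral_congr_ae ?_
    filter_upwards [hL.coeFn_toLp] with η hη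
    rw [hη, conj_conj]
  have h2 := b.orthonormal.sum_inner_products_le (s := s) hL.toLp
  have h3 : ∫⁻ η, ‖h η‖ₑ ^ 2 = ENNReal.ofReal (‖hL.toLp‖ ^ 2) := by
    rw [← lintegral_enorm_sq_eq]
    refine lintegral_congr_ae ?_
    filter_upwards [hL.coeFn_toLp] with η hη
    rw [hη]; simp
  rw [h3]
  refine le_trans (le_of_eq ?_) (ENNReal.ofReal_le_ofReal h2)
  rw [ENNReal.ofReal_sum_of_nonneg fun _ _ => by positivity]
  refine Finset.sum_congr rfl fun i _ => ?_
  rw [h1, ← inner_conj_symm, ← ofReal_norm, RCLike.norm_conj, ENNReal.ofReal_pow (norm_nonneg _)]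

/-- A bilinear kernel operator whose kernel satisfies the second quadratic bound gives
Hilbert-Schmidt operators. -/
lemma HSle_bilin {k : ℝ → ℝ → ℂ} {C : ℝ} (hm : Measurable (Function.uncurry k)) (hC : 0 ≤ C)
    (h : ∀ ζ, ∫⁻ η, ‖k (ζ + η) η‖ₑ ^ 2 ≤ ENNReal.ofReal (C ^ 2)) (p : L2) :
    HSle (bilin k p) (C * ‖p‖) := by
  have hk : KerBound k C := ⟨hm, hC, Or.inr h⟩
  refine ⟨by positivity, fun ι b s => ?_⟩
  have hp := (Lp.stronglyMeasurable p).measurable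
  have hpp : Measurable fun x : ℝ × ℝ => p (x.1 - x.2) := hp.comp (by fun_prop)
  have hk2 : Measurable fun x : ℝ × ℝ => k (x.1 + x.2) x.2 :=
      hm.comp ((measurable_fst.add measurable_snd).prodMk measurable_snd)
  rw [← ENNReal.ofReal_le_ofReal_iff (by positivity), ENNReal.ofReal_sum_of_nonneg fun _ _ => by positivity]
  calc _ = ∑ i ∈ s, ∫⁻ ξ, ‖∫ η, (k ξ η * p (ξ - η)) * (b i) η‖ₑ ^ 2 := by
        refine Finset.sum_congr rfl fun i _ => ?_
        rw [← lintegral_enorm_sq_eq]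
        refine lintegral_congr_ae ?_
        filter_upwards [hk.bilin_ae p (b i)] with ξ hξ
        rw [hξ]; simp only [mul_assoc]
    _ = ∫⁻ ξ, ∑ i ∈ s, ‖∫ η, (k ξ η * p (ξ - η)) * (b i) η‖ₑ ^ 2 := by
        rw [lintegral_finsetSum]
        intro i _
        have hb := (Lp.stronglyMeasurable (b i)).measurable
        have : Measurable fun x : ℝ × ℝ => k x.1 x.2 * p (x.1 - x.2) * (b i) x.2 :=
          (Measurable.mul hm hpp).mul (hb.comp measurable_snd)
        exact this.stronglyMeasurable.integral_prod_right'.measurable.enorm.pow_const 2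
    -- For each `ξ`, Bessel's inequality in `η` removes the basis; what remains is the square
    -- integral of the full integral kernel.
    _ ≤ ∫⁻ ξ, ∫⁻ η, ‖k ξ η * p (ξ - η)‖ₑ ^ 2 := by
        refine lintegral_mono fun ξ => ?_
        refine sum_norm_integral_sq_le b s ?_
        exact (Measurable.mul hm hpp).comp measurable_prodMk_left
    _ = ∫⁻ ξ, ∫⁻ η, ‖k ξ η‖ₑ ^ 2 * ‖p (ξ - η)‖ₑ ^ 2 := by simp only [enorm_mul, mul_pow]
    _ = ∫⁻ ζ, (∫⁻ η, ‖k (ζ + η) η‖ₑ ^ 2) * ‖p ζ‖ₑ ^ 2 := by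
        rw [lintegral_lintegral_swap ((hm.enorm.pow_const 2).mul (hpp.enorm.pow_const 2)).aemeasurable]
        have : ∀ η, ∫⁻ ξ, ‖k ξ η‖ₑ ^ 2 * ‖p (ξ - η)‖ₑ ^ 2
            = ∫⁻ ζ, ‖k (ζ + η) η‖ₑ ^ 2 * ‖p ζ‖ₑ ^ 2 := fun η => by
          rw [← lintegral_add_right_eq_self (fun ξ => ‖k ξ η‖ₑ ^ 2 * ‖p (ξ - η)‖ₑ ^ 2) η]
          simp
        simp only [this]
        rw [lintegral_lintegral_swap]
        · refine lintegral_congr fun ζ => ?_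
          rw [lintegral_mul_const]
          exact (hk2.comp measurable_prodMk_left).enorm.pow_const 2
        · exact (((hk2.comp measurable_swap).enorm.pow_const 2).mul
              ((hp.comp measurable_snd).enorm.pow_const 2)).aemeasurable
    _ ≤ ∫⁻ ζ, ENNReal.ofReal (C ^ 2) * ‖p ζ‖ₑ ^ 2 := by gcongr with ζ; exact h ζ
    _ = _ := by
        rw [lintegral_const_mul _ (by fun_prop), lintegral_enorm_sq_eq,
          ← ENNReal.ofReal_mul (by positivity), mul_pow]

/-! ### A cubic fixed point problem -/

section CubicFixedPoint

variable {E : Type*} [NormedAddCommGroup E] [NormedSpace ℂ E]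

open Classical in
/-- The solution `x` of `x = u - T p x x` in the ball of radius `η`. -/
def cubFix (T : E →L[ℂ] E →L[ℂ] E →L[ℂ] E) (η : ℝ) (p u : E) : E :=
  if h : ∃ x, ‖x‖ ≤ η ∧ x = u - T p x x then h.choose else 0

/-- `T` is bounded by `C`, and `η` is a radius on which the cubic fixed point problem contracts. -/
structure CubBound (T : E →L[ℂ] E →L[ℂ] E →L[ℂ] E) (C η : ℝ) : Prop where
  nonneg : 0 ≤ C
  pos : 0 < η
  small : C * η ^ 2 ≤ 1 / 4
  bound : ∀ p f g, ‖T p f g‖ ≤ C * ‖p‖ * ‖f‖ * ‖g‖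

variable {T : E →L[ℂ] E →L[ℂ] E →L[ℂ] E} {C η : ℝ}

lemma tendsto_clm_apply {α F G : Type*} [NormedAddCommGroup F] [NormedSpace ℂ F]
    [NormedAddCommGroup G] [NormedSpace ℂ G] {l : Filter α} {f : α → F →L[ℂ] G} {g : α → F}
    {f₀ : F →L[ℂ] G} {g₀ : F} (hf : Tendsto f l (𝓝 f₀)) (hg : Tendsto g l (𝓝 g₀)) :
    Tendsto (fun t => f t (g t)) l (𝓝 (f₀ g₀)) :=
  (isBoundedBilinearMap_apply.continuous.tendsto (f₀, g₀)).comp (hf.prodMk_nhds hg)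

lemma CubBound.bound_ball (h : CubBound T C η) {p f : E} (hp : ‖p‖ ≤ η) (hf : ‖f‖ ≤ η) (g : E) :
    ‖T p f g‖ ≤ 1 / 4 * ‖g‖ := by
  have := h.nonneg
  have := h.pos
  calc _ ≤ C * ‖p‖ * ‖f‖ * ‖g‖ := h.bound _ _ _
    _ ≤ C * η * η * ‖g‖ := by gcongr
    _ = C * η ^ 2 * ‖g‖ := by ring
    _ ≤ _ := by gcongr; exact h.small

lemma CubBound.bound_ball' (h : CubBound T C η) {p f : E} (hp : ‖p‖ ≤ η) (hf : ‖f‖ ≤ η) (g : E) :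
    ‖T p g f‖ ≤ 1 / 4 * ‖g‖ := by
  have := h.nonneg
  have := h.pos
  calc _ ≤ C * ‖p‖ * ‖g‖ * ‖f‖ := h.bound _ _ _
    _ ≤ C * η * ‖g‖ * η := by gcongr
    _ = C * η ^ 2 * ‖g‖ := by ring
    _ ≤ _ := by gcongr; exact h.small

lemma CubBound.bound_ball_left (h : CubBound T C η) {x y : E} (hx : ‖x‖ ≤ η) (hy : ‖y‖ ≤ η) (p : E) :
    ‖T p x y‖ ≤ 1 / 4 * ‖p‖ := by
  have := h.nonneg
  have := h.pos
  calc _ ≤ C * ‖p‖ * ‖x‖ * ‖y‖ := h.bound _ _ _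
    _ ≤ C * ‖p‖ * η * η := by gcongr
    _ = C * η ^ 2 * ‖p‖ := by ring
    _ ≤ _ := by gcongr; exact h.small

/-- The difference is telescoped one argument of `T` at a time. The two terms with `x - x'` cost a
quarter each and are absorbed on the left, which gives the factor 2. This yields continuity in the
data. -/
lemma CubBound.norm_fix_sub_le (h : CubBound T C η) {p p' u u' x x' : E} (hp' : ‖p'‖ ≤ η)
    (hx : ‖x‖ ≤ η) (hx' : ‖x'‖ ≤ η) (e : x = u - T p x x)
    (e' : x' = u' - T p' x' x') : ‖x - x'‖ ≤ 2 * (‖u - u'‖ + 1 / 4 * ‖p - p'‖) := by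
  have e1 : x - x' = (u - u') - T (p - p') x x - T p' (x - x') x - T p' x' (x - x') := by
    conv_lhs => rw [e, e']
    simp only [map_sub, sub_apply]; abel
  have h1 := h.bound_ball_left hx hx (p - p')
  have h2 := h.bound_ball' hp' hx (x - x')
  have h3 := h.bound_ball hp' hx' (x - x')
  have h4 : ‖x - x'‖ ≤ ‖u - u'‖ + ‖T (p - p') x x‖ + ‖T p' (x - x') x‖ + ‖T p' x' (x - x')‖ := by
    conv_lhs => rw [e1]
    refine (norm_sub_le _ _).trans (add_le_add_left ?_ _)
    refine (norm_sub_le _ _).trans (add_le_add_left ?_ _)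
    exact norm_sub_le _ _
  linarith

variable [CompleteSpace E]

/-- Banach's fixed point theorem: each of the two arguments `x` contributes a Lipschitz constant
1/4, and the ball is preserved because `η / 2 + η / 4 ≤ η`. -/
lemma CubBound.exists_fix (h : CubBound T C η) {p u : E} (hp : ‖p‖ ≤ η) (hu : ‖u‖ ≤ η / 2) :
    ∃ x, ‖x‖ ≤ η ∧ x = u - T p x x := by
  have hη := h.pos
  let Φ : E → E := fun x => u - T p x x
  have hmaps : Set.MapsTo Φ (Metric.closedBall 0 η) (Metric.closedBall 0 η) := by
    intro x hx
    rw [mem_closedBall_zero_iff] at hx ⊢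
    calc ‖u - T p x x‖ ≤ ‖u‖ + ‖T p x x‖ := norm_sub_le _ _
      _ ≤ η / 2 + 1 / 4 * η := by
          gcongr; exact (h.bound_ball hp hx x).trans (by gcongr)
      _ ≤ η := by linarith
  have hc : ContractingWith (1 / 2) (hmaps.restrict Φ _ _) := by
    refine ⟨by norm_num, LipschitzWith.of_dist_le_mul fun x y => ?_⟩
    have hx := mem_closedBall_zero_iff.1 x.2
    have hy := mem_closedBall_zero_iff.1 y.2
    rw [Subtype.dist_eq, Subtype.dist_eq, dist_eq_norm (x : E)]
    have e : Φ x - Φ y = -(T p (x - y : E) (x : E) + T p (y : E) (x - y : E)) := by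
      simp only [Φ, map_sub, sub_apply]; abel
    change dist (Φ x) (Φ y) ≤ _
    rw [dist_eq_norm, e, norm_neg]
    have h1 := h.bound_ball' hp hx (x - y : E)
    have h2 := h.bound_ball hp hy (x - y : E)
    refine (norm_add_le _ _).trans ?_
    push_cast
    linarith
  have hcpl : IsComplete (Metric.closedBall (0 : E) η) := Metric.isClosed_closedBall.isComplete
  obtain ⟨x, hx, hfix, -⟩ := hc.exists_fixedPoint' hcpl hmaps (x := 0)
    (Metric.mem_closedBall_self hη.le) (edist_ne_top _ _)
  exact ⟨x, mem_closedBall_zero_iff.1 hx, hfix.symm⟩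

lemma CubBound.cubFix_spec (h : CubBound T C η) {p u : E} (hp : ‖p‖ ≤ η) (hu : ‖u‖ ≤ η / 2) :
    ‖cubFix T η p u‖ ≤ η ∧ cubFix T η p u = u - T p (cubFix T η p u) (cubFix T η p u) := by
  have h1 := h.exists_fix hp hu
  rw [cubFix, dif_pos h1]
  exact h1.choose_spec

lemma CubBound.norm_cubFix_le (h : CubBound T C η) {p u : E} (hp : ‖p‖ ≤ η) (hu : ‖u‖ ≤ η / 2) :
    ‖cubFix T η p u‖ ≤ 2 * ‖u‖ := by
  obtain ⟨h1, h2⟩ := h.cubFix_spec hp hu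
  have h3 := h.bound_ball hp h1 (cubFix T η p u)
  have h4 : ‖cubFix T η p u‖ ≤ ‖u‖ + ‖T p (cubFix T η p u) (cubFix T η p u)‖ := by
    conv_lhs => rw [h2]
    exact norm_sub_le _ _
  linarith [norm_nonneg u]

lemma CubBound.tendsto_cubFix (h : CubBound T C η) {α : Type*} {l : Filter α} {p u : α → E}
    {p₀ u₀ : E} (hp : Tendsto p l (𝓝 p₀)) (hu : Tendsto u l (𝓝 u₀))
    (hpη : ∀ᶠ t in l, ‖p t‖ ≤ η) (huη : ∀ᶠ t in l, ‖u t‖ ≤ η / 2) (hp₀ : ‖p₀‖ ≤ η)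
    (hu₀ : ‖u₀‖ ≤ η / 2) :
    Tendsto (fun t => cubFix T η (p t) (u t)) l (𝓝 (cubFix T η p₀ u₀)) := by
  rw [tendsto_iff_norm_sub_tendsto_zero]
  have h1 : Tendsto (fun t => 2 * (‖u t - u₀‖ + 1 / 4 * ‖p t - p₀‖)) l (𝓝 0) := by
    have := ((tendsto_iff_norm_sub_tendsto_zero.1 hu).add
      ((tendsto_iff_norm_sub_tendsto_zero.1 hp).const_mul (1 / 4))).const_mul 2
    simpa using this
  refine tendsto_of_tendsto_of_tendsto_of_le_of_le' tendsto_const_nhds h1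
    (Eventually.of_forall fun _ => norm_nonneg _) ?_
  filter_upwards [hpη, huη] with t h2 h3
  exact h.norm_fix_sub_le hp₀ (h.cubFix_spec h2 h3).1 (h.cubFix_spec hp₀ hu₀).1
    (h.cubFix_spec h2 h3).2 (h.cubFix_spec hp₀ hu₀).2

/-- The difference quotients satisfy a linear equation exactly, with an operator `1 + A τ` that is
invertible at `t` because `A t` has norm at most 1/2. Continuity of inversion allows the passage to
the limit without an implicit function theorem. -/
lemma CubBound.hasDerivAt_cubFix (h : CubBound T C η) {p u : ℝ → E} {t : ℝ} {p' u' : E}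
    (hp : HasDerivAt p p' t) (hu : HasDerivAt u u' t) (hpη : ∀ᶠ τ in 𝓝 t, ‖p τ‖ ≤ η)
    (huη : ∀ᶠ τ in 𝓝 t, ‖u τ‖ ≤ η / 2) :
    ∃ x', HasDerivAt (fun τ => cubFix T η (p τ) (u τ)) x' t ∧
      x' = u' - T p' (cubFix T η (p t) (u t)) (cubFix T η (p t) (u t))
        - T (p t) x' (cubFix T η (p t) (u t)) - T (p t) (cubFix T η (p t) (u t)) x' := by
  set x : ℝ → E := fun τ => cubFix T η (p τ) (u τ) with hx
  have hp0 := hpη.self_of_nhds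
  have hu0 := huη.self_of_nhds
  have hxc : Tendsto x (𝓝 t) (𝓝 (x t)) :=
    h.tendsto_cubFix hp.continuousAt hu.continuousAt hpη huη hp0 hu0
  obtain ⟨hx0, he0⟩ := h.cubFix_spec hp0 hu0
  -- One slot carries the moving point and the other the fixed one; this asymmetry makes the
  -- equation for the increment exact, with no quadratic remainder.
  let A : ℝ → E →L[ℂ] E := fun τ => (T (p τ)).flip (x τ) + T (p τ) (x t)
  have hTc : Tendsto (fun τ => T (p τ)) (𝓝 t) (𝓝 (T (p t))) :=
    (T.continuous.tendsto _).comp hp.continuousAt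
  have hA : Tendsto A (𝓝 t) (𝓝 (A t)) := by
    refine Tendsto.add ?_ (tendsto_clm_apply hTc tendsto_const_nhds)
    exact tendsto_clm_apply (((ContinuousLinearMap.flipₗᵢ ℂ E E E).continuous.tendsto _).comp hTc) hxc
  have hAnorm : ‖-A t‖ < 1 := by
    rw [norm_neg]
    refine lt_of_le_of_lt (ContinuousLinearMap.opNorm_le_bound _ (M := 1 / 2) (by norm_num) fun g => ?_)
      (by norm_num)
    refine (norm_add_le _ _).trans ?_
    have h1 := h.bound_ball' hp0 hx0 g
    have h2 := h.bound_ball hp0 hx0 g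
    change ‖T (p t) g (x t)‖ + ‖T (p t) (x t) g‖ ≤ _
    linarith
  have hunit : IsUnit (1 + A t) := by
    have := (Units.oneSub (-A t) hAnorm).isUnit
    rwa [Units.val_oneSub, sub_neg_eq_add] at this
  obtain ⟨U, hU⟩ := hunit
  have hinv : Tendsto (fun τ => Ring.inverse (1 + A τ)) (𝓝 t) (𝓝 (Ring.inverse (1 + A t))) := by
    have h1 := NormedRing.inverse_continuousAt U
    rw [hU] at h1
    exact Tendsto.comp h1 (tendsto_const_nhds.add hA)
  have hiu : ∀ᶠ τ in 𝓝 t, IsUnit (1 + A τ) := by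
    have h1 : ∀ᶠ y in 𝓝 (1 + A t), IsUnit y := by rw [← hU]; exact Units.nhds U
    exact (tendsto_const_nhds.add hA).eventually h1
  refine ⟨Ring.inverse (1 + A t) (u' - T p' (x t) (x t)), ?_, ?_⟩
  · rw [hasDerivAt_iff_tendsto_slope]
    have hs : Tendsto (fun τ => Ring.inverse (1 + A τ) (slope u t τ - T (slope p t τ) (x t) (x t)))
        (𝓝[≠] t) (𝓝 (Ring.inverse (1 + A t) (u' - T p' (x t) (x t)))) := by
      refine tendsto_clm_apply (hinv.mono_left nhdsWithin_le_nhds) ?_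
      refine hu.tendsto_slope.sub ?_
      exact tendsto_clm_apply (tendsto_clm_apply ((T.continuous.tendsto _).comp hp.tendsto_slope)
        tendsto_const_nhds) tendsto_const_nhds
    refine hs.congr' ?_
    filter_upwards [(hiu.and (hpη.and huη)).filter_mono nhdsWithin_le_nhds] with τ hτ
    obtain ⟨h1, h2, h3⟩ := hτ
    have e1 := (h.cubFix_spec h2 h3).2
    have key : (1 + A τ) (x τ - x t) = (u τ - u t) - T (p τ - p t) (x t) (x t) := by
      have e2 : x τ = u τ - T (p τ) (x τ) (x τ) := e1
      have e3 : x t = u t - T (p t) (x t) (x t) := he0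
      calc (1 + A τ) (x τ - x t)
          = (x τ - x t) + (T (p τ) (x τ - x t) (x τ) + T (p τ) (x t) (x τ - x t)) := rfl
        _ = ((u τ - T (p τ) (x τ) (x τ)) - (u t - T (p t) (x t) (x t))) +
            (T (p τ) (x τ - x t) (x τ) + T (p τ) (x t) (x τ - x t)) := by rw [← e2, ← e3]
        _ = _ := by simp only [map_sub, sub_apply]; abel
    have key2 : (1 + A τ) (slope x t τ) = slope u t τ - T (slope p t τ) (x t) (x t) := by
      have hr : ∀ (r : ℝ) (y : E), r • y = (r : ℂ) • y := fun r y => rfl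
      simp only [slope_def_module, hr, map_smul, smul_apply] at key ⊢
      rw [key, ← smul_sub]
    rw [← key2, ← mul_apply_eq_comp, Ring.inverse_mul_cancel _ h1, one_apply_eq_self]
  · set y := Ring.inverse (1 + A t) (u' - T p' (x t) (x t)) with hy
    have h1 : (1 + A t) y = u' - T p' (x t) (x t) := by
      rw [hy, ← mul_apply_eq_comp, Ring.mul_inverse_cancel _ ⟨U, hU⟩, one_apply_eq_self]
    have h2 : (1 + A t) y = y + (T (p t) y (x t) + T (p t) (x t) y) := rfl
    rw [h2] at h1
    rw [sub_sub, ← h1]; abel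

end CubicFixedPoint

/-! ### Fourier transforms of convolutions -/

/-- The convolution of `v` and `w`. -/
def fconv (v w : ℝ → ℂ) (ξ : ℝ) : ℂ := ∫ η, v (ξ - η) * w η

lemma fconv_eq (v w : ℝ → ℂ) :
    fconv v w = convolution v w (ContinuousLinearMap.mul ℂ ℂ) volume := by
  funext ξ; exact (convolution_mul_swap (𝕜 := ℂ)).symm

lemma integrable_fconv {v w : ℝ → ℂ} (hv : Integrable v) (hw : Integrable w) :
    Integrable (fconv v w) := by
  rw [fconv_eq]; exact hv.integrable_convolution _ hw

lemma fourierInv_fconv {v w : ℝ → ℂ} (hv : Integrable v) (hw : Integrable w) (x : ℝ) :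
    𝓕⁻ (fconv v w) x = 𝓕⁻ v x * 𝓕⁻ w x := by
  rw [fconv_eq]
  simp only [Real.fourierInv_eq_fourier_neg]
  exact Real.fourier_mul_convolution_eq hv hw (-x)

lemma hasDerivAt_fourierInv {v : ℝ → ℂ} (hv : Integrable v)
    (hv' : Integrable fun ξ : ℝ => (2 * Real.pi * ξ * I) * v ξ) (x : ℝ) :
    HasDerivAt (𝓕⁻ v) (𝓕⁻ (fun ξ : ℝ => (2 * Real.pi * ξ * I) * v ξ) x) x := by
  have h1 : Integrable fun ξ : ℝ => ξ • v ξ := by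
    have := hv'.const_mul ((2 * Real.pi * I)⁻¹ : ℂ)
    refine this.congr (ae_of_all _ fun ξ => ?_)
    have hpi : (Real.pi : ℂ) ≠ 0 := by exact_mod_cast Real.pi_ne_zero
    simp only [real_smul]
    field_simp
  have h2 := Real.hasDerivAt_fourier hv h1 (-x)
  have h3 := h2.scomp x (hasDerivAt_neg x)
  have e1 : (𝓕 v ∘ fun y : ℝ => -y) = 𝓕⁻ v := by
    funext y; exact (Real.fourierInv_eq_fourier_neg v y).symm
  have e1' : (𝓕 v ∘ Neg.neg) = 𝓕⁻ v := e1
  rw [e1'] at h3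
  refine h3.congr_deriv ?_
  rw [Real.fourierInv_eq_fourier_neg, neg_one_smul, Real.fourier_real_eq, Real.fourier_real_eq,
    ← integral_neg]
  refine integral_congr_ae (ae_of_all _ fun ξ => ?_)
  simp only [smul_eq_mul, Circle.smul_def]; ring

lemma tendsto_fourierInv_zero (v : ℝ → ℂ) : Tendsto (𝓕⁻ v) (cocompact ℝ) (𝓝 0) := by
  rw [Real.fourierInv_eq_fourier_comp_neg]; exact Real.zero_at_infty_fourier _

lemma norm_fourierInv_le (v : ℝ → ℂ) (x : ℝ) : ‖𝓕⁻ v x‖ ≤ ∫ ξ, ‖v ξ‖ := by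
  rw [Real.fourierInv_eq_fourier_neg]
  exact VectorFourier.norm_fourierIntegral_le_integral_norm _ _ _ _ _

/-! ### Multiplication operators -/

lemma mulOp_ae {m : ℝ → ℂ} (hm : MemLp m ∞ (volume : Measure ℝ)) (f : L2) :
    (mulOp m f : L2) =ᵐ[volume] fun ξ => m ξ * f ξ := by
  rw [mulOp, dif_pos hm]
  have h := ContinuousLinearMap.coeFn_holder (ContinuousLinearMap.mul ℂ ℂ) (r := 2) (hm.toLp m) f
  filter_upwards [h, hm.coeFn_toLp] with ξ h1 h2
  rw [ContinuousLinearMap.holderL_apply_apply, h1, h2]; rfl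

lemma norm_mulOp_le {m : ℝ → ℂ} (hm : MemLp m ∞ (volume : Measure ℝ)) {C : ℝ}
    (hb : ∀ ξ, ‖m ξ‖ ≤ C) (f : L2) : ‖mulOp m f‖ ≤ C * ‖f‖ := by
  apply Lp.norm_le_mul_norm_of_ae_le_mul
  filter_upwards [mulOp_ae hm f] with ξ hξ
  rw [hξ, norm_mul]; gcongr; exact hb ξ

lemma memLp_top_of_measurable {m : ℝ → ℂ} (hm : Measurable m) {C : ℝ} (hb : ∀ ξ, ‖m ξ‖ ≤ C) :
    MemLp m ∞ (volume : Measure ℝ) :=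
  memLp_top_of_bound hm.aestronglyMeasurable C (ae_of_all _ hb)

/-- The complex valued weight `jb κ ^ a`. -/
def jw (κ a ξ : ℝ) : ℂ := ((jb κ ξ ^ a : ℝ) : ℂ)

@[fun_prop]
lemma measurable_jw (κ a : ℝ) : Measurable (jw κ a) :=
  Complex.measurable_ofReal.comp ((measurable_jb κ).pow_const a)

lemma norm_jw (κ a ξ : ℝ) : ‖jw κ a ξ‖ = jb κ ξ ^ a := by
  rw [jw, norm_real, Real.norm_of_nonneg (Real.rpow_nonneg (jb_nonneg _ _) _)]

lemma jw_neg (κ a ξ : ℝ) : jw κ a (-ξ) = jw κ a ξ := by simp [jw, jb_neg]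

lemma jw_add {κ : ℝ} (hκ : 1 ≤ |κ|) (a b ξ : ℝ) : jw κ (a + b) ξ = jw κ a ξ * jw κ b ξ := by
  rw [jw, Real.rpow_add (jb_pos hκ ξ)]; push_cast; rfl

lemma jw_mul_neg {κ : ℝ} (hκ : 1 ≤ |κ|) (a ξ : ℝ) : jw κ a ξ * jw κ (-a) ξ = 1 := by
  rw [← jw_add hκ]; simp [jw]

lemma jw_ne_zero {κ : ℝ} (hκ : 1 ≤ |κ|) (a ξ : ℝ) : jw κ a ξ ≠ 0 :=
  left_ne_zero_of_mul_eq_one (jw_mul_neg hκ a ξ)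

/-- The phase of `(2 κ + ∂)⁻¹`. -/
def phs (κ ξ : ℝ) : ℂ := jw κ 1 ξ / (2 * κ + 2 * Real.pi * ξ * I)

lemma sym_ne_zero {κ : ℝ} (hκ : 1 ≤ |κ|) (ξ : ℝ) : (2 * κ + 2 * Real.pi * ξ * I : ℂ) ≠ 0 := by
  rw [← norm_pos_iff, norm_two_mul_add]; exact jb_pos hκ ξ

lemma norm_phs {κ : ℝ} (hκ : 1 ≤ |κ|) (ξ : ℝ) : ‖phs κ ξ‖ = 1 := by
  rw [phs, norm_div, norm_two_mul_add, norm_jw, Real.rpow_one, div_self (jb_pos hκ ξ).ne']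

lemma memLp_phs {κ : ℝ} (hκ : 1 ≤ |κ|) : MemLp (phs κ) ∞ (volume : Measure ℝ) :=
  memLp_top_of_measurable (by unfold phs; fun_prop) fun ξ => (norm_phs hκ ξ).le

/-- The change of weight from `jb 1 ^ (-b)` to `jb κ ^ (-b)`. -/
def rew (b κ ξ : ℝ) : ℂ := jw 1 b ξ * jw κ (-b) ξ

lemma norm_rew_le {b κ : ℝ} (hb : 0 ≤ b) (hκ : 1 ≤ |κ|) (ξ : ℝ) : ‖rew b κ ξ‖ ≤ 1 := by
  rw [rew, norm_mul, norm_jw, norm_jw, Real.rpow_neg (jb_nonneg _ _), ← div_eq_mul_inv]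
  exact div_le_one_of_le₀ (Real.rpow_le_rpow (jb_nonneg _ _) (jb_one_le hκ ξ) hb)
    (Real.rpow_nonneg (jb_nonneg _ _) _)

lemma memLp_rew {b κ : ℝ} (hb : 0 ≤ b) (hκ : 1 ≤ |κ|) : MemLp (rew b κ) ∞ (volume : Measure ℝ) :=
  memLp_top_of_measurable (by unfold rew; fun_prop) (norm_rew_le hb hκ)

/-! ### The Riccati equation on the Fourier side -/

/-- The kernel of the product of two functions, with the weight of `H^(1-b)`. -/
def kerProd (b κ ξ η : ℝ) : ℂ := jw κ (1 - b) ξ * jw κ (-(1 - b)) (ξ - η) * jw κ (-(1 - b)) η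

/-- The kernel of the product of a distribution in `H^(-b)` and a function in `H^(1-b)`. -/
def kerMul (b κ ξ η : ℝ) : ℂ := jw κ (-b) ξ * jw κ b (ξ - η) * jw κ (-(1 - b)) η

/-- The square of the constant in the bounds for the two products is `ricC b * |κ| ^ (2 b - 1) / 2`. -/
def ricC (b : ℝ) : ℝ := 2 * (2 ^ (2 - 2 * b) * (2 * jbC (2 - 2 * b)))

lemma ricC_nonneg (b : ℝ) : 0 ≤ ricC b := by
  have := jbC_nonneg (2 - 2 * b); unfold ricC; positivity

lemma enorm_sq_eq_ofReal (z : ℂ) : ‖z‖ₑ ^ 2 = ENNReal.ofReal (‖z‖ ^ 2) := by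
  rw [← ofReal_norm, ENNReal.ofReal_pow (norm_nonneg _)]

lemma rpow_sq_eq {x : ℝ} (hx : 0 ≤ x) (a : ℝ) : (x ^ a) ^ 2 = x ^ (2 * a) := by
  rw [← Real.rpow_natCast, ← Real.rpow_mul hx]; congr 1; push_cast; ring

/-- H^(1-b) is an algebra because `2 - 2b > 1`. The output frequency is held fixed, and all three
exponents in the convolution bound equal `2 - 2b`. -/
lemma kerBound_kerProd {b κ : ℝ} (hb : b < 1 / 2) (hκ : 1 ≤ |κ|) :
    KerBound (kerProd b κ) (Real.sqrt (ricC b * |κ| ^ (2 * b - 1) / 2)) := by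
  have h0 : 0 ≤ ricC b * |κ| ^ (2 * b - 1) / 2 := by have := ricC_nonneg b; positivity
  refine ⟨by unfold kerProd; fun_prop, Real.sqrt_nonneg _, Or.inl fun ξ => ?_⟩
  rw [Real.sq_sqrt h0]
  have h := lintegral_jb_mul_jb_le hκ (μ := 2 - 2 * b) (α := 2 - 2 * b) (β := 2 - 2 * b)
    (by linarith) le_rfl le_rfl (by linarith) ξ
  have e : ∀ η, ‖kerProd b κ ξ η‖ₑ ^ 2 = ENNReal.ofReal (jb κ ξ ^ (2 - 2 * b)) *
      ENNReal.ofReal (jb κ (ξ - η) ^ (-(2 - 2 * b)) * jb κ η ^ (-(2 - 2 * b))) := fun η => by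
    rw [enorm_sq_eq_ofReal, ← ENNReal.ofReal_mul (Real.rpow_nonneg (jb_nonneg _ _) _), kerProd]
    simp only [norm_mul, norm_jw, mul_pow, rpow_sq_eq (jb_nonneg _ _)]
    congr 1; ring_nf
  simp only [e]
  rw [lintegral_const_mul' _ _ ENNReal.ofReal_ne_top]
  refine (mul_le_mul_right h _).trans ?_
  rw [← ENNReal.ofReal_mul (Real.rpow_nonneg (jb_nonneg _ _) _)]
  refine ENNReal.ofReal_le_ofReal (le_of_eq ?_)
  have h1 : jb κ ξ ^ (2 - 2 * b) * jb κ ξ ^ (-(2 - 2 * b)) = 1 := by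
    rw [← Real.rpow_add (jb_pos hκ ξ)]; simp
  have h2 : (2 - 2 * b + (2 - 2 * b) - (2 - 2 * b)) = 2 - 2 * b := by ring
  have h3 : 1 - (2 - 2 * b) = 2 * b - 1 := by ring
  rw [h2, h3, ricC, ← mul_assoc, mul_comm (jb κ ξ ^ (2 - 2 * b)), mul_assoc _ (jb κ ξ ^ (2 - 2 * b)), h1]
  ring

/-- Here the frequency `ζ` of the distribution is held fixed: its weight `jb ζ ^ (2b)` is
compensated by the decay `μ = 2b` of the convolution, and the integrable exponent left over is again
`2 - 2b`. -/
lemma kerBound_kerMul {b κ : ℝ} (hb0 : 0 ≤ b) (hb : b < 1 / 2) (hκ : 1 ≤ |κ|) :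
    KerBound (kerMul b κ) (Real.sqrt (ricC b * |κ| ^ (2 * b - 1) / 2)) := by
  have h0 : 0 ≤ ricC b * |κ| ^ (2 * b - 1) / 2 := by have := ricC_nonneg b; positivity
  refine ⟨by unfold kerMul; fun_prop, Real.sqrt_nonneg _, Or.inr fun ζ => ?_⟩
  rw [Real.sq_sqrt h0]
  -- Applied at `-ζ`: the weight is even, so `ζ + η` may be written as the difference `-ζ - η`.
  have h := lintegral_jb_mul_jb_le hκ (μ := 2 * b) (α := 2 * b) (β := 2 - 2 * b)
    (by linarith) le_rfl (by linarith) (by linarith) (-ζ)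
  have e : ∀ η, ‖kerMul b κ (ζ + η) η‖ₑ ^ 2 = ENNReal.ofReal (jb κ ζ ^ (2 * b)) *
      ENNReal.ofReal (jb κ (-ζ - η) ^ (-(2 * b)) * jb κ η ^ (-(2 - 2 * b))) := fun η => by
    rw [enorm_sq_eq_ofReal, ← ENNReal.ofReal_mul (Real.rpow_nonneg (jb_nonneg _ _) _), kerMul]
    have : -ζ - η = -(ζ + η) := by ring
    rw [this, jb_neg, add_sub_cancel_right]
    simp only [norm_mul, norm_jw, mul_pow, rpow_sq_eq (jb_nonneg _ _)]
    congr 1; ring_nf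
  simp only [e]
  rw [lintegral_const_mul' _ _ ENNReal.ofReal_ne_top]
  refine (mul_le_mul_right h _).trans ?_
  rw [← ENNReal.ofReal_mul (Real.rpow_nonneg (jb_nonneg _ _) _)]
  refine ENNReal.ofReal_le_ofReal ?_
  have h1 : jb κ ζ ^ (2 * b) * jb κ ζ ^ (-(2 * b)) = 1 := by
    rw [← Real.rpow_add (jb_pos hκ ζ)]; simp
  have h2 : (2 * b + (2 - 2 * b) - 2 * b) = 2 - 2 * b := by ring
  have h3 : 1 - (2 - 2 * b) = 2 * b - 1 := by ring
  rw [h2, h3, ricC, jb_neg, ← mul_assoc, mul_comm (jb κ ζ ^ (2 * b)), mul_assoc _ (jb κ ζ ^ (2 * b)), h1]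
  have h4 : (2 : ℝ) ^ (2 * b) ≤ 2 ^ (2 - 2 * b) :=
    Real.rpow_le_rpow_of_exponent_le (by norm_num) (by linarith)
  have h5 : 0 ≤ |κ| ^ (2 * b - 1) * jbC (2 - 2 * b) := by
    have := jbC_nonneg (2 - 2 * b); positivity
  nlinarith

/-- `2 (2 κ + ∂)⁻¹ (q f g)` on the Fourier side, with weights. -/
def ricT (b κ : ℝ) : L2 →L[ℂ] L2 →L[ℂ] L2 →L[ℂ] L2 :=
  ((ContinuousLinearMap.compL ℂ L2 (L2 →L[ℂ] L2) (L2 →L[ℂ] L2)).flip (bilin (kerProd b κ))) ∘L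
    (ContinuousLinearMap.compL ℂ L2 L2 L2) ∘L
    (ContinuousLinearMap.compL ℂ L2 L2 L2 ((2 : ℂ) • mulOp (phs κ))) ∘L
    (bilin (kerMul b κ)) ∘L mulOp (rew b κ)

lemma ricT_apply (b κ : ℝ) (p f g : L2) :
    ricT b κ p f g = (2 : ℂ) • mulOp (phs κ) (bilin (kerMul b κ) (mulOp (rew b κ) p)
      (bilin (kerProd b κ) f g)) := rfl

lemma norm_mulOp_phs_le {κ : ℝ} (hκ : 1 ≤ |κ|) (f : L2) : ‖mulOp (phs κ) f‖ ≤ ‖f‖ := by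
  simpa using norm_mulOp_le (memLp_phs hκ) (fun ξ => (norm_phs hκ ξ).le) f

lemma norm_mulOp_rew_le {b κ : ℝ} (hb : 0 ≤ b) (hκ : 1 ≤ |κ|) (f : L2) : ‖mulOp (rew b κ) f‖ ≤ ‖f‖ := by
  simpa using norm_mulOp_le (memLp_rew hb hκ) (norm_rew_le hb hκ) f

/-- Each of the two products contributes a square root of `ricC b * |κ| ^ (2b-1) / 2`, and the
factor 2 in the equation cancels the half. The negative power of `|κ|` is dropped for the
contraction, but kept for the error estimate of the energy. -/
lemma norm_ricT_le {b κ : ℝ} (hb0 : 0 ≤ b) (hb : b < 1 / 2) (hκ : 1 ≤ |κ|) (p f g : L2) :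
    ‖ricT b κ p f g‖ ≤ ricC b * |κ| ^ (2 * b - 1) * ‖p‖ * ‖f‖ * ‖g‖ := by
  have h0 : 0 ≤ ricC b * |κ| ^ (2 * b - 1) / 2 := by have := ricC_nonneg b; positivity
  set c := Real.sqrt (ricC b * |κ| ^ (2 * b - 1) / 2) with hc
  have hc2 : c * c = ricC b * |κ| ^ (2 * b - 1) / 2 := Real.mul_self_sqrt h0
  have hc0 : 0 ≤ c := Real.sqrt_nonneg _
  rw [ricT_apply, norm_smul]
  calc _ ≤ 2 * (c * ‖p‖ * (c * ‖f‖ * ‖g‖)) := by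
        gcongr
        · simp
        · refine (norm_mulOp_phs_le hκ _).trans (((kerBound_kerMul hb0 hb hκ).norm_bilin_le _ _).trans ?_)
          rw [← hc]
          gcongr
          · exact norm_mulOp_rew_le hb0 hκ p
          · exact (kerBound_kerProd hb hκ).norm_bilin_le _ _
    _ = 2 * (c * c) * ‖p‖ * ‖f‖ * ‖g‖ := by ring
    _ = _ := by rw [hc2]; ring

lemma cubBound_ricT {b κ η : ℝ} (hb0 : 0 ≤ b) (hb : b < 1 / 2) (hκ : 1 ≤ |κ|) (hη : 0 < η)
    (hs : ricC b * η ^ 2 ≤ 1 / 4) : CubBound (ricT b κ) (ricC b) η := by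
  refine ⟨ricC_nonneg b, hη, hs, fun p f g => (norm_ricT_le hb0 hb hκ p f g).trans ?_⟩
  have h1 : |κ| ^ (2 * b - 1) ≤ 1 := Real.rpow_le_one_of_one_le_of_nonpos hκ (by linarith)
  have := ricC_nonneg b
  gcongr
  exact mul_le_of_le_one_right this h1

/-- The function with Fourier transform `jb κ ^ (-(1-b)) f`. -/
def evF (b κ : ℝ) (f : L2) (x : ℝ) : ℂ := 𝓕⁻ (fun ξ => jw κ (-(1 - b)) ξ * f ξ) x

lemma memLp_jw {κ a : ℝ} (hκ : 1 ≤ |κ|) (ha : 1 / 2 < a) : MemLp (jw κ (-a)) 2 (volume : Measure ℝ) := by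
  rw [memLp_two_iff_integrable_sq_norm (measurable_jw _ _).aestronglyMeasurable]
  refine (integrable_jb_rpow hκ (p := 2 * a) (by linarith)).congr (ae_of_all _ fun ξ => ?_)
  simp only [norm_jw, rpow_sq_eq (jb_nonneg _ _)]; congr 1; ring

lemma integral_norm_jw_sq {κ a : ℝ} (hκ : 1 ≤ |κ|) :
    ∫ ξ, ‖jw κ (-a) ξ‖ ^ 2 = |κ| ^ (1 - 2 * a) * jbC (2 * a) := by
  rw [← integral_jb_rpow hκ]
  refine integral_congr_ae (ae_of_all _ fun ξ => ?_)
  simp only [norm_jw, rpow_sq_eq (jb_nonneg _ _)]; congr 1; ring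

lemma integral_norm_mul_L2_le {m : ℝ → ℂ} (hm : MemLp m 2 (volume : Measure ℝ)) (f : L2) :
    Integrable (fun ξ => m ξ * f ξ) ∧
      ∫ ξ, ‖m ξ * f ξ‖ ≤ Real.sqrt (∫ ξ, ‖m ξ‖ ^ 2) * ‖f‖ := by
  have hf := Lp.memLp f
  refine ⟨hm.integrable_mul hf, ?_⟩
  have h := integral_mul_norm_le_Lp_mul_Lq (μ := volume) (f := m) (g := f) Real.HolderConjugate.two_two
    (by simpa using hm) (by simpa using hf)
  simp only [norm_mul]
  refine h.trans (le_of_eq ?_)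
  have h2 : ∫ a, ‖f a‖ ^ (2 : ℝ) = ‖f‖ ^ 2 := by
    have h3 := @inner_self_eq_norm_sq_to_K ℂ _ _ _ _ f
    rw [inner_L2] at h3
    have h4 : ∫ x, conj (f x) * f x = ((∫ a, ‖f a‖ ^ (2 : ℝ) : ℝ) : ℂ) := by
      refine Eq.trans (integral_congr_ae (ae_of_all _ fun x => ?_)) (integral_ofReal (𝕜 := ℂ))
      simp only [Complex.conj_mul', Real.rpow_ofNat]; push_cast; rfl
    rw [h4] at h3
    exact Complex.ofReal_injective (by rw [h3]; push_cast; rfl)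
  rw [h2, Real.sqrt_eq_rpow, ← Real.sqrt_eq_rpow (‖f‖ ^ 2), Real.sqrt_sq (norm_nonneg f)]
  simp only [Real.rpow_ofNat]

lemma integrable_evF {b κ : ℝ} (hb : b < 1 / 2) (hκ : 1 ≤ |κ|) (f : L2) :
    Integrable fun ξ => jw κ (-(1 - b)) ξ * f ξ :=
  (integral_norm_mul_L2_le (memLp_jw hκ (by linarith)) f).1

/-- The constant of the embedding of `H^(1-b)` into the bounded functions. -/
def evC (b : ℝ) : ℝ := Real.sqrt (jbC (2 - 2 * b))

lemma norm_evF_le {b κ : ℝ} (hb : b < 1 / 2) (hκ : 1 ≤ |κ|) (f : L2) (x : ℝ) :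
    ‖evF b κ f x‖ ≤ evC b * ‖f‖ := by
  refine (norm_fourierInv_le _ _).trans
    ((integral_norm_mul_L2_le (memLp_jw hκ (by linarith)) f).2.trans ?_)
  rw [integral_norm_jw_sq hκ]
  gcongr
  apply Real.sqrt_le_sqrt
  have h1 : |κ| ^ (1 - 2 * (1 - b)) ≤ 1 := Real.rpow_le_one_of_one_le_of_nonpos hκ (by linarith)
  have h2 := jbC_nonneg (2 * (1 - b))
  have h3 : 2 - 2 * b = 2 * (1 - b) := by ring
  rw [h3]
  exact mul_le_of_le_one_left h2 h1

lemma tendsto_evF (b κ : ℝ) (f : L2) : Tendsto (evF b κ f) (cocompact ℝ) (𝓝 0) :=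
  tendsto_fourierInv_zero _

lemma fourierInv_eq_integral (v : ℝ → ℂ) (x : ℝ) :
    𝓕⁻ v x = ∫ ξ : ℝ, cexp ((2 * Real.pi * x * ξ : ℝ) * I) * v ξ := by
  rw [Real.fourierInv_eq']
  refine integral_congr_ae (ae_of_all _ fun ξ => ?_)
  simp only [smul_eq_mul]
  congr 3
  simp [mul_assoc]

/-- `evF` as a continuous linear functional. -/
def evL (b κ : ℝ) (hb : b < 1 / 2) (hκ : 1 ≤ |κ|) (x : ℝ) : L2 →L[ℂ] ℂ :=
  LinearMap.mkContinuous
    { toFun := fun f => evF b κ f x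
      map_add' := fun f g => by
        simp only [evF, fourierInv_eq_integral]
        have hi : ∀ f : L2, Integrable fun ξ : ℝ =>
            cexp ((2 * Real.pi * x * ξ : ℝ) * I) * (jw κ (-(1 - b)) ξ * f ξ) := fun f => by
          refine (integrable_evF hb hκ f).bdd_mul (c := 1) (by fun_prop) (ae_of_all _ fun ξ => ?_)
          rw [Complex.norm_exp_ofReal_mul_I]
        rw [← integral_add (hi f) (hi g)]
        refine integral_congr_ae ?_
        filter_upwards [Lp.coeFn_add f g] with ξ hξ
        rw [hξ]; simp only [Pi.add_apply]; ring
      map_smul' := fun c f => by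
        simp only [evF, fourierInv_eq_integral, RingHom.id_apply, smul_eq_mul]
        rw [← integral_const_mul]
        refine integral_congr_ae ?_
        filter_upwards [Lp.coeFn_smul c f] with ξ hξ
        rw [hξ]; simp only [Pi.smul_apply, smul_eq_mul]; ring }
    (evC b) (fun f => norm_evF_le hb hκ f x)

/-- The weighted Fourier transform of a Schwartz function. -/
def schw (b : ℝ) : 𝓢(ℝ, ℂ) →L[ℂ] L2 :=
  mulOp (jw 1 (-b)) ∘L SchwartzMap.toLpCLM ℂ ℂ 2 volume ∘L FourierTransform.fourierCLM ℂ 𝓢(ℝ, ℂ)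

lemma memLp_jw_top {κ b : ℝ} (hb : 0 ≤ b) (hκ : 1 ≤ |κ|) : MemLp (jw κ (-b)) ∞ (volume : Measure ℝ) :=
  memLp_top_of_measurable (measurable_jw _ _) (C := 1) fun ξ => by
    rw [norm_jw]; exact Real.rpow_le_one_of_one_le_of_nonpos (one_le_jb hκ ξ) (by linarith)

lemma schw_ae {b : ℝ} (hb : 0 ≤ b) (q : 𝓢(ℝ, ℂ)) :
    (schw b q : L2) =ᵐ[volume] fun ξ => jw 1 (-b) ξ * 𝓕 (q : ℝ → ℂ) ξ := by
  have h1 := mulOp_ae (memLp_jw_top hb one_le_abs_one) ((𝓕 q : 𝓢(ℝ, ℂ)).toLp 2)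
  filter_upwards [h1, (𝓕 q : 𝓢(ℝ, ℂ)).coeFn_toLp 2 volume] with ξ h1 h2
  change (mulOp (jw 1 (-b)) ((𝓕 q : 𝓢(ℝ, ℂ)).toLp 2) : L2) ξ = _
  rw [h1, h2]; rfl

lemma rew_schw_ae {b κ : ℝ} (hb : 0 ≤ b) (hκ : 1 ≤ |κ|) (q : 𝓢(ℝ, ℂ)) :
    (mulOp (rew b κ) (schw b q) : L2) =ᵐ[volume] fun ξ => jw κ (-b) ξ * 𝓕 (q : ℝ → ℂ) ξ := by
  filter_upwards [mulOp_ae (memLp_rew hb hκ) (schw b q), schw_ae hb q] with ξ h1 h2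
  rw [h1, h2, rew]
  linear_combination jw κ (-b) ξ * 𝓕 (q : ℝ → ℂ) ξ * jw_mul_neg one_le_abs_one b ξ

lemma integrable_fourier_schwartz (q : 𝓢(ℝ, ℂ)) : Integrable (𝓕 (q : ℝ → ℂ)) :=
  (𝓕 q : 𝓢(ℝ, ℂ)).integrable

lemma fourierInv_fourier_schwartz (q : 𝓢(ℝ, ℂ)) (x : ℝ) : 𝓕⁻ (𝓕 (q : ℝ → ℂ)) x = q x := by
  rw [q.continuous.fourierInv_fourier_eq q.integrable (integrable_fourier_schwartz q)]

/-- The exponents `-(1-b)`, `1` and `-b` of the weights add up to zero. Hence the Fourier transform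
of `evF b κ h` is `v` divided by the symbol of `2κ + ∂`, which is the asserted equation. -/
lemma hasDerivAt_evF_of_ae {b κ : ℝ} (hb : b < 1 / 2) (hκ : 1 ≤ |κ|) {h : L2} {v : ℝ → ℂ}
    (hv : Integrable v) (hh : h =ᵐ[volume] fun ξ => phs κ ξ * (jw κ (-b) ξ * v ξ)) (x : ℝ) :
    HasDerivAt (evF b κ h) (-2 * κ * evF b κ h x + 𝓕⁻ v x) x := by
  have e1 : (fun ξ => jw κ (-(1 - b)) ξ * h ξ) =ᵐ[volume]
      fun ξ : ℝ => v ξ / (2 * κ + 2 * Real.pi * ξ * I) := by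
    filter_upwards [hh] with ξ hξ
    rw [hξ, phs]
    have h1 : jw κ (-(1 - b)) ξ * jw κ 1 ξ * jw κ (-b) ξ = 1 := by
      rw [← jw_add hκ, ← jw_add hκ]
      have : -(1 - b) + 1 + -b = 0 := by ring
      rw [this]; simp [jw]
    linear_combination v ξ / (2 * κ + 2 * Real.pi * ξ * I) * h1
  have hi : Integrable fun ξ : ℝ => v ξ / (2 * κ + 2 * Real.pi * ξ * I) :=
    (integrable_evF hb hκ h).congr e1
  have e2 : evF b κ h = 𝓕⁻ fun ξ : ℝ => v ξ / (2 * κ + 2 * Real.pi * ξ * I) := by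
    funext y; exact Real.fourierInv_congr_ae e1 y
  have e3 : (fun ξ : ℝ => (2 * Real.pi * ξ * I) * (v ξ / (2 * κ + 2 * Real.pi * ξ * I))) =
      fun ξ : ℝ => v ξ - 2 * κ * (v ξ / (2 * κ + 2 * Real.pi * ξ * I)) := by
    funext ξ
    linear_combination mul_div_cancel₀ (v ξ) (sym_ne_zero hκ ξ)
  have hi2 : Integrable fun ξ : ℝ => (2 * Real.pi * ξ * I) * (v ξ / (2 * κ + 2 * Real.pi * ξ * I)) := by
    rw [e3]; exact hv.sub (hi.const_mul _)
  have h1 := hasDerivAt_fourierInv hi hi2 x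
  rw [e2]
  refine h1.congr_deriv ?_
  have hb' : ∀ {w : ℝ → ℂ}, Integrable w → Integrable fun ξ : ℝ => cexp ((2 * Real.pi * x * ξ : ℝ) * I) * w ξ :=
    fun hw => by
      refine hw.bdd_mul (c := 1) (by fun_prop) (ae_of_all _ fun ξ => ?_)
      rw [Complex.norm_exp_ofReal_mul_I]
  rw [e3, fourierInv_eq_integral, fourierInv_eq_integral, fourierInv_eq_integral]
  simp only [mul_sub]
  rw [integral_sub (hb' hv) (hb' (hi.const_mul _)), ← integral_const_mul, add_comm, sub_eq_add_neg,
    ← integral_neg]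
  congr 1
  refine integral_congr_ae (ae_of_all _ fun ξ => ?_)
  simp only; ring

lemma hasDerivAt_evF_phs {b κ : ℝ} (hb0 : 0 ≤ b) (hb : b < 1 / 2) (hκ : 1 ≤ |κ|) (r : 𝓢(ℝ, ℂ)) (x : ℝ) :
    HasDerivAt (evF b κ (mulOp (phs κ) (mulOp (rew b κ) (schw b r))))
      (-2 * κ * evF b κ (mulOp (phs κ) (mulOp (rew b κ) (schw b r))) x + r x) x := by
  have h := hasDerivAt_evF_of_ae hb hκ (h := mulOp (phs κ) (mulOp (rew b κ) (schw b r)))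
    (integrable_fourier_schwartz r) ?_ x
  · rwa [fourierInv_fourier_schwartz] at h
  · filter_upwards [mulOp_ae (memLp_phs hκ) (mulOp (rew b κ) (schw b r)), rew_schw_ae hb0 hκ r] with ξ h1 h2
    rw [h1, h2]

/-- The weights in the two kernels cancel in pairs, so that the Fourier transform of the trilinear
term is `2 (2κ + 2πiξ)⁻¹` times the convolution of the transforms of `q` and of the two functions.
-/
lemma hasDerivAt_evF_ricT {b κ : ℝ} (hb0 : 0 ≤ b) (hb : b < 1 / 2) (hκ : 1 ≤ |κ|) (q : 𝓢(ℝ, ℂ))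
    (f g : L2) (x : ℝ) :
    HasDerivAt (evF b κ (ricT b κ (schw b q) f g))
      (-2 * κ * evF b κ (ricT b κ (schw b q) f g) x + 2 * q x * evF b κ f x * evF b κ g x) x := by
  have hf := integrable_evF hb hκ f
  have hg := integrable_evF hb hκ g
  have hq := integrable_fourier_schwartz q
  set F : ℝ → ℂ := fun ξ => jw κ (-(1 - b)) ξ * f ξ with hF
  set G : ℝ → ℂ := fun ξ => jw κ (-(1 - b)) ξ * g ξ with hG
  have hFG := integrable_fconv hf hg
  have h := hasDerivAt_evF_of_ae hb hκ (h := ricT b κ (schw b q) f g)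
    (v := fun ξ => 2 * fconv (𝓕 (q : ℝ → ℂ)) (fconv F G) ξ)
    ((integrable_fconv hq hFG).const_mul 2) ?_ x
  · have e : 𝓕⁻ (fun ξ => 2 * fconv (𝓕 (q : ℝ → ℂ)) (fconv F G) ξ) x =
        2 * q x * evF b κ f x * evF b κ g x := by
      rw [fourierInv_eq_integral]
      have : ∀ ξ : ℝ, cexp ((2 * Real.pi * x * ξ : ℝ) * I) * (2 * fconv (𝓕 (q : ℝ → ℂ)) (fconv F G) ξ)
        = 2 * (cexp ((2 * Real.pi * x * ξ : ℝ) * I) * fconv (𝓕 (q : ℝ → ℂ)) (fconv F G) ξ) :=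
        fun ξ => by ring
      simp only [this]
      rw [integral_const_mul, ← fourierInv_eq_integral, fourierInv_fconv hq hFG,
        fourierInv_fconv hf hg, fourierInv_fourier_schwartz]
      change _ = 2 * q x * 𝓕⁻ F x * 𝓕⁻ G x
      ring
    rwa [e] at h
  · rw [ricT_apply]
    have h1 := (kerBound_kerProd hb hκ).bilin_ae f g
    have h2 := (kerBound_kerMul hb0 hb hκ).bilin_ae (mulOp (rew b κ) (schw b q)) (bilin (kerProd b κ) f g)
    have h3 : (fun η => jw κ (-(1 - b)) η * bilin (kerProd b κ) f g η) =ᵐ[volume] fconv F G := by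
      filter_upwards [h1] with η hη
      rw [hη, fconv, ← integral_const_mul]
      refine integral_congr_ae (ae_of_all _ fun ζ => ?_)
      simp only [kerProd, hF, hG]
      linear_combination jw κ (-(1 - b)) (η - ζ) * jw κ (-(1 - b)) ζ * (f (η - ζ) * g ζ) *
        jw_mul_neg hκ (1 - b) η
    filter_upwards [Lp.coeFn_smul (2 : ℂ) (mulOp (phs κ) (bilin (kerMul b κ) (mulOp (rew b κ) (schw b q))
      (bilin (kerProd b κ) f g))), mulOp_ae (memLp_phs hκ) (bilin (kerMul b κ) (mulOp (rew b κ) (schw b q))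
      (bilin (kerProd b κ) f g)), h2] with ξ e1 e2 e3
    rw [e1, Pi.smul_apply, e2, e3, smul_eq_mul]
    have : ∫ η, kerMul b κ ξ η * ((mulOp (rew b κ) (schw b q) : L2) (ξ - η) * bilin (kerProd b κ) f g η)
        = jw κ (-b) ξ * fconv (𝓕 (q : ℝ → ℂ)) (fconv F G) ξ := by
      rw [fconv, ← integral_const_mul]
      refine integral_congr_ae ?_
      filter_upwards [ae_comp_sub (rew_schw_ae hb0 hκ q) ξ, h3] with η e4 e5
      rw [e4, ← e5, kerMul]
      linear_combination jw κ (-b) ξ * jw κ (-(1 - b)) η * 𝓕 (q : ℝ → ℂ) (ξ - η) *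
        bilin (kerProd b κ) f g η * jw_mul_neg hκ b (ξ - η)
    rw [this]; ring

/-! ### Bounded solutions of scalar linear equations -/

lemma hasDerivAt_primitive {g : ℝ → ℂ} (hg : Continuous g) (x : ℝ) :
    HasDerivAt (fun x => ∫ t in (0 : ℝ)..x, g t) (g x) x :=
  intervalIntegral.integral_hasDerivAt_right (hg.intervalIntegrable _ _)
    hg.aestronglyMeasurable.stronglyMeasurableAtFilter hg.continuousAt

lemma norm_primitive_le {g : ℝ → ℂ} (hg : Integrable g) (x : ℝ) :
    ‖∫ t in (0 : ℝ)..x, g t‖ ≤ ∫ t, ‖g t‖ :=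
  (intervalIntegral.norm_integral_le_integral_norm_uIoc).trans
    (setIntegral_le_integral hg.norm (ae_of_all _ fun _ => norm_nonneg _))

/-- With the integrating factor, `y` becomes constant. The primitive of `g` is bounded because `g`
is integrable, so the factor decays exponentially at one end of the line and the constant is zero.
This is the uniqueness principle behind `Lax.tangent` and `Adm.conj_ricF`. -/
lemma eq_zero_of_bounded_solution {y g : ℝ → ℂ} {c : ℝ} (hc : c ≠ 0) (hg : Integrable g)
    (hgc : Continuous g) (hy : ∀ x, HasDerivAt y ((c + g x) * y x) x) {C : ℝ}
    (hb : ∀ x, ‖y x‖ ≤ C) : y = 0 := by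
  set P : ℝ → ℂ := fun x => ∫ t in (0 : ℝ)..x, g t with hP
  set Y : ℝ → ℂ := fun x => y x * cexp (-(c * x + P x)) with hY
  have hd : ∀ x, HasDerivAt Y 0 x := fun x => by
    have h1 : HasDerivAt (fun x : ℝ => (c * x + P x : ℂ)) (c + g x) x := by
      have h2 : HasDerivAt (fun x : ℝ => (c * x : ℂ)) (c * 1) x :=
        (Complex.ofRealCLM.hasDerivAt (x := x)).const_mul (c : ℂ)
      rw [mul_one] at h2
      exact h2.add (hasDerivAt_primitive hgc x)
    refine ((hy x).mul h1.neg.cexp).congr_deriv ?_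
    simp only [Pi.neg_apply]; ring
  have hconst : ∀ x x', Y x = Y x' :=
    is_const_of_deriv_eq_zero (fun x => (hd x).differentiableAt) fun x => (hd x).deriv
  have hYb : ∀ x, ‖Y x‖ ≤ C * Real.exp (-(c * x) + ∫ t, ‖g t‖) := fun x => by
    rw [hY, norm_mul, Complex.norm_exp]
    have h1 := norm_primitive_le hg x
    have h2 : -(P x).re ≤ ∫ t, ‖g t‖ := ((neg_le_abs _).trans (Complex.abs_re_le_norm _)).trans h1
    have h0 : 0 ≤ C := (norm_nonneg _).trans (hb x)
    gcongr
    · exact hb x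
    · simp only [neg_re, add_re, mul_re, ofReal_re, ofReal_im, mul_zero, sub_zero]
      linarith
  have hzero : ∀ x, Y x = 0 := fun x₀ => by
    -- The sign of `c` decides at which end of the line the integrating factor decays.
    have hlim : ∃ l : Filter ℝ, l.NeBot ∧ Tendsto (fun x => -(c * x)) l atBot := by
      rcases lt_or_gt_of_ne hc with h | h
      · refine ⟨atBot, inferInstance, ?_⟩
        have : (fun x : ℝ => -(c * x)) = fun x => (-c) * x := by funext x; ring
        rw [this]; exact tendsto_id.const_mul_atBot (by linarith)
      · refine ⟨atTop, inferInstance, ?_⟩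
        exact tendsto_neg_atTop_atBot.comp (tendsto_id.const_mul_atTop h)
    obtain ⟨l, hl, ht⟩ := hlim
    have h1 : Tendsto (fun x => C * Real.exp (-(c * x) + ∫ t, ‖g t‖)) l (𝓝 (C * 0)) :=
      (Real.tendsto_exp_atBot.comp (tendsto_atBot_add_const_right _ _ ht)).const_mul C
    rw [mul_zero] at h1
    have h2 : ‖Y x₀‖ ≤ 0 := ge_of_tendsto' h1 fun x => by rw [hconst x₀ x]; exact hYb x
    exact norm_le_zero_iff.mp h2
  funext x
  have := hzero x
  rw [hY] at this
  exact (mul_eq_zero.mp this).resolve_right (exp_ne_zero _)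

/-! ### The solution of the Riccati equation -/

/-- The constant in the Hilbert-Schmidt bounds. -/
def opC (b : ℝ) : ℝ := Real.sqrt (4 * (2 ^ (2 * b) * (2 * jbC (3 / 2 - b))))

/-- The radius `η` of a ball on which all constructions converge. -/
structure Adm (b η : ℝ) : Prop where
  hb0 : 0 < b
  hb : b < 1 / 2
  hη : 0 < η
  ric_le : ricC b * η ^ 2 ≤ 1 / 4
  ev_le : evC b * η ≤ 1 / 4
  op_le : opC b * η ≤ 1 / 2

lemma exists_adm {b : ℝ} (hb0 : 0 < b) (hb : b < 1 / 2) : ∃ η, Adm b η := by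
  have h1 := ricC_nonneg b
  have h2 : 0 ≤ evC b := Real.sqrt_nonneg _
  have h3 : 0 ≤ opC b := Real.sqrt_nonneg _
  set S := 4 * (1 + ricC b + evC b + opC b) with hS
  have hS1 : 1 ≤ S := by linarith
  have hS0 : 0 < S := by linarith
  refine ⟨S⁻¹, hb0, hb, inv_pos.mpr hS0, ?_, ?_, ?_⟩
  · have : S⁻¹ ^ 2 ≤ S⁻¹ := by
      rw [sq]; exact mul_le_of_le_one_left (inv_nonneg.mpr hS0.le) (inv_le_one_of_one_le₀ hS1)
    refine (mul_le_mul_of_nonneg_left this h1).trans ?_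
    rw [← div_eq_mul_inv, div_le_iff₀ hS0]; linarith
  · rw [← div_eq_mul_inv, div_le_iff₀ hS0]; linarith
  · rw [← div_eq_mul_inv, div_le_iff₀ hS0]; linarith

/-- The linear term of the Riccati equation. -/
def ricU (b κ : ℝ) : L2 →L[ℂ] L2 := (1 / 2 : ℂ) • (mulOp (phs κ) ∘L mulOp (rew b κ))

lemma ricU_apply (b κ : ℝ) (R : L2) :
    ricU b κ R = (1 / 2 : ℂ) • mulOp (phs κ) (mulOp (rew b κ) R) := rfl

/-- The weighted Fourier transform of the solution of the Riccati equation. -/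
def ric (b κ η : ℝ) (p R : L2) : L2 := cubFix (ricT b κ) η p (ricU b κ R)

/-- The solution of the Riccati equation. -/
def ricF (b κ η : ℝ) (p R : L2) : ℝ → ℂ := evF b κ (ric b κ η p R)

lemma hasDerivAt_clm {E F : Type*} [NormedAddCommGroup E] [NormedSpace ℂ E] [NormedAddCommGroup F]
    [NormedSpace ℂ F] (T : E →L[ℂ] F) {f : ℝ → E} {D : E} {t : ℝ} (hf : HasDerivAt f D t) :
    HasDerivAt (fun τ => T (f τ)) (T D) t :=
  (T.restrictScalars ℝ).hasFDerivAt.comp_hasDerivAt t hf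

section
variable {b κ η : ℝ}

lemma Adm.cubBound (h : Adm b η) (hκ : 1 ≤ |κ|) : CubBound (ricT b κ) (ricC b) η :=
  cubBound_ricT h.hb0.le h.hb hκ h.hη h.ric_le

lemma Adm.norm_ricU_le (h : Adm b η) (hκ : 1 ≤ |κ|) (R : L2) : ‖ricU b κ R‖ ≤ ‖R‖ / 2 := by
  rw [ricU_apply, norm_smul]
  have := (norm_mulOp_phs_le hκ (mulOp (rew b κ) R)).trans (norm_mulOp_rew_le h.hb0.le hκ R)
  have h2 : ‖(1 / 2 : ℂ)‖ = 1 / 2 := by norm_num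
  rw [h2]; linarith

lemma Adm.norm_ricU_le' (h : Adm b η) (hκ : 1 ≤ |κ|) {R : L2} (hR : ‖R‖ ≤ η) :
    ‖ricU b κ R‖ ≤ η / 2 :=
  (h.norm_ricU_le hκ R).trans (by linarith)

lemma Adm.norm_ric_le (h : Adm b η) (hκ : 1 ≤ |κ|) {p R : L2} (hp : ‖p‖ ≤ η) (hR : ‖R‖ ≤ η) :
    ‖ric b κ η p R‖ ≤ ‖R‖ :=
  ((h.cubBound hκ).norm_cubFix_le hp (h.norm_ricU_le' hκ hR)).trans
    (by linarith [h.norm_ricU_le hκ R])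

lemma Adm.ric_eq (h : Adm b η) (hκ : 1 ≤ |κ|) {p R : L2} (hp : ‖p‖ ≤ η) (hR : ‖R‖ ≤ η) :
    ric b κ η p R = ricU b κ R - ricT b κ p (ric b κ η p R) (ric b κ η p R) :=
  ((h.cubBound hκ).cubFix_spec hp (h.norm_ricU_le' hκ hR)).2

/-- The value 1/4 gives `‖4 F₁ F₂‖ ≤ 1/4`, which keeps the denominator `1 - 4 F₁ F₂` away from zero.
-/
lemma Adm.norm_ricF_le (h : Adm b η) (hκ : 1 ≤ |κ|) {p R : L2} (hp : ‖p‖ ≤ η) (hR : ‖R‖ ≤ η)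
    (x : ℝ) : ‖ricF b κ η p R x‖ ≤ 1 / 4 := by
  refine (norm_evF_le h.hb hκ _ x).trans (le_trans ?_ h.ev_le)
  have : 0 ≤ evC b := Real.sqrt_nonneg _
  gcongr
  exact (h.norm_ric_le hκ hp hR).trans hR

lemma Adm.tendsto_ric (h : Adm b η) (hκ : 1 ≤ |κ|) {α : Type*} {l : Filter α} {p R : α → L2}
    {p₀ R₀ : L2} (hp : Tendsto p l (𝓝 p₀)) (hR : Tendsto R l (𝓝 R₀))
    (hpη : ∀ᶠ t in l, ‖p t‖ ≤ η) (hRη : ∀ᶠ t in l, ‖R t‖ ≤ η) (hp₀ : ‖p₀‖ ≤ η) (hR₀ : ‖R₀‖ ≤ η) :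
    Tendsto (fun t => ric b κ η (p t) (R t)) l (𝓝 (ric b κ η p₀ R₀)) :=
  (h.cubBound hκ).tendsto_cubFix hp (((ricU b κ).continuous.tendsto _).comp hR) hpη
    (hRη.mono fun _ ht => h.norm_ricU_le' hκ ht) hp₀ (h.norm_ricU_le' hκ hR₀)

lemma evF_sub (hb : b < 1 / 2) (hκ : 1 ≤ |κ|) (f g : L2) (x : ℝ) :
    evF b κ (f - g) x = evF b κ f x - evF b κ g x := map_sub (evL b κ hb hκ x) f g

lemma evF_smul (hb : b < 1 / 2) (hκ : 1 ≤ |κ|) (c : ℂ) (g : L2) (x : ℝ) :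
    evF b κ (c • g) x = c * evF b κ g x := map_smul (evL b κ hb hκ x) c g

lemma continuous_evF (hb : b < 1 / 2) (hκ : 1 ≤ |κ|) (f : L2) : Continuous (evF b κ f) := by
  have h := integrable_evF hb hκ f
  have : evF b κ f = (𝓕 fun ξ => jw κ (-(1 - b)) ξ * f ξ) ∘ fun x => -x := by
    funext x; exact Real.fourierInv_eq_fourier_neg _ x
  rw [this]
  exact (VectorFourier.fourierIntegral_continuous Real.continuous_fourierChar
    (by exact continuous_inner) h).comp continuous_neg

lemma hasDerivAt_evF_ricU (hb0 : 0 ≤ b) (hb : b < 1 / 2) (hκ : 1 ≤ |κ|) (r : 𝓢(ℝ, ℂ)) (x : ℝ) :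
    HasDerivAt (evF b κ (ricU b κ (schw b r)))
      (-2 * κ * evF b κ (ricU b κ (schw b r)) x + r x / 2) x := by
  have e : evF b κ (ricU b κ (schw b r)) =
      fun x => (1 / 2 : ℂ) * evF b κ (mulOp (phs κ) (mulOp (rew b κ) (schw b r))) x := by
    funext x; rw [ricU_apply, evF_smul hb hκ]
  rw [e]
  refine ((hasDerivAt_evF_phs hb0 hb hκ r x).const_mul (1 / 2 : ℂ)).congr_deriv ?_
  ring

lemma Adm.hasDerivAt_ricF (h : Adm b η) (hκ : 1 ≤ |κ|) {q r : 𝓢(ℝ, ℂ)} (hq : ‖schw b q‖ ≤ η)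
    (hr : ‖schw b r‖ ≤ η) (x : ℝ) :
    HasDerivAt (ricF b κ η (schw b q) (schw b r))
      (-2 * κ * ricF b κ η (schw b q) (schw b r) x + r x / 2
        - 2 * q x * ricF b κ η (schw b q) (schw b r) x ^ 2) x := by
  set f := ric b κ η (schw b q) (schw b r) with hf
  have e : evF b κ f = fun x => evF b κ (ricU b κ (schw b r)) x - evF b κ (ricT b κ (schw b q) f f) x := by
    funext y
    rw [← evF_sub h.hb hκ]
    congr 1
    exact h.ric_eq hκ hq hr
  change HasDerivAt (evF b κ f) (-2 * κ * evF b κ f x + r x / 2 - 2 * q x * evF b κ f x ^ 2) x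
  have h1 := (hasDerivAt_evF_ricU h.hb0.le h.hb hκ r x).sub
    (hasDerivAt_evF_ricT h.hb0.le h.hb hκ q f f x)
  have h2 : HasDerivAt (evF b κ f) _ x := h1.congr_of_eventuallyEq (Eventually.of_forall fun y => congrFun e y)
  refine h2.congr_deriv ?_
  rw [show evF b κ f x = _ from congrFun e x]
  ring

lemma tendsto_ricF (b κ η : ℝ) (p R : L2) : Tendsto (ricF b κ η p R) (cocompact ℝ) (𝓝 0) :=
  tendsto_evF _ _ _

lemma Adm.continuous_ricF (h : Adm b η) (hκ : 1 ≤ |κ|) (p R : L2) : Continuous (ricF b κ η p R) :=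
  continuous_evF h.hb hκ _

/-- Differentiability of the solution of the Riccati equation along curves. -/
lemma Adm.exists_hasDerivAt_ric (h : Adm b η) (hκ : 1 ≤ |κ|) {q r : ℝ → 𝓢(ℝ, ℂ)} {q' r' : 𝓢(ℝ, ℂ)}
    {t : ℝ} (hq : HasDerivAt (fun τ => schw b (q τ)) (schw b q') t)
    (hr : HasDerivAt (fun τ => schw b (r τ)) (schw b r') t)
    (hqη : ∀ᶠ τ in 𝓝 t, ‖schw b (q τ)‖ ≤ η) (hrη : ∀ᶠ τ in 𝓝 t, ‖schw b (r τ)‖ ≤ η) :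
    ∃ D : L2, HasDerivAt (fun τ => ric b κ η (schw b (q τ)) (schw b (r τ))) D t ∧
      ∀ x, HasDerivAt (evF b κ D) (-2 * κ * evF b κ D x + r' x / 2
        - 2 * q' x * ricF b κ η (schw b (q t)) (schw b (r t)) x ^ 2
        - 4 * q t x * ricF b κ η (schw b (q t)) (schw b (r t)) x * evF b κ D x) x := by
  obtain ⟨D, hD, e⟩ := (h.cubBound hκ).hasDerivAt_cubFix hq
    (hasDerivAt_clm (ricU b κ) hr) hqη (hrη.mono fun τ hτ => h.norm_ricU_le' hκ hτ)
  refine ⟨D, hD, fun x => ?_⟩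
  set f := ric b κ η (schw b (q t)) (schw b (r t)) with hf
  have e' : D = ricU b κ (schw b r') - ricT b κ (schw b q') f f - ricT b κ (schw b (q t)) D f
    - ricT b κ (schw b (q t)) f D := e
  have e2 : evF b κ D = fun x => evF b κ (ricU b κ (schw b r')) x
      - evF b κ (ricT b κ (schw b q') f f) x - evF b κ (ricT b κ (schw b (q t)) D f) x
      - evF b κ (ricT b κ (schw b (q t)) f D) x := by
    funext y
    rw [← evF_sub h.hb hκ, ← evF_sub h.hb hκ, ← evF_sub h.hb hκ, ← e']
  have h1 := (((hasDerivAt_evF_ricU h.hb0.le h.hb hκ r' x).sub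
    (hasDerivAt_evF_ricT h.hb0.le h.hb hκ q' f f x)).sub
    (hasDerivAt_evF_ricT h.hb0.le h.hb hκ (q t) D f x)).sub
    (hasDerivAt_evF_ricT h.hb0.le h.hb hκ (q t) f D x)
  have h2 : HasDerivAt (evF b κ D) _ x :=
    h1.congr_of_eventuallyEq (Eventually.of_forall fun y => congrFun e2 y)
  refine h2.congr_deriv ?_
  have e3 := congrFun e2 x
  change _ = -2 * κ * evF b κ D x + r' x / 2 - 2 * q' x * evF b κ f x ^ 2
    - 4 * q t x * evF b κ f x * evF b κ D x
  linear_combination (2 * κ : ℂ) * e3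

lemma hasDerivAt_evF_curve (hb : b < 1 / 2) (hκ : 1 ≤ |κ|) {f : ℝ → L2} {D : L2} {t : ℝ}
    (hf : HasDerivAt f D t) (x : ℝ) : HasDerivAt (fun τ => evF b κ (f τ) x) (evF b κ D x) t :=
  hasDerivAt_clm (evL b κ hb hκ x) hf

lemma integrable_schwartz_mul (q : 𝓢(ℝ, ℂ)) {g : ℝ → ℂ} (hg : Continuous g) {C : ℝ}
    (hC : ∀ x, ‖g x‖ ≤ C) : Integrable fun x => q x * g x :=
  q.integrable.mul_bdd (c := C) hg.aestronglyMeasurable (ae_of_all _ hC)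

end

/-! ### The symbols of the square roots -/

lemma sqrtSym_base_ne_zero {κ ε : ℝ} (hκ : 1 ≤ |κ|) (ξ : ℝ) :
    ((κ : ℂ) + ε * (2 * Real.pi * ξ) * I) ≠ 0 := fun h => by
  have h1 := congrArg Complex.re h
  simp at h1
  rw [h1] at hκ; norm_num at hκ

lemma norm_sqrtSym_base {κ ε : ℝ} (hε : ε = 1 ∨ ε = -1) (ξ : ℝ) :
    ‖((κ : ℂ) + ε * (2 * Real.pi * ξ) * I)‖ = jb (κ / 2) ξ := by
  have : ((κ : ℂ) + ε * (2 * Real.pi * ξ) * I) = (κ : ℝ) + (ε * (2 * Real.pi * ξ) : ℝ) * I := by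
    push_cast; ring
  rw [this, Complex.norm_add_mul_I, jb]
  congr 1
  rcases hε with rfl | rfl <;> ring

lemma jb_le_two_mul_jb_half {κ : ℝ} (hκ : 1 ≤ |κ|) (ξ : ℝ) : jb 1 ξ / 2 ≤ jb (κ / 2) ξ := by
  have h1 : jb κ ξ ≤ 2 * jb (κ / 2) ξ := by
    have h2 := jb_sq κ ξ
    have h3 := jb_sq (κ / 2) ξ
    have h4 := jb_nonneg (κ / 2) ξ
    have h5 : jb κ ξ ^ 2 ≤ (2 * jb (κ / 2) ξ) ^ 2 := by
      rw [mul_pow, h2, h3]; nlinarith [sq_nonneg (2 * Real.pi * ξ)]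
    exact (sq_le_sq₀ (jb_nonneg _ _) (by linarith)).mp h5
  linarith [jb_one_le hκ ξ]

@[fun_prop]
lemma measurable_sqrtSym (κ ε : ℝ) : Measurable (sqrtSym κ ε) := by
  unfold sqrtSym; fun_prop

lemma norm_sqrtSym_sq_le {κ ε : ℝ} (hκ : 1 ≤ |κ|) (hε : ε = 1 ∨ ε = -1) (ξ : ℝ) :
    ‖sqrtSym κ ε ξ‖ ^ 2 ≤ 2 * jb 1 ξ ^ (-1 : ℝ) := by
  have h1 := sqrtSym_base_ne_zero (ε := ε) hκ ξ
  have h2 : ‖sqrtSym κ ε ξ‖ = jb (κ / 2) ξ ^ (-(1 / 2) : ℝ) := by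
    rw [sqrtSym, Complex.norm_cpow_of_ne_zero h1, norm_sqrtSym_base hε]
    simp
  have h3 := jb_pos one_le_abs_one ξ
  rw [h2, rpow_sq_eq (jb_nonneg _ _)]
  have h4 : (2 * -(1 / 2) : ℝ) = -1 := by norm_num
  rw [h4, Real.rpow_neg_one, Real.rpow_neg_one]
  have h5 := jb_le_two_mul_jb_half hκ ξ
  have h6 : (jb (κ / 2) ξ)⁻¹ ≤ (jb 1 ξ / 2)⁻¹ := inv_anti₀ (by linarith) h5
  rw [inv_div] at h6
  rwa [div_eq_mul_inv] at h6

lemma norm_sqrtSym_le {κ ε : ℝ} (hκ : 1 ≤ |κ|) (hε : ε = 1 ∨ ε = -1) (ξ : ℝ) :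
    ‖sqrtSym κ ε ξ‖ ≤ 1 := by
  have h := norm_sqrtSym_sq_le hκ hε ξ
  rw [Real.rpow_neg_one] at h
  have h2 : (jb 1 ξ)⁻¹ ≤ 2⁻¹ := inv_anti₀ two_pos (two_le_jb one_le_abs_one ξ)
  have h3 : ‖sqrtSym κ ε ξ‖ ^ 2 ≤ 1 ^ 2 := by linarith
  exact (sq_le_sq₀ (norm_nonneg _) zero_le_one).mp h3

lemma memLp_sqrtSym {κ ε : ℝ} (hκ : 1 ≤ |κ|) (hε : ε = 1 ∨ ε = -1) :
    MemLp (sqrtSym κ ε) ∞ (volume : Measure ℝ) :=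
  memLp_top_of_measurable (measurable_sqrtSym _ _) (norm_sqrtSym_le hκ hε)

lemma sqrtSym_mul_self {κ ε : ℝ} (hκ : 1 ≤ |κ|) (ξ : ℝ) :
    sqrtSym κ ε ξ * sqrtSym κ ε ξ * ((κ : ℂ) + ε * (2 * Real.pi * ξ) * I) = 1 := by
  have h1 := sqrtSym_base_ne_zero (ε := ε) hκ ξ
  rw [sqrtSym, ← Complex.cpow_add _ _ h1]
  have : (-(1 / 2) + -(1 / 2) : ℂ) = -1 := by norm_num
  rw [this, Complex.cpow_neg_one, inv_mul_cancel₀ h1]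

/-! ### The operators `Λ` and `Γ` on the Fourier side -/

/-- The exponent of the smoothing weight split off from the operators. -/
def th (b : ℝ) : ℝ := (1 - 2 * b) / 8

/-- The kernel of the smoothed operator. -/
def kW (b κ ε ξ η : ℝ) : ℂ :=
  (sqrtSym κ (-ε) ξ * jw 1 (th b) ξ) * jw 1 b (ξ - η) * (sqrtSym κ ε η * jw 1 (th b) η)

/-- The smoothing operator. -/
def opW (b : ℝ) : L2 →L[ℂ] L2 := mulOp (jw 1 (-th b))

/-- The part `Λ''` of `Λ = W Λ'' W` (for `ε = 1`), and `Γ''` (for `ε = -1`). -/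
def opT (b κ ε : ℝ) (p : L2) : L2 →L[ℂ] L2 := bilin (kW b κ ε) p

/-- The operators `Λ` (for `ε = 1`) and `Γ` (for `ε = -1`) on the Fourier side. -/
def opL (b κ ε : ℝ) (p : L2) : L2 →L[ℂ] L2 := opW b * opT b κ ε p * opW b

section
variable {b κ ε : ℝ}

lemma opC_nonneg (b : ℝ) : 0 ≤ opC b := Real.sqrt_nonneg _

lemma neg_sign (hε : ε = 1 ∨ ε = -1) : -ε = 1 ∨ -ε = -1 := by
  rcases hε with rfl | rfl <;> norm_num

lemma measurable_kW : Measurable (Function.uncurry (kW b κ ε)) := by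
  unfold kW Function.uncurry; fun_prop

/-- Each squared square-root symbol decays with exponent 1, of which the weight `jb 1 ^ (2 th)`
takes back `(1-2b)/4`. The two remaining exponents `3/4 + b/2` pay for `jb 1 ζ ^ (2b)` and still
leave `3/2 - b > 1`. So the choice of `th` keeps the Hilbert-Schmidt property while smoothing is
split off on both sides. -/
lemma lintegral_kW_le (hb0 : 0 ≤ b) (hb : b < 1 / 2) (hκ : 1 ≤ |κ|) (hε : ε = 1 ∨ ε = -1) (ζ : ℝ) :
    ∫⁻ η, ‖kW b κ ε (ζ + η) η‖ₑ ^ 2 ≤ ENNReal.ofReal (opC b ^ 2) := by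
  have hC := jbC_nonneg (3 / 2 - b)
  have h0 : 0 ≤ 4 * (2 ^ (2 * b) * (2 * jbC (3 / 2 - b))) := by positivity
  rw [opC, Real.sq_sqrt h0]
  have hth : 0 ≤ th b := by unfold th; linarith
  have h := lintegral_jb_mul_jb_le one_le_abs_one (μ := 2 * b) (α := 3 / 4 + b / 2)
    (β := 3 / 4 + b / 2) (by linarith) (by linarith) (by linarith) (by linarith) (-ζ)
  have e1 : (3 / 4 + b / 2 + (3 / 4 + b / 2) - 2 * b) = 3 / 2 - b := by ring
  rw [e1, abs_one, Real.one_rpow, one_mul, jb_neg] at h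
  have key : ∀ (δ ξ : ℝ), (δ = 1 ∨ δ = -1) →
      ‖sqrtSym κ δ ξ * jw 1 (th b) ξ‖ ^ 2 ≤ 2 * jb 1 ξ ^ (-(3 / 4 + b / 2)) := fun δ ξ hδ => by
    rw [norm_mul, mul_pow, norm_jw, rpow_sq_eq (jb_nonneg _ _)]
    have h1 := norm_sqrtSym_sq_le hκ hδ ξ
    have h2 : -(3 / 4 + b / 2) = -1 + 2 * th b := by unfold th; ring
    rw [h2, Real.rpow_add (jb_pos one_le_abs_one ξ), ← mul_assoc]
    exact mul_le_mul_of_nonneg_right h1 (Real.rpow_nonneg (jb_nonneg _ _) _)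
  have hpt : ∀ η, ‖kW b κ ε (ζ + η) η‖ₑ ^ 2 ≤ ENNReal.ofReal (4 * jb 1 ζ ^ (2 * b)) *
      ENNReal.ofReal (jb 1 (-ζ - η) ^ (-(3 / 4 + b / 2)) * jb 1 η ^ (-(3 / 4 + b / 2))) := fun η => by
    have hn : 0 ≤ jb 1 ζ ^ (2 * b) := Real.rpow_nonneg (jb_nonneg _ _) _
    rw [enorm_sq_eq_ofReal, ← ENNReal.ofReal_mul (by positivity)]
    apply ENNReal.ofReal_le_ofReal
    have e2 : -ζ - η = -(ζ + η) := by ring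
    rw [e2, jb_neg, kW, add_sub_cancel_right, norm_mul, norm_mul, mul_pow, mul_pow, norm_jw,
      rpow_sq_eq (jb_nonneg _ _)]
    have h1 := key (-ε) (ζ + η) (neg_sign hε)
    have h2 := key ε η hε
    calc _ ≤ (2 * jb 1 (ζ + η) ^ (-(3 / 4 + b / 2))) * jb 1 ζ ^ (2 * b) *
          (2 * jb 1 η ^ (-(3 / 4 + b / 2))) := by
          have := Real.rpow_nonneg (jb_nonneg 1 (ζ + η)) (-(3 / 4 + b / 2))
          gcongr
      _ = _ := by ring
  refine (lintegral_mono hpt).trans ?_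
  rw [lintegral_const_mul' _ _ ENNReal.ofReal_ne_top]
  refine (mul_le_mul_right h _).trans ?_
  have hn : 0 ≤ jb 1 ζ ^ (2 * b) := Real.rpow_nonneg (jb_nonneg _ _) _
  rw [← ENNReal.ofReal_mul (by positivity)]
  refine ENNReal.ofReal_le_ofReal (le_of_eq ?_)
  have h1 : jb 1 ζ ^ (2 * b) * jb 1 ζ ^ (-(2 * b)) = 1 := by
    rw [← Real.rpow_add (jb_pos one_le_abs_one ζ)]; simp
  linear_combination (4 * (2 ^ (2 * b) * (2 * jbC (3 / 2 - b)))) * h1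

lemma kerBound_kW (hb0 : 0 ≤ b) (hb : b < 1 / 2) (hκ : 1 ≤ |κ|) (hε : ε = 1 ∨ ε = -1) :
    KerBound (kW b κ ε) (opC b) :=
  ⟨measurable_kW, opC_nonneg b, Or.inr (lintegral_kW_le hb0 hb hκ hε)⟩

lemma th_nonneg (hb : b < 1 / 2) : 0 ≤ th b := by unfold th; linarith

lemma norm_opW_le (hb : b < 1 / 2) : ‖opW b‖ ≤ 1 :=
  ContinuousLinearMap.opNorm_le_bound _ zero_le_one fun f =>
    norm_mulOp_le (memLp_jw_top (th_nonneg hb) one_le_abs_one) (fun ξ => by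
      rw [norm_jw]
      exact Real.rpow_le_one_of_one_le_of_nonpos (one_le_jb one_le_abs_one ξ)
        (by linarith [th_nonneg hb])) f

lemma HSle_opT (hb0 : 0 ≤ b) (hb : b < 1 / 2) (hκ : 1 ≤ |κ|) (hε : ε = 1 ∨ ε = -1) (p : L2) :
    HSle (opT b κ ε p) (opC b * ‖p‖) :=
  HSle_bilin measurable_kW (opC_nonneg b) (lintegral_kW_le hb0 hb hκ hε) p

lemma HSle_opL (hb0 : 0 ≤ b) (hb : b < 1 / 2) (hκ : 1 ≤ |κ|) (hε : ε = 1 ∨ ε = -1) (p : L2) :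
    HSle (opL b κ ε p) (opC b * ‖p‖) := by
  have h0 : 0 ≤ opC b * ‖p‖ := mul_nonneg (opC_nonneg b) (norm_nonneg p)
  have hW := norm_opW_le hb
  refine (((HSle_opT hb0 hb hκ hε p).mul_left (opW b)).mul_right (opW b)).mono ?_
  calc _ ≤ 1 * (opC b * ‖p‖) * 1 := by gcongr
    _ = _ := by ring

lemma opT_sub (p p' : L2) : opT b κ ε (p - p') = opT b κ ε p - opT b κ ε p' := map_sub _ _ _

lemma opL_sub (p p' : L2) : opL b κ ε (p - p') = opL b κ ε p - opL b κ ε p' := by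
  simp only [opL, opT_sub, mul_sub, sub_mul]

lemma opT_smul (c : ℂ) (p : L2) : opT b κ ε (c • p) = c • opT b κ ε p := map_smul _ _ _

lemma opL_smul (c : ℂ) (p : L2) : opL b κ ε (c • p) = c • opL b κ ε p := by
  simp only [opL, opT_smul, mul_smul_comm, smul_mul_assoc]

lemma continuous_opT : Continuous (opT b κ ε) := (bilin (kW b κ ε)).continuous

lemma continuous_opL : Continuous (opL b κ ε) :=
  (continuous_const.mul continuous_opT).mul continuous_const

/-- The weights with exponents `± th` cancel, so splitting off the smoothing operator does not alter
`Λ` and `Γ`. -/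
lemma opL_ae (hb0 : 0 ≤ b) (hb : b < 1 / 2) (hκ : 1 ≤ |κ|) (hε : ε = 1 ∨ ε = -1) {p : L2} {h : ℝ → ℂ}
    (hp : h =ᵐ[volume] fun ξ => jw 1 b ξ * p ξ) (f : L2) :
    (opL b κ ε p f : L2) =ᵐ[volume]
      fun ξ => sqrtSym κ (-ε) ξ * ∫ η, h (ξ - η) * (sqrtSym κ ε η * f η) := by
  have hW := memLp_jw_top (κ := 1) (th_nonneg hb) one_le_abs_one
  have h1 : (opL b κ ε p f : L2) =ᵐ[volume] _ := mulOp_ae hW (opT b κ ε p (opW b f))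
  have h2 := (kerBound_kW hb0 hb hκ hε).bilin_ae p (opW b f)
  have h3 := mulOp_ae hW f
  filter_upwards [h1, h2] with ξ e1 e2
  rw [e1]
  change _ * bilin (kW b κ ε) p (opW b f) ξ = _
  rw [e2, ← integral_const_mul, ← integral_const_mul]
  refine integral_congr_ae ?_
  filter_upwards [ae_comp_sub hp ξ, h3] with η e3 e4
  change _ * (_ * (_ * (mulOp (jw 1 (-th b)) f : L2) η)) = _
  rw [e3, e4, kW]
  linear_combination (sqrtSym κ (-ε) ξ * jw 1 b (ξ - η) * sqrtSym κ ε η * p (ξ - η) * f η) *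
    (jw 1 (-th b) ξ * jw 1 (th b) ξ * jw_mul_neg one_le_abs_one (th b) η
      + jw_mul_neg one_le_abs_one (th b) ξ)

end

/-! ### Conjugation with the Fourier transform -/

/-- The operator on `L²` which is `T` on the Fourier side. -/
def cj : (L2 →L[ℂ] L2) →+* (L2 →L[ℂ] L2) where
  toFun T := ((Lp.fourierTransformₗᵢ ℝ ℂ).symm.toContinuousLinearEquiv : L2 →L[ℂ] L2) ∘L T ∘L
    ((Lp.fourierTransformₗᵢ ℝ ℂ).toContinuousLinearEquiv : L2 →L[ℂ] L2)
  map_one' := by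
    ext1 f
    exact (Lp.fourierTransformₗᵢ ℝ ℂ).symm_apply_apply f
  map_mul' S T := by
    ext1 f
    change (Lp.fourierTransformₗᵢ ℝ ℂ).symm (S (T (Lp.fourierTransformₗᵢ ℝ ℂ f))) =
      (Lp.fourierTransformₗᵢ ℝ ℂ).symm (S (Lp.fourierTransformₗᵢ ℝ ℂ ((Lp.fourierTransformₗᵢ ℝ ℂ).symm
        (T (Lp.fourierTransformₗᵢ ℝ ℂ f)))))
    rw [LinearIsometryEquiv.apply_symm_apply]
  map_zero' := by ext1 f; exact map_zero (Lp.fourierTransformₗᵢ ℝ ℂ).symm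
  map_add' S T := by ext1 f; exact map_add (Lp.fourierTransformₗᵢ ℝ ℂ).symm _ _

lemma fourierMul_eq (m : ℝ → ℂ) : fourierMul m = cj (mulOp m) := rfl

lemma fourier_cj (T : L2 →L[ℂ] L2) (f : L2) : 𝓕 (cj T f) = T (𝓕 f) :=
  (Lp.fourierTransformₗᵢ ℝ ℂ).apply_symm_apply _

lemma IsSandwich.unique {a h c : ℝ → ℂ} {T T' : L2 →L[ℂ] L2} (hT : IsSandwich a h c T)
    (hT' : IsSandwich a h c T') : T = T' := by
  ext1 f
  apply (Lp.fourierTransformₗᵢ ℝ ℂ).injective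
  apply Lp.ext
  filter_upwards [hT f, hT' f] with ξ h1 h2
  exact h1.trans h2.symm

lemma IsSandwich.sandwich_eq {a h c : ℝ → ℂ} {T : L2 →L[ℂ] L2} (hT : IsSandwich a h c T) :
    sandwich a h c = T := by
  have hex : ∃ T, IsSandwich a h c T := ⟨T, hT⟩
  rw [sandwich, dif_pos hex]
  exact hex.choose_spec.unique hT

/-- The Fourier transforms of `q` and `r` are `jb 1 ^ b * p` and `jb 1 ^ b * R`. -/
structure Rep (b σ : ℝ) (q : 𝓢'(ℝ, ℂ)) (p R : L2) : Prop where
  hq : fourierFun q =ᵐ[volume] fun ξ => jw 1 b ξ * p ξ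
  hr : fourierFunR σ q =ᵐ[volume] fun ξ => jw 1 b ξ * R ξ

section
variable {b κ η σ : ℝ} {q : 𝓢'(ℝ, ℂ)} {p R : L2}

lemma Rep.isSandwich_lambda (h : Rep b σ q p R) (hb0 : 0 ≤ b) (hb : b < 1 / 2) (hκ : 1 ≤ |κ|) :
    IsSandwich (sqrtSym κ (-1)) (fourierFun q) (sqrtSym κ 1) (cj (opL b κ 1 p)) := fun f => by
  rw [fourier_cj]
  exact opL_ae hb0 hb hκ (Or.inl rfl) h.hq (𝓕 f)

lemma Rep.isSandwich_gamma (h : Rep b σ q p R) (hb0 : 0 ≤ b) (hb : b < 1 / 2) (hκ : 1 ≤ |κ|) :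
    IsSandwich (sqrtSym κ 1) (fourierFunR σ q) (sqrtSym κ (-1)) (cj (opL b κ (-1) R)) := fun f => by
  rw [fourier_cj]
  have := opL_ae hb0 hb hκ (ε := -1) (Or.inr rfl) h.hr (𝓕 f)
  rwa [neg_neg] at this

lemma Rep.opLambda_eq (h : Rep b σ q p R) (hb0 : 0 ≤ b) (hb : b < 1 / 2) (hκ : 1 ≤ |κ|) :
    opLambda q κ = cj (opL b κ 1 p) := (h.isSandwich_lambda hb0 hb hκ).sandwich_eq

lemma Rep.opGamma_eq (h : Rep b σ q p R) (hb0 : 0 ≤ b) (hb : b < 1 / 2) (hκ : 1 ≤ |κ|) :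
    opGamma σ q κ = cj (opL b κ (-1) R) := (h.isSandwich_gamma hb0 hb hκ).sandwich_eq

end

/-! ### The resolvent -/

/-- `(1 + Λ Γ)⁻¹` on the Fourier side. -/
def opD (b κ : ℝ) (p R : L2) : L2 →L[ℂ] L2 := Ring.inverse (1 + opL b κ 1 p * opL b κ (-1) R)

/-- The inverse of `1 + √R₀ (L - L₀) √R₀` on the Fourier side. -/
def invCore (b κ : ℝ) (p R : L2) : Matrix (Fin 2) (Fin 2) (L2 →L[ℂ] L2) :=
  !![opD b κ p R, -(opD b κ p R * opL b κ 1 p);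
    opL b κ (-1) R * opD b κ p R, 1 - opL b κ (-1) R * opD b κ p R * opL b κ 1 p]

/-- The operator `N` in `(1 + √R₀ (L - L₀) √R₀)⁻¹ - 1 = W N W`. -/
def opN (b κ : ℝ) (p R : L2) : Matrix (Fin 2) (Fin 2) (L2 →L[ℂ] L2) :=
  !![-(opT b κ 1 p * opW b * opW b * opT b κ (-1) R) +
        opT b κ 1 p * opW b * opL b κ (-1) R * opD b κ p R * opL b κ 1 p * opW b * opT b κ (-1) R,
      -opT b κ 1 p +
        opT b κ 1 p * opW b * opL b κ (-1) R * opD b κ p R * opW b * opT b κ 1 p;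
    opT b κ (-1) R -
        opT b κ (-1) R * opW b * opD b κ p R * opL b κ 1 p * opW b * opT b κ (-1) R,
      -(opT b κ (-1) R * opW b * opD b κ p R * opW b * opT b κ 1 p)]

section
variable {b κ η σ : ℝ} {q : 𝓢'(ℝ, ℂ)} {p R : L2}

lemma Adm.norm_opL_le (h : Adm b η) (hκ : 1 ≤ |κ|) {ε : ℝ} (hε : ε = 1 ∨ ε = -1) (hp : ‖p‖ ≤ η) :
    ‖opL b κ ε p‖ ≤ 1 / 2 :=
  (HSle_opL h.hb0.le h.hb hκ hε p).opNorm_le.trans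
    ((mul_le_mul_of_nonneg_left hp (opC_nonneg b)).trans h.op_le)

lemma Adm.norm_opL_mul_le (h : Adm b η) (hκ : 1 ≤ |κ|) (hp : ‖p‖ ≤ η) (hR : ‖R‖ ≤ η) :
    ‖opL b κ 1 p * opL b κ (-1) R‖ ≤ 1 / 4 :=
  (norm_mul_le _ _).trans <| by
    have h1 := h.norm_opL_le hκ (Or.inl rfl) hp
    have h2 := h.norm_opL_le hκ (ε := -1) (Or.inr rfl) hR
    calc _ ≤ (1 / 2 : ℝ) * (1 / 2) := by gcongr
      _ = 1 / 4 := by norm_num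

lemma Adm.isUnit_one_add (h : Adm b η) (hκ : 1 ≤ |κ|) (hp : ‖p‖ ≤ η) (hR : ‖R‖ ≤ η) :
    IsUnit (1 + opL b κ 1 p * opL b κ (-1) R) := by
  have h1 := h.norm_opL_mul_le hκ hp hR
  have h2 : ‖-(opL b κ 1 p * opL b κ (-1) R)‖ < 1 := by rw [norm_neg]; linarith
  have := (Units.oneSub _ h2).isUnit
  rwa [Units.val_oneSub, sub_neg_eq_add] at this

lemma Adm.opD_mul (h : Adm b η) (hκ : 1 ≤ |κ|) (hp : ‖p‖ ≤ η) (hR : ‖R‖ ≤ η) :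
    opD b κ p R + opD b κ p R * opL b κ 1 p * opL b κ (-1) R = 1 := by
  have := Ring.inverse_mul_cancel _ (h.isUnit_one_add hκ hp hR)
  rwa [mul_add, mul_one, ← mul_assoc] at this

lemma Adm.mul_opD (h : Adm b η) (hκ : 1 ≤ |κ|) (hp : ‖p‖ ≤ η) (hR : ‖R‖ ≤ η) :
    opD b κ p R + opL b κ 1 p * opL b κ (-1) R * opD b κ p R = 1 := by
  have := Ring.mul_inverse_cancel _ (h.isUnit_one_add hκ hp hR)
  rwa [add_mul, one_mul] at this

lemma Adm.invCore_mul (h : Adm b η) (hκ : 1 ≤ |κ|) (hp : ‖p‖ ≤ η) (hR : ‖R‖ ≤ η) :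
    invCore b κ p R * (1 + !![0, opL b κ 1 p; -opL b κ (-1) R, 0]) = 1 ∧
    (1 + !![0, opL b κ 1 p; -opL b κ (-1) R, 0]) * invCore b κ p R = 1 := by
  have h1 := h.opD_mul hκ hp hR
  have h2 := h.mul_opD hκ hp hR
  unfold invCore
  set D := opD b κ p R
  set Λ := opL b κ 1 p
  set Γ := opL b κ (-1) R
  have e : (1 + !![0, Λ; -Γ, 0] : Matrix (Fin 2) (Fin 2) (L2 →L[ℂ] L2)) = !![1, Λ; -Γ, 1] := by
    ext1 i j; fin_cases i <;> fin_cases j <;> simp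
  have h1' : D * Λ * Γ = 1 - D := by rw [← h1]; abel
  have h2' : Λ * Γ * D = 1 - D := by rw [← h2]; abel
  rw [e, Matrix.mul_fin_two, Matrix.mul_fin_two, Matrix.one_fin_two]
  refine ⟨?_, ?_⟩
  · congr 1
    ext1 i; ext1 j
    fin_cases i <;> fin_cases j
    · change D * 1 + -(D * Λ) * -Γ = 1
      rw [neg_mul_neg, mul_one]; exact h1
    · change D * Λ + -(D * Λ) * 1 = 0
      rw [mul_one]; abel
    · change Γ * D * 1 + (1 - Γ * D * Λ) * -Γ = 0
      have : Γ * D * Λ * Γ = Γ * (D * Λ * Γ) := by simp only [mul_assoc]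
      rw [mul_neg, sub_mul, this, h1', mul_sub]; simp only [one_mul, mul_one]; abel
    · change Γ * D * Λ + (1 - Γ * D * Λ) * 1 = 1
      rw [mul_one]; abel
  · congr 1
    ext1 i; ext1 j
    fin_cases i <;> fin_cases j
    · change 1 * D + Λ * (Γ * D) = 1
      rw [one_mul, ← mul_assoc]; exact h2
    · change 1 * -(D * Λ) + Λ * (1 - Γ * D * Λ) = 0
      have : Λ * (Γ * D * Λ) = Λ * Γ * D * Λ := by simp only [mul_assoc]
      rw [one_mul, mul_sub, this, h2', sub_mul]; simp only [one_mul, mul_one]; abel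
    · change -Γ * D + 1 * (Γ * D) = 0
      rw [one_mul, neg_mul]; abel
    · change -Γ * -(D * Λ) + 1 * (1 - Γ * D * Λ) = 1
      rw [neg_mul_neg, one_mul, ← mul_assoc]; abel

lemma Rep.laxCore_eq (hr : Rep b σ q p R) (h : Adm b η) (hκ : 1 ≤ |κ|) :
    laxCore σ q κ = cj.mapMatrix (1 + !![0, opL b κ 1 p; -opL b κ (-1) R, 0]) := by
  rw [laxCore, hr.opLambda_eq h.hb0.le h.hb hκ, hr.opGamma_eq h.hb0.le h.hb hκ, map_add, map_one]
  congr 1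
  ext1 i j; fin_cases i <;> fin_cases j <;> simp

lemma Rep.isUnit_laxCore (hr : Rep b σ q p R) (h : Adm b η) (hκ : 1 ≤ |κ|) (hp : ‖p‖ ≤ η)
    (hR : ‖R‖ ≤ η) :
    IsUnit (laxCore σ q κ) ∧ Ring.inverse (laxCore σ q κ) = cj.mapMatrix (invCore b κ p R) := by
  have h1 := h.invCore_mul hκ hp hR
  rw [hr.laxCore_eq h hκ]
  set A : Matrix (Fin 2) (Fin 2) (L2 →L[ℂ] L2) := 1 + !![0, opL b κ 1 p; -opL b κ (-1) R, 0]
  let u : (Matrix (Fin 2) (Fin 2) (L2 →L[ℂ] L2))ˣ :=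
    ⟨cj.mapMatrix A, cj.mapMatrix (invCore b κ p R), by rw [← map_mul, h1.2, map_one],
      by rw [← map_mul, h1.1, map_one]⟩
  exact ⟨u.isUnit, Ring.inverse_unit u⟩

/-- The symbols on the diagonal of `√R₀`. -/
def sgn2 (i : Fin 2) : ℝ := if i = 0 then -1 else 1

lemma sgn2_sign (i : Fin 2) : sgn2 i = 1 ∨ sgn2 i = -1 := by
  fin_cases i <;> simp [sgn2]

/-- In the expansion of the inverse every term other than 1 begins and ends with `Λ = W S W` or `Γ =
W T W`, so a factor `W` can be taken out on both sides. -/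
lemma Adm.invCore_sub_one (h : Adm b η) (hκ : 1 ≤ |κ|) (hp : ‖p‖ ≤ η) (hR : ‖R‖ ≤ η) (i j : Fin 2) :
    (invCore b κ p R - 1) i j = opW b * opN b κ p R i j * opW b := by
  have h1 := h.opD_mul hκ hp hR
  have h2 := h.mul_opD hκ hp hR
  have eL : opW b * opT b κ 1 p * opW b = opL b κ 1 p := rfl
  have eG : opW b * opT b κ (-1) R * opW b = opL b κ (-1) R := rfl
  unfold invCore opN
  set D := opD b κ p R
  set Λ := opL b κ 1 p
  set Γ := opL b κ (-1) R
  set W := opW b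
  set S := opT b κ 1 p
  set T := opT b κ (-1) R
  have h1' : D = 1 - D * Λ * Γ := by rw [← h1]; abel
  have h2' : D = 1 - Λ * Γ * D := by rw [← h2]; abel
  fin_cases i <;> fin_cases j
  · change D - 1 = W * (-(S * W * W * T) + S * W * Γ * D * Λ * W * T) * W
    have e : W * (-(S * W * W * T) + S * W * Γ * D * Λ * W * T) * W =
      -(W * S * W * (W * T * W)) + W * S * W * Γ * D * Λ * (W * T * W) := by noncomm_ring
    rw [e, eL, eG]
    -- `D` is expanded twice, on the left and on the right, so that both outer letters of each word
    -- become visible.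
    have e2 : -(Λ * Γ) + Λ * Γ * D * Λ * Γ = -(Λ * Γ * (1 - D * Λ * Γ)) := by noncomm_ring
    rw [e2, ← h1', ← h2]; abel
  · change -(D * Λ) - 0 = W * (-S + S * W * Γ * D * W * S) * W
    have e : W * (-S + S * W * Γ * D * W * S) * W =
      -(W * S * W) + W * S * W * Γ * D * (W * S * W) := by noncomm_ring
    rw [e, eL]
    have e2 : -Λ + Λ * Γ * D * Λ = -((1 - Λ * Γ * D) * Λ) := by noncomm_ring
    rw [e2, ← h2', sub_zero]
  · change Γ * D - 0 = W * (T - T * W * D * Λ * W * T) * W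
    have e : W * (T - T * W * D * Λ * W * T) * W =
      W * T * W - W * T * W * D * Λ * (W * T * W) := by noncomm_ring
    rw [e, eG]
    have e2 : Γ - Γ * D * Λ * Γ = Γ * (1 - D * Λ * Γ) := by noncomm_ring
    rw [e2, ← h1', sub_zero]
  · change 1 - Γ * D * Λ - 1 = W * (-(T * W * D * W * S)) * W
    have e : W * (-(T * W * D * W * S)) * W = -(W * T * W * D * (W * S * W)) := by noncomm_ring
    rw [e, eG, eL]; abel

lemma Rep.resolventDiff_eq (hr : Rep b σ q p R) (h : Adm b η) (hκ : 1 ≤ |κ|) (hp : ‖p‖ ≤ η)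
    (hR : ‖R‖ ≤ η) (i j : Fin 2) :
    resolventDiff σ q κ i j = cj (mulOp (sqrtSym κ (sgn2 i)) * opW b * opN b κ p R i j * opW b *
      mulOp (sqrtSym κ (sgn2 j))) := by
  have e0 : sqrtR0 κ = cj.mapMatrix (Matrix.diagonal fun i => mulOp (sqrtSym κ (sgn2 i))) := by
    ext1 i j
    fin_cases i <;> fin_cases j <;> simp [sqrtR0, sgn2, fourierMul_eq]
  rw [resolventDiff, (hr.isUnit_laxCore h hκ hp hR).2, e0, ← map_mul, ← map_mul, ← map_mul, ← map_sub,
    RingHom.mapMatrix_apply, Matrix.map_apply]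
  congr 1
  have e1 := h.invCore_sub_one hκ hp hR i j
  set S := Matrix.diagonal fun i => mulOp (sqrtSym κ (sgn2 i)) with hS
  have e2 : S * invCore b κ p R * S - S * S = S * (invCore b κ p R - 1) * S := by noncomm_ring
  rw [e2, hS, Matrix.mul_diagonal, Matrix.diagonal_mul, e1]
  simp only [mul_assoc]

end

/-! ### Flip identities -/

lemma integral_fourier_mul_flip {f g : ℝ → ℂ} (hf : Integrable f) (hg : Integrable g) :
    ∫ ξ, 𝓕 f ξ * g ξ = ∫ x, f x * 𝓕 g x := by
  have h := VectorFourier.integral_fourierIntegral_smul_eq_flip (L := innerₗ ℝ)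
    Real.continuous_fourierChar (by exact continuous_inner) hf hg
  rw [flip_innerₗ] at h
  exact h

lemma integral_fourierInv_mul_flip {f g : ℝ → ℂ} (hf : Integrable f) (hg : Integrable g) :
    ∫ ξ, 𝓕⁻ f ξ * g ξ = ∫ x, f x * 𝓕⁻ g x := by
  have h := integral_fourier_mul_flip hf.comp_neg hg
  rw [← integral_neg_eq_self] at h
  rw [Real.fourierInv_eq_fourier_comp_neg, ← integral_neg_eq_self, h,
    ← integral_neg_eq_self (fun x => f x * 𝓕⁻ g x)]
  refine integral_congr_ae (ae_of_all _ fun x => ?_)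
  simp [Real.fourierInv_eq_fourier_neg]

lemma schwartz_fourier_coe (q : 𝓢(ℝ, ℂ)) : ((𝓕 q : 𝓢(ℝ, ℂ)) : ℝ → ℂ) = 𝓕 (q : ℝ → ℂ) := rfl

lemma schwartz_fourierInv_coe (q : 𝓢(ℝ, ℂ)) : ((𝓕⁻ q : 𝓢(ℝ, ℂ)) : ℝ → ℂ) = 𝓕⁻ (q : ℝ → ℂ) :=
  SchwartzMap.fourierInv_coe q

lemma integral_mul_fourierInv_L2 (φ : 𝓢(ℝ, ℂ)) (G : L2) :
    ∫ x, φ x * (𝓕⁻ G : L2) x = ∫ ξ, 𝓕⁻ (φ : ℝ → ℂ) ξ * G ξ := by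
  have h := congrArg (fun T : 𝓢'(ℝ, ℂ) => T φ) (Lp.fourierInv_toTemperedDistribution_eq G)
  simp only [TemperedDistribution.fourierInv_apply, Lp.toTemperedDistribution_apply, smul_eq_mul] at h
  rw [← h, schwartz_fourierInv_coe]

lemma fourier_toLp_ae (ψ : 𝓢(ℝ, ℂ)) : (𝓕 (ψ.toLp 2 : L2) : L2) =ᵐ[volume] 𝓕 (ψ : ℝ → ℂ) := by
  rw [SchwartzMap.toLp_fourier_eq]
  exact (𝓕 ψ : 𝓢(ℝ, ℂ)).coeFn_toLp 2 volume

/-! ### Exponentials -/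

/-- The function `ξ ↦ exp (- 2 π i y ξ)`. -/
def chr (y ξ : ℝ) : ℂ := cexp ((-(2 * Real.pi * y * ξ) : ℝ) * I)

lemma norm_chr (y ξ : ℝ) : ‖chr y ξ‖ = 1 := Complex.norm_exp_ofReal_mul_I _

lemma continuous_chr (y : ℝ) : Continuous (chr y) := by unfold chr; fun_prop

lemma memLp_chr (y : ℝ) : MemLp (chr y) ∞ (volume : Measure ℝ) :=
  memLp_top_of_measurable (continuous_chr y).measurable fun ξ => (norm_chr y ξ).le

lemma conj_chr (y ξ : ℝ) : conj (chr y ξ) = cexp ((2 * Real.pi * y * ξ : ℝ) * I) := by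
  rw [chr, ← Complex.exp_conj, map_mul, conj_ofReal, conj_I]; push_cast; ring_nf

lemma fourier_eq_integral_chr (v : ℝ → ℂ) (y : ℝ) : 𝓕 v y = ∫ ξ, chr y ξ * v ξ := by
  rw [Real.fourier_real_eq_integral_exp_smul]
  refine integral_congr_ae (ae_of_all _ fun ξ => ?_)
  simp only [smul_eq_mul, chr]
  congr 2; push_cast; ring

lemma fourierInv_eq_integral_chr (v : ℝ → ℂ) (y : ℝ) : 𝓕⁻ v y = ∫ ξ, conj (chr y ξ) * v ξ := by
  rw [fourierInv_eq_integral]; simp only [conj_chr]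

lemma norm_mulOp_chr_le (y : ℝ) (f : L2) : ‖mulOp (chr y) f‖ ≤ ‖f‖ := by
  simpa using norm_mulOp_le (memLp_chr y) (fun ξ => (norm_chr y ξ).le) f

lemma tendsto_norm_of_lintegral {α : Type*} {l : Filter α} {f : α → L2}
    (h : Tendsto (fun a => ∫⁻ x, ‖f a x‖ₑ ^ 2) l (𝓝 0)) : Tendsto f l (𝓝 0) := by
  simp only [lintegral_enorm_sq_eq] at h
  rw [tendsto_zero_iff_norm_tendsto_zero]
  have h2 := (ENNReal.tendsto_toReal ENNReal.zero_ne_top).comp h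
  simp only [ENNReal.toReal_zero] at h2
  have h3 : Tendsto (fun a => ‖f a‖ ^ 2) l (𝓝 0) := by
    refine h2.congr fun a => ?_
    simp only [Function.comp]
    rw [ENNReal.toReal_ofReal (by positivity)]
  have h4 := (Real.continuous_sqrt.tendsto 0).comp h3
  rw [Real.sqrt_zero] at h4
  refine h4.congr fun a => ?_
  simp only [Function.comp]
  exact Real.sqrt_sq (norm_nonneg _)

/-- Strong continuity of modulations, by dominated convergence. On the Fourier side modulations are
translations of the smoothed delta functions, so this gives the continuity of the kernel. -/
lemma continuous_mulOp_chr (f : L2) : Continuous fun y => mulOp (chr y) f := by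
  rw [continuous_iff_continuousAt]
  intro y₀
  rw [ContinuousAt, tendsto_iff_norm_sub_tendsto_zero, ← tendsto_zero_iff_norm_tendsto_zero]
  apply tendsto_norm_of_lintegral
  have e : ∀ y, ∫⁻ x, ‖(mulOp (chr y) f - mulOp (chr y₀) f : L2) x‖ₑ ^ 2 =
      ∫⁻ x, ‖(chr y x - chr y₀ x) * f x‖ₑ ^ 2 := fun y => by
    refine lintegral_congr_ae ?_
    filter_upwards [Lp.coeFn_sub (mulOp (chr y) f) (mulOp (chr y₀) f), mulOp_ae (memLp_chr y) f,
      mulOp_ae (memLp_chr y₀) f] with x h1 h2 h3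
    rw [h1, Pi.sub_apply, h2, h3, sub_mul]
  simp only [e]
  have hm : Measurable (f : ℝ → ℂ) := (Lp.stronglyMeasurable f).measurable
  have h := tendsto_lintegral_filter_of_dominated_convergence (μ := (volume : Measure ℝ)) (l := 𝓝 y₀)
    (F := fun y x => ‖(chr y x - chr y₀ x) * f x‖ₑ ^ 2) (f := fun _ => 0) (fun x => 4 * ‖f x‖ₑ ^ 2)
    ?_ ?_ ?_ ?_
  · simpa using h
  · refine Eventually.of_forall fun y => ?_
    exact (((continuous_chr y).sub (continuous_chr y₀)).measurable.mul hm).enorm.pow_const 2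
  · refine Eventually.of_forall fun y => ae_of_all _ fun x => ?_
    rw [enorm_mul, mul_pow]
    gcongr
    have h1 : ‖chr y x - chr y₀ x‖ₑ ≤ 2 := by
      have : ‖chr y x - chr y₀ x‖ ≤ 2 := (norm_sub_le _ _).trans (by rw [norm_chr, norm_chr]; norm_num)
      rw [← ofReal_norm]
      exact (ENNReal.ofReal_le_ofReal this).trans (by simp)
    calc ‖chr y x - chr y₀ x‖ₑ ^ 2 ≤ 2 ^ 2 := by gcongr
      _ = 4 := by norm_num
  · rw [lintegral_const_mul' _ _ (by norm_num), lintegral_enorm_sq_eq]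
    exact ENNReal.mul_ne_top (by norm_num) ENNReal.ofReal_ne_top
  · refine ae_of_all _ fun x => ?_
    have h1 : Tendsto (fun y => (chr y x - chr y₀ x) * f x) (𝓝 y₀) (𝓝 ((chr y₀ x - chr y₀ x) * f x)) := by
      have : Continuous fun y => (chr y x - chr y₀ x) * f x := by unfold chr; fun_prop
      exact this.tendsto y₀
    rw [sub_self, zero_mul] at h1
    have h2 := (ENNReal.continuous_pow 2).tendsto _ |>.comp (continuous_enorm.tendsto _ |>.comp h1)
    rw [enorm_zero, zero_pow two_ne_zero] at h2
    exact h2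

/-! ### The kernel of the resolvent difference -/

/-- The smoothed symbols. -/
def um (b κ : ℝ) (i : Fin 2) (ξ : ℝ) : ℂ := sqrtSym κ (sgn2 i) ξ * jw 1 (-th b) ξ

section
variable {b κ η σ : ℝ} {q : 𝓢'(ℝ, ℂ)} {p R : L2}

lemma measurable_um (b κ : ℝ) (i : Fin 2) : Measurable (um b κ i) := by unfold um; fun_prop

lemma norm_um_le (hb : b < 1 / 2) (hκ : 1 ≤ |κ|) (i : Fin 2) (ξ : ℝ) : ‖um b κ i ξ‖ ≤ 1 := by
  rw [um, norm_mul, norm_jw]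
  exact mul_le_one₀ (norm_sqrtSym_le hκ (sgn2_sign i) ξ) (Real.rpow_nonneg (jb_nonneg _ _) _)
    (Real.rpow_le_one_of_one_le_of_nonpos (one_le_jb one_le_abs_one ξ) (by linarith [th_nonneg hb]))

lemma memLp_um_top (hb : b < 1 / 2) (hκ : 1 ≤ |κ|) (i : Fin 2) :
    MemLp (um b κ i) ∞ (volume : Measure ℝ) :=
  memLp_top_of_measurable (measurable_um _ _ _) (norm_um_le hb hκ i)

/-- The squared symbol of the square root decays only like `1 / |ξ|` and just fails to be
integrable; the additional `jb 1 ^ (-2 th)` from the smoothing operator repairs this. It is the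
reason for splitting off `W`. -/
lemma memLp_um (hb : b < 1 / 2) (hκ : 1 ≤ |κ|) (i : Fin 2) :
    MemLp (um b κ i) 2 (volume : Measure ℝ) := by
  rw [memLp_two_iff_integrable_sq_norm (measurable_um _ _ _).aestronglyMeasurable]
  have hth : 0 < th b := by unfold th; linarith
  have hi := (integrable_jb_one_rpow (p := 1 + 2 * th b) (by linarith)).const_mul 2
  refine hi.mono' ((measurable_um _ _ _).norm.pow_const 2).aestronglyMeasurable
    (ae_of_all _ fun ξ => ?_)
  rw [Real.norm_of_nonneg (by positivity), um, norm_mul, mul_pow, norm_jw, rpow_sq_eq (jb_nonneg _ _)]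
  have h1 := norm_sqrtSym_sq_le hκ (sgn2_sign i) ξ
  have h2 : -(1 + 2 * th b) = -1 + 2 * -th b := by ring
  rw [h2, Real.rpow_add (jb_pos one_le_abs_one ξ), ← mul_assoc]
  exact mul_le_mul_of_nonneg_right h1 (Real.rpow_nonneg (jb_nonneg _ _) _)

open Classical in
/-- The smoothed delta functions on the right. -/
def uV (b κ : ℝ) (i : Fin 2) : L2 :=
  if h : MemLp (um b κ i) 2 (volume : Measure ℝ) then h.toLp else 0

open Classical in
/-- The smoothed delta functions on the left. -/
def vV (b κ : ℝ) (i : Fin 2) : L2 :=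
  if h : MemLp (fun ξ => conj (um b κ i ξ)) 2 (volume : Measure ℝ) then h.toLp else 0

lemma uV_ae (hb : b < 1 / 2) (hκ : 1 ≤ |κ|) (i : Fin 2) : (uV b κ i : L2) =ᵐ[volume] um b κ i := by
  rw [uV, dif_pos (memLp_um hb hκ i)]; exact MemLp.coeFn_toLp _

lemma vV_ae (hb : b < 1 / 2) (hκ : 1 ≤ |κ|) (i : Fin 2) :
    (vV b κ i : L2) =ᵐ[volume] fun ξ => conj (um b κ i ξ) := by
  have h : MemLp (fun ξ => conj (um b κ i ξ)) 2 (volume : Measure ℝ) := (memLp_um hb hκ i).star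
  rw [vV, dif_pos h]; exact MemLp.coeFn_toLp _

lemma inner_vV (hb : b < 1 / 2) (hκ : 1 ≤ |κ|) (i : Fin 2) (x : ℝ) (H : L2) :
    inner ℂ (mulOp (chr x) (vV b κ i)) H = 𝓕⁻ (fun ξ => um b κ i ξ * H ξ) x := by
  rw [inner_L2, fourierInv_eq_integral_chr]
  refine integral_congr_ae ?_
  filter_upwards [mulOp_ae (memLp_chr x) (vV b κ i), vV_ae hb hκ i] with ξ h1 h2
  rw [h1, h2, map_mul, conj_conj, mul_assoc]

lemma inner_uV (hb : b < 1 / 2) (hκ : 1 ≤ |κ|) (i : Fin 2) (y : ℝ) (f : L2) :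
    inner ℂ f (mulOp (chr y) (uV b κ i)) = 𝓕 (fun ξ => conj (f ξ) * um b κ i ξ) y := by
  rw [inner_L2, fourier_eq_integral_chr]
  refine integral_congr_ae ?_
  filter_upwards [mulOp_ae (memLp_chr y) (uV b κ i), uV_ae hb hκ i] with ξ h1 h2
  rw [h1, h2]; ring

/-- The continuous kernel of `R - R₀`. -/
def grK (b κ : ℝ) (p R : L2) (x y : ℝ) : Matrix (Fin 2) (Fin 2) ℂ :=
  Matrix.of fun i j => inner ℂ (mulOp (chr x) (vV b κ i)) (opN b κ p R i j (mulOp (chr y) (uV b κ j)))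

lemma continuous_grK (b κ : ℝ) (p R : L2) : Continuous fun z : ℝ × ℝ => grK b κ p R z.1 z.2 := by
  refine continuous_matrix fun i j => ?_
  change Continuous fun z : ℝ × ℝ =>
    inner ℂ (mulOp (chr z.1) (vV b κ i)) (opN b κ p R i j (mulOp (chr z.2) (uV b κ j)))
  exact ((continuous_mulOp_chr _).comp continuous_fst).inner
    ((opN b κ p R i j).continuous.comp ((continuous_mulOp_chr _).comp continuous_snd))

/-- `N_ij W √R₀ ψ` on the Fourier side. -/
def resH (b κ : ℝ) (p R : L2) (i j : Fin 2) (ψ : 𝓢(ℝ, ℂ)) : L2 :=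
  opN b κ p R i j (mulOp (um b κ j) (𝓕 (ψ.toLp 2 : L2)))

lemma opW_mulOp_sqrtSym (hb : b < 1 / 2) (hκ : 1 ≤ |κ|) (j : Fin 2) (f : L2) :
    opW b (mulOp (sqrtSym κ (sgn2 j)) f) = mulOp (um b κ j) f := by
  apply Lp.ext
  filter_upwards [mulOp_ae (memLp_jw_top (κ := 1) (th_nonneg hb) one_le_abs_one)
    (mulOp (sqrtSym κ (sgn2 j)) f), mulOp_ae (memLp_sqrtSym hκ (sgn2_sign j)) f,
    mulOp_ae (memLp_um_top hb hκ j) f] with ξ h1 h2 h3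
  rw [h3, um]
  refine h1.trans ?_
  rw [h2]; ring

lemma Rep.fourier_resolventDiff_ae (hr : Rep b σ q p R) (h : Adm b η) (hκ : 1 ≤ |κ|) (hp : ‖p‖ ≤ η)
    (hR : ‖R‖ ≤ η) (i j : Fin 2) (ψ : 𝓢(ℝ, ℂ)) :
    (𝓕 (resolventDiff σ q κ i j (ψ.toLp 2 : L2)) : L2) =ᵐ[volume]
      fun ξ => um b κ i ξ * resH b κ p R i j ψ ξ := by
  rw [hr.resolventDiff_eq h hκ hp hR, fourier_cj]
  have e : (mulOp (sqrtSym κ (sgn2 i)) * opW b * opN b κ p R i j * opW b *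
      mulOp (sqrtSym κ (sgn2 j))) (𝓕 (ψ.toLp 2 : L2)) =
      mulOp (sqrtSym κ (sgn2 i)) (opW b (resH b κ p R i j ψ)) := by
    rw [resH, ← opW_mulOp_sqrtSym h.hb hκ]; rfl
  rw [e]
  filter_upwards [mulOp_ae (memLp_sqrtSym hκ (sgn2_sign i)) (opW b (resH b κ p R i j ψ)),
    mulOp_ae (memLp_jw_top (κ := 1) (th_nonneg h.hb) one_le_abs_one) (resH b κ p R i j ψ)] with ξ h1 h2
  rw [h1, um, mul_assoc]
  congr 1

lemma integrable_um_mul (hb : b < 1 / 2) (hκ : 1 ≤ |κ|) (i : Fin 2) (H : L2) :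
    Integrable fun ξ => um b κ i ξ * H ξ := (memLp_um hb hκ i).integrable_mul (Lp.memLp H)

/-- After `N` is moved to its adjoint, each row of the kernel is the Fourier transform of an
integrable function, and the transform can be passed on to the Schwartz function. -/
lemma inner_vV_resH (hb : b < 1 / 2) (hκ : 1 ≤ |κ|) (i j : Fin 2) (x : ℝ) (ψ : 𝓢(ℝ, ℂ)) :
    𝓕⁻ (fun ξ => um b κ i ξ * resH b κ p R i j ψ ξ) x = ∫ y, grK b κ p R x y i j * ψ y := by
  rw [← inner_vV hb hκ, resH, ← ContinuousLinearMap.adjoint_inner_left]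
  set f := ContinuousLinearMap.adjoint (opN b κ p R i j) (mulOp (chr x) (vV b κ i)) with hf
  have e1 : ∀ y, grK b κ p R x y i j = 𝓕 (fun ξ => conj (f ξ) * um b κ j ξ) y := fun y => by
    rw [← inner_uV hb hκ, hf, ContinuousLinearMap.adjoint_inner_left]; rfl
  simp only [e1]
  have hi : Integrable fun ξ => conj (f ξ) * um b κ j ξ :=
    (Lp.memLp f).star.integrable_mul (memLp_um hb hκ j)
  rw [integral_fourier_mul_flip hi ψ.integrable, inner_L2]
  refine integral_congr_ae ?_
  filter_upwards [mulOp_ae (memLp_um_top hb hκ j) (𝓕 (ψ.toLp 2 : L2)), fourier_toLp_ae ψ] with ξ h1 h2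
  rw [h1, h2, mul_assoc]

lemma Rep.isGreenDiff (hr : Rep b σ q p R) (h : Adm b η) (hκ : 1 ≤ |κ|) (hp : ‖p‖ ≤ η)
    (hR : ‖R‖ ≤ η) : IsGreenDiff σ q κ (grK b κ p R) := by
  refine ⟨continuous_grK b κ p R, fun i j φ ψ _ _ => ?_⟩
  have h1 := hr.fourier_resolventDiff_ae h hκ hp hR i j ψ
  set G : L2 := 𝓕 (resolventDiff σ q κ i j (ψ.toLp 2 : L2)) with hG
  have e : resolventDiff σ q κ i j (ψ.toLp 2 : L2) = 𝓕⁻ G := (FourierTransform.fourierInv_fourier_eq _).symm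
  rw [e, integral_mul_fourierInv_L2]
  have e2 : ∫ ξ, 𝓕⁻ (φ : ℝ → ℂ) ξ * G ξ =
      ∫ ξ, 𝓕⁻ (φ : ℝ → ℂ) ξ * (um b κ i ξ * resH b κ p R i j ψ ξ) := by
    refine integral_congr_ae ?_
    filter_upwards [h1] with ξ h2
    rw [h2]
  rw [e2, integral_fourierInv_mul_flip φ.integrable (integrable_um_mul h.hb hκ i _)]
  refine integral_congr_ae (ae_of_all _ fun x => ?_)
  simp only
  rw [inner_vV_resH h.hb hκ, ← integral_const_mul]
  simp only [mul_assoc]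

end

/-! ### Uniqueness of the continuous kernel -/

/-- The fundamental lemma of the calculus of variations, with the conclusion extended by continuity
to the closure. The closure matters for half lines, where the value at the endpoint is wanted. -/
lemma eq_zero_of_forall_integral_mul {D : ℝ → ℂ} {U : Set ℝ} (hU : IsOpen U) (hD : Continuous D)
    (h : ∀ φ : 𝓢(ℝ, ℂ), HasCompactSupport φ → tsupport φ ⊆ U → ∫ x, φ x * D x = 0) :
    ∀ x ∈ closure U, D x = 0 := by
  have h1 : ∀ᵐ x ∂(volume : Measure ℝ), x ∈ U → D x = 0 := by
    refine hU.ae_eq_zero_of_integral_contDiff_smul_eq_zero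
      (hD.locallyIntegrable.locallyIntegrableOn U) fun g hg hgc hgU => ?_
    have hs : tsupport (fun x => (g x : ℂ)) ⊆ tsupport g := closure_mono fun x hx => by
      simpa using hx
    have hc : HasCompactSupport fun x => (g x : ℂ) := hgc.of_isClosed_subset isClosed_closure hs
    exact h (hc.toSchwartzMap (Complex.ofRealCLM.contDiff.comp hg)) hc (hs.trans hgU)
  have h2 : U ⊆ closure (U ∩ {x | D x = 0}) := fun x hx => by
    rw [mem_closure_iff]
    intro o ho hxo
    by_contra hne
    have h3 : o ∩ U ⊆ {x | ¬(x ∈ U → D x = 0)} := fun z hz hz2 => hne ⟨z, hz.1, hz.2, hz2 hz.2⟩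
    have h4 : volume (o ∩ U) = 0 := measure_mono_null h3 h1
    exact ((ho.inter hU).measure_pos volume ⟨x, hxo, hx⟩).ne' h4
  intro x hx
  have h5 : closure U ⊆ {x | D x = 0} :=
    closure_minimal (h2.trans (closure_minimal Set.inter_subset_right
      (isClosed_eq hD continuous_const))) (isClosed_eq hD continuous_const)
  exact h5 hx

lemma continuous_integral_mul_compact {f : ℝ → ℝ → ℂ} (hf : Continuous fun z : ℝ × ℝ => f z.1 z.2)
    {ψ : ℝ → ℂ} (hψ : Continuous ψ) (hc : HasCompactSupport ψ) :
    Continuous fun x => ∫ y, f x y * ψ y := by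
  have h := continuous_parametric_integral_of_continuous (μ := (volume : Measure ℝ))
    (f := fun x y => f x y * ψ y) (hf.mul (hψ.comp continuous_snd)) (s := tsupport ψ) hc
  refine h.congr fun x => ?_
  refine setIntegral_eq_integral_of_forall_compl_eq_zero fun y hy => ?_
  rw [image_eq_zero_of_notMem_tsupport hy, mul_zero]

/-- The two test functions are removed one after the other; both times continuity turns an identity
of integrals into a pointwise one. -/
lemma IsGreenDiff.unique {σ κ : ℝ} {q : 𝓢'(ℝ, ℂ)} {K K' : ℝ → ℝ → Matrix (Fin 2) (Fin 2) ℂ}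
    (hK : IsGreenDiff σ q κ K) (hK' : IsGreenDiff σ q κ K') : K = K' := by
  funext x y
  ext i j
  have hc : ∀ {K : ℝ → ℝ → Matrix (Fin 2) (Fin 2) ℂ}, IsGreenDiff σ q κ K →
      Continuous fun z : ℝ × ℝ => K z.1 z.2 i j := fun h => h.1.matrix_elem i j
  have h1 : ∀ ψ : 𝓢(ℝ, ℂ), HasCompactSupport ψ → ∀ x,
      ∫ y, K x y i j * ψ y = ∫ y, K' x y i j * ψ y := fun ψ hψ x => by
    have ha := continuous_integral_mul_compact (f := fun x y => K x y i j) (hc hK) ψ.continuous hψ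
    have hb := continuous_integral_mul_compact (f := fun x y => K' x y i j) (hc hK') ψ.continuous hψ
    have h2 := eq_zero_of_forall_integral_mul (U := Set.univ) isOpen_univ (ha.sub hb) (fun φ hφ _ => by
      have hi : ∀ {f : ℝ → ℂ}, Continuous f → Integrable fun x => φ x * f x := fun hf =>
        (φ.continuous.mul hf).integrable_of_hasCompactSupport hφ.mul_right
      simp only [Pi.sub_apply, mul_sub]
      rw [integral_sub (hi ha) (hi hb)]
      have h3 := hK.2 i j φ ψ hφ hψ
      have h4 := hK'.2 i j φ ψ hφ hψ
      simp only [mul_assoc, integral_const_mul] at h3 h4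
      rw [← h3, ← h4, sub_self]) x (by simp)
    exact sub_eq_zero.mp h2
  have hcx : ∀ {K : ℝ → ℝ → Matrix (Fin 2) (Fin 2) ℂ}, IsGreenDiff σ q κ K →
      Continuous fun y => K x y i j := fun h => (hc h).comp (by fun_prop : Continuous fun y : ℝ => (x, y))
  have h2 := eq_zero_of_forall_integral_mul (U := Set.univ) isOpen_univ ((hcx hK).sub (hcx hK'))
    (fun ψ hψ _ => by
      have hi : ∀ {f : ℝ → ℂ}, Continuous f → Integrable fun x => ψ x * f x := fun hf =>
        (ψ.continuous.mul hf).integrable_of_hasCompactSupport hψ.mul_right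
      simp only [Pi.sub_apply, mul_sub]
      rw [integral_sub (hi (hcx hK)) (hi (hcx hK'))]
      have := h1 ψ hψ x
      simp only [mul_comm (ψ _)]
      rw [this, sub_self]) y (by simp)
  exact sub_eq_zero.mp h2

lemma IsGreenDiff.greenDiff_eq {σ κ : ℝ} {q : 𝓢'(ℝ, ℂ)} {K : ℝ → ℝ → Matrix (Fin 2) (Fin 2) ℂ}
    (hK : IsGreenDiff σ q κ K) : greenDiff σ q κ = K := by
  have hex : ∃ K, IsGreenDiff σ q κ K := ⟨K, hK⟩
  rw [greenDiff, dif_pos hex]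
  exact hex.choose_spec.unique hK

section
variable {b κ η σ : ℝ} {q : 𝓢'(ℝ, ℂ)} {p R : L2}

lemma Rep.greenDiff_eq (hr : Rep b σ q p R) (h : Adm b η) (hκ : 1 ≤ |κ|) (hp : ‖p‖ ≤ η)
    (hR : ‖R‖ ≤ η) : greenDiff σ q κ = grK b κ p R := (hr.isGreenDiff h hκ hp hR).greenDiff_eq

lemma Rep.hasGreen (hr : Rep b σ q p R) (h : Adm b η) (hκ : 1 ≤ |κ|) (hp : ‖p‖ ≤ η)
    (hR : ‖R‖ ≤ η) : HasGreen σ q κ := by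
  refine ⟨?_, ?_, (hr.isUnit_laxCore h hκ hp hR).1, ?_⟩
  · rw [hr.opLambda_eq h.hb0.le h.hb hκ]; exact hr.isSandwich_lambda h.hb0.le h.hb hκ
  · rw [hr.opGamma_eq h.hb0.le h.hb hκ]; exact hr.isSandwich_gamma h.hb0.le h.hb hκ
  · rw [hr.greenDiff_eq h hκ hp hR]; exact hr.isGreenDiff h hκ hp hR

/-! ### Continuity in the potentials -/

lemma Adm.tendsto_opD (h : Adm b η) (hκ : 1 ≤ |κ|) {α : Type*} {l : Filter α} {P Q : α → L2}
    (hP : Tendsto P l (𝓝 p)) (hQ : Tendsto Q l (𝓝 R)) (hp : ‖p‖ ≤ η) (hR : ‖R‖ ≤ η) :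
    Tendsto (fun t => opD b κ (P t) (Q t)) l (𝓝 (opD b κ p R)) := by
  obtain ⟨u, hu⟩ := h.isUnit_one_add hκ hp hR
  have h1 := NormedRing.inverse_continuousAt u
  rw [ContinuousAt, hu] at h1
  refine h1.comp ?_
  exact tendsto_const_nhds.add (((continuous_opL.tendsto _).comp hP).mul
    ((continuous_opL.tendsto _).comp hQ))

lemma Adm.tendsto_opN (h : Adm b η) (hκ : 1 ≤ |κ|) {α : Type*} {l : Filter α} {P Q : α → L2}
    (hP : Tendsto P l (𝓝 p)) (hQ : Tendsto Q l (𝓝 R)) (hp : ‖p‖ ≤ η) (hR : ‖R‖ ≤ η) (i j : Fin 2) :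
    Tendsto (fun t => opN b κ (P t) (Q t) i j) l (𝓝 (opN b κ p R i j)) := by
  have hD := h.tendsto_opD hκ hP hQ hp hR
  have hL := (continuous_opL (b := b) (κ := κ) (ε := 1)).tendsto _ |>.comp hP
  have hG := (continuous_opL (b := b) (κ := κ) (ε := -1)).tendsto _ |>.comp hQ
  have hS := (continuous_opT (b := b) (κ := κ) (ε := 1)).tendsto _ |>.comp hP
  have hT := (continuous_opT (b := b) (κ := κ) (ε := -1)).tendsto _ |>.comp hQ
  have hW : Tendsto (fun _ : α => opW b) l (𝓝 (opW b)) := tendsto_const_nhds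
  fin_cases i <;> fin_cases j
  · exact (((hS.mul hW).mul hW).mul hT).neg.add
      (((((((hS.mul hW).mul hG).mul hD).mul hL).mul hW)).mul hT)
  · exact hS.neg.add (((((hS.mul hW).mul hG).mul hD).mul hW).mul hS)
  · exact hT.sub (((((hT.mul hW).mul hD).mul hL).mul hW).mul hT)
  · exact ((((hT.mul hW).mul hD).mul hW).mul hS).neg

lemma Adm.tendsto_grK (h : Adm b η) (hκ : 1 ≤ |κ|) {α : Type*} {l : Filter α} {P Q : α → L2}
    (hP : Tendsto P l (𝓝 p)) (hQ : Tendsto Q l (𝓝 R)) (hp : ‖p‖ ≤ η) (hR : ‖R‖ ≤ η) (x y : ℝ)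
    (i j : Fin 2) :
    Tendsto (fun t => grK b κ (P t) (Q t) x y i j) l (𝓝 (grK b κ p R x y i j)) := by
  have h1 := h.tendsto_opN hκ hP hQ hp hR i j
  exact tendsto_const_nhds.inner (tendsto_clm_apply h1 tendsto_const_nhds)

end

/-! ### Solutions of the inhomogeneous system -/

/-- `(u₀, u₁)` solves `L(κ) u = f`. -/
structure IsSol (κ : ℝ) (q r f₀ f₁ u₀ u₁ : ℝ → ℂ) : Prop where
  int₀ : Integrable u₀
  int₁ : Integrable u₁
  bdd : ∃ C, ∀ x, ‖u₀ x‖ ≤ C ∧ ‖u₁ x‖ ≤ C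
  deriv₀ : ∀ x, HasDerivAt u₀ (κ * u₀ x + q x * u₁ x - f₀ x) x
  deriv₁ : ∀ x, HasDerivAt u₁ (-κ * u₁ x + r x * u₀ x + f₁ x) x

/-- Exchanging the two components turns `κ` into `-κ` and `q` into `r`, with sign changes in the
sources. Negative spectral parameters are thereby reduced to positive ones. -/
lemma IsSol.swap {κ : ℝ} {q r f₀ f₁ u₀ u₁ : ℝ → ℂ} (h : IsSol (-κ) r q (-f₁) (-f₀) u₀ u₁) :
    IsSol κ q r f₀ f₁ u₁ u₀ where
  int₀ := h.int₁
  int₁ := h.int₀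
  bdd := h.bdd.imp fun _ hC x => ⟨(hC x).2, (hC x).1⟩
  deriv₀ x := (h.deriv₁ x).congr_deriv (by push_cast; simp; ring)
  deriv₁ x := (h.deriv₀ x).congr_deriv (by push_cast; simp)

/-- The decoupled Riccati equations. -/
structure RicPair (κ : ℝ) (q r F₁ F₂ : ℝ → ℂ) : Prop where
  contq : Continuous q
  contr : Continuous r
  intq : Integrable q
  intr : Integrable r
  ode₁ : ∀ x, HasDerivAt F₁ (-2 * κ * F₁ x + r x / 2 - 2 * q x * F₁ x ^ 2) x
  ode₂ : ∀ x, HasDerivAt F₂ (2 * κ * F₂ x + q x / 2 - 2 * r x * F₂ x ^ 2) x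
  le₁ : ∀ x, ‖F₁ x‖ ≤ 1 / 4
  le₂ : ∀ x, ‖F₂ x‖ ≤ 1 / 4

namespace RicPair

variable {κ : ℝ} {q r F₁ F₂ : ℝ → ℂ}

lemma swap (h : RicPair κ q r F₁ F₂) : RicPair (-κ) r q F₂ F₁ where
  contq := h.contr
  contr := h.contq
  intq := h.intr
  intr := h.intq
  ode₁ x := (h.ode₂ x).congr_deriv (by push_cast; ring)
  ode₂ x := (h.ode₁ x).congr_deriv (by push_cast; ring)
  le₁ := h.le₂
  le₂ := h.le₁

/-- The free case, whose Green's function `G₀` has to be subtracted. -/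
lemma zero (κ : ℝ) : RicPair κ 0 0 0 0 where
  contq := continuous_const
  contr := continuous_const
  intq := integrable_zero _ _ _
  intr := integrable_zero _ _ _
  ode₁ x := (hasDerivAt_const x (0 : ℂ)).congr_deriv (by simp)
  ode₂ x := (hasDerivAt_const x (0 : ℂ)).congr_deriv (by simp)
  le₁ x := by simp
  le₂ x := by simp

lemma cont₁ (h : RicPair κ q r F₁ F₂) : Continuous F₁ :=
  continuous_iff_continuousAt.mpr fun x => (h.ode₁ x).continuousAt

lemma cont₂ (h : RicPair κ q r F₁ F₂) : Continuous F₂ := h.swap.cont₁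

lemma norm_mul_le (h : RicPair κ q r F₁ F₂) (x : ℝ) : ‖4 * F₁ x * F₂ x‖ ≤ 1 / 4 := by
  have h1 := h.le₁ x
  have h2 := h.le₂ x
  rw [norm_mul, norm_mul]
  have : ‖(4 : ℂ)‖ = 4 := by norm_num
  rw [this]
  have := mul_le_mul h1 h2 (norm_nonneg _) (by norm_num)
  linarith

lemma ne_zero (h : RicPair κ q r F₁ F₂) (x : ℝ) : 1 - 4 * F₁ x * F₂ x ≠ 0 := fun h0 => by
  have h1 := h.norm_mul_le x
  rw [← sub_eq_zero.mp h0] at h1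
  norm_num at h1

lemma integrable_mul (h : RicPair κ q r F₁ F₂) : Integrable fun x => 2 * (q x * F₁ x) :=
  (h.intq.mul_bdd (c := 1 / 4) h.cont₁.aestronglyMeasurable (ae_of_all _ h.le₁)).const_mul 2

/-- The correction of the phase. -/
def phase (q F₁ : ℝ → ℂ) (x : ℝ) : ℂ := ∫ t in (0 : ℝ)..x, 2 * (q t * F₁ t)

lemma hasDerivAt_phase (h : RicPair κ q r F₁ F₂) (x : ℝ) :
    HasDerivAt (phase q F₁) (2 * (q x * F₁ x)) x :=
  hasDerivAt_primitive (g := fun t => 2 * (q t * F₁ t)) (by have := h.cont₁; have := h.contq; fun_prop) x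

lemma cont_phase (h : RicPair κ q r F₁ F₂) : Continuous (phase q F₁) :=
  continuous_iff_continuousAt.mpr fun x => (h.hasDerivAt_phase x).continuousAt

lemma norm_exp_phase_le (h : RicPair κ q r F₁ F₂) : ∃ C, 0 ≤ C ∧ ∀ x, ‖cexp (phase q F₁ x)‖ ≤ C := by
  refine ⟨Real.exp (∫ t, ‖2 * (q t * F₁ t)‖), Real.exp_nonneg _, fun x => ?_⟩
  rw [Complex.norm_exp]
  exact Real.exp_le_exp.mpr ((le_abs_self _).trans ((Complex.abs_re_le_norm _).trans
    (norm_primitive_le h.integrable_mul x)))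

end RicPair

lemma integrable_exp_neg_abs {κ : ℝ} (hκ : 0 < κ) : Integrable fun x : ℝ => Real.exp (-(κ * |x|)) := by
  rw [← integrableOn_univ, ← Set.Iic_union_Ioi (a := (0 : ℝ))]
  refine IntegrableOn.union ?_ ?_
  · refine (integrableOn_exp_mul_Iic hκ 0).congr_fun (fun x hx => ?_) measurableSet_Iic
    simp only [abs_of_nonpos (Set.mem_Iic.mp hx), mul_neg, neg_neg]
  · refine (integrableOn_exp_mul_Ioi (neg_lt_zero.mpr hκ) 0).congr_fun (fun x hx => ?_) measurableSet_Ioi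
    simp only [abs_of_pos (Set.mem_Ioi.mp hx), neg_mul]

/-- The primitive of a compactly supported function which vanishes on the right. -/
lemma exists_right_primitive {κ : ℝ} (hκ : 0 < κ) {α e : ℝ → ℂ} (hα : Continuous α) {M : ℝ}
    (hM : 0 ≤ M) (hs : ∀ x, M < |x| → α x = 0) {C : ℝ} (hC : 0 ≤ C) (he : ∀ x, ‖e x‖ ≤ C) :
    ∃ a : ℝ → ℂ, (∀ x, HasDerivAt a (-α x) x) ∧
      (∃ C', 0 ≤ C' ∧ ∀ x : ℝ, ‖cexp (κ * x) * e x * a x‖ ≤ C' * Real.exp (-(κ * |x|))) ∧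
      (∀ x, (∀ y < x, α y = 0) → a x = ∫ y, α y) ∧ ∀ x, (∀ y > x, α y = 0) → a x = 0 := by
  have hac : HasCompactSupport α := HasCompactSupport.intro (isCompact_Icc (a := -M) (b := M)) fun x hx => by
    apply hs
    by_contra h
    exact hx (abs_le.mp (not_lt.mp h))
  have hi : Integrable α := hα.integrable_of_hasCompactSupport hac
  -- This is the integral from `x` to `M + 1`; since `α` vanishes beyond `M`, the endpoint `M + 1`
  -- replaces infinity.
  set a : ℝ → ℂ := fun x => (∫ y in (0 : ℝ)..(M + 1), α y) - ∫ y in (0 : ℝ)..x, α y with ha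
  have e1 : ∀ x, a x = ∫ y in x..(M + 1), α y := fun x => by
    rw [ha]; simp only
    rw [intervalIntegral.integral_interval_sub_left (hα.intervalIntegrable _ _) (hα.intervalIntegrable _ _)]
  have hz : ∀ x, M < x → a x = 0 := fun x hx => by
    rw [e1]
    refine intervalIntegral.integral_zero_ae (ae_of_all _ fun y hy => ?_)
    apply hs
    have : M < y := lt_of_lt_of_le (lt_min hx (by linarith)) (le_of_lt hy.1)
    exact this.trans_le (le_abs_self y)
  refine ⟨a, fun x => ?_, ⟨C * (∫ y, ‖α y‖) * Real.exp (2 * κ * M), ?_, fun x => ?_⟩, fun x hx => ?_, fun x hx => ?_⟩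
  · have := (hasDerivAt_const x (∫ y in (0 : ℝ)..(M + 1), α y)).sub (hasDerivAt_primitive hα x)
    rwa [zero_sub] at this
  · have : 0 ≤ ∫ y, ‖α y‖ := integral_nonneg fun _ => norm_nonneg _
    positivity
  · have hn : 0 ≤ ∫ y, ‖α y‖ := integral_nonneg fun _ => norm_nonneg _
    rcases lt_or_ge M x with hx | hx
    · rw [hz x hx, mul_zero, norm_zero]; positivity
    · have h1 : ‖a x‖ ≤ ∫ y, ‖α y‖ := by
        rw [e1]
        exact (intervalIntegral.norm_integral_le_integral_norm_uIoc).trans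
          (setIntegral_le_integral hi.norm (ae_of_all _ fun _ => norm_nonneg _))
      -- To the left of zero the exponential decays by itself, and between 0 and `M` the constant
      -- `exp (2κM)` pays for its growth.
      have h2 : ‖cexp (κ * x)‖ ≤ Real.exp (2 * κ * M) * Real.exp (-(κ * |x|)) := by
        rw [Complex.norm_exp, ← Real.exp_add]
        apply Real.exp_le_exp.mpr
        have : ((κ : ℂ) * x).re = κ * x := by simp
        rw [this]
        have h3 : x + |x| ≤ 2 * M := by
          rcases abs_cases x with ⟨h, _⟩ | ⟨h, _⟩ <;> rw [h] <;> linarith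
        nlinarith
      rw [norm_mul, norm_mul]
      calc _ ≤ Real.exp (2 * κ * M) * Real.exp (-(κ * |x|)) * C * ∫ y, ‖α y‖ := by
            gcongr
            exact he x
        _ = _ := by ring
  · have h1 : ∫ y, α y = ∫ y in Set.Ioc (min x (M + 1)) (M + 1), α y := by
      refine (setIntegral_eq_integral_of_forall_compl_eq_zero fun y hy => ?_).symm
      simp only [Set.mem_Ioc, not_and_or, not_lt, not_le] at hy
      rcases hy with hy | hy
      · rcases lt_or_eq_of_le (hy.trans (min_le_left _ _)) with h | h
        · exact hx y h
        · rw [h]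
          have hcl : closure (Set.Iio x) ⊆ {z | α z = 0} :=
            closure_minimal (fun z hz => hx z hz) (isClosed_eq hα continuous_const)
          rw [closure_Iio] at hcl
          exact hcl (Set.mem_Iic.mpr le_rfl)
      · exact hs y (lt_of_lt_of_le (by linarith) (le_abs_self y))
    rcases le_total x (M + 1) with h | h
    · rw [e1, h1, min_eq_left h, intervalIntegral.integral_of_le h]
    · rw [hz x (by linarith), h1, min_eq_right h, Set.Ioc_self, setIntegral_empty]
  · rcases lt_or_ge M x with h | h
    · exact hz x h
    · rw [e1]
      refine intervalIntegral.integral_zero_ae (ae_of_all _ fun y hy => hx y ?_)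
      rw [Set.uIoc_of_le (by linarith)] at hy
      exact hy.1

/-- Variation of constants for `κ > 0`. -/
lemma RicPair.exists_sol {κ : ℝ} {q r F₁ F₂ : ℝ → ℂ} (h : RicPair κ q r F₁ F₂) (hκ : 0 < κ)
    {f₀ f₁ : ℝ → ℂ} (hf₀ : Continuous f₀) (hf₁ : Continuous f₁) (hc₀ : HasCompactSupport f₀)
    (hc₁ : HasCompactSupport f₁) {x₀ : ℝ} (hs₀ : ∀ y < x₀, f₀ y = 0) (hs₁ : ∀ y < x₀, f₁ y = 0) :
    ∃ u₀ u₁, IsSol κ q r f₀ f₁ u₀ u₁ ∧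
      u₀ x₀ = cexp (κ * x₀ + phase q F₁ x₀) * ∫ y, cexp (-(κ * y + phase q F₁ y)) /
        (1 - 4 * F₁ y * F₂ y) * (f₀ y + 2 * F₂ y * f₁ y) ∧
      u₁ x₀ = 2 * F₁ x₀ * (cexp (κ * x₀ + phase q F₁ x₀) * ∫ y, cexp (-(κ * y + phase q F₁ y)) /
        (1 - 4 * F₁ y * F₂ y) * (f₀ y + 2 * F₂ y * f₁ y)) := by
  have hP := h.cont_phase
  have hQ := h.swap.cont_phase
  have hF₁ := h.cont₁
  have hF₂ := h.cont₂
  have hh : Continuous fun y => 1 - 4 * F₁ y * F₂ y := by fun_prop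
  obtain ⟨M, hM⟩ : ∃ M, 0 ≤ M ∧ ∀ x, M < |x| → f₀ x = 0 ∧ f₁ x = 0 := by
    obtain ⟨M₀, h₀⟩ := hc₀.isCompact.isBounded.exists_norm_le
    obtain ⟨M₁, h₁⟩ := hc₁.isCompact.isBounded.exists_norm_le
    refine ⟨max 0 (max M₀ M₁), le_max_left _ _, fun x hx => ⟨?_, ?_⟩⟩
    · by_contra hne
      have := h₀ x (subset_tsupport _ hne)
      rw [Real.norm_eq_abs] at this
      have h3 := le_max_left M₀ M₁
      have h4 := le_max_right 0 (max M₀ M₁)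
      linarith
    · by_contra hne
      have := h₁ x (subset_tsupport _ hne)
      rw [Real.norm_eq_abs] at this
      have h3 := le_max_right M₀ M₁
      have h4 := le_max_right 0 (max M₀ M₁)
      linarith
  -- The sources of `v` and `w` in `u = (v + 2 F₂ w, 2 F₁ v + w)`: the inverse of this change of
  -- variables has determinant denominator `1 - 4 F₁ F₂`, and the exponentials are the integrating
  -- factors of the decoupled equations.
  set α : ℝ → ℂ := fun y => cexp (-(κ * y + phase q F₁ y)) / (1 - 4 * F₁ y * F₂ y) *
    (f₀ y + 2 * F₂ y * f₁ y) with hα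
  set β : ℝ → ℂ := fun y => cexp (κ * y - phase r F₂ y) / (1 - 4 * F₁ y * F₂ y) *
    (2 * F₁ y * f₀ y + f₁ y) with hβ
  have hαc : Continuous α := by
    refine Continuous.mul (Continuous.div (by fun_prop) hh h.ne_zero) (by fun_prop)
  have hβc : Continuous β := by
    refine Continuous.mul (Continuous.div (by fun_prop) hh h.ne_zero) (by fun_prop)
  obtain ⟨C₁, hC₁, he₁⟩ := h.norm_exp_phase_le
  obtain ⟨C₂, hC₂, he₂⟩ := h.swap.norm_exp_phase_le
  obtain ⟨a, ha, ⟨A, hA, hab⟩, hav, -⟩ := exists_right_primitive hκ hαc hM.1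
    (fun x hx => by simp [hα, hM.2 x hx]) hC₁ he₁
  -- The component `w` has to be integrated from the left; reflecting the line reduces this to the
  -- same primitive.
  obtain ⟨c, hc, ⟨B, hB, hcb⟩, -, hcv⟩ := exists_right_primitive hκ (α := fun y => β (-y))
    (e := fun y => cexp (phase r F₂ (-y))) (hβc.comp continuous_neg) hM.1
    (fun x hx => by simp [hβ, hM.2 (-x) (by rwa [abs_neg])]) hC₂ (fun x => he₂ (-x))
  set v : ℝ → ℂ := fun x => cexp (κ * x) * cexp (phase q F₁ x) * a x with hv
  set w : ℝ → ℂ := fun x => cexp (κ * (-x : ℝ)) * cexp (phase r F₂ x) * c (-x) with hw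
  have hvd : ∀ x, HasDerivAt v ((κ + 2 * (q x * F₁ x)) * v x -
      (f₀ x + 2 * F₂ x * f₁ x) / (1 - 4 * F₁ x * F₂ x)) x := fun x => by
    have h1 : HasDerivAt (fun x : ℝ => cexp (κ * x)) (cexp (κ * x) * κ) x := by
      have := ((Complex.ofRealCLM.hasDerivAt (x := x)).const_mul (κ : ℂ)).cexp
      simpa using this
    refine ((h1.mul (h.hasDerivAt_phase x).cexp).mul (ha x)).congr_deriv ?_
    have e : cexp (κ * x) * cexp (phase q F₁ x) * cexp (-(κ * x + phase q F₁ x)) = 1 := by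
      rw [← Complex.exp_add, ← Complex.exp_add]; simp
    simp only [hv, hα, Pi.mul_apply]
    linear_combination -((f₀ x + 2 * F₂ x * f₁ x) / (1 - 4 * F₁ x * F₂ x)) * e
  have hwd : ∀ x, HasDerivAt w ((-κ + 2 * (r x * F₂ x)) * w x +
      (2 * F₁ x * f₀ x + f₁ x) / (1 - 4 * F₁ x * F₂ x)) x := fun x => by
    have h1 : HasDerivAt (fun x : ℝ => cexp (κ * (-x : ℝ))) (cexp (κ * (-x : ℝ)) * -κ) x := by
      have := (((Complex.ofRealCLM.hasDerivAt (x := x)).neg).const_mul (κ : ℂ)).cexp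
      simpa using this
    have h2 : HasDerivAt (fun x : ℝ => c (-x)) (β x) x := by
      have := (hc (-x)).scomp x (hasDerivAt_neg x)
      simpa [Function.comp_def] using this
    refine ((h1.mul (h.swap.hasDerivAt_phase x).cexp).mul h2).congr_deriv ?_
    have e : cexp (κ * (-x : ℝ)) * cexp (phase r F₂ x) * cexp (κ * x - phase r F₂ x) = 1 := by
      rw [← Complex.exp_add, ← Complex.exp_add]
      push_cast; ring_nf; simp
    simp only [hw, hβ, Pi.mul_apply]
    linear_combination ((2 * F₁ x * f₀ x + f₁ x) / (1 - 4 * F₁ x * F₂ x)) * e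
  have hvb : ∀ x, ‖v x‖ ≤ A * Real.exp (-(κ * |x|)) := hab
  have hwb : ∀ x, ‖w x‖ ≤ B * Real.exp (-(κ * |x|)) := fun x => by
    have := hcb (-x)
    rwa [abs_neg, neg_neg] at this
  have hvc : Continuous v := continuous_iff_continuousAt.mpr fun x => (hvd x).continuousAt
  have hwc : Continuous w := continuous_iff_continuousAt.mpr fun x => (hwd x).continuousAt
  have hvi : Integrable v := ((integrable_exp_neg_abs hκ).const_mul A).mono' hvc.aestronglyMeasurable
    (ae_of_all _ hvb)
  have hwi : Integrable w := ((integrable_exp_neg_abs hκ).const_mul B).mono' hwc.aestronglyMeasurable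
    (ae_of_all _ hwb)
  have hexp : ∀ x : ℝ, Real.exp (-(κ * |x|)) ≤ 1 := fun x =>
    Real.exp_le_one_iff.mpr (by have := mul_nonneg hκ.le (abs_nonneg x); linarith)
  have hvb' : ∀ x, ‖v x‖ ≤ A := fun x => (hvb x).trans (mul_le_of_le_one_right hA (hexp x))
  have hwb' : ∀ x, ‖w x‖ ≤ B := fun x => (hwb x).trans (mul_le_of_le_one_right hB (hexp x))
  -- The sources live on `[x₀, ∞)`, and `w` collects only what lies to the left of `x₀`. Hence the
  -- solution at `x₀` is determined by `v` alone and factorizes into a function of `x₀` and an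
  -- integral.
  have hw0 : w x₀ = 0 := by
    simp only [hw]
    rw [hcv (-x₀) (fun y hy => ?_), mul_zero]
    have hy' : -y < x₀ := by linarith
    simp [hβ, hs₀ (-y) hy', hs₁ (-y) hy']
  refine ⟨fun x => v x + 2 * (F₂ x * w x), fun x => 2 * (F₁ x * v x) + w x, ⟨?_, ?_, ?_, fun x => ?_,
    fun x => ?_⟩, ?_, ?_⟩
  · exact hvi.add ((hwi.bdd_mul (c := 1 / 4) hF₂.aestronglyMeasurable (ae_of_all _ h.le₂)).const_mul 2)
  · exact ((hvi.bdd_mul (c := 1 / 4) hF₁.aestronglyMeasurable (ae_of_all _ h.le₁)).const_mul 2).add hwi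
  · have key : ∀ F : ℝ → ℂ, (∀ x, ‖F x‖ ≤ 1 / 4) → ∀ (z : ℂ) x, ‖2 * (F x * z)‖ ≤ ‖z‖ := fun F hF z x => by
      rw [norm_mul, norm_mul]
      have h2 : ‖(2 : ℂ)‖ = 2 := by norm_num
      rw [h2]
      nlinarith [hF x, norm_nonneg z]
    refine ⟨A + B, fun x => ⟨?_, ?_⟩⟩
    · exact (norm_add_le _ _).trans (add_le_add (hvb' x) ((key F₂ h.le₂ _ x).trans (hwb' x)))
    · exact (norm_add_le _ _).trans (add_le_add ((key F₁ h.le₁ _ x).trans (hvb' x)) (hwb' x))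
  · refine ((hvd x).add (((h.ode₂ x).mul (hwd x)).const_mul 2)).congr_deriv ?_
    linear_combination (-f₀ x) * mul_inv_cancel₀ (h.ne_zero x)
  · refine ((((h.ode₁ x).mul (hvd x)).const_mul 2).add (hwd x)).congr_deriv ?_
    linear_combination f₁ x * mul_inv_cancel₀ (h.ne_zero x)
  · simp only [hw0, mul_zero, add_zero, hv]
    rw [hav x₀ (fun y hy => by simp [hα, hs₀ y hy, hs₁ y hy]), ← Complex.exp_add]
  · simp only [hw0, add_zero, hv]
    rw [hav x₀ (fun y hy => by simp [hα, hs₀ y hy, hs₁ y hy]), ← Complex.exp_add]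
    ring

/-- The values of the Green's function, on both half lines of the spectral parameter. -/
lemma RicPair.exists_green {κ : ℝ} {q r F₁ F₂ : ℝ → ℂ} (h : RicPair κ q r F₁ F₂) (hκ : 1 ≤ |κ|)
    (x₀ : ℝ) :
    ∃ (c : Fin 2 → ℂ) (m : Fin 2 → ℝ → ℂ), (∀ j, Continuous (m j)) ∧
      Real.sign κ * (c 0 * m 1 x₀) = 2 * F₂ x₀ / (1 - 4 * F₁ x₀ * F₂ x₀) ∧
      Real.sign κ * (c 1 * m 0 x₀) = 2 * F₁ x₀ / (1 - 4 * F₁ x₀ * F₂ x₀) ∧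
      Real.sign κ * (c 0 * m 0 x₀) = 4 * F₁ x₀ * F₂ x₀ / (1 - 4 * F₁ x₀ * F₂ x₀) +
        (if 0 < κ then 1 else 0) ∧
      Real.sign κ * (c 1 * m 1 x₀) = 4 * F₁ x₀ * F₂ x₀ / (1 - 4 * F₁ x₀ * F₂ x₀) +
        (if 0 < κ then 0 else 1) ∧
      ∀ f₀ f₁ : ℝ → ℂ, Continuous f₀ → Continuous f₁ → HasCompactSupport f₀ → HasCompactSupport f₁ →
        (∀ y < x₀, f₀ y = 0) → (∀ y < x₀, f₁ y = 0) →
        ∃ u : Fin 2 → ℝ → ℂ, IsSol κ q r f₀ f₁ (u 0) (u 1) ∧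
          ∀ i, u i x₀ = c i * ∫ y, (m 0 y * f₀ y + m 1 y * f₁ y) := by
  have hF₁ := h.cont₁
  have hF₂ := h.cont₂
  have hh0 := h.ne_zero x₀
  have hinv : cexp (κ * x₀ + phase q F₁ x₀) * cexp (-(κ * x₀ + phase q F₁ x₀)) = 1 := by
    rw [← Complex.exp_add]; simp
  -- For negative `κ` the same construction is applied to the exchanged pair, with the sources
  -- exchanged and negated.
  rcases lt_or_ge 0 κ with hpos | hneg
  · have hP := h.cont_phase
    set C := cexp (κ * x₀ + phase q F₁ x₀) with hC
    set e : ℝ → ℂ := fun y => cexp (-(κ * y + phase q F₁ y)) / (1 - 4 * F₁ y * F₂ y) with he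
    have hec : Continuous e := Continuous.div (by fun_prop) (by fun_prop) h.ne_zero
    have hCe : C * e x₀ = 1 / (1 - 4 * F₁ x₀ * F₂ x₀) := by
      simp only [he]; rw [mul_div_assoc', hinv]
    refine ⟨![C, 2 * F₁ x₀ * C], ![e, fun y => e y * (2 * F₂ y)], fun j => ?_, ?_, ?_, ?_, ?_,
      fun f₀ f₁ h₀ h₁ hc₀ hc₁ hs₀ hs₁ => ?_⟩
    · fin_cases j
      · exact hec
      · exact hec.mul (by fun_prop)
    · simp only [Real.sign_of_pos hpos, ofReal_one, Matrix.cons_val_zero, Matrix.cons_val_one]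
      linear_combination 2 * F₂ x₀ * hCe
    · simp only [Real.sign_of_pos hpos, ofReal_one, Matrix.cons_val_zero, Matrix.cons_val_one]
      linear_combination 2 * F₁ x₀ * hCe
    · simp only [Real.sign_of_pos hpos, ofReal_one, Matrix.cons_val_zero, if_pos hpos]
      linear_combination hCe + mul_inv_cancel₀ hh0
    · simp only [Real.sign_of_pos hpos, ofReal_one, Matrix.cons_val_one, Matrix.cons_val_zero, if_pos hpos]
      linear_combination 4 * F₁ x₀ * F₂ x₀ * hCe
    · obtain ⟨u₀, u₁, hu, e₀, e₁⟩ := h.exists_sol hpos h₀ h₁ hc₀ hc₁ hs₀ hs₁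
      refine ⟨![u₀, u₁], hu, fun i => ?_⟩
      have e3 : ∀ y, cexp (-(κ * y + phase q F₁ y)) / (1 - 4 * F₁ y * F₂ y) * (f₀ y + 2 * F₂ y * f₁ y) =
        e y * f₀ y + e y * (2 * F₂ y) * f₁ y := fun y => by simp only [he]; ring
      simp only [e3] at e₀ e₁
      fin_cases i
      · exact e₀
      · refine e₁.trans ?_
        simp [mul_assoc, hC]
  · have hκ' : κ ≠ 0 := by rintro rfl; norm_num at hκ
    have hneg : κ < 0 := lt_of_le_of_ne hneg hκ'
    have hpos : 0 < -κ := by linarith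
    have hP := h.swap.cont_phase
    have hinv : cexp ((-κ : ℝ) * x₀ + phase r F₂ x₀) * cexp (-((-κ : ℝ) * x₀ + phase r F₂ x₀)) = 1 := by
      rw [← Complex.exp_add]; simp
    set C := cexp ((-κ : ℝ) * x₀ + phase r F₂ x₀) with hC
    set e : ℝ → ℂ := fun y => cexp (-((-κ : ℝ) * y + phase r F₂ y)) / (1 - 4 * F₂ y * F₁ y) with he
    have hec : Continuous e := Continuous.div (by fun_prop) (by fun_prop) h.swap.ne_zero
    have hcomm : 1 - 4 * F₂ x₀ * F₁ x₀ = 1 - 4 * F₁ x₀ * F₂ x₀ := by ring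
    have hCe : C * e x₀ = 1 / (1 - 4 * F₁ x₀ * F₂ x₀) := by
      simp only [he]; rw [mul_div_assoc', hinv, hcomm]
    have hnp : ¬ 0 < κ := by linarith
    refine ⟨![2 * F₂ x₀ * C, C], ![fun y => -(e y * (2 * F₁ y)), fun y => -e y], fun j => ?_, ?_, ?_, ?_, ?_,
      fun f₀ f₁ h₀ h₁ hc₀ hc₁ hs₀ hs₁ => ?_⟩
    · fin_cases j
      · exact (hec.mul (by fun_prop)).neg
      · exact hec.neg
    · simp only [Real.sign_of_neg hneg, ofReal_neg, ofReal_one, Matrix.cons_val_zero, Matrix.cons_val_one]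
      linear_combination 2 * F₂ x₀ * hCe
    · simp only [Real.sign_of_neg hneg, ofReal_neg, ofReal_one, Matrix.cons_val_zero, Matrix.cons_val_one]
      linear_combination 2 * F₁ x₀ * hCe
    · simp only [Real.sign_of_neg hneg, ofReal_neg, ofReal_one, Matrix.cons_val_zero, if_neg hnp]
      linear_combination 4 * F₁ x₀ * F₂ x₀ * hCe
    · simp only [Real.sign_of_neg hneg, ofReal_neg, ofReal_one, Matrix.cons_val_one, Matrix.cons_val_zero, if_neg hnp]
      linear_combination hCe + mul_inv_cancel₀ hh0
    · obtain ⟨u₀, u₁, hu, e₀, e₁⟩ := h.swap.exists_sol hpos h₁.neg h₀.neg hc₁.neg hc₀.neg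
        (x₀ := x₀) (fun y hy => by simp [hs₁ y hy]) (fun y hy => by simp [hs₀ y hy])
      refine ⟨![u₁, u₀], hu.swap, fun i => ?_⟩
      have e3 : ∀ y, cexp (-((-κ : ℝ) * y + phase r F₂ y)) / (1 - 4 * F₂ y * F₁ y) *
        ((-f₁) y + 2 * F₁ y * (-f₀) y) =
        -(e y * (2 * F₁ y)) * f₀ y + -e y * f₁ y := fun y => by
          simp only [he, Pi.neg_apply]; ring
      simp only [e3] at e₀ e₁
      fin_cases i
      · refine e₁.trans ?_
        simp [mul_assoc, hC]
      · exact e₀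

/-! ### Fourier transforms of integrable functions -/

lemma ae_eq_of_forall_integral_schwartz {f g : ℝ → ℂ} (hf : LocallyIntegrable f)
    (hg : LocallyIntegrable g)
    (h : ∀ φ : 𝓢(ℝ, ℂ), HasCompactSupport φ → ∫ x, φ x * f x = ∫ x, φ x * g x) :
    f =ᵐ[volume] g := by
  refine ae_eq_of_integral_contDiff_smul_eq hf hg fun χ hχ hc => ?_
  have hs : tsupport (fun x => (χ x : ℂ)) ⊆ tsupport χ := closure_mono fun x hx => by simpa using hx
  have hc' : HasCompactSupport fun x => (χ x : ℂ) := hc.of_isClosed_subset isClosed_closure hs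
  exact h (hc'.toSchwartzMap (Complex.ofRealCLM.contDiff.comp hχ)) hc'

lemma continuous_fourier {f : ℝ → ℂ} (hf : Integrable f) : Continuous (𝓕 f) :=
  VectorFourier.fourierIntegral_continuous Real.continuous_fourierChar (by exact continuous_inner) hf

lemma locallyIntegrable_L2 (G : L2) : LocallyIntegrable G :=
  (Lp.memLp G).locallyIntegrable (by norm_num)

lemma fourier_L2_ae {G : L2} (hG : Integrable G) : (𝓕 G : L2) =ᵐ[volume] 𝓕 (G : ℝ → ℂ) := by
  refine ae_eq_of_forall_integral_schwartz (locallyIntegrable_L2 _)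
    (continuous_fourier hG).locallyIntegrable fun φ _ => ?_
  have h := congrArg (fun T : 𝓢'(ℝ, ℂ) => T φ) (Lp.fourier_toTemperedDistribution_eq G)
  simp only [TemperedDistribution.fourier_apply, Lp.toTemperedDistribution_apply, smul_eq_mul] at h
  rw [← h, ← integral_fourier_mul_flip φ.integrable hG]
  rfl

lemma fourier_schwartz_mul (q : 𝓢(ℝ, ℂ)) {u : ℝ → ℂ} (hu : Integrable u) (ξ : ℝ) :
    𝓕 (fun x => q x * u x) ξ = ∫ η, 𝓕 (q : ℝ → ℂ) (ξ - η) * 𝓕 u η := by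
  have hi : Integrable fun η => 𝓕 (q : ℝ → ℂ) (ξ - η) :=
    (integrable_fourier_schwartz q).comp_sub_left ξ
  have h := integral_fourier_mul_flip hu hi
  simp only [mul_comm (𝓕 u _)] at h
  rw [h, fourier_eq_integral_chr]
  refine integral_congr_ae (ae_of_all _ fun x => ?_)
  simp only
  have e : 𝓕 (fun η => 𝓕 (q : ℝ → ℂ) (ξ - η)) x = chr ξ x * q x := by
    rw [← fourierInv_fourier_schwartz q x, fourierInv_eq_integral_chr, fourier_eq_integral_chr,
      ← integral_sub_left_eq_self _ volume ξ, ← integral_const_mul]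
    refine integral_congr_ae (ae_of_all _ fun η => ?_)
    simp only [sub_sub_cancel, conj_chr]
    simp only [chr]
    rw [← mul_assoc, ← Complex.exp_add]
    congr 2; push_cast; ring
  rw [e]; ring

lemma schw_rep {b : ℝ} (hb : 0 ≤ b) (q : 𝓢(ℝ, ℂ)) :
    𝓕 (q : ℝ → ℂ) =ᵐ[volume] fun ξ => jw 1 b ξ * schw b q ξ := by
  filter_upwards [schw_ae hb q] with ξ h
  rw [h, ← mul_assoc, jw_mul_neg one_le_abs_one, one_mul]

/-! ### Identification of the resolvent -/

section
variable {b κ η : ℝ}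

lemma memLp_two_of_bdd {u : ℝ → ℂ} (hu : Integrable u) {C : ℝ} (hC : ∀ x, ‖u x‖ ≤ C) :
    MemLp u 2 (volume : Measure ℝ) := by
  rw [memLp_two_iff_integrable_sq_norm hu.1]
  have := hu.norm.mul_bdd (c := C) (hu.1.norm) (ae_of_all _ fun x => by simpa using hC x)
  simpa [sq] using this

lemma exists_fourier_repr {v : ℝ → ℂ} (hv : Integrable v) {C : ℝ} (hC : ∀ x, ‖v x‖ ≤ C) :
    ∃ G : L2, G =ᵐ[volume] 𝓕 v := by
  have hm := memLp_two_of_bdd hv hC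
  refine ⟨𝓕 (hm.toLp v : L2), ?_⟩
  have h2 := fourier_L2_ae (G := hm.toLp v) ((integrable_congr hm.coeFn_toLp).mpr hv)
  have h3 : 𝓕 ((hm.toLp v : L2) : ℝ → ℂ) = 𝓕 v := by
    funext ξ; exact Real.fourier_congr_ae hm.coeFn_toLp ξ
  rwa [h3] at h2

/-- Formally `w` is `(√R₀)⁻¹ u` on the Fourier side. It is square integrable because the products of
Schwartz potentials and bounded solutions are, and dividing the transformed equations by the symbols
turns the system into `(1 + √R₀ (L - L₀) √R₀) w = √R₀ f`. -/
lemma IsSol.exists_fourier {q r f₀ f₁ : 𝓢(ℝ, ℂ)} {u₀ u₁ : ℝ → ℂ} (h : IsSol κ q r f₀ f₁ u₀ u₁)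
    (hb0 : 0 ≤ b) (hb : b < 1 / 2) (hκ : 1 ≤ |κ|) :
    ∃ w₀ w₁ : L2, 𝓕 u₀ =ᵐ[volume] (fun ξ => sqrtSym κ (-1) ξ * w₀ ξ) ∧
      𝓕 u₁ =ᵐ[volume] (fun ξ => sqrtSym κ 1 ξ * w₁ ξ) ∧
      w₀ + opL b κ 1 (schw b q) w₁ = mulOp (sqrtSym κ (-1)) (𝓕 (f₀.toLp 2 : L2)) ∧
      w₁ - opL b κ (-1) (schw b r) w₀ = mulOp (sqrtSym κ 1) (𝓕 (f₁.toLp 2 : L2)) := by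
  obtain ⟨C, hC⟩ := h.bdd
  have hm₀ : MemLp (sqrtSym κ (-1)) ∞ (volume : Measure ℝ) := memLp_sqrtSym hκ (Or.inr rfl)
  have hm₁ : MemLp (sqrtSym κ 1) ∞ (volume : Measure ℝ) := memLp_sqrtSym hκ (Or.inl rfl)
  have hc₀ : Continuous u₀ := continuous_iff_continuousAt.mpr fun x => (h.deriv₀ x).continuousAt
  have hc₁ : Continuous u₁ := continuous_iff_continuousAt.mpr fun x => (h.deriv₁ x).continuousAt
  have hbd : ∀ (s : 𝓢(ℝ, ℂ)) (u : ℝ → ℂ), (∀ x, ‖u x‖ ≤ C) → ∃ C', ∀ x, ‖s x * u x‖ ≤ C' := fun s u hu => by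
    obtain ⟨A, hA0, hA⟩ := s.decay 0 0
    refine ⟨A * C, fun x => ?_⟩
    rw [norm_mul]
    have h1 : ‖s x‖ ≤ A := by simpa using hA x
    exact mul_le_mul h1 (hu x) (norm_nonneg _) hA0.le
  have hq1 := integrable_schwartz_mul q hc₁ fun x => (hC x).2
  have hr0 := integrable_schwartz_mul r hc₀ fun x => (hC x).1
  obtain ⟨Cq, hCq⟩ := hbd q u₁ fun x => (hC x).2
  obtain ⟨Cr, hCr⟩ := hbd r u₀ fun x => (hC x).1
  obtain ⟨Gq, hGq⟩ := exists_fourier_repr hq1 hCq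
  obtain ⟨Gr, hGr⟩ := exists_fourier_repr hr0 hCr
  have lin : ∀ (c : ℂ) (u v f : ℝ → ℂ), Integrable u → Integrable v → Integrable f → ∀ ξ,
      𝓕 (fun x => c * u x + v x + f x) ξ = c * 𝓕 u ξ + 𝓕 v ξ + 𝓕 f ξ := fun c u v f hu hv hf ξ => by
    have hi : ∀ {w : ℝ → ℂ}, Integrable w → Integrable fun x => chr ξ x * w x := fun hw =>
      hw.bdd_mul (c := 1) (continuous_chr ξ).aestronglyMeasurable (ae_of_all _ fun x => (norm_chr ξ x).le)
    simp only [fourier_eq_integral_chr]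
    have hs := integral_add (((hi hu).const_mul c).add (hi hv)) (hi hf)
    simp only [Pi.add_apply] at hs
    rw [← integral_const_mul, ← integral_add ((hi hu).const_mul c) (hi hv), ← hs]
    refine integral_congr_ae (ae_of_all _ fun x => ?_)
    simp only; ring
  have d₀ : deriv u₀ = fun x => κ * u₀ x + q x * u₁ x + (-f₀) x := by
    funext x; rw [(h.deriv₀ x).deriv]; simp [sub_eq_add_neg]
  have d₁ : deriv u₁ = fun x => -κ * u₁ x + r x * u₀ x + f₁ x := by
    funext x; rw [(h.deriv₁ x).deriv]
  have i₀ : Integrable (deriv u₀) := by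
    rw [d₀]; exact ((h.int₀.const_mul _).add hq1).add (-f₀).integrable
  have i₁ : Integrable (deriv u₁) := by
    rw [d₁]; exact ((h.int₁.const_mul _).add hr0).add f₁.integrable
  have k₀ := Real.fourier_deriv h.int₀ (fun x => (h.deriv₀ x).differentiableAt) i₀
  have k₁ := Real.fourier_deriv h.int₁ (fun x => (h.deriv₁ x).differentiableAt) i₁
  have e₀ : ∀ ξ, 𝓕 u₀ ξ = sqrtSym κ (-1) ξ * (sqrtSym κ (-1) ξ *
      (𝓕 (f₀ : ℝ → ℂ) ξ - 𝓕 (fun x => q x * u₁ x) ξ)) := fun ξ => by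
    have h1 := congrFun k₀ ξ
    rw [d₀, lin κ u₀ _ _ h.int₀ hq1 (-f₀).integrable] at h1
    have hneg : 𝓕 ((-f₀ : 𝓢(ℝ, ℂ)) : ℝ → ℂ) ξ = -𝓕 (f₀ : ℝ → ℂ) ξ := by
      simp only [fourier_eq_integral_chr]; rw [← integral_neg]
      simp
    rw [hneg, smul_eq_mul] at h1
    have h2 := sqrtSym_mul_self (ε := -1) hκ ξ
    push_cast at h2
    linear_combination -𝓕 u₀ ξ * h2 + (sqrtSym κ (-1) ξ * sqrtSym κ (-1) ξ) * h1
  have e₁ : ∀ ξ, 𝓕 u₁ ξ = sqrtSym κ 1 ξ * (sqrtSym κ 1 ξ *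
      (𝓕 (f₁ : ℝ → ℂ) ξ + 𝓕 (fun x => r x * u₀ x) ξ)) := fun ξ => by
    have h1 := congrFun k₁ ξ
    rw [d₁] at h1
    have hl := lin (-κ) u₁ _ _ h.int₁ hr0 f₁.integrable ξ
    rw [hl, smul_eq_mul] at h1
    have h2 := sqrtSym_mul_self (ε := 1) hκ ξ
    push_cast at h2
    linear_combination -𝓕 u₁ ξ * h2 - (sqrtSym κ 1 ξ * sqrtSym κ 1 ξ) * h1
  set w₀ : L2 := mulOp (sqrtSym κ (-1)) (𝓕 (f₀.toLp 2 : L2) - Gq) with hw₀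
  set w₁ : L2 := mulOp (sqrtSym κ 1) (𝓕 (f₁.toLp 2 : L2) + Gr) with hw₁
  have hu₀ : 𝓕 u₀ =ᵐ[volume] (fun ξ => sqrtSym κ (-1) ξ * w₀ ξ) := by
    filter_upwards [mulOp_ae hm₀ (𝓕 (f₀.toLp 2 : L2) - Gq), Lp.coeFn_sub (𝓕 (f₀.toLp 2 : L2)) Gq, hGq,
      fourier_toLp_ae f₀] with ξ h1 h2 h3 h4
    rw [h1, h2, Pi.sub_apply, h3, h4, ← e₀]
  have hu₁ : 𝓕 u₁ =ᵐ[volume] (fun ξ => sqrtSym κ 1 ξ * w₁ ξ) := by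
    filter_upwards [mulOp_ae hm₁ (𝓕 (f₁.toLp 2 : L2) + Gr), Lp.coeFn_add (𝓕 (f₁.toLp 2 : L2)) Gr, hGr,
      fourier_toLp_ae f₁] with ξ h1 h2 h3 h4
    rw [h1, h2, Pi.add_apply, h3, h4, ← e₁]
  have hL : opL b κ 1 (schw b q) w₁ = mulOp (sqrtSym κ (-1)) Gq := by
    apply Lp.ext
    filter_upwards [opL_ae hb0 hb hκ (Or.inl rfl) (schw_rep hb0 q) w₁, mulOp_ae hm₀ Gq, hGq] with ξ h1 h2 h3
    rw [h1, h2, h3, fourier_schwartz_mul q h.int₁]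
    congr 1
    refine integral_congr_ae ?_
    filter_upwards [hu₁] with η h5
    rw [h5]
  have hG : opL b κ (-1) (schw b r) w₀ = mulOp (sqrtSym κ 1) Gr := by
    apply Lp.ext
    filter_upwards [opL_ae hb0 hb hκ (Or.inr rfl) (schw_rep hb0 r) w₀, mulOp_ae hm₁ Gr, hGr] with ξ h1 h2 h3
    rw [h1, h2, h3, fourier_schwartz_mul r h.int₀, neg_neg]
    congr 1
    refine integral_congr_ae ?_
    filter_upwards [hu₀] with η h5
    rw [h5]
  refine ⟨w₀, w₁, hu₀, hu₁, ?_, ?_⟩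
  · rw [hL, hw₀, map_sub, sub_add_cancel]
  · rw [hG, hw₁, map_add, add_sub_cancel_right]

/-- The system is inverted with `invCore`; subtracting the source leaves the part `W N W` of the
inverse. -/
lemma Adm.solve_core (h : Adm b η) (hκ : 1 ≤ |κ|) {p R : L2} (hp : ‖p‖ ≤ η) (hR : ‖R‖ ≤ η)
    {w₀ w₁ a₀ a₁ : L2} (e₀ : w₀ + opL b κ 1 p w₁ = a₀) (e₁ : w₁ - opL b κ (-1) R w₀ = a₁) :
    ∀ i, ![w₀, w₁] i - ![a₀, a₁] i =
      opW b (opN b κ p R i 0 (opW b a₀) + opN b κ p R i 1 (opW b a₁)) := by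
  have h1 := h.opD_mul hκ hp hR
  have hs := fun i j => h.invCore_sub_one hκ hp hR i j
  have hw₀ : w₀ = opD b κ p R a₀ - opD b κ p R (opL b κ 1 p a₁) := by
    rw [← e₀, ← e₁]
    have h2 := congrArg (fun T : L2 →L[ℂ] L2 => T w₀) h1
    change opD b κ p R w₀ + opD b κ p R (opL b κ 1 p (opL b κ (-1) R w₀)) = w₀ at h2
    simp only [map_add, map_sub]
    rw [← sub_eq_zero]
    nth_rewrite 1 [← h2]
    abel
  have hw₁ : w₁ = a₁ + opL b κ (-1) R w₀ := by rw [← e₁]; abel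
  have key : ∀ (i j) (a : L2), opW b (opN b κ p R i j (opW b a)) = (invCore b κ p R - 1) i j a :=
    fun i j a => by rw [hs i j]; rfl
  intro i
  rw [map_add, key, key]
  fin_cases i
  · change w₀ - a₀ = opD b κ p R a₀ - a₀ + (-(opD b κ p R (opL b κ 1 p a₁)) - 0)
    rw [hw₀]; abel
  · change w₁ - a₁ = opL b κ (-1) R (opD b κ p R a₀) - 0 +
      (a₁ - opL b κ (-1) R (opD b κ p R (opL b κ 1 p a₁)) - a₁)
    rw [hw₁, hw₀, map_sub]; abel

lemma schw_zero (b : ℝ) : schw b 0 = 0 := map_zero _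

lemma opL_zero (b κ ε : ℝ) : opL b κ ε 0 = 0 := by
  have := opL_smul (b := b) (κ := κ) (ε := ε) 0 0
  simpa using this

/-- The solutions of the inhomogeneous equation are given by the kernel. -/
lemma Adm.sol_sub_eq (h : Adm b η) (hκ : 1 ≤ |κ|) {q r f₀ f₁ : 𝓢(ℝ, ℂ)} (hq : ‖schw b q‖ ≤ η)
    (hr : ‖schw b r‖ ≤ η) {u v : Fin 2 → ℝ → ℂ} (hu : IsSol κ q r f₀ f₁ (u 0) (u 1))
    (hv : IsSol κ 0 0 f₀ f₁ (v 0) (v 1)) (i : Fin 2) (x : ℝ) :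
    u i x - v i x = (∫ y, grK b κ (schw b q) (schw b r) x y i 0 * f₀ y) +
      ∫ y, grK b κ (schw b q) (schw b r) x y i 1 * f₁ y := by
  set p := schw b q
  set R := schw b r
  obtain ⟨w₀, w₁, hu₀, hu₁, e₀, e₁⟩ := hu.exists_fourier h.hb0.le h.hb hκ
  -- For zero potentials `Λ` and `Γ` vanish, so the free solution is represented by the sources
  -- themselves and its subtraction is exactly the subtraction of `R₀`.
  obtain ⟨z₀, z₁, hv₀, hv₁, g₀, g₁⟩ := IsSol.exists_fourier (b := b) (q := 0) (r := 0) hv h.hb0.le h.hb hκ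
  rw [schw_zero, opL_zero, zero_apply, add_zero] at g₀
  rw [schw_zero, opL_zero, zero_apply, sub_zero] at g₁
  have hsol := h.solve_core hκ hq hr e₀ e₁
  have hin : ∀ i, Integrable (u i) ∧ Integrable (v i) ∧ Continuous (u i) ∧ Continuous (v i) := fun i => by
    fin_cases i
    · exact ⟨hu.int₀, hv.int₀, continuous_iff_continuousAt.mpr fun x => (hu.deriv₀ x).continuousAt,
        continuous_iff_continuousAt.mpr fun x => (hv.deriv₀ x).continuousAt⟩
    · exact ⟨hu.int₁, hv.int₁, continuous_iff_continuousAt.mpr fun x => (hu.deriv₁ x).continuousAt,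
        continuous_iff_continuousAt.mpr fun x => (hv.deriv₁ x).continuousAt⟩
  have hF : ∀ i, 𝓕 (u i) =ᵐ[volume] (fun ξ => sqrtSym κ (sgn2 i) ξ * (![w₀, w₁] i : L2) ξ) ∧
      𝓕 (v i) =ᵐ[volume] (fun ξ => sqrtSym κ (sgn2 i) ξ *
        (![mulOp (sqrtSym κ (-1)) (𝓕 (f₀.toLp 2 : L2)), mulOp (sqrtSym κ 1) (𝓕 (f₁.toLp 2 : L2))] i : L2) ξ) :=
    fun i => by
      rw [← g₀, ← g₁]
      fin_cases i
      · simpa [sgn2] using ⟨hu₀, hv₀⟩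
      · simpa [sgn2] using ⟨hu₁, hv₁⟩
  set a₀ := mulOp (sqrtSym κ (-1)) (𝓕 (f₀.toLp 2 : L2)) with ha₀
  set a₁ := mulOp (sqrtSym κ 1) (𝓕 (f₁.toLp 2 : L2)) with ha₁
  have hW₀ : opN b κ p R i 0 (opW b a₀) = resH b κ p R i 0 f₀ := by
    rw [resH, ← opW_mulOp_sqrtSym h.hb hκ]; simp [sgn2, ha₀]
  have hW₁ : opN b κ p R i 1 (opW b a₁) = resH b κ p R i 1 f₁ := by
    rw [resH, ← opW_mulOp_sqrtSym h.hb hκ]; simp [sgn2, ha₁]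
  have hs := hsol i
  rw [hW₀, hW₁] at hs
  have hd : 𝓕 (fun x => u i x - v i x) =ᵐ[volume] fun ξ => um b κ i ξ * resH b κ p R i 0 f₀ ξ +
      um b κ i ξ * resH b κ p R i 1 f₁ ξ := by
    have hsub : ∀ ξ, 𝓕 (fun x => u i x - v i x) ξ = 𝓕 (u i) ξ - 𝓕 (v i) ξ := fun ξ => by
      have hi : ∀ {w : ℝ → ℂ}, Integrable w → Integrable fun x => chr ξ x * w x := fun hw =>
        hw.bdd_mul (c := 1) (continuous_chr ξ).aestronglyMeasurable (ae_of_all _ fun x => (norm_chr ξ x).le)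
      simp only [fourier_eq_integral_chr]
      rw [← integral_sub (hi (hin i).1) (hi (hin i).2.1)]
      simp only [mul_sub]
    have h5 : ((![w₀, w₁] i - ![a₀, a₁] i : L2) : ℝ → ℂ) =ᵐ[volume]
        fun ξ => jw 1 (-th b) ξ * (resH b κ p R i 0 f₀ + resH b κ p R i 1 f₁ : L2) ξ := by
      rw [hs]
      exact mulOp_ae (memLp_jw_top (κ := 1) (th_nonneg h.hb) one_le_abs_one) _
    filter_upwards [(hF i).1, (hF i).2, h5, Lp.coeFn_sub (![w₀, w₁] i : L2) (![a₀, a₁] i : L2),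
      Lp.coeFn_add (resH b κ p R i 0 f₀) (resH b κ p R i 1 f₁)] with ξ h1 h2 h3 h4 h6
    rw [hsub, h1, h2, ← mul_sub]
    rw [h4, Pi.sub_apply, h6, Pi.add_apply] at h3
    rw [h3, um]; ring
  have i0 := integrable_um_mul h.hb hκ i (resH b κ p R i 0 f₀)
  have i1 := integrable_um_mul h.hb hκ i (resH b κ p R i 1 f₁)
  have hdi : Integrable (𝓕 fun x => u i x - v i x) := (integrable_congr hd).mpr (i0.add i1)
  have hinv := ((hin i).2.2.1.sub (hin i).2.2.2).fourierInv_fourier_eq ((hin i).1.sub (hin i).2.1) hdi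
  have h6 := congrFun hinv x
  change 𝓕⁻ (𝓕 fun x => u i x - v i x) x = u i x - v i x at h6
  rw [← h6, Real.fourierInv_congr_ae hd x, ← inner_vV_resH h.hb hκ, ← inner_vV_resH h.hb hκ]
  simp only [fourierInv_eq_integral_chr]
  have hi : ∀ {w : ℝ → ℂ}, Integrable w → Integrable fun ξ => conj (chr x ξ) * w ξ := fun hw =>
    hw.bdd_mul (c := 1) (Complex.continuous_conj.comp (continuous_chr x)).aestronglyMeasurable
      (ae_of_all _ fun ξ => by simp [norm_chr])
  rw [← integral_add (hi i0) (hi i1)]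
  simp only [mul_add]

lemma continuous_grK_apply (b κ : ℝ) (p R : L2) (x : ℝ) (i j : Fin 2) :
    Continuous fun y => grK b κ p R x y i j := by
  change Continuous fun y =>
    inner ℂ (mulOp (chr x) (vV b κ i)) (opN b κ p R i j (mulOp (chr y) (uV b κ j)))
  exact continuous_const.inner ((opN b κ p R i j).continuous.comp (continuous_mulOp_chr _))

/-- Test functions to the right of `x` suffice, since all functions involved are continuous up to
the endpoint. This is how diagonal values are read off although each Green's function separately may
jump there. -/
lemma eq_of_forall_integral_Ioi {k m m' : ℝ → ℂ} (hk : Continuous k) (hm : Continuous m)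
    (hm' : Continuous m') {c c' : ℂ} {x : ℝ}
    (h : ∀ ψ : 𝓢(ℝ, ℂ), HasCompactSupport ψ → (∀ y < x, ψ y = 0) →
      ∫ y, k y * ψ y = c * (∫ y, m y * ψ y) - c' * ∫ y, m' y * ψ y) :
    k x = c * m x - c' * m' x := by
  have hDc : Continuous fun y => k y - (c * m y - c' * m' y) := by fun_prop
  have hD := eq_zero_of_forall_integral_mul (U := Set.Ioi x) isOpen_Ioi hDc (fun ψ hψ hs => ?_) x
    (by rw [closure_Ioi]; exact Set.mem_Ici.mpr le_rfl)
  · exact sub_eq_zero.mp hD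
  · have hz : ∀ y < x, ψ y = 0 := fun y hy => by
      by_contra hne
      have := hs (subset_tsupport _ hne)
      exact absurd (Set.mem_Ioi.mp this) (by linarith)
    have hi : ∀ {f : ℝ → ℂ}, Continuous f → Integrable fun y => f y * ψ y := fun hf =>
      (hf.mul ψ.continuous).integrable_of_hasCompactSupport hψ.mul_left
    have e : ∀ y, ψ y * (k y - (c * m y - c' * m' y)) =
      k y * ψ y - (c * (m y * ψ y) - c' * (m' y * ψ y)) := fun y => by ring
    simp only [e]
    rw [integral_sub (g := fun y => c * (m y * ψ y) - c' * (m' y * ψ y)) (hi hk)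
        (((hi hm).const_mul _).sub ((hi hm').const_mul _)), integral_sub ((hi hm).const_mul _) ((hi hm').const_mul _), integral_const_mul,
      integral_const_mul, sub_eq_zero]
    exact h ψ hψ hz

/-- The Riccati equations hold for Schwartz functions. -/
lemma Adm.ricPair (h : Adm b η) (hκ : 1 ≤ |κ|) {q r : 𝓢(ℝ, ℂ)} (hq : ‖schw b q‖ ≤ η)
    (hr : ‖schw b r‖ ≤ η) :
    RicPair κ q r (ricF b κ η (schw b q) (schw b r)) (ricF b (-κ) η (schw b r) (schw b q)) where
  contq := q.continuous
  contr := r.continuous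
  intq := q.integrable
  intr := r.integrable
  ode₁ x := h.hasDerivAt_ricF hκ hq hr x
  ode₂ x := (h.hasDerivAt_ricF (κ := -κ) (by rwa [abs_neg]) hr hq x).congr_deriv (by push_cast; ring)
  le₁ x := h.norm_ricF_le hκ hq hr x
  le₂ x := h.norm_ricF_le (by rwa [abs_neg]) hr hq x

/-- The diagonal Green's functions of Schwartz potentials. -/
lemma Adm.grK_diag_schwartz (h : Adm b η) (hκ : 1 ≤ |κ|) {q r : 𝓢(ℝ, ℂ)} (hq : ‖schw b q‖ ≤ η)
    (hr : ‖schw b r‖ ≤ η) (x : ℝ) :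
    let F₁ := ricF b κ η (schw b q) (schw b r) x
    let F₂ := ricF b (-κ) η (schw b r) (schw b q) x
    let K := grK b κ (schw b q) (schw b r) x x
    Real.sign κ * K 0 1 = 2 * F₂ / (1 - 4 * F₁ * F₂) ∧ Real.sign κ * K 1 0 = 2 * F₁ / (1 - 4 * F₁ * F₂) ∧
    Real.sign κ * K 0 0 = 4 * F₁ * F₂ / (1 - 4 * F₁ * F₂) ∧
    Real.sign κ * K 1 1 = 4 * F₁ * F₂ / (1 - 4 * F₁ * F₂) := by
  intro F₁ F₂ K
  obtain ⟨c, m, hm, v01, v10, v00, v11, hsol⟩ := (h.ricPair hκ hq hr).exists_green hκ x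
  obtain ⟨c', m', hm', w01, w10, w00, w11, hsol'⟩ := (RicPair.zero κ).exists_green hκ x
  have key : ∀ i j, K i j = c i * m j x - c' i * m' j x := fun i j => by
    have hKc : Continuous fun y => grK b κ (schw b q) (schw b r) x y i j :=
      continuous_grK_apply b κ _ _ x i j
    refine eq_of_forall_integral_Ioi hKc (hm j) (hm' j) fun ψ hψ hz => ?_
    · have hc0 : HasCompactSupport (0 : ℝ → ℂ) := HasCompactSupport.zero
      fin_cases j
      · obtain ⟨u, hu, eu⟩ := hsol ψ 0 ψ.continuous continuous_const hψ hc0 hz (fun _ _ => rfl)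
        obtain ⟨v, hv, ev⟩ := hsol' ψ 0 ψ.continuous continuous_const hψ hc0 hz (fun _ _ => rfl)
        have := h.sol_sub_eq hκ (f₁ := 0) hq hr hu hv i x
        rw [eu, ev] at this
        simp at this
        exact this.symm
      · obtain ⟨u, hu, eu⟩ := hsol 0 ψ continuous_const ψ.continuous hc0 hψ (fun _ _ => rfl) hz
        obtain ⟨v, hv, ev⟩ := hsol' 0 ψ continuous_const ψ.continuous hc0 hψ (fun _ _ => rfl) hz
        have := h.sol_sub_eq hκ (f₀ := 0) hq hr hu hv i x
        rw [eu, ev] at this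
        simp at this
        exact this.symm
  -- For the free pair only the one-sided jump terms `if 0 < κ` are left; they are the same with and
  -- without potentials and cancel in the differences below.
  simp only [Pi.zero_apply, mul_zero, sub_zero, zero_div, zero_add] at w01 w10 w00 w11
  refine ⟨?_, ?_, ?_, ?_⟩
  · rw [key]; linear_combination v01 - w01
  · rw [key]; linear_combination v10 - w10
  · rw [key]; linear_combination v00 - w00
  · rw [key]; linear_combination v11 - w11

end

/-! ### Reflection and the bilinear pairing -/

lemma ae_comp_neg {P : ℝ → Prop} (h : ∀ᵐ x : ℝ, P x) : ∀ᵐ x : ℝ, P (-x) := by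
  simpa using ae_comp_sub h 0

lemma memLp_reflC (f : L2) : MemLp (fun ξ => conj (f (-ξ))) 2 (volume : Measure ℝ) :=
  ((Lp.memLp f).comp_measurePreserving (Measure.measurePreserving_neg volume)).star

/-- The operation `f ↦ conj (f (- ·))`, which is complex conjugation on the Fourier side. -/
def reflC : L2 →ₗᵢ[ℝ] L2 where
  toFun f := (memLp_reflC f).toLp
  map_add' f g := by
    apply Lp.ext
    filter_upwards [(memLp_reflC (f + g)).coeFn_toLp, (memLp_reflC f).coeFn_toLp,
      (memLp_reflC g).coeFn_toLp, ae_comp_neg (Lp.coeFn_add f g),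
      Lp.coeFn_add (memLp_reflC f).toLp (memLp_reflC g).toLp] with ξ h1 h2 h3 h4 h5
    rw [h1, h5, Pi.add_apply, h2, h3, h4, Pi.add_apply, map_add]
  map_smul' c f := by
    apply Lp.ext
    filter_upwards [(memLp_reflC (c • f)).coeFn_toLp, (memLp_reflC f).coeFn_toLp,
      ae_comp_neg (Lp.coeFn_smul c f), Lp.coeFn_smul c (memLp_reflC f).toLp] with ξ h1 h2 h3 h4
    simp only [RingHom.id_apply]
    rw [h1, h4, Pi.smul_apply, h2, h3, Pi.smul_apply, real_smul, real_smul, map_mul, conj_ofReal]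
  norm_map' f := by
    change ‖(memLp_reflC f).toLp‖ = ‖f‖
    rw [Lp.norm_toLp, Lp.norm_def]
    congr 1
    have h := eLpNorm_comp_measurePreserving (Lp.memLp f).1 (Measure.measurePreserving_neg (volume : Measure ℝ))
      (p := 2)
    rw [← h]
    refine eLpNorm_congr_norm_ae (ae_of_all _ fun ξ => ?_)
    simp

lemma reflC_ae (f : L2) : (reflC f : L2) =ᵐ[volume] fun ξ => conj (f (-ξ)) :=
  (memLp_reflC f).coeFn_toLp

/-- The weight of the pairing. -/
def pw (b κ ξ : ℝ) : ℂ := jw 1 b ξ * jw κ (-(1 - b)) ξ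

lemma norm_pw_le {b κ : ℝ} (hb0 : 0 ≤ b) (hb : b < 1 / 2) (hκ : 1 ≤ |κ|) (ξ : ℝ) : ‖pw b κ ξ‖ ≤ 1 := by
  rw [pw, norm_mul, norm_jw, norm_jw, Real.rpow_neg (jb_nonneg _ _), ← div_eq_mul_inv]
  refine div_le_one_of_le₀ ?_ (Real.rpow_nonneg (jb_nonneg _ _) _)
  exact (Real.rpow_le_rpow (jb_nonneg _ _) (jb_one_le hκ ξ) hb0).trans
    (Real.rpow_le_rpow_of_exponent_le (one_le_jb hκ ξ) (by linarith))

lemma memLp_pw {b κ : ℝ} (hb0 : 0 ≤ b) (hb : b < 1 / 2) (hκ : 1 ≤ |κ|) :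
    MemLp (pw b κ) ∞ (volume : Measure ℝ) :=
  memLp_top_of_measurable (by unfold pw; fun_prop) (norm_pw_le hb0 hb hκ)

/-- The pairing of the distribution with weighted Fourier transform `p` and the function `evF b κ f`. -/
def pairF (b κ : ℝ) (p f : L2) : ℂ := inner ℂ (reflC (mulOp (pw b κ) f)) p

section
variable {b κ : ℝ}

lemma pairF_eq (hb0 : 0 ≤ b) (hb : b < 1 / 2) (hκ : 1 ≤ |κ|) (p f : L2) :
    pairF b κ p f = ∫ ξ, jw 1 b ξ * p ξ * (jw κ (-(1 - b)) (-ξ) * f (-ξ)) := by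
  rw [pairF, inner_L2]
  refine integral_congr_ae ?_
  filter_upwards [reflC_ae (mulOp (pw b κ) f), ae_comp_neg (mulOp_ae (memLp_pw hb0 hb hκ) f)] with ξ h1 h2
  rw [h1, h2, conj_conj, pw, jw_neg]; ring

lemma tendsto_pairF {α : Type*} {l : Filter α} {p f : α → L2} {p₀ f₀ : L2} (hp : Tendsto p l (𝓝 p₀))
    (hf : Tendsto f l (𝓝 f₀)) : Tendsto (fun t => pairF b κ (p t) (f t)) l (𝓝 (pairF b κ p₀ f₀)) :=
  ((reflC.continuous.tendsto _).comp (((mulOp (pw b κ)).continuous.tendsto _).comp hf)).inner hp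

lemma hasDerivAt_pairF {p f : ℝ → L2} {p' f' : L2} {t : ℝ} (hp : HasDerivAt p p' t)
    (hf : HasDerivAt f f' t) :
    HasDerivAt (fun τ => pairF b κ (p τ) (f τ)) (pairF b κ p' (f t) + pairF b κ (p t) f') t := by
  have h1 := hasDerivAt_clm (mulOp (pw b κ)) hf
  have h2 : HasDerivAt (fun τ => reflC (mulOp (pw b κ) (f τ))) (reflC (mulOp (pw b κ) f')) t :=
    reflC.toContinuousLinearMap.hasFDerivAt.comp_hasDerivAt t h1
  exact h2.inner ℂ hp

lemma pairF_schw (hb0 : 0 ≤ b) (hb : b < 1 / 2) (hκ : 1 ≤ |κ|) (q : 𝓢(ℝ, ℂ)) (f : L2) :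
    pairF b κ (schw b q) f = ∫ x, q x * evF b κ f x := by
  have hf := integrable_evF hb hκ f
  have h := integral_fourierInv_mul_flip q.integrable hf
  change _ = ∫ x, q x * 𝓕⁻ (fun ξ => jw κ (-(1 - b)) ξ * f ξ) x
  rw [← h, pairF_eq hb0 hb hκ, ← integral_neg_eq_self (fun ξ => 𝓕⁻ (q : ℝ → ℂ) ξ * _)]
  refine integral_congr_ae ?_
  filter_upwards [schw_rep hb0 q] with ξ h1
  rw [← h1, Real.fourierInv_eq_fourier_neg, neg_neg]

end

/-! ### The trace formula -/

section
variable {b κ η : ℝ}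

lemma fourier_mul_fourierInv (q : 𝓢(ℝ, ℂ)) {h : ℝ → ℂ} (hh : Integrable h) (ξ : ℝ) :
    ∫ η, 𝓕 (q : ℝ → ℂ) (ξ - η) * h η = 𝓕 (fun x => q x * 𝓕⁻ h x) ξ := by
  have hi : Integrable fun x => chr ξ x * q x :=
    q.integrable.bdd_mul (c := 1) (continuous_chr ξ).aestronglyMeasurable
      (ae_of_all _ fun x => (norm_chr ξ x).le)
  have e : ∀ η, 𝓕 (q : ℝ → ℂ) (ξ - η) = 𝓕⁻ (fun x => chr ξ x * q x) η := fun η => by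
    rw [fourier_eq_integral_chr, fourierInv_eq_integral_chr]
    refine integral_congr_ae (ae_of_all _ fun x => ?_)
    simp only [conj_chr]
    simp only [chr]
    rw [← mul_assoc, ← Complex.exp_add]
    congr 2; push_cast; ring
  simp only [e]
  rw [integral_fourierInv_mul_flip hi hh, fourier_eq_integral_chr]
  simp only [mul_assoc]

lemma continuous_fourierInv {f : ℝ → ℂ} (hf : Integrable f) : Continuous (𝓕⁻ f) := by
  rw [Real.fourierInv_eq_fourier_comp_neg]; exact continuous_fourier hf.comp_neg

lemma inner_opW_left (hb : b < 1 / 2) (f g : L2) : inner ℂ f (opW b g) = inner ℂ (opW b f) g := by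
  rw [inner_L2, inner_L2]
  have hW := memLp_jw_top (κ := 1) (th_nonneg hb) one_le_abs_one
  refine integral_congr_ae ?_
  filter_upwards [mulOp_ae hW f, mulOp_ae hW g] with ξ h1 h2
  change _ * (mulOp (jw 1 (-th b)) g : L2) ξ = conj ((mulOp (jw 1 (-th b)) f : L2) ξ) * _
  rw [h1, h2, map_mul, jw, conj_ofReal]; ring

/-- Superposition of rank one operators. -/
lemma inner_opL_eq (hb0 : 0 ≤ b) (hb : b < 1 / 2) (hκ : 1 ≤ |κ|) (q : 𝓢(ℝ, ℂ)) (f g : L2) :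
    inner ℂ f (opW b (opL b κ 1 (schw b q) (opW b g))) =
      ∫ x, q x * (inner ℂ f (mulOp (chr x) (uV b κ 0)) * inner ℂ (mulOp (chr x) (vV b κ 1)) g) := by
  have hW := memLp_jw_top (κ := 1) (th_nonneg hb) one_le_abs_one
  have i0 : Integrable fun ξ => conj (f ξ) * um b κ 0 ξ :=
    (Lp.memLp f).star.integrable_mul (memLp_um hb hκ 0)
  have i1 := integrable_um_mul hb hκ 1 g
  simp only [inner_uV hb hκ, inner_vV hb hκ]
  have hc := continuous_fourierInv i1
  have hi : Integrable fun x => q x * 𝓕⁻ (fun ξ => um b κ 1 ξ * g ξ) x :=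
    integrable_schwartz_mul q hc (norm_fourierInv_le _)
  have h := integral_fourier_mul_flip i0 hi
  have e : ∀ x, q x * (𝓕 (fun ξ => conj (f ξ) * um b κ 0 ξ) x * 𝓕⁻ (fun ξ => um b κ 1 ξ * g ξ) x) =
    𝓕 (fun ξ => conj (f ξ) * um b κ 0 ξ) x * (q x * 𝓕⁻ (fun ξ => um b κ 1 ξ * g ξ) x) := fun x => by ring
  simp only [e]
  rw [h, inner_opW_left hb, inner_L2]
  refine integral_congr_ae ?_
  have h1 := opL_ae hb0 hb hκ (Or.inl rfl) (schw_rep hb0 q) (opW b g)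
  filter_upwards [mulOp_ae hW f, h1] with ξ e1 e2
  rw [e2, ← fourier_mul_fourierInv q i1]
  change conj ((mulOp (jw 1 (-th b)) f : L2) ξ) * _ = _
  have e3 : ∫ η, 𝓕 (q : ℝ → ℂ) (ξ - η) * (sqrtSym κ 1 η * (opW b g : L2) η) =
      ∫ η, 𝓕 (q : ℝ → ℂ) (ξ - η) * (um b κ 1 η * g η) := by
    refine integral_congr_ae ?_
    filter_upwards [mulOp_ae hW g] with η e4
    change _ * (_ * (mulOp (jw 1 (-th b)) g : L2) η) = _
    rw [e4, um, show sgn2 1 = 1 from by simp [sgn2]]; ring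
  rw [e3, e1, um, map_mul]
  simp only [jw, conj_ofReal, sgn2, if_true]; ring

lemma Adm.HSle_opT' (h : Adm b η) (hκ : 1 ≤ |κ|) {ε : ℝ} (hε : ε = 1 ∨ ε = -1) {p : L2}
    (hp : ‖p‖ ≤ η) : HSle (opT b κ ε p) (1 / 2) :=
  (HSle_opT h.hb0.le h.hb hκ hε p).mono
    ((mul_le_mul_of_nonneg_left hp (opC_nonneg b)).trans h.op_le)

lemma Adm.HSle_opL' (h : Adm b η) (hκ : 1 ≤ |κ|) {ε : ℝ} (hε : ε = 1 ∨ ε = -1) {p : L2}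
    (hp : ‖p‖ ≤ η) : HSle (opL b κ ε p) (1 / 2) :=
  (HSle_opL h.hb0.le h.hb hκ hε p).mono
    ((mul_le_mul_of_nonneg_left hp (opC_nonneg b)).trans h.op_le)

lemma Adm.exists_HSle_opN (h : Adm b η) (hκ : 1 ≤ |κ|) {p R : L2} (hR : ‖R‖ ≤ η) :
    ∃ c, HSle (opN b κ p R 1 0) c := by
  have hT := h.HSle_opT' hκ (ε := -1) (Or.inr rfl) hR
  exact ⟨_, hT.sub (hT.mul_left (opT b κ (-1) R * opW b * opD b κ p R * opL b κ 1 p * opW b))⟩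

lemma Adm.gamma_D_eq (h : Adm b η) (hκ : 1 ≤ |κ|) {p R : L2} (hp : ‖p‖ ≤ η) (hR : ‖R‖ ≤ η) :
    opL b κ (-1) R * opD b κ p R = opW b * opN b κ p R 1 0 * opW b := by
  rw [← h.invCore_sub_one hκ hp hR 1 0]
  change _ = opL b κ (-1) R * opD b κ p R - 0
  rw [sub_zero]

/-- The trace of `Λ Γ (1 + Λ Γ)⁻¹` in terms of the diagonal Green's function. -/
lemma Adm.trace_formula (h : Adm b η) (hκ : 1 ≤ |κ|) {q : 𝓢(ℝ, ℂ)} {R : L2} (hq : ‖schw b q‖ ≤ η)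
    (hR : ‖R‖ ≤ η) :
    opTrace (opL b κ 1 (schw b q) * (opL b κ (-1) R * opD b κ (schw b q) R)) =
      ∫ x, q x * grK b κ (schw b q) R x x 1 0 := by
  set p := schw b q
  set N := opN b κ p R 1 0 with hN
  obtain ⟨c, hc⟩ := h.exists_HSle_opN hκ (p := p) hR
  have hS := h.HSle_opT' hκ (ε := 1) (Or.inl rfl) hq
  set S := opT b κ 1 p with hS'
  set W := opW b with hW
  have e1 : opL b κ 1 p * (opL b κ (-1) R * opD b κ p R) = (W * S) * (W * W * N * W) := by
    rw [h.gamma_D_eq hκ hq hR]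
    change W * S * W * (W * N * W) = _
    noncomm_ring
  have hA := hS.mul_left W
  have hB := ((hc.mul_left (W * W)).mul_right W)
  -- Cyclicity is used twice to collect the smoothing factors: the operator becomes `W Λ W N`, and
  -- `W Λ W` is a superposition of rank one operators by `inner_opL_eq`.
  rw [e1, hA.opTrace_mul_comm hB]
  have e2 : W * W * N * W * (W * S) = (W * W * N) * (W * W * S) := by noncomm_ring
  have hA2 := hc.mul_left (W * W)
  have hB2 := hS.mul_left (W * W)
  rw [e2, hA2.opTrace_mul_comm hB2]
  obtain ⟨w, e, -⟩ := exists_hilbertBasis ℂ L2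
  have htr := hB2.hasOpTrace hA2 w e
  -- Countability is needed to integrate the sum over the basis term by term.
  have : Countable w := countable_of_hilbertBasis e
  set F : w → ℝ → ℂ := fun i x => q x * (inner ℂ (e i) (mulOp (chr x) (uV b κ 0)) *
    inner ℂ (mulOp (chr x) (vV b κ 1)) (N (e i))) with hF
  have e3 : ∀ i, inner ℂ (e i) ((W * W * S * (W * W * N)) (e i)) = ∫ x, F i x := fun i => by
    rw [hF, ← inner_opL_eq h.hb0.le h.hb hκ q]
    rfl
  have hsum : ∀ x, HasSum (fun i => F i x) (q x * grK b κ p R x x 1 0) := fun x => by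
    have h1 := e.hasSum_inner_mul_inner (ContinuousLinearMap.adjoint N (mulOp (chr x) (vV b κ 1)))
      (mulOp (chr x) (uV b κ 0))
    rw [ContinuousLinearMap.adjoint_inner_left] at h1
    have h2 := h1.mul_left (q x)
    have e5 : (fun i => F i x) = fun i => q x * (inner ℂ (ContinuousLinearMap.adjoint N
        (mulOp (chr x) (vV b κ 1))) (e i) * inner ℂ (e i) (mulOp (chr x) (uV b κ 0))) := by
      funext i
      rw [ContinuousLinearMap.adjoint_inner_left, hF]
      ring
    rw [e5]; exact h2
  have hcont : ∀ i, Continuous fun x => inner ℂ (e i) (mulOp (chr x) (uV b κ 0)) *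
      inner ℂ (mulOp (chr x) (vV b κ 1)) (N (e i)) := fun i =>
    (continuous_const.inner (continuous_mulOp_chr _)).mul
      ((continuous_mulOp_chr _).inner continuous_const)
  have hu : ∀ x, ‖mulOp (chr x) (uV b κ 0)‖ ≤ ‖uV b κ 0‖ := fun x => norm_mulOp_chr_le x _
  have hv : ∀ x, ‖mulOp (chr x) (vV b κ 1)‖ ≤ ‖vV b κ 1‖ := fun x => norm_mulOp_chr_le x _
  have hFi : ∀ i, Integrable (F i) := fun i => by
    refine integrable_schwartz_mul q (hcont i) (C := ‖uV b κ 0‖ * (‖vV b κ 1‖ * ‖N (e i)‖)) fun x => ?_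
    rw [norm_mul]
    refine mul_le_mul ((norm_inner_le_norm _ _).trans ?_) ((norm_inner_le_norm _ _).trans ?_)
      (norm_nonneg _) (norm_nonneg _)
    · rw [e.orthonormal.1 i, one_mul]; exact hu x
    · gcongr; exact hv x
  -- Bessel's inequality for the two vectors `a` and `d` bounds all partial sums uniformly in `x`,
  -- so that `q` alone supplies the integrability.
  have hbound : ∀ (s : Finset w) x, ∑ i ∈ s, ‖F i x‖ ≤ ‖q x‖ *
      ((‖uV b κ 0‖ ^ 2 + (‖ContinuousLinearMap.adjoint N‖ * ‖vV b κ 1‖) ^ 2) / 2) := fun s x => by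
    simp only [hF, norm_mul]
    rw [← Finset.mul_sum]
    refine mul_le_mul_of_nonneg_left ?_ (norm_nonneg _)
    set a := mulOp (chr x) (uV b κ 0)
    set d := ContinuousLinearMap.adjoint N (mulOp (chr x) (vV b κ 1))
    have h3 : ∀ i, ‖inner ℂ (mulOp (chr x) (vV b κ 1)) (N (e i))‖ = ‖inner ℂ (e i) d‖ := fun i => by
      rw [← ContinuousLinearMap.adjoint_inner_left, norm_inner_symm]
    simp only [h3]
    have h4 := e.orthonormal.sum_inner_products_le (s := s) a
    have h5 := e.orthonormal.sum_inner_products_le (s := s) d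
    have h6 : ‖d‖ ≤ ‖ContinuousLinearMap.adjoint N‖ * ‖vV b κ 1‖ :=
      (ContinuousLinearMap.le_opNorm _ _).trans (by gcongr; exact hv x)
    have h7 : ‖a‖ ≤ ‖uV b κ 0‖ := hu x
    calc ∑ i ∈ s, ‖inner ℂ (e i) a‖ * ‖inner ℂ (e i) d‖
        ≤ ∑ i ∈ s, (‖inner ℂ (e i) a‖ ^ 2 + ‖inner ℂ (e i) d‖ ^ 2) / 2 :=
          Finset.sum_le_sum fun i _ => by
            nlinarith [sq_nonneg (‖inner ℂ (e i) a‖ - ‖inner ℂ (e i) d‖)]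
      _ = (∑ i ∈ s, ‖inner ℂ (e i) a‖ ^ 2 + ∑ i ∈ s, ‖inner ℂ (e i) d‖ ^ 2) / 2 := by
          rw [← Finset.sum_div, Finset.sum_add_distrib]
      _ ≤ (‖a‖ ^ 2 + ‖d‖ ^ 2) / 2 := by gcongr
      _ ≤ _ := by gcongr
  have hsumm : Summable fun i => ∫ x, ‖F i x‖ := by
    refine summable_of_sum_le (c := ∫ x, ‖q x‖ *
      ((‖uV b κ 0‖ ^ 2 + (‖ContinuousLinearMap.adjoint N‖ * ‖vV b κ 1‖) ^ 2) / 2))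
      (fun i => integral_nonneg fun _ => norm_nonneg _) fun s => ?_
    rw [← integral_finsetSum _ fun i _ => (hFi i).norm]
    exact integral_mono (integrable_finsetSum _ fun i _ => (hFi i).norm)
      (q.integrable.norm.mul_const _) fun x => hbound s x
  have hres := hasSum_integral_of_summable_integral_norm hFi hsumm
  have htr' : HasSum (fun i => ∫ x, F i x) (opTrace (W * W * S * (W * W * N))) := by
    rw [← funext e3]; exact htr
  rw [htr'.unique hres]
  refine integral_congr_ae (ae_of_all _ fun x => ?_)
  exact (hsum x).tsum_eq

/-! ### The series of the logarithmic determinant -/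

/-- The traces of the powers of `Λ Γ`. -/
def trP (b κ : ℝ) (p R : L2) (m : ℕ) : ℂ := opTrace ((opL b κ 1 p * opL b κ (-1) R) ^ (m + 1))

/-- The logarithm of the determinant of `1 + Λ Γ`. -/
def ld (b κ : ℝ) (p R : L2) : ℂ := ∑' m : ℕ, (-1) ^ m / (m + 1) * trP b κ p R m

lemma Adm.pow_HSle (h : Adm b η) (hκ : 1 ≤ |κ|) {p R : L2} (hp : ‖p‖ ≤ η) (hR : ‖R‖ ≤ η) (m : ℕ) :
    HSle ((opL b κ 1 p * opL b κ (-1) R) ^ m * opL b κ 1 p) ((1 / 4) ^ m * (1 / 2)) := by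
  refine ((h.HSle_opL' hκ (Or.inl rfl) hp).mul_left _).mono ?_
  gcongr
  rcases Nat.eq_zero_or_pos m with rfl | hm
  · rw [pow_zero, pow_zero]; exact ContinuousLinearMap.norm_id_le
  · exact (norm_pow_le' _ hm).trans (by gcongr; exact h.norm_opL_mul_le hκ hp hR)

lemma Adm.hasOpTrace_pow (h : Adm b η) (hκ : 1 ≤ |κ|) {p R : L2} (hp : ‖p‖ ≤ η) (hR : ‖R‖ ≤ η)
    (m : ℕ) : HasOpTrace ((opL b κ 1 p * opL b κ (-1) R) ^ (m + 1)) (trP b κ p R m) := by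
  have := (h.pow_HSle hκ hp hR m).hasOpTrace (h.HSle_opL' hκ (ε := -1) (Or.inr rfl) hR)
  rw [mul_assoc, ← pow_succ] at this
  exact this

lemma Adm.norm_trP_le (h : Adm b η) (hκ : 1 ≤ |κ|) {p R : L2} (hp : ‖p‖ ≤ η) (hR : ‖R‖ ≤ η) (m : ℕ) :
    ‖trP b κ p R m‖ ≤ (1 / 4) ^ (m + 1) := by
  have := (h.pow_HSle hκ hp hR m).norm_opTrace_le (h.HSle_opL' hκ (ε := -1) (Or.inr rfl) hR)
  rw [mul_assoc, ← pow_succ] at this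
  refine this.trans (le_of_eq ?_)
  rw [pow_succ]; ring

lemma norm_ldCoeff_le (m : ℕ) : ‖((-1) ^ m / (m + 1) : ℂ)‖ ≤ 1 := by
  rw [norm_div, norm_pow, norm_neg, norm_one, one_pow]
  have : ‖(m + 1 : ℂ)‖ = m + 1 := by
    have := Complex.norm_natCast (m + 1); push_cast at this; exact this
  rw [this]
  exact div_le_one_of_le₀ (by linarith [(Nat.cast_nonneg m : (0 : ℝ) ≤ m)]) (by positivity)

lemma Adm.summable_ld (h : Adm b η) (hκ : 1 ≤ |κ|) {p R : L2} (hp : ‖p‖ ≤ η) (hR : ‖R‖ ≤ η) :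
    Summable fun m : ℕ => ‖((-1) ^ m / (m + 1) : ℂ) * trP b κ p R m‖ := by
  refine Summable.of_nonneg_of_le (fun _ => norm_nonneg _) (fun m => ?_)
    ((summable_nat_add_iff 1).mpr (summable_geometric_of_lt_one (by norm_num) (by norm_num : (1 / 4 : ℝ) < 1)))
  rw [norm_mul]
  exact (mul_le_of_le_one_left (norm_nonneg _) (norm_ldCoeff_le m)).trans (h.norm_trP_le hκ hp hR m)

/-- The series of the trace of `Λ Γ (1 + Λ Γ)⁻¹`. -/
lemma Adm.hasSum_trace (h : Adm b η) (hκ : 1 ≤ |κ|) {p R : L2} (hp : ‖p‖ ≤ η) (hR : ‖R‖ ≤ η) :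
    HasSum (fun m : ℕ => (-1) ^ m * trP b κ p R m)
      (opTrace (opL b κ 1 p * (opL b κ (-1) R * opD b κ p R))) := by
  set X := opL b κ 1 p * opL b κ (-1) R with hX
  set D := opD b κ p R with hD
  have hXD : D = 1 - X * D := by rw [← h.mul_opD hκ hp hR]; abel
  have hG := h.HSle_opL' hκ (ε := -1) (Or.inr rfl) hR
  have hGD := hG.mul_right D
  have hpow : ∀ n, HasOpTrace (X ^ (n + 1) * D)
      (opTrace (X ^ n * opL b κ 1 p * (opL b κ (-1) R * D))) := fun n => by
    have := (h.pow_HSle hκ hp hR n).hasOpTrace hGD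
    have e : X ^ n * opL b κ 1 p * (opL b κ (-1) R * D) = X ^ (n + 1) * D := by
      rw [pow_succ, hX]; simp only [mul_assoc]
    rw [e] at this ⊢
    exact this
  have hsumm : Summable fun m : ℕ => (-1) ^ m * trP b κ p R m := by
    refine Summable.of_norm_bounded ((summable_nat_add_iff 1).mpr
      (summable_geometric_of_lt_one (by norm_num) (by norm_num : (1 / 4 : ℝ) < 1))) fun m => ?_
    rw [norm_mul, norm_pow, norm_neg, norm_one, one_pow, one_mul]
    exact h.norm_trP_le hκ hp hR m
  set T : ℕ → ℂ := fun n => opTrace (X ^ n * opL b κ 1 p * (opL b κ (-1) R * D)) with hT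
  -- The identity `D = 1 - X D` is iterated under the trace; the remainder decays geometrically
  -- because its Hilbert-Schmidt factor does.
  have hrec : ∀ n, T n = trP b κ p R n - T (n + 1) := fun n => by
    have h1 : X ^ (n + 1) * D = X ^ (n + 1) - X ^ (n + 1 + 1) * D := by
      nth_rewrite 1 [hXD]
      rw [mul_sub, mul_one, ← mul_assoc, ← pow_succ]
    have h2 := (h.hasOpTrace_pow hκ hp hR n).sub (hpow (n + 1))
    rw [← hX, ← h1] at h2
    exact (hpow n).unique h2
  have hpart : ∀ n, ∑ m ∈ Finset.range n, (-1) ^ m * trP b κ p R m = T 0 - (-1) ^ n * T n := fun n => by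
    induction n with
    | zero => simp
    | succ n ih =>
      rw [Finset.sum_range_succ, ih, pow_succ]
      linear_combination -(-1) ^ n * hrec n
  have hT0 : Tendsto (fun n => (-1) ^ n * T n) atTop (𝓝 0) := by
    rw [tendsto_zero_iff_norm_tendsto_zero]
    have hg : Tendsto (fun n : ℕ => (1 / 4 : ℝ) ^ n * (1 / 2 * (1 / 2 * ‖D‖))) atTop (𝓝 (0 * (1 / 2 * (1 / 2 * ‖D‖)))) :=
      (tendsto_pow_atTop_nhds_zero_of_lt_one (by norm_num) (by norm_num)).mul_const _
    rw [zero_mul] at hg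
    refine squeeze_zero (fun _ => norm_nonneg _) (fun n => ?_) hg
    rw [norm_mul, norm_pow, norm_neg, norm_one, one_pow, one_mul]
    refine ((h.pow_HSle hκ hp hR n).norm_opTrace_le hGD).trans (le_of_eq ?_)
    ring
  have hlim : Tendsto (fun n => ∑ m ∈ Finset.range n, (-1) ^ m * trP b κ p R m) atTop (𝓝 (T 0)) := by
    simp only [hpart]
    simpa using (tendsto_const_nhds (x := T 0)).sub hT0
  have e0 : T 0 = opTrace (opL b κ 1 p * (opL b κ (-1) R * D)) := by simp [hT]
  rw [← e0, ← tendsto_nhds_unique hsumm.hasSum.tendsto_sum_nat hlim]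
  exact hsumm.hasSum

end

/-! ### The logarithmic determinant for Schwartz functions -/

lemma integral_deriv_eq_zero {f f' : ℝ → ℂ} (hd : ∀ x, HasDerivAt f (f' x) x) (hi : Integrable f')
    (h0 : Tendsto f (cocompact ℝ) (𝓝 0)) : ∫ x, f' x = 0 := by
  rw [cocompact_eq_atBot_atTop, tendsto_sup] at h0
  rw [integral_of_hasDerivAt_of_tendsto hd hi h0.1 h0.2, sub_zero]

namespace RicPair
variable {κ : ℝ} {q r F₁ F₂ : ℝ → ℂ}

lemma hasDerivAt_den (h : RicPair κ q r F₁ F₂) (x : ℝ) :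
    HasDerivAt (fun x => 1 - 4 * F₁ x * F₂ x)
      (-2 * (q x * F₁ x + r x * F₂ x) * (1 - 4 * F₁ x * F₂ x)) x :=
  ((((h.ode₁ x).const_mul 4).mul (h.ode₂ x)).const_sub 1).congr_deriv (by ring)

lemma integrable_mul_of_bdd (h : RicPair κ q r F₁ F₂) {g : ℝ → ℂ} (hg : Continuous g) {C : ℝ}
    (hC : ∀ x, ‖g x‖ ≤ C) : Integrable fun x => q x * g x := by
  simp only [mul_comm (q _)]
  exact h.intq.bdd_mul hg.aestronglyMeasurable (ae_of_all _ hC)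

lemma norm_inv_den_le (h : RicPair κ q r F₁ F₂) (x : ℝ) : ‖(1 - 4 * F₁ x * F₂ x)⁻¹‖ ≤ 4 / 3 := by
  have h1 := h.norm_mul_le x
  have h2 : 1 - ‖4 * F₁ x * F₂ x‖ ≤ ‖1 - 4 * F₁ x * F₂ x‖ := by
    simpa using norm_sub_norm_le (1 : ℂ) (4 * F₁ x * F₂ x)
  rw [norm_inv]
  exact (inv_anti₀ (by norm_num) (by linarith : (3 / 4 : ℝ) ≤ _)).trans (by norm_num)

/-- The integrand is the derivative of `-½ log (1 - 4 F₁ F₂)`, which vanishes at both ends. The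
bound `‖4 F₁ F₂‖ ≤ 1/4` keeps the argument of the logarithm in the slit plane. -/
lemma integral_add_eq_zero (h : RicPair κ q r F₁ F₂) (h1 : Tendsto F₁ (cocompact ℝ) (𝓝 0))
    (h2 : Tendsto F₂ (cocompact ℝ) (𝓝 0)) : ∫ x, (q x * F₁ x + r x * F₂ x) = 0 := by
  have hd : ∀ x, HasDerivAt (fun x => -(1 / 2) * Complex.log (1 - 4 * F₁ x * F₂ x))
      (q x * F₁ x + r x * F₂ x) x := fun x => by
    have hs : 1 - 4 * F₁ x * F₂ x ∈ slitPlane := by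
      left
      have := (abs_re_le_norm _).trans (h.norm_mul_le x)
      rw [sub_re, one_re]
      linarith [le_abs_self (4 * F₁ x * F₂ x).re]
    refine (((h.hasDerivAt_den x).clog_real hs).const_mul _).congr_deriv ?_
    rw [mul_div_assoc, div_self (h.ne_zero x)]
    ring
  refine integral_deriv_eq_zero hd ((h.integrable_mul_of_bdd h.cont₁ h.le₁).add
    (h.swap.integrable_mul_of_bdd h.cont₂ h.le₂)) ?_
  have h3 : Tendsto (fun x => 1 - 4 * F₁ x * F₂ x) (cocompact ℝ) (𝓝 1) := by
    simpa using tendsto_const_nhds.sub ((h1.const_mul 4).mul h2)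
  have h4 := (h3.clog one_mem_slitPlane).const_mul (-(1 / 2))
  rwa [Complex.log_one, mul_zero] at h4

/-- `E` plays the role of `τ ∂F₁/∂τ` when both potentials are multiplied by `τ`, so the left side is
`τ d/dτ` of `∫ q F₁`. The two integrands differ by the derivative of `(2 F₂ E - 2 F₁ F₂) / (1 - 4 F₁
F₂)`, which decays at both ends. -/
lemma integral_tangent (h : RicPair κ q r F₁ F₂) (h1 : Tendsto F₁ (cocompact ℝ) (𝓝 0))
    (h2 : Tendsto F₂ (cocompact ℝ) (𝓝 0)) {E : ℝ → ℂ}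
    (hE : ∀ x, HasDerivAt E (-2 * κ * E x + r x / 2 - 2 * q x * F₁ x ^ 2 - 4 * q x * F₁ x * E x) x)
    (hE0 : Tendsto E (cocompact ℝ) (𝓝 0)) {C : ℝ} (hC : ∀ x, ‖E x‖ ≤ C) :
    (∫ x, q x * F₁ x) + ∫ x, q x * E x = ∫ x, q x * (2 * F₁ x / (1 - 4 * F₁ x * F₂ x)) := by
  have hEc : Continuous E := continuous_iff_continuousAt.mpr fun x => (hE x).continuousAt
  have i1 := h.integrable_mul_of_bdd h.cont₁ h.le₁
  have i2 := h.integrable_mul_of_bdd hEc hC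
  have hc : Continuous fun x => 2 * F₁ x / (1 - 4 * F₁ x * F₂ x) :=
    (continuous_const.mul h.cont₁).div
      (continuous_const.sub ((continuous_const.mul h.cont₁).mul h.cont₂)) h.ne_zero
  have i3 : Integrable fun x => q x * (2 * F₁ x / (1 - 4 * F₁ x * F₂ x)) := by
    refine h.integrable_mul_of_bdd hc (C := 2 * (1 / 4) * (4 / 3)) fun x => ?_
    rw [div_eq_mul_inv, norm_mul, norm_mul, RCLike.norm_ofNat]
    have := h.le₁ x
    have := h.norm_inv_den_le x
    gcongr
  have hd : ∀ x, HasDerivAt (fun x => (2 * F₂ x * E x - 2 * F₁ x * F₂ x) / (1 - 4 * F₁ x * F₂ x))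
      (q x * F₁ x + q x * E x - q x * (2 * F₁ x / (1 - 4 * F₁ x * F₂ x))) x := fun x => by
    have hne := h.ne_zero x
    refine (((((h.ode₂ x).const_mul 2).mul (hE x)).sub (((h.ode₁ x).const_mul 2).mul (h.ode₂ x))).div
      (h.hasDerivAt_den x) hne).congr_deriv ?_
    simp only [Pi.mul_apply, Pi.sub_apply]
    rw [div_eq_iff (pow_ne_zero 2 hne)]
    linear_combination (q x * (1 - 4 * F₁ x * F₂ x)) * div_mul_cancel₀ (2 * F₁ x) hne
  have hz := integral_deriv_eq_zero hd ((i1.add i2).sub i3) (by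
    have h3 : Tendsto (fun x => 1 - 4 * F₁ x * F₂ x) (cocompact ℝ) (𝓝 1) := by
      simpa using tendsto_const_nhds.sub ((h1.const_mul 4).mul h2)
    have h4 : Tendsto (fun x => 2 * F₂ x * E x - 2 * F₁ x * F₂ x) (cocompact ℝ) (𝓝 0) := by
      simpa using ((h2.const_mul 2).mul hE0).sub ((h1.const_mul 2).mul h2)
    have h5 := h4.div h3 one_ne_zero
    rwa [zero_div] at h5)
  have e1 := integral_sub (i1.add i2) i3
  simp only [Pi.add_apply] at e1
  rw [e1, integral_add i1 i2] at hz
  exact sub_eq_zero.mp hz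

end RicPair

section
variable {b κ η : ℝ}

lemma Adm.trP_smul (h : Adm b η) (hκ : 1 ≤ |κ|) {p R : L2} (hp : ‖p‖ ≤ η) (hR : ‖R‖ ≤ η) (c : ℂ)
    (m : ℕ) : trP b κ (c • p) (c • R) m = c ^ (2 * (m + 1)) * trP b κ p R m := by
  have h1 := (h.hasOpTrace_pow hκ hp hR m).smul (c ^ (2 * (m + 1)))
  rw [← h1.opTrace_eq, trP]
  congr 1
  rw [opL_smul, opL_smul, smul_mul_smul_comm, smul_pow, ← pow_two, ← pow_mul]

lemma norm_smul_le_of_abs_le {p : L2} (hp : ‖p‖ ≤ η) {τ : ℝ} (hτ : |τ| ≤ 1) :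
    ‖(τ : ℂ) • p‖ ≤ η := by
  rw [norm_smul, norm_real, Real.norm_eq_abs]
  exact (mul_le_of_le_one_left (norm_nonneg _) hτ).trans hp

/-- The traces decay like `4 ^ (-m)`, so the differentiated series converges with ratio `(3/2)² / 4
= 9/16` on an open interval that contains `[-1, 1]`. -/
lemma Adm.hasDerivAt_ld (h : Adm b η) (hκ : 1 ≤ |κ|) {p R : L2} (hp : ‖p‖ ≤ η) (hR : ‖R‖ ≤ η) {τ : ℝ}
    (hτ : τ ∈ Set.Ioo (-(3 / 2) : ℝ) (3 / 2)) :
    HasDerivAt (fun τ : ℝ => ∑' m : ℕ, (-1) ^ m / (m + 1) * ((τ : ℂ) ^ (2 * (m + 1)) * trP b κ p R m))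
      (∑' m : ℕ, 2 * ((-1) ^ m * ((τ : ℂ) ^ (2 * m + 1) * trP b κ p R m))) τ := by
  refine hasDerivAt_tsum_of_isPreconnected (F := ℂ)
    (g := fun (m : ℕ) (τ : ℝ) => (-1 : ℂ) ^ m / (m + 1) * ((τ : ℂ) ^ (2 * (m + 1)) * trP b κ p R m))
    (g' := fun (m : ℕ) (τ : ℝ) => 2 * ((-1 : ℂ) ^ m * ((τ : ℂ) ^ (2 * m + 1) * trP b κ p R m))) (u := fun m : ℕ => 3 / 4 * (9 / 16 : ℝ) ^ m)
    ((summable_geometric_of_lt_one (by norm_num) (by norm_num)).mul_left _) isOpen_Ioo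
    isPreconnected_Ioo (fun m x _ => ?_) (fun m x hx => ?_) (y₀ := 0) (by norm_num) ?_ hτ
  · have h1 : HasDerivAt (fun τ : ℝ => (τ : ℂ) ^ (2 * (m + 1)))
        (((2 * (m + 1) : ℕ) : ℂ) * (x : ℂ) ^ (2 * (m + 1) - 1)) x := (hasDerivAt_pow _ (x : ℂ)).comp_ofReal
    refine ((h1.mul_const (trP b κ p R m)).const_mul _).congr_deriv ?_
    have hm : (m + 1 : ℂ) ≠ 0 := Nat.cast_add_one_ne_zero m
    rw [show 2 * (m + 1) - 1 = 2 * m + 1 by omega]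
    push_cast
    field_simp
  · rw [norm_mul, norm_mul, norm_mul, norm_pow, norm_pow, norm_neg, norm_one, one_pow, one_mul,
      RCLike.norm_ofNat, norm_real, Real.norm_eq_abs]
    have h1 : |x| ≤ 3 / 2 := (abs_lt.mpr hx).le
    calc 2 * (|x| ^ (2 * m + 1) * ‖trP b κ p R m‖) ≤ 2 * ((3 / 2) ^ (2 * m + 1) * (1 / 4) ^ (m + 1)) := by
          have := h.norm_trP_le hκ hp hR m
          gcongr
      _ = 3 / 4 * (9 / 16) ^ m := by
          rw [pow_succ, pow_mul, pow_succ (1 / 4 : ℝ)]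
          have : (9 / 16 : ℝ) ^ m = ((3 / 2 : ℝ) ^ 2) ^ m * (1 / 4) ^ m := by
            rw [← mul_pow]; norm_num
          rw [this]; ring
  · simp

lemma Adm.ld_smul (h : Adm b η) (hκ : 1 ≤ |κ|) {p R : L2} (hp : ‖p‖ ≤ η) (hR : ‖R‖ ≤ η) (c : ℂ) :
    ld b κ (c • p) (c • R) = ∑' m : ℕ, (-1) ^ m / (m + 1) * (c ^ (2 * (m + 1)) * trP b κ p R m) := by
  simp only [ld, h.trP_smul hκ hp hR]

/-- Differentiation cancels the denominators `m + 1` of the logarithmic series and leaves the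
geometric series of `hasSum_trace`. Multiplying by `τ` avoids a division at zero. -/
lemma Adm.hasDerivAt_ld_smul (h : Adm b η) (hκ : 1 ≤ |κ|) {p R : L2} (hp : ‖p‖ ≤ η) (hR : ‖R‖ ≤ η)
    {τ : ℝ} (hτ : |τ| ≤ 1) :
    ∃ L' : ℂ, HasDerivAt (fun τ : ℝ => ld b κ ((τ : ℂ) • p) ((τ : ℂ) • R)) L' τ ∧
      τ * L' = 2 * opTrace (opL b κ 1 ((τ : ℂ) • p) *
        (opL b κ (-1) ((τ : ℂ) • R) * opD b κ ((τ : ℂ) • p) ((τ : ℂ) • R))) := by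
  have hτ' : τ ∈ Set.Ioo (-(3 / 2) : ℝ) (3 / 2) := by
    obtain ⟨h1, h2⟩ := abs_le.mp hτ
    constructor <;> linarith
  simp only [h.ld_smul hκ hp hR]
  refine ⟨_, h.hasDerivAt_ld hκ hp hR hτ', ?_⟩
  rw [← (h.hasSum_trace hκ (norm_smul_le_of_abs_le hp hτ) (norm_smul_le_of_abs_le hR hτ)).tsum_eq, ← tsum_mul_left,
    ← tsum_mul_left]
  refine tsum_congr fun m => ?_
  rw [h.trP_smul hκ hp hR]
  ring

/-- The logarithmic determinant for Schwartz functions. -/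
lemma Adm.ld_schwartz (h : Adm b η) (hκ : 1 ≤ |κ|) {q r : 𝓢(ℝ, ℂ)} (hq : ‖schw b q‖ ≤ η)
    (hr : ‖schw b r‖ ≤ η) :
    Real.sign κ * ld b κ (schw b q) (schw b r) =
      2 * pairF b κ (schw b q) (ric b κ η (schw b q) (schw b r)) := by
  set Z : ℝ → ℂ := fun τ => Real.sign κ * ld b κ ((τ : ℂ) • schw b q) ((τ : ℂ) • schw b r) -
    2 * pairF b κ ((τ : ℂ) • schw b q) (ric b κ η ((τ : ℂ) • schw b q) ((τ : ℂ) • schw b r)) with hZ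
  have hbq : ∀ {τ : ℝ}, |τ| ≤ 1 → ‖(τ : ℂ) • schw b q‖ ≤ η := fun hτ => norm_smul_le_of_abs_le hq hτ
  have hbr : ∀ {τ : ℝ}, |τ| ≤ 1 → ‖(τ : ℂ) • schw b r‖ ≤ η := fun hτ => norm_smul_le_of_abs_le hr hτ
  have hlin : ∀ (f : 𝓢(ℝ, ℂ)) (τ : ℝ), HasDerivAt (fun τ : ℝ => schw b ((τ : ℂ) • f)) (schw b f) τ :=
    fun f τ => by
    simp only [map_smul]
    exact ((hasDerivAt_id (τ : ℂ)).comp_ofReal.smul_const (schw b f)).congr_deriv (one_smul _ _)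
  have hcont : ∀ τ ∈ Set.Icc (0 : ℝ) 1, ContinuousWithinAt Z (Set.Icc 0 1) τ := fun τ hτ => by
    have ht : |τ| ≤ 1 := abs_le.mpr ⟨by linarith [hτ.1], hτ.2⟩
    obtain ⟨L', hL, -⟩ := h.hasDerivAt_ld_smul hκ hq hr ht
    have c1 : ∀ f : L2, Tendsto (fun τ : ℝ => (τ : ℂ) • f) (𝓝[Set.Icc 0 1] τ) (𝓝 ((τ : ℂ) • f)) :=
      fun f => ((continuous_ofReal.smul continuous_const).tendsto τ).mono_left nhdsWithin_le_nhds
    have hev : ∀ᶠ s in 𝓝[Set.Icc 0 1] τ, |s| ≤ 1 := by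
      filter_upwards [self_mem_nhdsWithin] with s hs
      exact abs_le.mpr ⟨by linarith [hs.1], hs.2⟩
    refine (hL.continuousAt.continuousWithinAt.const_mul _).sub ((tendsto_pairF (c1 _)
      (h.tendsto_ric hκ (c1 _) (c1 _) (hev.mono fun s hs => hbq hs) (hev.mono fun s hs => hbr hs)
        (hbq ht) (hbr ht))).const_mul 2)
  have hder : ∀ τ ∈ Set.Ioo (0 : ℝ) 1, HasDerivAt Z 0 τ := fun τ hτ => by
    have ht : |τ| ≤ 1 := abs_le.mpr ⟨by linarith [hτ.1], hτ.2.le⟩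
    obtain ⟨L', hL, hL'⟩ := h.hasDerivAt_ld_smul hκ hq hr ht
    have hev : ∀ᶠ s in 𝓝 τ, |s| ≤ 1 := by
      filter_upwards [isOpen_Ioo.mem_nhds hτ] with s hs
      exact abs_le.mpr ⟨by linarith [hs.1], hs.2.le⟩
    obtain ⟨D, hD, hD'⟩ := h.exists_hasDerivAt_ric hκ (hlin q τ) (hlin r τ)
      (hev.mono fun s hs => by rw [map_smul]; exact hbq hs)
      (hev.mono fun s hs => by rw [map_smul]; exact hbr hs)
    have hP := hasDerivAt_pairF (b := b) (κ := κ) (hlin q τ) hD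
    set Q := (τ : ℂ) • q
    set P := (τ : ℂ) • r
    have hQn : ‖schw b Q‖ ≤ η := by rw [map_smul]; exact hbq ht
    have hPn : ‖schw b P‖ ≤ η := by rw [map_smul]; exact hbr ht
    have hpair := h.ricPair hκ hQn hPn
    -- `τ • D` solves the linearized Riccati equation whose data are the scaled potentials `Q` and
    -- `P`, which is the form required of `E`.
    have htan := hpair.integral_tangent (tendsto_ricF _ _ _ _ _) (tendsto_ricF _ _ _ _ _)
      (E := evF b κ ((τ : ℂ) • D)) (fun x => by
        simp only [evF_smul h.hb hκ]
        have := (hD' x).const_mul (τ : ℂ)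
        rw [show evF b κ ((τ : ℂ) • D) = fun x => (τ : ℂ) * evF b κ D x from
          funext fun x => evF_smul h.hb hκ _ _ _]
        refine this.congr_deriv ?_
        change _ = -2 * κ * (τ * evF b κ D x) + (τ * r x) / 2 - 2 * (τ * q x) *
          ricF b κ η (schw b Q) (schw b P) x ^ 2 - 4 * (τ * q x) *
          ricF b κ η (schw b Q) (schw b P) x * (τ * evF b κ D x)
        have e : Q x = τ * q x := rfl
        rw [e]
        ring) (tendsto_evF _ _ _) (norm_evF_le h.hb hκ _)
    have hz := (hL.const_mul (Real.sign κ : ℂ)).sub (hP.const_mul 2)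
    simp only [map_smul] at hz
    refine hz.congr_deriv ?_
    have hτ0 : (τ : ℂ) ≠ 0 := ofReal_ne_zero.mpr hτ.1.ne'
    refine mul_left_cancel₀ hτ0 ?_
    rw [← map_smul, ← map_smul] at hL'
    rw [h.trace_formula hκ hQn hPn] at hL'
    change τ * (Real.sign κ * L' - 2 * (pairF b κ (schw b q) (ric b κ η (schw b Q) (schw b P)) +
      pairF b κ (schw b Q) D)) = τ * 0
    have e1 : Real.sign κ * ∫ x, Q x * grK b κ (schw b Q) (schw b P) x x 1 0 =
        ∫ x, Q x * (2 * ricF b κ η (schw b Q) (schw b P) x / (1 - 4 * ricF b κ η (schw b Q) (schw b P) x *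
          ricF b (-κ) η (schw b P) (schw b Q) x)) := by
      rw [← integral_const_mul]
      refine integral_congr_ae (ae_of_all _ fun x => ?_)
      have := (h.grK_diag_schwartz hκ hQn hPn x).2.1
      simp only at this ⊢
      rw [← this]; ring
    have e2 : ∫ x, Q x * ricF b κ η (schw b Q) (schw b P) x =
        τ * pairF b κ (schw b q) (ric b κ η (schw b Q) (schw b P)) := by
      rw [pairF_schw h.hb0.le h.hb hκ, ← integral_const_mul]
      refine integral_congr_ae (ae_of_all _ fun x => ?_)
      change τ * q x * _ = τ * (q x * _)
      rw [mul_assoc]; rfl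
    have e3 : ∫ x, Q x * evF b κ ((τ : ℂ) • D) x = τ * pairF b κ (schw b Q) D := by
      rw [pairF_schw h.hb0.le h.hb hκ, ← integral_const_mul]
      refine integral_congr_ae (ae_of_all _ fun x => ?_)
      simp only [evF_smul h.hb hκ]; ring
    rw [← e1, e2, e3] at htan
    linear_combination (Real.sign κ : ℂ) * hL' - 2 * htan
  -- The derivative is known only for `τ` strictly between 0 and 1, since a factor `τ` has been
  -- cancelled; the value at zero is reached by continuity.
  have hconst : ∀ ε ∈ Set.Ioo (0 : ℝ) 1, Z ε = Z 1 := fun ε hε => by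
    have h1 := constant_of_has_deriv_right_zero (f := Z) (a := ε) (b := 1)
      (fun τ hτ => (hcont τ ⟨hε.1.le.trans hτ.1, hτ.2⟩).mono (Set.Icc_subset_Icc_left hε.1.le))
      (fun τ hτ => (hder τ ⟨hε.1.trans_le hτ.1, hτ.2⟩).hasDerivWithinAt) 1 ⟨hε.2.le, le_rfl⟩
    exact h1.symm
  have hlim : Z 0 = Z 1 := by
    have h1 : Tendsto Z (𝓝[Set.Ioo 0 1] 0) (𝓝 (Z 0)) :=
      (hcont 0 ⟨le_rfl, zero_le_one⟩).mono_left (nhdsWithin_mono _ Set.Ioo_subset_Icc_self)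
    have h2 : Tendsto Z (𝓝[Set.Ioo 0 1] 0) (𝓝 (Z 1)) :=
      tendsto_const_nhds.congr' (by
        filter_upwards [self_mem_nhdsWithin] with ε hε using (hconst ε hε).symm)
    have : (𝓝[Set.Ioo 0 1] (0 : ℝ)).NeBot := by
      rw [← mem_closure_iff_nhdsWithin_neBot, closure_Ioo zero_ne_one]
      exact ⟨le_rfl, zero_le_one⟩
    exact tendsto_nhds_unique h1 h2
  have hZ0 : Z 0 = 0 := by
    simp only [hZ, ofReal_zero, zero_smul]
    have : ld b κ 0 0 = 0 := by
      have := h.ld_smul hκ hq hr 0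
      rw [zero_smul, zero_smul] at this
      rw [this]; simp
    rw [this, pairF, inner_zero_right]; simp
  have hZ1 := hlim.symm.trans hZ0
  simp only [hZ, ofReal_one, one_smul] at hZ1
  exact sub_eq_zero.mp hZ1

lemma Adm.pairF_add_pairF (h : Adm b η) (hκ : 1 ≤ |κ|) {q r : 𝓢(ℝ, ℂ)} (hq : ‖schw b q‖ ≤ η)
    (hr : ‖schw b r‖ ≤ η) :
    pairF b κ (schw b q) (ric b κ η (schw b q) (schw b r)) +
      pairF b (-κ) (schw b r) (ric b (-κ) η (schw b r) (schw b q)) = 0 := by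
  have hp := h.ricPair hκ hq hr
  have hκ' : 1 ≤ |-κ| := by rwa [abs_neg]
  rw [pairF_schw h.hb0.le h.hb hκ, pairF_schw h.hb0.le h.hb hκ',
    ← hp.integral_add_eq_zero (tendsto_ricF _ _ _ _ _) (tendsto_ricF _ _ _ _ _)]
  exact (integral_add (hp.integrable_mul_of_bdd hp.cont₁ hp.le₁)
    (hp.swap.integrable_mul_of_bdd hp.cont₂ hp.le₂)).symm

end

/-! ### Extension by density -/

section
variable {b κ η : ℝ}

/-- A vector orthogonal to the range is annihilated, after multiplication by the nowhere vanishing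
weight, by all Schwartz functions. -/
lemma denseRange_schw {b : ℝ} (hb : 0 ≤ b) : DenseRange (schw b) := by
  have hperp : (LinearMap.range (schw b).toLinearMap)ᗮ = ⊥ := by
    rw [Submodule.eq_bot_iff]
    intro f hf
    rw [Submodule.mem_orthogonal'] at hf
    have hW := memLp_jw_top (κ := 1) hb one_le_abs_one
    have hloc : LocallyIntegrable fun ξ => jw 1 (-b) ξ * conj (f ξ) :=
      (((Lp.memLp f).star.mul hW (r := 2)).locallyIntegrable one_le_two)
    have h := ae_eq_of_forall_integral_schwartz hloc (g := fun _ => 0) locallyIntegrable_zero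
      fun φ _ => by
        have h1 := hf (schw b (𝓕⁻ φ)) ⟨_, rfl⟩
        rw [inner_L2] at h1
        simp only [mul_zero, integral_zero]
        rw [← h1]
        refine integral_congr_ae ?_
        filter_upwards [schw_ae hb (𝓕⁻ φ)] with ξ h2
        rw [h2, ← schwartz_fourier_coe, FourierTransform.fourier_fourierInv_eq]
        ring
    apply Lp.ext
    filter_upwards [h, Lp.coeFn_zero ℂ 2 (volume : Measure ℝ)] with ξ h1 h2
    rw [h2]
    have := (mul_eq_zero.mp h1).resolve_left (jw_ne_zero one_le_abs_one _ _)
    simpa using this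
  have := Submodule.topologicalClosure_eq_top_iff.mpr hperp
  rw [← Submodule.dense_iff_topologicalClosure_eq_top] at this
  exact this

/-- A dense set meets the open ball densely, and the closed ball is the closure of the open one;
hence the approximations can be kept in the region where all constructions converge. -/
lemma Adm.exists_schw_tendsto (h : Adm b η) {p : L2} (hp : ‖p‖ ≤ η) :
    ∃ u : ℕ → 𝓢(ℝ, ℂ), (∀ n, ‖schw b (u n)‖ ≤ η) ∧ Tendsto (fun n => schw b (u n)) atTop (𝓝 p) := by
  have h1 : p ∈ closure (Metric.ball (0 : L2) η) := by
    rw [closure_ball _ h.hη.ne']; simpa using hp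
  have h2 : p ∈ closure (Metric.ball (0 : L2) η ∩ Set.range (schw b)) :=
    closure_minimal ((denseRange_schw h.hb0.le).open_subset_closure_inter Metric.isOpen_ball)
      isClosed_closure h1
  obtain ⟨x, hx, hlim⟩ := mem_closure_iff_seq_limit.mp h2
  choose u hu using fun n => (hx n).2
  refine ⟨u, fun n => ?_, by simpa only [hu] using hlim⟩
  rw [hu]
  exact (mem_ball_zero_iff.mp (hx n).1).le

lemma Adm.tendsto_ricF (h : Adm b η) (hκ : 1 ≤ |κ|) {α : Type*} {l : Filter α} {P Q : α → L2}
    {p R : L2} (hP : Tendsto P l (𝓝 p)) (hQ : Tendsto Q l (𝓝 R)) (hPη : ∀ t, ‖P t‖ ≤ η)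
    (hQη : ∀ t, ‖Q t‖ ≤ η) (hp : ‖p‖ ≤ η) (hR : ‖R‖ ≤ η) (x : ℝ) :
    Tendsto (fun t => ricF b κ η (P t) (Q t) x) l (𝓝 (ricF b κ η p R x)) :=
  ((evL b κ h.hb hκ x).continuous.tendsto _).comp (h.tendsto_ric hκ hP hQ (Eventually.of_forall hPη)
    (Eventually.of_forall hQη) hp hR)

lemma Adm.den_ne_zero (h : Adm b η) (hκ : 1 ≤ |κ|) {p R : L2} (hp : ‖p‖ ≤ η) (hR : ‖R‖ ≤ η) (x : ℝ) :
    1 - 4 * ricF b κ η p R x * ricF b (-κ) η R p x ≠ 0 := fun h0 => by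
  have h1 := h.norm_ricF_le hκ hp hR x
  have h2 := h.norm_ricF_le (κ := -κ) (by rwa [abs_neg]) hR hp x
  have h3 := congrArg norm (sub_eq_zero.mp h0)
  rw [norm_one, norm_mul, norm_mul, RCLike.norm_ofNat] at h3
  nlinarith [norm_nonneg (ricF b κ η p R x), norm_nonneg (ricF b (-κ) η R p x)]

/-- Both sides are continuous in `(p, R)` and agree for Schwartz potentials. The two potentials are
approximated independently, so no relation between `r` and `q` is used. -/
lemma Adm.grK_diag (h : Adm b η) (hκ : 1 ≤ |κ|) {p R : L2} (hp : ‖p‖ ≤ η) (hR : ‖R‖ ≤ η) (x : ℝ) :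
    let F₁ := ricF b κ η p R x
    let F₂ := ricF b (-κ) η R p x
    let K := grK b κ p R x x
    Real.sign κ * K 0 1 = 2 * F₂ / (1 - 4 * F₁ * F₂) ∧ Real.sign κ * K 1 0 = 2 * F₁ / (1 - 4 * F₁ * F₂) ∧
    Real.sign κ * K 0 0 = 4 * F₁ * F₂ / (1 - 4 * F₁ * F₂) ∧
    Real.sign κ * K 1 1 = 4 * F₁ * F₂ / (1 - 4 * F₁ * F₂) := by
  intro F₁ F₂ K
  obtain ⟨u, hu, hul⟩ := h.exists_schw_tendsto hp
  obtain ⟨v, hv, hvl⟩ := h.exists_schw_tendsto hR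
  have hκ' : 1 ≤ |-κ| := by rwa [abs_neg]
  have t1 := h.tendsto_ricF hκ hul hvl hu hv hp hR x
  have t2 := h.tendsto_ricF hκ' hvl hul hv hu hR hp x
  have td : Tendsto (fun n => 1 - 4 * ricF b κ η (schw b (u n)) (schw b (v n)) x *
      ricF b (-κ) η (schw b (v n)) (schw b (u n)) x) atTop (𝓝 (1 - 4 * F₁ * F₂)) :=
    tendsto_const_nhds.sub ((t1.const_mul 4).mul t2)
  have tK := fun i j => (h.tendsto_grK hκ hul hvl hp hR x x i j).const_mul (Real.sign κ : ℂ)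
  have hne := h.den_ne_zero hκ hp hR x
  have hd := fun n => h.grK_diag_schwartz hκ (hu n) (hv n) x
  exact ⟨tendsto_nhds_unique_of_eventuallyEq (tK 0 1) ((t2.const_mul 2).div td hne)
      (Eventually.of_forall fun n => (hd n).1),
    tendsto_nhds_unique_of_eventuallyEq (tK 1 0) ((t1.const_mul 2).div td hne)
      (Eventually.of_forall fun n => (hd n).2.1),
    tendsto_nhds_unique_of_eventuallyEq (tK 0 0) (((t1.const_mul 4).mul t2).div td hne)
      (Eventually.of_forall fun n => (hd n).2.2.1),
    tendsto_nhds_unique_of_eventuallyEq (tK 1 1) (((t1.const_mul 4).mul t2).div td hne)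
      (Eventually.of_forall fun n => (hd n).2.2.2)⟩

/-- The trace is not continuous in the operator norm. One factor `Λ` and the last factor `Γ` are
therefore compared in the Hilbert-Schmidt norm, while the powers in front need only converge in
operator norm. -/
lemma Adm.tendsto_trP (h : Adm b η) (hκ : 1 ≤ |κ|) {α : Type*} {l : Filter α} {P Q : α → L2}
    {p R : L2} (hP : Tendsto P l (𝓝 p)) (hQ : Tendsto Q l (𝓝 R))
    (hQη : ∀ t, ‖Q t‖ ≤ η) (hp : ‖p‖ ≤ η) (hR : ‖R‖ ≤ η) (m : ℕ) :
    Tendsto (fun t => trP b κ (P t) (Q t) m) l (𝓝 (trP b κ p R m)) := by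
  set X : α → L2 →L[ℂ] L2 := fun t => opL b κ 1 (P t) * opL b κ (-1) (Q t)
  set Y := opL b κ 1 p * opL b κ (-1) R
  have hX : Tendsto (fun t => X t ^ m) l (𝓝 (Y ^ m)) :=
    (((continuous_opL.tendsto p).comp hP).mul ((continuous_opL.tendsto R).comp hQ)).pow m
  rw [tendsto_iff_norm_sub_tendsto_zero]
  have hb1 : ∀ t, ‖trP b κ (P t) (Q t) m - trP b κ p R m‖ ≤
      (‖X t ^ m‖ * (opC b * ‖P t - p‖) + ‖X t ^ m - Y ^ m‖ * (1 / 2)) * (1 / 2) +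
        (1 / 4) ^ m * (1 / 2) * (opC b * ‖Q t - R‖) := fun t => by
    have e : X t ^ m * opL b κ 1 (P t) - Y ^ m * opL b κ 1 p =
        X t ^ m * opL b κ 1 (P t - p) + (X t ^ m - Y ^ m) * opL b κ 1 p := by
      rw [opL_sub]; noncomm_ring
    have hA : HSle (X t ^ m * opL b κ 1 (P t) - Y ^ m * opL b κ 1 p)
        (‖X t ^ m‖ * (opC b * ‖P t - p‖) + ‖X t ^ m - Y ^ m‖ * (1 / 2)) := by
      rw [e]
      exact ((HSle_opL h.hb0.le h.hb hκ (Or.inl rfl) _).mul_left _).add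
        ((h.HSle_opL' hκ (Or.inl rfl) hp).mul_left _)
    have hB : HSle (opL b κ (-1) (Q t) - opL b κ (-1) R) (opC b * ‖Q t - R‖) := by
      rw [← opL_sub]; exact HSle_opL h.hb0.le h.hb hκ (Or.inr rfl) _
    have := norm_opTrace_sub_le (h.HSle_opL' hκ (ε := -1) (Or.inr rfl) (hQη t))
      (h.pow_HSle hκ hp hR m) hA hB
    rw [mul_assoc, ← pow_succ, mul_assoc, ← pow_succ] at this
    exact this
  refine squeeze_zero (fun _ => norm_nonneg _) hb1 ?_
  have t1 := (tendsto_iff_norm_sub_tendsto_zero.mp hP).const_mul (opC b)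
  have t2 := (tendsto_iff_norm_sub_tendsto_zero.mp hQ).const_mul (opC b)
  have t3 := tendsto_iff_norm_sub_tendsto_zero.mp hX
  have := (((hX.norm.mul t1).add (t3.mul_const (1 / 2))).mul_const (1 / 2)).add
    (t2.const_mul ((1 / 4) ^ m * (1 / 2)))
  simpa using this

lemma Adm.tendsto_ld (h : Adm b η) (hκ : 1 ≤ |κ|) {α : Type*} {l : Filter α} {P Q : α → L2}
    {p R : L2} (hP : Tendsto P l (𝓝 p)) (hQ : Tendsto Q l (𝓝 R)) (hPη : ∀ t, ‖P t‖ ≤ η)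
    (hQη : ∀ t, ‖Q t‖ ≤ η) (hp : ‖p‖ ≤ η) (hR : ‖R‖ ≤ η) :
    Tendsto (fun t => ld b κ (P t) (Q t)) l (𝓝 (ld b κ p R)) := by
  refine tendsto_tsum_of_dominated_convergence (bound := fun m : ℕ => (1 / 4 : ℝ) ^ (m + 1))
    ((summable_nat_add_iff 1).mpr (summable_geometric_of_lt_one (by norm_num) (by norm_num)))
    (fun m => (h.tendsto_trP hκ hP hQ hQη hp hR m).const_mul _) (Eventually.of_forall fun t m => ?_)
  rw [norm_mul]
  exact (mul_le_of_le_one_left (norm_nonneg _) (norm_ldCoeff_le m)).trans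
    (h.norm_trP_le hκ (hPη t) (hQη t) m)

/-- The logarithmic determinant is the integral of the density. -/
lemma Adm.ld_eq (h : Adm b η) (hκ : 1 ≤ |κ|) {p R : L2} (hp : ‖p‖ ≤ η) (hR : ‖R‖ ≤ η) :
    Real.sign κ * ld b κ p R = 2 * pairF b κ p (ric b κ η p R) ∧
      pairF b κ p (ric b κ η p R) + pairF b (-κ) R (ric b (-κ) η R p) = 0 := by
  obtain ⟨u, hu, hul⟩ := h.exists_schw_tendsto hp
  obtain ⟨v, hv, hvl⟩ := h.exists_schw_tendsto hR
  have hκ' : 1 ≤ |-κ| := by rwa [abs_neg]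
  have t1 := tendsto_pairF (b := b) (κ := κ) hul (h.tendsto_ric hκ hul hvl (Eventually.of_forall hu)
    (Eventually.of_forall hv) hp hR)
  have t2 := tendsto_pairF (b := b) (κ := -κ) hvl (h.tendsto_ric hκ' hvl hul (Eventually.of_forall hv)
    (Eventually.of_forall hu) hR hp)
  exact ⟨tendsto_nhds_unique_of_eventuallyEq ((h.tendsto_ld hκ hul hvl hu hv hp hR).const_mul _)
      (t1.const_mul 2) (Eventually.of_forall fun n => h.ld_schwartz hκ (hu n) (hv n)),
    tendsto_nhds_unique_of_eventuallyEq (t1.add t2) tendsto_const_nhds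
      (Eventually.of_forall fun n => h.pairF_add_pairF hκ (hu n) (hv n))⟩

end

/-! ### The Green's function and the determinant for distributions -/

/-- `HasOpTrace` refers to all orthonormal bases, and the unitary Fourier transform maps bases to
bases. -/
lemma hasOpTrace_cj {T : L2 →L[ℂ] L2} {a : ℂ} (h : HasOpTrace T a) : HasOpTrace (cj T) a := by
  classical
  intro ι e
  have := h ι (HilbertBasis.ofRepr ((Lp.fourierTransformₗᵢ ℝ ℂ).symm.trans e.repr))
  have hb : ∀ i, HilbertBasis.ofRepr ((Lp.fourierTransformₗᵢ ℝ ℂ).symm.trans e.repr) i =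
      Lp.fourierTransformₗᵢ ℝ ℂ (e i) := fun i => by
    rw [← HilbertBasis.repr_symm_single, ← e.repr_symm_single]
    rfl
  simp only [hb] at this
  have e1 : ∀ i, inner ℂ (e i) (cj T (e i)) = inner ℂ (Lp.fourierTransformₗᵢ ℝ ℂ (e i))
      (T (Lp.fourierTransformₗᵢ ℝ ℂ (e i))) := fun i => by
    rw [← LinearIsometryEquiv.inner_map_map (Lp.fourierTransformₗᵢ ℝ ℂ)]
    exact congrArg _ (fourier_cj T (e i))
  simp only [e1]
  exact this

section
variable {b κ η σ : ℝ} {q : 𝓢'(ℝ, ℂ)} {p R : L2}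

lemma Rep.hasOpTrace_pow (hr : Rep b σ q p R) (h : Adm b η) (hκ : 1 ≤ |κ|) (hp : ‖p‖ ≤ η)
    (hR : ‖R‖ ≤ η) (m : ℕ) :
    HasOpTrace ((opLambda q κ * opGamma σ q κ) ^ (m + 1)) (trP b κ p R m) := by
  rw [hr.opLambda_eq h.hb0.le h.hb hκ, hr.opGamma_eq h.hb0.le h.hb hκ, ← map_mul, ← map_pow]
  exact hasOpTrace_cj (h.hasOpTrace_pow hκ hp hR m)

lemma Rep.logDetTerm_eq (hr : Rep b σ q p R) (h : Adm b η) (hκ : 1 ≤ |κ|) (hp : ‖p‖ ≤ η)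
    (hR : ‖R‖ ≤ η) (m : ℕ) : logDetTerm σ q κ m = (-1) ^ m / (m + 1) * trP b κ p R m := by
  rw [logDetTerm, (hr.hasOpTrace_pow h hκ hp hR m).opTrace_eq]

/-- Both integrals are equal up to sign, so twice the first one may be written as their difference.
This symmetric form matches the density. -/
lemma Rep.logDet_eq (hr : Rep b σ q p R) (h : Adm b η) (hκ : 1 ≤ |κ|) (hp : ‖p‖ ≤ η)
    (hR : ‖R‖ ≤ η) : logDet σ q κ =
      pairF b κ p (ric b κ η p R) - pairF b (-κ) R (ric b (-κ) η R p) := by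
  obtain ⟨h1, h2⟩ := h.ld_eq hκ hp hR
  simp only [logDet, hr.logDetTerm_eq h hκ hp hR]
  rw [ld] at h1
  rw [h1]
  linear_combination h2

lemma Rep.green_diag (hr : Rep b σ q p R) (h : Adm b η) (hκ : 1 ≤ |κ|) (hp : ‖p‖ ≤ η)
    (hR : ‖R‖ ≤ η) (x : ℝ) :
    let F₁ := ricF b κ η p R x
    let F₂ := ricF b (-κ) η R p x
    g12 σ q κ x = 2 * F₂ / (1 - 4 * F₁ * F₂) ∧ g21 σ q κ x = 2 * F₁ / (1 - 4 * F₁ * F₂) ∧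
      gam σ q κ x = 8 * F₁ * F₂ / (1 - 4 * F₁ * F₂) ∧ 2 + gam σ q κ x = 2 / (1 - 4 * F₁ * F₂) ∧
      2 + gam σ q κ x ≠ 0 := by
  intro F₁ F₂
  have hne : 1 - 4 * F₁ * F₂ ≠ 0 := h.den_ne_zero hκ hp hR x
  obtain ⟨h1, h2, h3, h4⟩ := h.grK_diag hκ hp hR x
  have hg := hr.greenDiff_eq h hκ hp hR
  have h5 : gam σ q κ x = 8 * F₁ * F₂ / (1 - 4 * F₁ * F₂) := by
    rw [gam, hg, mul_add, h3, h4]; ring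
  have h6 : 2 + gam σ q κ x = 2 / (1 - 4 * F₁ * F₂) := by
    rw [h5, eq_div_iff hne, add_mul, div_mul_cancel₀ _ hne]; ring
  refine ⟨?_, ?_, h5, h6, ?_⟩
  · rw [g12, hg]; exact h1
  · rw [g21, hg]; exact h2
  · rw [h6]; exact div_ne_zero two_ne_zero hne

lemma Rep.densityDefined (hr : Rep b σ q p R) (h : Adm b η) (hκ : 1 ≤ |κ|) (hp : ‖p‖ ≤ η)
    (hR : ‖R‖ ≤ η) : DensityDefined σ q κ :=
  ⟨hr.hasGreen h hκ hp hR, fun x => (hr.green_diag h hκ hp hR x).2.2.2.2⟩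

lemma Rep.quotient_eq (hr : Rep b σ q p R) (h : Adm b η) (hκ : 1 ≤ |κ|) (hp : ‖p‖ ≤ η)
    (hR : ‖R‖ ≤ η) (x : ℝ) :
    g21 σ q κ x / (2 + gam σ q κ x) = ricF b κ η p R x ∧
      g12 σ q κ x / (2 + gam σ q κ x) = ricF b (-κ) η R p x := by
  obtain ⟨h1, h2, -, h4, -⟩ := hr.green_diag h hκ hp hR x
  have hne := h.den_ne_zero hκ hp hR x
  rw [h1, h2, h4]
  constructor <;> rw [div_div_div_cancel_right₀ hne, mul_div_cancel_left₀ _ two_ne_zero]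

end

/-! ### Fourier transforms of distributions that are functions -/

/-- Testing with a bump function that is 1 on a ball shows integrability there. -/
lemma IsFourierFun.locallyIntegrable {q : 𝓢'(ℝ, ℂ)} {f : ℝ → ℂ} (h : IsFourierFun q f) :
    LocallyIntegrable f := fun x => by
  let β : ContDiffBump x := ⟨1, 2, one_pos, one_lt_two⟩
  have hs : HasCompactSupport fun y => (β y : ℂ) := β.hasCompactSupport.comp_left ofReal_zero
  have hc : ContDiff ℝ (⊤ : ℕ∞) fun y => (β y : ℂ) := ofRealCLM.contDiff.comp β.contDiff
  refine ⟨Metric.closedBall x 1, Metric.closedBall_mem_nhds x one_pos, ?_⟩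
  have h1 := (h.2 (hs.toSchwartzMap hc)).1.integrableOn (s := Metric.closedBall x 1)
  refine (integrableOn_congr_fun (fun y hy => ?_) Metric.isClosed_closedBall.measurableSet).mp h1
  simp [β.one_of_mem_closedBall hy]

lemma IsFourierFun.ae_eq {q : 𝓢'(ℝ, ℂ)} {f g : ℝ → ℂ} (hf : IsFourierFun q f) (hg : IsFourierFun q g) :
    f =ᵐ[volume] g :=
  ae_eq_of_forall_integral_schwartz hf.locallyIntegrable hg.locallyIntegrable fun φ _ => by
    rw [← (hf.2 φ).2, (hg.2 φ).2]

lemma IsFourierFun.fourierFun_ae {q : 𝓢'(ℝ, ℂ)} {f : ℝ → ℂ} (hf : IsFourierFun q f) :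
    fourierFun q =ᵐ[volume] f := by
  have h : ∃ f, IsFourierFun q f := ⟨f, hf⟩
  rw [fourierFun, dif_pos h]
  exact h.choose_spec.ae_eq hf

lemma isFourierFun_schwartz (q : 𝓢(ℝ, ℂ)) : IsFourierFun q (𝓕 (q : ℝ → ℂ)) := by
  refine ⟨(continuous_fourier q.integrable).aestronglyMeasurable, fun φ => ⟨?_, ?_⟩⟩
  · exact integrable_schwartz_mul φ (continuous_fourier q.integrable)
      fun ξ => VectorFourier.norm_fourierIntegral_le_integral_norm _ _ _ _ _
  · rw [TemperedDistribution.fourier_toTemperedDistributionCLM_eq]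
    exact SchwartzMap.toTemperedDistributionCLM_apply_apply volume _ φ

lemma fourierInv_L2_ae {G : L2} (hG : Integrable G) : (𝓕⁻ G : L2) =ᵐ[volume] 𝓕⁻ (G : ℝ → ℂ) := by
  refine ae_eq_of_forall_integral_schwartz (locallyIntegrable_L2 _)
    (continuous_fourierInv hG).locallyIntegrable fun φ _ => ?_
  rw [integral_mul_fourierInv_L2, integral_fourierInv_mul_flip φ.integrable hG]

lemma isFourierFun_ofL2 {G : L2} (hG : Integrable G) :
    MemLp (𝓕⁻ (G : ℝ → ℂ)) 2 (volume : Measure ℝ) ∧ IsFourierFun (ofL2 (𝓕⁻ (G : ℝ → ℂ))) G := by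
  have h1 := fourierInv_L2_ae hG
  have h2 : MemLp (𝓕⁻ (G : ℝ → ℂ)) 2 (volume : Measure ℝ) := (memLp_congr_ae h1).mp (Lp.memLp _)
  refine ⟨h2, (Lp.memLp G).1, fun φ => ⟨(φ.memLp 2 volume).integrable_mul (Lp.memLp G), ?_⟩⟩
  have h3 : (h2.toLp (𝓕⁻ (G : ℝ → ℂ)) : L2) = 𝓕⁻ G := by
    apply Lp.ext
    exact h2.coeFn_toLp.trans h1.symm
  rw [ofL2, dif_pos h2, h3, ← Lp.fourierInv_toTemperedDistribution_eq,
    FourierTransform.fourier_fourierInv_eq, Lp.toTemperedDistribution_apply]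
  simp only [smul_eq_mul]

lemma weight_eq (s ξ : ℝ) : (4 + (2 * Real.pi * ξ) ^ 2) ^ s = jb 1 ξ ^ (2 * s) := by
  rw [Real.rpow_mul (jb_nonneg 1 ξ), Real.rpow_two, jb_sq]; norm_num

lemma sobolevNorm_eq {s : ℝ} {q : 𝓢'(ℝ, ℂ)} {f : ℝ → ℂ} (hf : IsFourierFun q f) :
    sobolevNorm s q = (∫⁻ ξ, ‖jw 1 s ξ * f ξ‖ₑ ^ 2) ^ (1 / 2 : ℝ) := by
  rw [sobolevNorm, if_pos ⟨f, hf⟩]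
  congr 1
  refine lintegral_congr_ae ?_
  filter_upwards [hf.fourierFun_ae] with ξ h1
  rw [h1, weight_eq, enorm_mul, mul_pow, enorm_sq_eq_ofReal (jw 1 s ξ), norm_jw, ← Real.rpow_natCast,
    ← Real.rpow_mul (jb_nonneg 1 ξ)]
  congr 3
  push_cast; ring

section
variable {b κ η σ s : ℝ}

lemma fourierFunR_ae {q : 𝓢'(ℝ, ℂ)} {p : L2} (h : fourierFun q =ᵐ[volume] fun ξ => jw 1 b ξ * p ξ) :
    Rep b σ q p ((σ : ℂ) • reflC p) := by
  refine ⟨h, ?_⟩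
  filter_upwards [ae_comp_neg h, reflC_ae p, Lp.coeFn_smul (σ : ℂ) (reflC p)] with ξ h1 h2 h3
  rw [fourierFunR, h1, h3, Pi.smul_apply, h2, map_mul, jw_neg, jw, conj_ofReal, smul_eq_mul]
  ring

lemma norm_smul_reflC (hσ : σ = 1 ∨ σ = -1) (p : L2) : ‖(σ : ℂ) • reflC p‖ = ‖p‖ := by
  rw [norm_smul, LinearIsometry.norm_map]
  rcases hσ with rfl | rfl <;> simp

/-- For `-b ≤ s` the H^s norm dominates the H^(-b) norm, since the weight is at least 1. The case `b
= -s` is used as well, for initial data. -/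
lemma exists_rep (σ : ℝ) (hb : -b ≤ s) {q : 𝓢'(ℝ, ℂ)} {δ : ℝ} (hδ : 0 ≤ δ)
    (hq : sobolevNorm s q ≤ ENNReal.ofReal δ) :
    ∃ p : L2, ‖p‖ ≤ δ ∧ Rep b σ q p ((σ : ℂ) • reflC p) := by
  have hex : ∃ f, IsFourierFun q f := by
    by_contra h
    rw [sobolevNorm, if_neg h] at hq
    exact ENNReal.ofReal_ne_top (top_le_iff.mp hq)
  obtain ⟨f, hf⟩ := hex
  rw [sobolevNorm_eq hf] at hq
  have h1 : ∫⁻ ξ, ‖jw 1 s ξ * f ξ‖ₑ ^ 2 ≤ ENNReal.ofReal (δ ^ 2) := by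
    have := ENNReal.rpow_le_rpow hq (by norm_num : (0 : ℝ) ≤ 2)
    rw [← ENNReal.rpow_mul, ENNReal.ofReal_rpow_of_nonneg hδ (by norm_num)] at this
    simpa only [one_div, inv_mul_cancel₀ (two_ne_zero (α := ℝ)), ENNReal.rpow_one, Real.rpow_two] using this
  have h2 : ∫⁻ ξ, ‖jw 1 (-b) ξ * f ξ‖ₑ ^ 2 ≤ ENNReal.ofReal (δ ^ 2) := by
    refine (lintegral_mono fun ξ => ?_).trans h1
    have : ‖jw 1 (-b) ξ * f ξ‖ ≤ ‖jw 1 s ξ * f ξ‖ := by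
      rw [norm_mul, norm_mul, norm_jw, norm_jw]
      gcongr
      exact one_le_jb one_le_abs_one ξ
    rw [enorm_sq_eq_ofReal, enorm_sq_eq_ofReal]
    exact ENNReal.ofReal_le_ofReal (pow_le_pow_left₀ (norm_nonneg _) this 2)
  have hmeas : AEStronglyMeasurable (fun ξ => jw 1 (-b) ξ * f ξ) volume :=
    (measurable_jw 1 (-b)).aestronglyMeasurable.mul hf.1
  have hm : MemLp (fun ξ => jw 1 (-b) ξ * f ξ) 2 (volume : Measure ℝ) := by
    refine ⟨hmeas, ?_⟩
    rw [eLpNorm_lt_top_iff_lintegral_rpow_enorm_lt_top (by norm_num) (by norm_num)]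
    refine lt_of_le_of_lt (b := ENNReal.ofReal (δ ^ 2)) ?_ ENNReal.ofReal_lt_top
    simpa only [ENNReal.toReal_ofNat, ENNReal.rpow_two] using h2
  refine ⟨hm.toLp, norm_le_of_lintegral_enorm_sq_le hδ ?_, fourierFunR_ae ?_⟩
  · refine (lintegral_congr_ae ?_).trans_le h2
    filter_upwards [hm.coeFn_toLp] with ξ h3
    rw [h3]
  · filter_upwards [hf.fourierFun_ae, hm.coeFn_toLp] with ξ h3 h4
    rw [h3, h4, ← mul_assoc, jw_mul_neg one_le_abs_one, one_mul]

lemma Rep.unique {q : 𝓢'(ℝ, ℂ)} {p p' R R' : L2} (h : Rep b σ q p R) (h' : Rep b σ q p' R') : p = p' := by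
  apply Lp.ext
  filter_upwards [h.hq, h'.hq] with ξ h1 h2
  exact mul_left_cancel₀ (jw_ne_zero one_le_abs_one b ξ) (h1.symm.trans h2)

lemma rep_schwartz (hb : 0 ≤ b) (q : 𝓢(ℝ, ℂ)) :
    Rep b σ q (schw b q) ((σ : ℂ) • reflC (schw b q)) :=
  fourierFunR_ae ((isFourierFun_schwartz q).fourierFun_ae.trans (schw_rep hb q))

lemma evF_spec (hb : b < 1 / 2) (hκ : 1 ≤ |κ|) (f : L2) :
    MemLp (evF b κ f) 2 (volume : Measure ℝ) ∧
      IsFourierFun (ofL2 (evF b κ f)) (fun ξ => jw κ (-(1 - b)) ξ * f ξ) := by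
  have hW := memLp_jw_top (κ := κ) (b := 1 - b) (by linarith) hκ
  set G : L2 := mulOp (jw κ (-(1 - b))) f with hG
  have hGe := mulOp_ae hW f
  have hGi : Integrable G := (integrable_congr hGe).mpr (integrable_evF hb hκ f)
  have e : 𝓕⁻ (G : ℝ → ℂ) = evF b κ f := by
    funext x
    exact Real.fourierInv_congr_ae hGe x
  obtain ⟨h1, h2, h3⟩ := isFourierFun_ofL2 hGi
  rw [e] at h1 h3
  refine ⟨h1, h2.congr hGe, fun φ => ?_⟩
  obtain ⟨h4, h5⟩ := h3 φ
  have h6 : (fun ξ => φ ξ * G ξ) =ᵐ[volume] fun ξ => φ ξ * (jw κ (-(1 - b)) ξ * f ξ) := by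
    filter_upwards [hGe] with ξ h7
    rw [h7]
  exact ⟨(integrable_congr h6).mp h4, h5.trans (integral_congr_ae h6)⟩

/-- `evF` produces functions in H^(1-b), and `1 - b > 1/2 ≥ s`. -/
lemma sobolevNorm_evF_lt_top (hb : b < 1 / 2) (hκ : 1 ≤ |κ|) (hs : s ≤ 1 / 2) (hs0 : 0 ≤ s)
    (f : L2) : sobolevNorm s (ofL2 (evF b κ f)) < ⊤ := by
  rw [sobolevNorm_eq (evF_spec hb hκ f).2]
  refine ENNReal.rpow_lt_top_of_nonneg (by norm_num) (ne_of_lt ?_)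
  refine lt_of_le_of_lt (lintegral_mono fun ξ => ?_)
    ((lintegral_enorm_sq_eq f).trans_lt ENNReal.ofReal_lt_top)
  refine pow_le_pow_left₀ (zero_le) (enorm_le_iff_norm_le.mpr ?_) 2
  rw [norm_mul, norm_mul, norm_jw, norm_jw, ← mul_assoc]
  refine mul_le_of_le_one_left (norm_nonneg _) ?_
  have h0 := jb_pos hκ ξ
  calc jb 1 ξ ^ s * jb κ ξ ^ (-(1 - b)) ≤ jb κ ξ ^ s * jb κ ξ ^ (-(1 - b)) := by
        gcongr
        · exact jb_nonneg 1 ξ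
        · exact jb_one_le hκ ξ
    _ = jb κ ξ ^ (s - (1 - b)) := by rw [← Real.rpow_add h0]; ring_nf
    _ ≤ 1 := Real.rpow_le_one_of_one_le_of_nonpos (one_le_jb hκ ξ) (by linarith)

lemma pairing_eq (hb0 : 0 ≤ b) (hb : b < 1 / 2) (hκ : 1 ≤ |κ|) {h : ℝ → ℂ} {p : L2}
    (hh : h =ᵐ[volume] fun ξ => jw 1 b ξ * p ξ) (f : L2) :
    ∫ ξ, h ξ * fourierFun (ofL2 (evF b κ f)) (-ξ) = pairF b κ p f := by
  rw [pairF_eq hb0 hb hκ]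
  refine integral_congr_ae ?_
  filter_upwards [hh, ae_comp_neg (evF_spec hb hκ f).2.fourierFun_ae] with ξ h1 h2
  rw [h1, h2]

/-- The density, for Schwartz functions. -/
lemma Rep.rho_eq {q : 𝓢(ℝ, ℂ)} {p R : L2} (hr : Rep b σ q p R) (h : Adm b η) (hκ : 1 ≤ |κ|)
    (hp : ‖p‖ ≤ η) (hR : ‖R‖ ≤ η) (x : ℝ) :
    rho σ q κ x = q x * ricF b κ η p R x - rFun σ q x * ricF b (-κ) η R p x := by
  obtain ⟨h1, h2⟩ := hr.quotient_eq h hκ hp hR x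
  rw [rho, ← h1, ← h2]; ring

/-- The Schwartz function `r = σ q̄`. -/
def rS (σ : ℝ) (q : 𝓢(ℝ, ℂ)) : 𝓢(ℝ, ℂ) := σ • SchwartzMap.postcompCLM (𝕜 := ℝ) conjCLE.toContinuousLinearMap q

lemma rS_apply (σ : ℝ) (q : 𝓢(ℝ, ℂ)) (x : ℝ) : rS σ q x = rFun σ q x := by
  change σ • conj (q x) = _
  rw [rFun, real_smul]

lemma schw_rS (hb : 0 ≤ b) (σ : ℝ) (q : 𝓢(ℝ, ℂ)) : schw b (rS σ q) = (σ : ℂ) • reflC (schw b q) := by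
  apply Lp.ext
  filter_upwards [schw_ae hb (rS σ q), reflC_ae (schw b q), Lp.coeFn_smul (σ : ℂ) (reflC (schw b q)),
    ae_comp_neg (schw_ae hb q)] with ξ h1 h2 h3 h4
  rw [h1, h3, Pi.smul_apply, h2, h4, map_mul, jw_neg, jw, conj_ofReal, smul_eq_mul, mul_left_comm]
  congr 1
  rw [fourier_eq_integral_chr, fourier_eq_integral_chr, ← integral_conj, ← integral_const_mul]
  refine integral_congr_ae (ae_of_all _ fun x => ?_)
  simp only [rS_apply, rFun, map_mul, conj_chr]
  rw [chr]
  push_cast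
  ring_nf

end

/-! ### Lax pairs and conservation laws -/

/-- Bounded functions. -/
def Bd (f : ℝ → ℂ) : Prop := ∃ M, ∀ x, ‖f x‖ ≤ M

lemma Bd.const (c : ℂ) : Bd fun _ => c := ⟨‖c‖, fun _ => le_rfl⟩

lemma Bd.add {f g : ℝ → ℂ} (hf : Bd f) (hg : Bd g) : Bd fun x => f x + g x := by
  obtain ⟨M, hM⟩ := hf
  obtain ⟨N, hN⟩ := hg
  exact ⟨M + N, fun x => norm_add_le_of_le (hM x) (hN x)⟩

lemma Bd.mul {f g : ℝ → ℂ} (hf : Bd f) (hg : Bd g) : Bd fun x => f x * g x := by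
  obtain ⟨M, hM⟩ := hf
  obtain ⟨N, hN⟩ := hg
  refine ⟨M * N, fun x => ?_⟩
  rw [norm_mul]
  exact mul_le_mul (hM x) (hN x) (norm_nonneg _) ((norm_nonneg _).trans (hM x))

lemma Bd.neg {f : ℝ → ℂ} (hf : Bd f) : Bd fun x => -f x :=
  hf.imp fun M hM x => by rw [norm_neg]; exact hM x

lemma Bd.sub {f g : ℝ → ℂ} (hf : Bd f) (hg : Bd g) : Bd fun x => f x - g x := by
  simpa only [sub_eq_add_neg] using hf.add hg.neg

/-- The functions `A`, `B`, `C` are the entries of the time component of a Lax pair for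
`qₜ = u`, `rₜ = v` at the spectral parameter `κ`. -/
structure Lax (κ : ℝ) (q r u v A B C : ℝ → ℂ) : Prop where
  derivA : ∀ x, HasDerivAt A (q x * C x - r x * B x) x
  derivB : ∀ x, HasDerivAt B (u x + 2 * κ * B x - 2 * q x * A x) x
  derivC : ∀ x, HasDerivAt C (v x - 2 * κ * C x + 2 * r x * A x) x
  bddA : Bd A
  bddB : Bd B
  bddC : Bd C
  lim : ∃ a, Tendsto A (cocompact ℝ) (𝓝 a)

namespace Lax
variable {κ : ℝ} {q r u v A B C u' v' A' B' C' F E : ℝ → ℂ}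

/-- The same symmetry as for Riccati pairs; it makes every statement about `q F₁` available for `r
F₂`. -/
lemma swap (h : Lax κ q r u v A B C) : Lax (-κ) r q v u (-A) C B where
  derivA x := (h.derivA x).neg.congr_deriv (by ring)
  derivB x := (h.derivC x).congr_deriv (by simp only [Pi.neg_apply]; push_cast; ring)
  derivC x := (h.derivB x).congr_deriv (by simp only [Pi.neg_apply]; push_cast; ring)
  bddA := h.bddA.neg
  bddB := h.bddC
  bddC := h.bddB
  lim := h.lim.elim fun a ha => ⟨-a, ha.neg⟩

lemma of_eq (h : Lax κ q r u v A B C) (hu : ∀ x, u' x = u x) (hv : ∀ x, v' x = v x) :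
    Lax κ q r u' v' A B C := by rwa [funext hu, funext hv]

lemma add (h : Lax κ q r u v A B C) (h' : Lax κ q r u' v' A' B' C') :
    Lax κ q r (u + u') (v + v') (A + A') (B + B') (C + C') where
  derivA x := ((h.derivA x).add (h'.derivA x)).congr_deriv (by simp only [Pi.add_apply]; ring)
  derivB x := ((h.derivB x).add (h'.derivB x)).congr_deriv (by simp only [Pi.add_apply]; ring)
  derivC x := ((h.derivC x).add (h'.derivC x)).congr_deriv (by simp only [Pi.add_apply]; ring)
  bddA := h.bddA.add h'.bddA
  bddB := h.bddB.add h'.bddB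
  bddC := h.bddC.add h'.bddC
  lim := by
    obtain ⟨a, ha⟩ := h.lim
    obtain ⟨a', ha'⟩ := h'.lim
    exact ⟨a + a', ha.add ha'⟩

/-- The evolution of the bounded solution of the Riccati equation. -/
lemma tangent (h : Lax κ q r u v A B C) (hκ : κ ≠ 0) (hqc : Continuous q) (hqi : Integrable q)
    (hF : ∀ x, HasDerivAt F (-2 * κ * F x + r x / 2 - 2 * q x * F x ^ 2) x) {M : ℝ}
    (hFM : ∀ x, ‖F x‖ ≤ M)
    (hE : ∀ x, HasDerivAt E (-2 * κ * E x + v x / 2 - 2 * u x * F x ^ 2 - 4 * q x * F x * E x) x)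
    {M' : ℝ} (hEM : ∀ x, ‖E x‖ ≤ M') (x : ℝ) :
    2 * E x = C x - 4 * A x * F x - 4 * B x * F x ^ 2 := by
  obtain ⟨⟨K₁, h1⟩, ⟨K₂, h2⟩, ⟨K₃, h3⟩⟩ := And.intro h.bddA (And.intro h.bddB h.bddC)
  have hFc : Continuous F := continuous_iff_continuousAt.mpr fun x => (hF x).continuousAt
  have hg : Integrable fun x => -4 * (q x * F x) := by
    simp only [mul_comm (q _)]
    exact (hqi.bdd_mul hFc.aestronglyMeasurable (ae_of_all _ hFM)).const_mul _
  have hM0 : 0 ≤ M := (norm_nonneg _).trans (hFM 0)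
  have hK1 : 0 ≤ K₁ := (norm_nonneg _).trans (h1 0)
  have hK2 : 0 ≤ K₂ := (norm_nonneg _).trans (h2 0)
  -- The difference of the two sides is bounded and solves `y' = (-2κ - 4 q F) y`.
  have := eq_zero_of_bounded_solution (c := -2 * κ) (by simpa using hκ) hg
    (continuous_const.mul (hqc.mul hFc))
    (y := fun x => 2 * E x - (C x - 4 * A x * F x - 4 * B x * F x ^ 2)) (fun x => by
      refine (((hE x).const_mul 2).sub (((h.derivC x).sub (((h.derivA x).const_mul 4).mul (hF x))).sub
        (((h.derivB x).const_mul 4).mul ((hF x).pow 2)))).congr_deriv ?_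
      simp only [Pi.pow_apply]
      push_cast
      ring) (C := 2 * M' + (K₃ + 4 * K₁ * M + 4 * K₂ * M ^ 2)) (fun x => by
      have h4 := hFM x
      have h5 : ‖4 * A x * F x‖ ≤ 4 * K₁ * M := by
        rw [norm_mul, norm_mul, RCLike.norm_ofNat]; gcongr; exact h1 x
      have h6 : ‖4 * B x * F x ^ 2‖ ≤ 4 * K₂ * M ^ 2 := by
        rw [norm_mul, norm_mul, norm_pow, RCLike.norm_ofNat]; gcongr; exact h2 x
      have h7 : ‖2 * E x‖ ≤ 2 * M' := by
        rw [norm_mul, RCLike.norm_ofNat]; gcongr; exact hEM x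
      exact norm_sub_le_of_le h7 (norm_sub_le_of_le (norm_sub_le_of_le (h3 x) h5) h6))
  exact sub_eq_zero.mp (congrFun this x)

/-- Once the time derivative `E` of `F` is known algebraically, the time derivative of `q F` is seen
to be an exact `x` derivative: the quadratic terms in `F` cancel between the equation of `B` and the
Riccati equation. -/
lemma hasDerivAt_flux (h : Lax κ q r u v A B C)
    (hF : ∀ x, HasDerivAt F (-2 * κ * F x + r x / 2 - 2 * q x * F x ^ 2) x)
    (hE : ∀ x, 2 * E x = C x - 4 * A x * F x - 4 * B x * F x ^ 2) (x : ℝ) :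
    HasDerivAt (fun x => A x / 2 + B x * F x) (u x * F x + q x * E x) x :=
  (((h.derivA x).div_const 2).add ((h.derivB x).mul (hF x))).congr_deriv (by
    linear_combination (-q x / 2) * hE x)

end Lax

section
variable {b κ η σ : ℝ}

lemma hasDerivAt_apply_schwartz {q : ℝ → 𝓢(ℝ, ℂ)} {t : ℝ} {v : 𝓢(ℝ, ℂ)}
    (h : Tendsto (slope q t) (𝓝[≠] t) (𝓝 v)) {G : Type*} [NormedAddCommGroup G] [NormedSpace ℂ G]
    (T : 𝓢(ℝ, ℂ) →L[ℂ] G) : HasDerivAt (fun τ => T (q τ)) (T v) t := by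
  rw [hasDerivAt_iff_tendsto_slope]
  refine ((T.continuous.tendsto v).comp h).congr fun τ => ?_
  simp only [Function.comp_apply, slope, vsub_eq_sub]
  rw [ContinuousLinearMap.map_smul_of_tower, map_sub]

/-- The evaluation at a point. -/
def evalS (x : ℝ) : 𝓢(ℝ, ℂ) →L[ℂ] ℂ :=
  (BoundedContinuousFunction.evalCLM ℂ x) ∘L (SchwartzMap.toBoundedContinuousFunctionCLM ℂ ℝ ℂ)

/-- A curve of Schwartz functions with a velocity at `t`. -/
structure Flow (q : ℝ → 𝓢(ℝ, ℂ)) (v : 𝓢(ℝ, ℂ)) (t : ℝ) : Prop where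
  slope : Tendsto (slope q t) (𝓝[≠] t) (𝓝 v)

lemma Flow.hasDerivAt {q : ℝ → 𝓢(ℝ, ℂ)} {v : 𝓢(ℝ, ℂ)} {t : ℝ} (h : Flow q v t) {G : Type*}
    [NormedAddCommGroup G] [NormedSpace ℂ G]
    (T : 𝓢(ℝ, ℂ) →L[ℂ] G) : HasDerivAt (fun τ => T (q τ)) (T v) t := hasDerivAt_apply_schwartz h.slope T

/-- The reflection `q ↦ r = σ q̄` as a continuous real linear map. -/
def rSL (σ : ℝ) : 𝓢(ℝ, ℂ) →L[ℝ] 𝓢(ℝ, ℂ) := σ • SchwartzMap.postcompCLM (𝕜 := ℝ) conjCLE.toContinuousLinearMap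

lemma Flow.rS {q : ℝ → 𝓢(ℝ, ℂ)} {v : 𝓢(ℝ, ℂ)} {t : ℝ} (h : Flow q v t) (σ : ℝ) :
    Flow (fun τ => rS σ (q τ)) (rS σ v) t := by
  refine ⟨(((rSL σ).continuous.tendsto v).comp h.slope).congr fun τ => ?_⟩
  simp only [Function.comp_apply, _root_.slope, vsub_eq_sub]
  rw [map_smul, map_sub]
  rfl

/-- The solution of the Riccati equation is differentiable in time, its velocity solves the
linearized equation, and `Lax.tangent` identifies it. The pointwise law follows from the flux
identity and the conservation of the integral from the behaviour of the flux at infinity. -/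
lemma Adm.conservation (h : Adm b η) (hκ : 1 ≤ |κ|) {q r : ℝ → 𝓢(ℝ, ℂ)} {u v : 𝓢(ℝ, ℂ)} {t : ℝ}
    (hq : Flow q u t) (hr : Flow r v t) (hqη : ‖schw b (q t)‖ < η) (hrη : ‖schw b (r t)‖ < η)
    {A B C : ℝ → ℂ} (hL : Lax κ (q t) (r t) u v A B C) :
    (∀ x, ∃ d, HasDerivAt (fun τ => q τ x * ricF b κ η (schw b (q τ)) (schw b (r τ)) x) d t ∧
      HasDerivAt (fun x => A x / 2 + B x * ricF b κ η (schw b (q t)) (schw b (r t)) x) d x) ∧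
    HasDerivAt (fun τ => pairF b κ (schw b (q τ)) (ric b κ η (schw b (q τ)) (schw b (r τ)))) 0 t := by
  have hdq := hq.hasDerivAt (schw b)
  have hdr := hr.hasDerivAt (schw b)
  obtain ⟨D, hD, hD'⟩ := h.exists_hasDerivAt_ric hκ hdq hdr
    ((hdq.continuousAt.norm.eventually_lt continuousAt_const hqη).mono fun _ => le_of_lt)
    ((hdr.continuousAt.norm.eventually_lt continuousAt_const hrη).mono fun _ => le_of_lt)
  have hκ0 : κ ≠ 0 := by rintro rfl; norm_num at hκ
  have hode := fun x => h.hasDerivAt_ricF hκ hqη.le hrη.le x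
  have hle := h.norm_ricF_le hκ hqη.le hrη.le
  have htan := hL.tangent hκ0 (q t).continuous (q t).integrable hode hle hD' (norm_evF_le h.hb hκ D)
  have hflux := hL.hasDerivAt_flux hode htan
  refine ⟨fun x => ⟨_, ?_, hflux x⟩, ?_⟩
  · exact (hq.hasDerivAt (evalS x)).mul (hasDerivAt_evF_curve h.hb hκ hD x)
  · refine (hasDerivAt_pairF hdq hD).congr_deriv ?_
    rw [pairF_schw h.hb0.le h.hb hκ, pairF_schw h.hb0.le h.hb hκ]
    have i1 : Integrable fun x => u x * ricF b κ η (schw b (q t)) (schw b (r t)) x :=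
      integrable_schwartz_mul u (h.continuous_ricF hκ _ _) hle
    have i2 : Integrable fun x => q t x * evF b κ D x :=
      integrable_schwartz_mul (q t) (continuous_evF h.hb hκ D) (norm_evF_le h.hb hκ D)
    -- `A` has the same limit at both ends. Subtracting half of it makes the flux vanish at
    -- infinity, as `B` is bounded and the Riccati solution decays.
    obtain ⟨a, ha⟩ := hL.lim
    obtain ⟨M, hM⟩ := hL.bddB
    have hz := integral_deriv_eq_zero (f := fun x => A x / 2 +
      B x * ricF b κ η (schw b (q t)) (schw b (r t)) x - a / 2) (fun x => (hflux x).sub_const _) (i1.add i2) (by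
        have h1 : Tendsto (fun x => B x * ricF b κ η (schw b (q t)) (schw b (r t)) x) (cocompact ℝ) (𝓝 0) := by
          refine squeeze_zero_norm (a := fun x => M * ‖ricF b κ η (schw b (q t)) (schw b (r t)) x‖)
            (fun x => ?_) ?_
          · rw [norm_mul]; gcongr; exact hM x
          · simpa using (AKNS.tendsto_ricF b κ η (schw b (q t)) (schw b (r t))).norm.const_mul M
        have h2 := ((ha.div_const 2).add h1).sub_const (a / 2)
        rwa [add_zero, sub_self] at h2)
    exact (integral_add i1 i2).symm.trans hz

end

/-! ### The Lax pairs of the flows -/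

/-- The derivative of a Schwartz function. -/
def dS : 𝓢(ℝ, ℂ) →L[ℂ] 𝓢(ℝ, ℂ) := SchwartzMap.derivCLM ℂ ℂ

lemma dS_eq (f : 𝓢(ℝ, ℂ)) : (dS f : ℝ → ℂ) = deriv f := rfl

lemma iteratedDeriv_two_eq (f : 𝓢(ℝ, ℂ)) : iteratedDeriv 2 (f : ℝ → ℂ) = dS (dS f) := by
  rw [iteratedDeriv_succ, iteratedDeriv_one]; rfl

lemma iteratedDeriv_three_eq (f : 𝓢(ℝ, ℂ)) : iteratedDeriv 3 (f : ℝ → ℂ) = dS (dS (dS f)) := by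
  rw [iteratedDeriv_succ, iteratedDeriv_two_eq]; rfl

lemma hasDerivAt_schwartz (f : 𝓢(ℝ, ℂ)) (x : ℝ) : HasDerivAt f (dS f x) x :=
  f.differentiableAt.hasDerivAt

lemma Bd.schwartz (f : 𝓢(ℝ, ℂ)) : Bd f :=
  ⟨_, fun x => (BoundedContinuousFunction.norm_coe_le_norm
    (SchwartzMap.toBoundedContinuousFunction f) x)⟩

lemma tendsto_schwartz (f : 𝓢(ℝ, ℂ)) : Tendsto f (cocompact ℝ) (𝓝 0) := zero_at_infty f

lemma dS_rS (σ : ℝ) (q : 𝓢(ℝ, ℂ)) : dS (rS σ q) = rS σ (dS q) := by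
  ext x
  have h : HasDerivAt (rS σ q) (σ • conj (dS q x)) x :=
    (conjCLE.toContinuousLinearMap.hasFDerivAt.comp_hasDerivAt x (hasDerivAt_schwartz q x)).const_smul σ
  exact h.deriv

lemma rS_apply' (σ : ℝ) (q : 𝓢(ℝ, ℂ)) (x : ℝ) : rS σ q x = σ * conj (q x) := rS_apply σ q x

section
variable (κ : ℝ) (q r : 𝓢(ℝ, ℂ))

/-- The usual polynomial ansatz in the spectral parameter. The constant `2iκ²` in `A` does not
affect the equation of `A`; it is forced by the equations of `B` and `C`. -/
lemma lax_nls : Lax κ q r (fun x => I * (dS (dS q) x) - 2 * I * q x ^ 2 * r x)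
    (fun x => -I * (dS (dS r) x) + 2 * I * r x ^ 2 * q x)
    (fun x => 2 * I * κ ^ 2 - I * (q x * r x)) (fun x => I * (dS q x + 2 * κ * q x))
    (fun x => I * (2 * κ * r x - dS r x)) where
  derivA x := (((hasDerivAt_schwartz q x).mul (hasDerivAt_schwartz r x)).const_mul I).const_sub
    (2 * I * (κ : ℂ) ^ 2) |>.congr_deriv (by ring)
  derivB x := (((hasDerivAt_schwartz (dS q) x).add ((hasDerivAt_schwartz q x).const_mul
    (2 * (κ : ℂ)))).const_mul I).congr_deriv (by ring)
  derivC x := ((((hasDerivAt_schwartz r x).const_mul (2 * (κ : ℂ))).sub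
    (hasDerivAt_schwartz (dS r) x)).const_mul I).congr_deriv (by ring)
  bddA := (Bd.const _).sub ((Bd.const _).mul ((Bd.schwartz q).mul (Bd.schwartz r)))
  bddB := (Bd.const _).mul ((Bd.schwartz (dS q)).add ((Bd.const _).mul (Bd.schwartz q)))
  bddC := (Bd.const _).mul (((Bd.const _).mul (Bd.schwartz r)).sub (Bd.schwartz (dS r)))
  lim := ⟨_, tendsto_const_nhds.sub (((tendsto_schwartz q).mul (tendsto_schwartz r)).const_mul I)⟩

lemma lax_mkdv : Lax κ q r (fun x => -dS (dS (dS q)) x + 6 * q x * r x * dS q x)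
    (fun x => -dS (dS (dS r)) x + 6 * q x * r x * dS r x)
    (fun x => dS q x * r x - q x * dS r x + 2 * κ * (q x * r x) - 4 * κ ^ 3)
    (fun x => 2 * (q x * q x * r x) - dS (dS q) x - 2 * κ * dS q x - 4 * κ ^ 2 * q x)
    (fun x => 2 * (r x * r x * q x) - dS (dS r) x + 2 * κ * dS r x - 4 * κ ^ 2 * r x) where
  derivA x := ((((hasDerivAt_schwartz (dS q) x).mul (hasDerivAt_schwartz r x)).sub
    ((hasDerivAt_schwartz q x).mul (hasDerivAt_schwartz (dS r) x))).add
    (((hasDerivAt_schwartz q x).mul (hasDerivAt_schwartz r x)).const_mul (2 * (κ : ℂ)))).sub_const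
    (4 * (κ : ℂ) ^ 3) |>.congr_deriv (by ring)
  derivB x := (((((((hasDerivAt_schwartz q x).mul (hasDerivAt_schwartz q x)).mul
    (hasDerivAt_schwartz r x)).const_mul 2).sub (hasDerivAt_schwartz (dS (dS q)) x)).sub
    ((hasDerivAt_schwartz (dS q) x).const_mul (2 * (κ : ℂ)))).sub
    ((hasDerivAt_schwartz q x).const_mul (4 * (κ : ℂ) ^ 2))).congr_deriv (by
      simp only [Pi.mul_apply]; ring)
  derivC x := (((((((hasDerivAt_schwartz r x).mul (hasDerivAt_schwartz r x)).mul
    (hasDerivAt_schwartz q x)).const_mul 2).sub (hasDerivAt_schwartz (dS (dS r)) x)).add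
    ((hasDerivAt_schwartz (dS r) x).const_mul (2 * (κ : ℂ)))).sub
    ((hasDerivAt_schwartz r x).const_mul (4 * (κ : ℂ) ^ 2))).congr_deriv (by
      simp only [Pi.mul_apply]; ring)
  bddA := ((((Bd.schwartz (dS q)).mul (Bd.schwartz r)).sub ((Bd.schwartz q).mul
    (Bd.schwartz (dS r)))).add ((Bd.const _).mul ((Bd.schwartz q).mul (Bd.schwartz r)))).sub (Bd.const _)
  bddB := ((((Bd.const _).mul (((Bd.schwartz q).mul (Bd.schwartz q)).mul (Bd.schwartz r))).sub
    (Bd.schwartz (dS (dS q)))).sub ((Bd.const _).mul (Bd.schwartz (dS q)))).sub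
    ((Bd.const _).mul (Bd.schwartz q))
  bddC := ((((Bd.const _).mul (((Bd.schwartz r).mul (Bd.schwartz r)).mul (Bd.schwartz q))).sub
    (Bd.schwartz (dS (dS r)))).add ((Bd.const _).mul (Bd.schwartz (dS r)))).sub
    ((Bd.const _).mul (Bd.schwartz r))
  lim := ⟨_, ((((tendsto_schwartz (dS q)).mul (tendsto_schwartz r)).sub ((tendsto_schwartz q).mul
    (tendsto_schwartz (dS r)))).add (((tendsto_schwartz q).mul (tendsto_schwartz r)).const_mul _)).sub
    tendsto_const_nhds⟩

/-- Phase rotation, and below it translation, are the symmetry flows that account for the terms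
`4κ²q` and `4κ²q'` of the difference flows. -/
lemma lax_phase (c : ℂ) : Lax κ q r (fun x => 2 * c * q x) (fun x => -(2 * c * r x))
    (fun _ => c) (fun _ => 0) (fun _ => 0) where
  derivA x := (hasDerivAt_const x c).congr_deriv (by ring)
  derivB x := (hasDerivAt_const x (0 : ℂ)).congr_deriv (by ring)
  derivC x := (hasDerivAt_const x (0 : ℂ)).congr_deriv (by ring)
  bddA := Bd.const _
  bddB := Bd.const _
  bddC := Bd.const _
  lim := ⟨_, tendsto_const_nhds⟩

lemma lax_translation (c : ℂ) : Lax κ q r (fun x => c * dS q x) (fun x => c * dS r x)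
    (fun _ => c * κ) (fun x => c * q x) (fun x => c * r x) where
  derivA x := (hasDerivAt_const x (c * (κ : ℂ))).congr_deriv (by ring)
  derivB x := ((hasDerivAt_schwartz q x).const_mul c).congr_deriv (by ring)
  derivC x := ((hasDerivAt_schwartz r x).const_mul c).congr_deriv (by ring)
  bddA := Bd.const _
  bddB := (Bd.const _).mul (Bd.schwartz q)
  bddC := (Bd.const _).mul (Bd.schwartz r)
  lim := ⟨_, tendsto_const_nhds⟩

end

/-! ### The Lax pair of the flow of the logarithmic determinant -/

namespace RicPair
variable {k : ℝ} {q r F₁ F₂ : ℝ → ℂ}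

/-- `2 F₂ / (1 - 4 F₁ F₂)`. -/
def G (F₁ F₂ : ℝ → ℂ) (x : ℝ) : ℂ := 2 * F₂ x / (1 - 4 * F₁ x * F₂ x)

/-- `8 F₁ F₂ / (1 - 4 F₁ F₂)`. -/
def Gam (F₁ F₂ : ℝ → ℂ) (x : ℝ) : ℂ := 8 * F₁ x * F₂ x / (1 - 4 * F₁ x * F₂ x)

/-- Together with the next two derivative formulas, this is the closed linear system of the diagonal
Green's functions, `g₁₂' = 2k g₁₂ + q (1 + γ)` and its companions. Linearity in `(g₁₂, g₂₁, 1 + γ)`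
is what turns them into the time components of a Lax pair. -/
lemma hasDerivAt_G (h : RicPair k q r F₁ F₂) (x : ℝ) :
    HasDerivAt (G F₁ F₂) (2 * k * G F₁ F₂ x + q x * (1 + Gam F₁ F₂ x)) x := by
  have hne := h.ne_zero x
  refine (((h.ode₂ x).const_mul 2).div (h.hasDerivAt_den x) hne).congr_deriv ?_
  rw [div_eq_iff (pow_ne_zero 2 hne), G, Gam]
  linear_combination (-(2 * k) * (1 - 4 * F₁ x * F₂ x)) * div_mul_cancel₀ (2 * F₂ x) hne -
    q x * (1 - 4 * F₁ x * F₂ x) * div_mul_cancel₀ (8 * F₁ x * F₂ x) hne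

lemma Gam_comm : Gam F₂ F₁ = Gam F₁ F₂ := by
  funext x
  rw [Gam, Gam]; congr 1 <;> ring

lemma hasDerivAt_G_swap (h : RicPair k q r F₁ F₂) (x : ℝ) :
    HasDerivAt (G F₂ F₁) (-2 * k * G F₂ F₁ x + r x * (1 + Gam F₁ F₂ x)) x := by
  have := h.swap.hasDerivAt_G x
  rw [Gam_comm] at this
  exact this.congr_deriv (by push_cast; ring)

lemma hasDerivAt_Gam (h : RicPair k q r F₁ F₂) (x : ℝ) :
    HasDerivAt (Gam F₁ F₂) (2 * (q x * G F₂ F₁ x + r x * G F₁ F₂ x)) x := by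
  have hne := h.ne_zero x
  have hne' := h.swap.ne_zero x
  refine ((((h.ode₁ x).const_mul 8).mul (h.ode₂ x)).div (h.hasDerivAt_den x) hne).congr_deriv ?_
  have e : G F₂ F₁ x = 2 * F₁ x / (1 - 4 * F₁ x * F₂ x) := by rw [G]; congr 1; ring
  rw [div_eq_iff (pow_ne_zero 2 hne), e, G]
  simp only [Pi.mul_apply]
  linear_combination (-2 * q x * (1 - 4 * F₁ x * F₂ x)) * div_mul_cancel₀ (2 * F₁ x) hne -
    2 * r x * (1 - 4 * F₁ x * F₂ x) * div_mul_cancel₀ (2 * F₂ x) hne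

lemma bd_inv (h : RicPair k q r F₁ F₂) : Bd fun x => (1 - 4 * F₁ x * F₂ x)⁻¹ := ⟨_, h.norm_inv_den_le⟩

lemma bd_G (h : RicPair k q r F₁ F₂) : Bd (G F₁ F₂) :=
  ((Bd.const 2).mul ⟨_, h.le₂⟩).mul h.bd_inv

lemma bd_Gam (h : RicPair k q r F₁ F₂) : Bd (Gam F₁ F₂) :=
  (((Bd.const 8).mul ⟨_, h.le₁⟩).mul ⟨_, h.le₂⟩).mul h.bd_inv

lemma tendsto_Gam (h1 : Tendsto F₁ (cocompact ℝ) (𝓝 0))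
    (h2 : Tendsto F₂ (cocompact ℝ) (𝓝 0)) : Tendsto (Gam F₁ F₂) (cocompact ℝ) (𝓝 0) := by
  have h3 : Tendsto (fun x => 1 - 4 * F₁ x * F₂ x) (cocompact ℝ) (𝓝 1) := by
    simpa using tendsto_const_nhds.sub ((h1.const_mul 4).mul h2)
  have h4 := ((h1.const_mul 8).mul h2).div h3 one_ne_zero
  rw [mul_zero, zero_div] at h4
  exact h4

/-- The flow of the logarithmic determinant. -/
lemma lax (h : RicPair k q r F₁ F₂) (h1 : Tendsto F₁ (cocompact ℝ) (𝓝 0))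
    (h2 : Tendsto F₂ (cocompact ℝ) (𝓝 0)) {κ : ℝ} (hk : k ≠ κ) (c : ℂ) :
    Lax κ q r (fun x => 2 * c * G F₁ F₂ x) (fun x => 2 * c * G F₂ F₁ x)
      (fun x => -c / (2 * (k - κ)) * (1 + Gam F₁ F₂ x)) (fun x => c / (k - κ) * G F₁ F₂ x)
      (fun x => -c / (k - κ) * G F₂ F₁ x) := by
  have hne : (k - κ : ℂ) ≠ 0 := by rw [← ofReal_sub]; exact ofReal_ne_zero.mpr (sub_ne_zero.mpr hk)
  refine ⟨fun x => ?_, fun x => ?_, fun x => ?_, (Bd.const _).mul ((Bd.const _).add h.bd_Gam),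
    (Bd.const _).mul h.bd_G, (Bd.const _).mul h.swap.bd_G,
    ⟨_, ((tendsto_Gam h1 h2).const_add 1).const_mul _⟩⟩
  · refine (((h.hasDerivAt_Gam x).const_add 1).const_mul _).congr_deriv ?_
    field_simp
    ring
  · refine ((h.hasDerivAt_G x).const_mul _).congr_deriv ?_
    field_simp
    ring
  · refine ((h.hasDerivAt_G_swap x).const_mul _).congr_deriv ?_
    field_simp
    ring

end RicPair

/-! ### Complex conjugation of the Green's functions -/

section
variable {b κ η σ : ℝ}

lemma norm_schw_rS (hb : 0 ≤ b) (hσ : σ = 1 ∨ σ = -1) (q : 𝓢(ℝ, ℂ)) : ‖schw b (rS σ q)‖ = ‖schw b q‖ := by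
  rw [schw_rS hb, norm_smul_reflC hσ]

lemma rep_schwartz' (hb : 0 ≤ b) (q : 𝓢(ℝ, ℂ)) : Rep b σ q (schw b q) (schw b (rS σ q)) := by
  rw [schw_rS hb]; exact rep_schwartz hb q

/-- Complex conjugation exchanges the two solutions of the Riccati equations. -/
lemma Adm.conj_ricF (h : Adm b η) (hκ : 1 ≤ |κ|) (hσ : σ = 1 ∨ σ = -1) {q : 𝓢(ℝ, ℂ)}
    (hq : ‖schw b q‖ ≤ η) (x : ℝ) :
    σ * conj (ricF b κ η (schw b q) (schw b (rS σ q)) x) =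
      ricF b κ η (schw b (rS σ q)) (schw b q) x := by
  have hr : ‖schw b (rS σ q)‖ ≤ η := by rwa [norm_schw_rS h.hb0.le hσ]
  have hκ0 : κ ≠ 0 := by rintro rfl; norm_num at hκ
  set F := ricF b κ η (schw b q) (schw b (rS σ q)) with hF
  set H := ricF b κ η (schw b (rS σ q)) (schw b q) with hH
  have hσ2 : (σ : ℂ) * σ = 1 := by rcases hσ with rfl | rfl <;> norm_num
  have hσn : ‖(σ : ℂ)‖ = 1 := by rcases hσ with rfl | rfl <;> simp
  have hFle := h.norm_ricF_le hκ hq hr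
  have hHle := h.norm_ricF_le hκ hr hq
  have hFc : Continuous fun x => σ * conj (F x) :=
    continuous_const.mul (continuous_conj.comp (h.continuous_ricF hκ _ _))
  have hHc := h.continuous_ricF hκ (schw b (rS σ q)) (schw b q)
  have hsum : ∀ x, ‖σ * conj (F x) + H x‖ ≤ 1 / 4 + 1 / 4 := fun x => by
    refine norm_add_le_of_le ?_ (hHle x)
    rw [norm_mul, hσn, one_mul, RCLike.norm_conj]
    exact hFle x
  -- `σ conj F` and `H` solve the same Riccati equation. Its quadratic term is a difference of
  -- squares, so their difference solves a linear equation with the integrable coefficient `-2 r (σ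
  -- conj F + H)`.
  have hz := eq_zero_of_bounded_solution (c := -2 * κ) (by simpa using hκ0)
    (g := fun x => rS σ q x * (-2 * (σ * conj (F x) + H x)))
    (integrable_schwartz_mul (rS σ q) (continuous_const.mul (hFc.add hHc))
      (C := 2 * (1 / 4 + 1 / 4)) fun x => by
        rw [norm_mul]; simp only [norm_neg, RCLike.norm_ofNat]
        gcongr; exact hsum x)
    ((rS σ q).continuous.mul (continuous_const.mul (hFc.add hHc)))
    (y := fun x => σ * conj (F x) - H x) (fun x => by
      have h1 := ((conjCLE.toContinuousLinearMap.hasFDerivAt.comp_hasDerivAt x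
        (h.hasDerivAt_ricF hκ hq hr x)).const_mul (σ : ℂ)).sub (h.hasDerivAt_ricF hκ hr hq x)
      refine h1.congr_deriv ?_
      change (σ : ℂ) * (starRingEnd ℂ) _ - _ = _
      simp only [← hF, ← hH, map_sub, map_add, map_mul, map_neg, map_ofNat, conj_ofReal, map_pow, map_div₀,
        rS_apply', conj_conj]
      push_cast
      linear_combination (q x / 2 + 2 * σ * conj (q x) * conj (F x) ^ 2) * hσ2)
    (C := 1 / 4 + 1 / 4) (fun x => by
      refine norm_sub_le_of_le ?_ (hHle x)
      rw [norm_mul, hσn, one_mul, RCLike.norm_conj]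
      exact hFle x)
  exact sub_eq_zero.mp (congrFun hz x)

lemma Adm.conj_G (h : Adm b η) (hκ : 1 ≤ |κ|) (hσ : σ = 1 ∨ σ = -1) {q : 𝓢(ℝ, ℂ)}
    (hq : ‖schw b q‖ ≤ η) (x : ℝ) :
    σ * conj (RicPair.G (ricF b κ η (schw b q) (schw b (rS σ q)))
        (ricF b (-κ) η (schw b (rS σ q)) (schw b q)) x) =
      RicPair.G (ricF b κ η (schw b (rS σ q)) (schw b q)) (ricF b (-κ) η (schw b q) (schw b (rS σ q))) x := by
  have hσ2 : (σ : ℂ) * σ = 1 := by rcases hσ with rfl | rfl <;> norm_num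
  have hκ' : 1 ≤ |-κ| := by rwa [abs_neg]
  have e1 := h.conj_ricF hκ hσ hq x
  have e2 := congrArg conj (h.conj_ricF hκ' hσ hq x)
  simp only [map_mul, conj_ofReal, conj_conj] at e2
  rw [RicPair.G, RicPair.G, map_div₀, map_sub, map_mul, map_mul, map_mul, map_one, map_ofNat, map_ofNat,
    ← e1, ← e2, ← mul_div_assoc]
  congr 1
  · linear_combination 2 * ricF b (-κ) η (schw b q) (schw b (rS σ q)) x * hσ2
  · ring

end

/-! ### The conservation laws of the flows -/

section
variable {b κ η σ : ℝ}

/-- The laws for `q F₁` and `r F₂` are subtracted. The halves of `A` add up, since the exchange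
changes its sign, and the constant `c` absorbs the part of `A` that is missing in the physical
currents. -/
lemma Adm.conservationLawAt (h : Adm b η) (hκ : 1 ≤ |κ|) (hσ : σ = 1 ∨ σ = -1) {q : ℝ → 𝓢(ℝ, ℂ)}
    {u : 𝓢(ℝ, ℂ)} {t : ℝ} (hq : Flow q u t) (hqη : ‖schw b (q t)‖ < η) {A B C : ℝ → ℂ}
    (hL : Lax κ (q t) (rS σ (q t)) u (rS σ u) A B C) {j : ℝ → ℝ → ℂ} {c : ℂ}
    (hj : ∀ x, j t x = c - (A x + B x * ricF b κ η (schw b (q t)) (schw b (rS σ (q t))) x -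
      C x * ricF b (-κ) η (schw b (rS σ (q t))) (schw b (q t)) x)) (x : ℝ) :
    ConservationLawAt (fun τ => rho σ (q τ) κ) j t x := by
  have hκ' : 1 ≤ |-κ| := by rwa [abs_neg]
  have hrη : ‖schw b (rS σ (q t))‖ < η := by rwa [norm_schw_rS h.hb0.le hσ]
  obtain ⟨d₁, h1, h2⟩ := (h.conservation hκ hq (hq.rS σ) hqη hrη hL).1 x
  obtain ⟨d₂, h3, h4⟩ := (h.conservation hκ' (hq.rS σ) hq hrη hqη hL.swap).1 x
  have h5 : HasDerivAt (fun τ => rho σ (q τ) κ x) (d₁ - d₂) t := by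
    refine (h1.sub h3).congr_of_eventuallyEq ?_
    have hc := (hq.hasDerivAt (schw b)).continuousAt.norm.eventually_lt continuousAt_const hqη
    filter_upwards [hc] with τ hτ
    rw [(rep_schwartz' h.hb0.le (q τ)).rho_eq h hκ hτ.le (by rw [norm_schw_rS h.hb0.le hσ]; exact hτ.le),
      ← rS_apply]
    rfl
  have h6 : HasDerivAt (j t) (-(d₁ - d₂)) x := by
    have e : j t = fun x => c - ((A x / 2 + B x * ricF b κ η (schw b (q t)) (schw b (rS σ (q t))) x) -
        ((-A) x / 2 + C x * ricF b (-κ) η (schw b (rS σ (q t))) (schw b (q t)) x)) := by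
      funext x
      rw [hj x, Pi.neg_apply]; ring
    rw [e]
    exact (h2.sub h4).const_sub c
  refine ⟨h5.differentiableAt, h6.differentiableAt, ?_⟩
  rw [h5.deriv, h6.deriv, add_neg_cancel]

/-- The flow of the vector field `V` has Lax pairs at all spectral parameters `ϰ ≥ 1`, `ϰ ≠ κ`,
with currents `j`. -/
def HasLax (b η σ κ : ℝ) (V : 𝓢(ℝ, ℂ) → ℝ → ℂ) (j : 𝓢(ℝ, ℂ) → ℝ → ℝ → ℂ) : Prop :=
  ∀ q, ‖schw b q‖ < η → ∀ v : 𝓢(ℝ, ℂ), (∀ x, v x = V q x) → ∀ ϰ : ℝ, 1 ≤ ϰ → κ ≠ ϰ →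
    ∃ (A B C : ℝ → ℂ) (c : ℂ), Lax ϰ q (rS σ q) v (rS σ v) A B C ∧
      ∀ x, j q ϰ x = c - (A x + B x * ricF b ϰ η (schw b q) (schw b (rS σ q)) x -
        C x * ricF b (-ϰ) η (schw b (rS σ q)) (schw b q) x)

lemma fieldNLS_eq (q : 𝓢(ℝ, ℂ)) (x : ℝ) :
    fieldNLS σ q x = I * (dS (dS q) x) - 2 * I * q x ^ 2 * rS σ q x := by
  rw [fieldNLS, iteratedDeriv_two_eq, rS_apply]; ring

lemma conj_fieldNLS (q : 𝓢(ℝ, ℂ)) (x : ℝ) :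
    σ * conj (fieldNLS σ q x) = -I * (dS (dS (rS σ q)) x) + 2 * I * rS σ q x ^ 2 * q x := by
  rw [fieldNLS_eq, dS_rS, dS_rS]
  simp only [rS_apply', map_sub, map_mul, map_pow, conj_I, map_ofNat, conj_ofReal, conj_conj]
  ring

lemma fieldMKdV_eq (q : 𝓢(ℝ, ℂ)) (x : ℝ) :
    fieldMKdV σ q x = -dS (dS (dS q)) x + 6 * q x * rS σ q x * dS q x := by
  rw [fieldMKdV, iteratedDeriv_three_eq, rS_apply, ← dS_eq]

lemma conj_fieldMKdV (q : 𝓢(ℝ, ℂ)) (x : ℝ) :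
    σ * conj (fieldMKdV σ q x) =
      -dS (dS (dS (rS σ q))) x + 6 * q x * rS σ q x * dS (rS σ q) x := by
  rw [fieldMKdV_eq, dS_rS, dS_rS, dS_rS]
  simp only [rS_apply', map_add, map_neg, map_mul, map_ofNat, conj_ofReal, conj_conj]
  ring

lemma Adm.g_eq (h : Adm b η) (hκ : 1 ≤ |κ|) (hσ : σ = 1 ∨ σ = -1) {q : 𝓢(ℝ, ℂ)}
    (hq : ‖schw b q‖ ≤ η) (x : ℝ) :
    let F₁ := ricF b κ η (schw b q) (schw b (rS σ q))
    let F₂ := ricF b (-κ) η (schw b (rS σ q)) (schw b q)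
    g12 σ q κ x = RicPair.G F₁ F₂ x ∧ g21 σ q κ x = RicPair.G F₂ F₁ x ∧
      gam σ q κ x = RicPair.Gam F₁ F₂ x ∧ 2 + gam σ q κ x ≠ 0 ∧
      g21 σ q κ x / (2 + gam σ q κ x) = F₁ x ∧ g12 σ q κ x / (2 + gam σ q κ x) = F₂ x := by
  intro F₁ F₂
  have hr : ‖schw b (rS σ q)‖ ≤ η := by rwa [norm_schw_rS h.hb0.le hσ]
  have hrep := rep_schwartz' (σ := σ) h.hb0.le q
  obtain ⟨h1, h2, h3, -, h5⟩ := hrep.green_diag h hκ hq hr x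
  obtain ⟨h6, h7⟩ := hrep.quotient_eq h hκ hq hr x
  refine ⟨h1, ?_, h3, h5, h6, h7⟩
  rw [h2, RicPair.G, mul_right_comm 4 (F₂ x)]

/-- Conjugation reverses the spectral parameter. The difference flows contain `κ` and `-κ`
symmetrically, so the equation for `q` implies the companion equation for `r` that the Lax pair
requires. -/
lemma Adm.conj_g12 (h : Adm b η) (hκ : 1 ≤ |κ|) (hσ : σ = 1 ∨ σ = -1) {q : 𝓢(ℝ, ℂ)}
    (hq : ‖schw b q‖ ≤ η) (x : ℝ) : σ * conj (g12 σ q κ x) = g21 σ q (-κ) x := by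
  have hκ' : 1 ≤ |-κ| := by rwa [abs_neg]
  rw [(h.g_eq hκ hσ hq x).1, (h.g_eq hκ' hσ hq x).2.1, h.conj_G hκ hσ hq, neg_neg]

lemma Adm.jNLS_eq (h : Adm b η) (hκ : 1 ≤ |κ|) (hσ : σ = 1 ∨ σ = -1) {q : 𝓢(ℝ, ℂ)}
    (hq : ‖schw b q‖ ≤ η) (x : ℝ) :
    jNLS σ q κ x = 2 * I * κ ^ 2 - ((2 * I * κ ^ 2 - I * (q x * rS σ q x)) +
      I * (dS q x + 2 * κ * q x) * ricF b κ η (schw b q) (schw b (rS σ q)) x -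
      I * (2 * κ * rS σ q x - dS (rS σ q) x) * ricF b (-κ) η (schw b (rS σ q)) (schw b q) x) := by
  have hr : ‖schw b (rS σ q)‖ ≤ η := by rwa [norm_schw_rS h.hb0.le hσ]
  obtain ⟨-, -, -, -, h6, h7⟩ := h.g_eq hκ hσ hq x
  have e : rFun σ q = rS σ q := funext fun x => (rS_apply σ q x).symm
  rw [jNLS, (rep_schwartz' h.hb0.le q).rho_eq h hκ hq hr, add_div, mul_div_assoc, mul_div_assoc, h6, h7, e]
  simp only [dS_eq]
  ring

lemma Adm.jMKdV_eq (h : Adm b η) (hκ : 1 ≤ |κ|) (hσ : σ = 1 ∨ σ = -1) {q : 𝓢(ℝ, ℂ)}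
    (hq : ‖schw b q‖ ≤ η) (x : ℝ) :
    jMKdV σ q κ x = -4 * κ ^ 3 - ((dS q x * rS σ q x - q x * dS (rS σ q) x +
        2 * κ * (q x * rS σ q x) - 4 * κ ^ 3) +
      (2 * (q x * q x * rS σ q x) - dS (dS q) x - 2 * κ * dS q x - 4 * κ ^ 2 * q x) *
        ricF b κ η (schw b q) (schw b (rS σ q)) x -
      (2 * (rS σ q x * rS σ q x * q x) - dS (dS (rS σ q)) x + 2 * κ * dS (rS σ q) x -
        4 * κ ^ 2 * rS σ q x) * ricF b (-κ) η (schw b (rS σ q)) (schw b q) x) := by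
  obtain ⟨-, -, -, -, h6, h7⟩ := h.g_eq hκ hσ hq x
  have e : rFun σ q = rS σ q := funext fun x => (rS_apply σ q x).symm
  rw [jMKdV, h.jNLS_eq hκ hσ hq, sub_div, mul_div_assoc, mul_div_assoc, h6, h7, e, iteratedDeriv_two_eq,
    iteratedDeriv_two_eq, ← dS_eq, ← dS_eq]
  linear_combination (-4 * κ * (κ ^ 2 - q x * rS σ q x - κ ^ 2 + κ * (q x *
    ricF b κ η (schw b q) (schw b (rS σ q)) x - rS σ q x *
    ricF b (-κ) η (schw b (rS σ q)) (schw b q) x)) -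
    2 * κ * (q x * rS σ q x + ricF b κ η (schw b q) (schw b (rS σ q)) x * dS q x +
    ricF b (-κ) η (schw b (rS σ q)) (schw b q) x * dS (rS σ q) x)) * I_sq

/-- The factor `m` is the coefficient with which the current enters a difference flow; it
corresponds to `c = m I / 2` in `Adm.lax_logDet`. -/
lemma Adm.jA_eq (h : Adm b η) (hκ : 1 ≤ |κ|) (hσ : σ = 1 ∨ σ = -1) {q : 𝓢(ℝ, ℂ)}
    (hq : ‖schw b q‖ ≤ η) {k : ℝ} (hk : 1 ≤ |k|) (hne : k ≠ κ) (m : ℂ) (x : ℝ) :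
    let f₁ := ricF b k η (schw b q) (schw b (rS σ q))
    let f₂ := ricF b (-k) η (schw b (rS σ q)) (schw b q)
    m * jA σ q κ k x = -(m * I / 2) / (2 * (k - κ)) -
      (-(m * I / 2) / (2 * (k - κ)) * (1 + RicPair.Gam f₁ f₂ x) +
      (m * I / 2) / (k - κ) * RicPair.G f₁ f₂ x * ricF b κ η (schw b q) (schw b (rS σ q)) x -
      -(m * I / 2) / (k - κ) * RicPair.G f₂ f₁ x * ricF b (-κ) η (schw b (rS σ q)) (schw b q) x) := by
  intro f₁ f₂
  obtain ⟨-, -, -, h5, h6, h7⟩ := h.g_eq hκ hσ hq x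
  obtain ⟨h1, h2, h3, -, -, -⟩ := h.g_eq hk hσ hq x
  have hne : (k - κ : ℂ) ≠ 0 := by rw [← ofReal_sub]; exact ofReal_ne_zero.mpr (sub_ne_zero.mpr hne)
  rw [← h6, ← h7, jA, h1, h2, h3]
  field_simp
  ring

lemma Adm.lax_logDet (h : Adm b η) (hκ : 1 ≤ |κ|) (hσ : σ = 1 ∨ σ = -1) {q : 𝓢(ℝ, ℂ)}
    (hq : ‖schw b q‖ ≤ η) (k : ℝ) (hne : κ ≠ k) (c : ℂ) :
    let f₁ := ricF b κ η (schw b q) (schw b (rS σ q))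
    let f₂ := ricF b (-κ) η (schw b (rS σ q)) (schw b q)
    Lax k q (rS σ q) (fun x => 2 * c * g12 σ q κ x) (fun x => 2 * c * g21 σ q κ x)
      (fun x => -c / (2 * (κ - k)) * (1 + RicPair.Gam f₁ f₂ x))
      (fun x => c / (κ - k) * RicPair.G f₁ f₂ x) (fun x => -c / (κ - k) * RicPair.G f₂ f₁ x) := by
  intro f₁ f₂
  have hr : ‖schw b (rS σ q)‖ ≤ η := by rwa [norm_schw_rS h.hb0.le hσ]
  have hL := (h.ricPair hκ hq hr).lax (AKNS.tendsto_ricF _ _ _ _ _) (AKNS.tendsto_ricF _ _ _ _ _) hne c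
  simp only [fun x => (h.g_eq hκ hσ hq x).1, fun x => (h.g_eq hκ hσ hq x).2.1]
  exact hL

/-- The excluded parameter is 0, so no `ϰ ≥ 1` is actually excluded. -/
lemma Adm.hasLax_nls (h : Adm b η) (hσ : σ = 1 ∨ σ = -1) : HasLax b η σ 0 (fieldNLS σ) (jNLS σ) := by
  intro q hq v hv ϰ hϰ _
  exact ⟨_, _, _, _, (lax_nls ϰ q (rS σ q)).of_eq (fun x => by rw [hv, fieldNLS_eq])
    (fun x => by rw [rS_apply', hv, conj_fieldNLS]),
    fun x => h.jNLS_eq (le_abs.mpr (Or.inl hϰ)) hσ hq.le x⟩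

lemma Adm.hasLax_mkdv (h : Adm b η) (hσ : σ = 1 ∨ σ = -1) : HasLax b η σ 0 (fieldMKdV σ) (jMKdV σ) := by
  intro q hq v hv ϰ hϰ _
  exact ⟨_, _, _, _, (lax_mkdv ϰ q (rS σ q)).of_eq (fun x => by rw [hv, fieldMKdV_eq])
    (fun x => by rw [rS_apply', hv, conj_fieldMKdV]),
    fun x => h.jMKdV_eq (le_abs.mpr (Or.inl hϰ)) hσ hq.le x⟩

/-- The vector field is the sum of the NLS field, the determinant flows at `κ` and `-κ` with
opposite coefficients, and a phase rotation; Lax pairs and currents are added accordingly. -/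
lemma Adm.hasLax_nlsDiff (h : Adm b η) (hσ : σ = 1 ∨ σ = -1) (hκ : 1 ≤ κ) :
    HasLax b η σ κ (fieldNLSdiff σ κ) (fun q ϰ => jNLSdiff σ q ϰ κ) := by
  intro q hq v hv ϰ hϰ hne
  have hκ1 : 1 ≤ |κ| := le_abs.mpr (Or.inl hκ)
  have hκ2 : 1 ≤ |-κ| := by rwa [abs_neg]
  have hϰ1 : 1 ≤ |ϰ| := le_abs.mpr (Or.inl hϰ)
  have hne2 : -κ ≠ ϰ := by intro e; linarith
  have L := ((lax_nls ϰ q (rS σ q)).add (h.lax_logDet hκ1 hσ hq.le ϰ hne (4 * κ ^ 3 * I / 2))).add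
    ((h.lax_logDet hκ2 hσ hq.le ϰ hne2 (-4 * κ ^ 3 * I / 2)).add (lax_phase ϰ q (rS σ q) (2 * I * κ ^ 2)))
  have hf : ∀ x, v x = fieldNLS σ q x + 4 * κ ^ 3 * I * (g12 σ q κ x - g12 σ q (-κ) x) +
      4 * I * κ ^ 2 * q x := fun x => by
    rw [hv, fieldNLSdiff, fieldNLS]; ring
  refine ⟨_, _, _, 2 * I * ϰ ^ 2 + -(4 * κ ^ 3 * I / 2) / (2 * (κ - ϰ)) +
    -(-4 * κ ^ 3 * I / 2) / (2 * ((-κ : ℝ) - ϰ)) + 2 * I * κ ^ 2, L.of_eq (fun x => ?_) (fun x => ?_),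
    fun x => ?_⟩
  · simp only [Pi.add_apply]
    rw [hf, fieldNLS_eq]; ring
  · have e := h.conj_g12 hκ2 hσ hq.le x
    rw [neg_neg] at e
    simp only [Pi.add_apply]
    rw [rS_apply', hf, map_add, map_add, mul_add, mul_add, conj_fieldNLS, ← h.conj_g12 hκ1 hσ hq.le, ← e]
    simp only [rS_apply', map_sub, map_mul, map_pow, conj_I, map_ofNat, conj_ofReal]
    ring
  · have e0 := h.jNLS_eq hϰ1 hσ hq.le x
    have e1 := h.jA_eq hϰ1 hσ hq.le hκ1 hne (4 * κ ^ 3) x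
    have e2 := h.jA_eq hϰ1 hσ hq.le hκ2 hne2 (-4 * κ ^ 3) x
    dsimp only at e1 e2
    simp only [Pi.add_apply, jNLSdiff]
    linear_combination e0 + e1 + e2

lemma Adm.hasLax_mkdvDiff (h : Adm b η) (hσ : σ = 1 ∨ σ = -1) (hκ : 1 ≤ κ) :
    HasLax b η σ κ (fieldMKdVdiff σ κ) (fun q ϰ => jMKdVdiff σ q ϰ κ) := by
  intro q hq v hv ϰ hϰ hne
  have hκ1 : 1 ≤ |κ| := le_abs.mpr (Or.inl hκ)
  have hκ2 : 1 ≤ |-κ| := by rwa [abs_neg]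
  have hϰ1 : 1 ≤ |ϰ| := le_abs.mpr (Or.inl hϰ)
  have hne2 : -κ ≠ ϰ := by intro e; linarith
  have hr : ‖schw b (rS σ q)‖ ≤ η := by rw [norm_schw_rS h.hb0.le hσ]; exact hq.le
  have L := ((lax_mkdv ϰ q (rS σ q)).add (h.lax_logDet hκ1 hσ hq.le ϰ hne (8 * I * κ ^ 4 * I / 2))).add
    ((h.lax_logDet hκ2 hσ hq.le ϰ hne2 (8 * I * κ ^ 4 * I / 2)).add
      (lax_translation ϰ q (rS σ q) (-4 * κ ^ 2)))
  have hf : ∀ x, v x = fieldMKdV σ q x - 8 * κ ^ 4 * (g12 σ q κ x + g12 σ q (-κ) x) -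
      4 * κ ^ 2 * dS q x := fun x => by
    rw [hv, fieldMKdVdiff, fieldMKdV, ← dS_eq]
  refine ⟨_, _, _, -4 * ϰ ^ 3 + -(8 * I * κ ^ 4 * I / 2) / (2 * (κ - ϰ)) +
    -(8 * I * κ ^ 4 * I / 2) / (2 * ((-κ : ℝ) - ϰ)) - 4 * κ ^ 2 * ϰ, L.of_eq (fun x => ?_) (fun x => ?_),
    fun x => ?_⟩
  · simp only [Pi.add_apply]
    rw [hf, fieldMKdV_eq]
    linear_combination (-8 * κ ^ 4 * (g12 σ q κ x + g12 σ q (-κ) x)) * I_sq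
  · have e := h.conj_g12 hκ2 hσ hq.le x
    rw [neg_neg] at e
    simp only [Pi.add_apply]
    rw [rS_apply', hf, map_sub, map_sub, mul_sub, mul_sub, conj_fieldMKdV, ← h.conj_g12 hκ1 hσ hq.le, ← e,
      dS_rS]
    simp only [rS_apply', map_add, map_mul, map_pow, map_ofNat, conj_ofReal]
    linear_combination (-8 * κ ^ 4 * σ * (conj (g12 σ q κ x) + conj (g12 σ q (-κ) x))) * I_sq
  · have e0 := h.jMKdV_eq hϰ1 hσ hq.le x
    have e1 := h.jA_eq hϰ1 hσ hq.le hκ1 hne (8 * I * κ ^ 4) x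
    have e2 := h.jA_eq hϰ1 hσ hq.le hκ2 hne2 (8 * I * κ ^ 4) x
    have e3 := (rep_schwartz' h.hb0.le q).rho_eq h hϰ1 hq.le hr x
    rw [← rS_apply] at e3
    dsimp only at e1 e2
    simp only [Pi.add_apply, jMKdVdiff]
    linear_combination e0 + e1 + e2 + 4 * κ ^ 2 * e3

end

/-! ### The a priori bound -/

section
variable {b κ η σ : ℝ}

/-- The quadratic part of the conserved quantity. -/
def energy (κ : ℝ) (q : 𝓢(ℝ, ℂ)) : ℝ := ∫ ξ, 2 * κ / jb κ ξ ^ 2 * ‖𝓕 (q : ℝ → ℂ) ξ‖ ^ 2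

lemma fourier_memLp_two (q : 𝓢(ℝ, ℂ)) : MemLp (𝓕 (q : ℝ → ℂ)) 2 (volume : Measure ℝ) :=
  (𝓕 q : 𝓢(ℝ, ℂ)).memLp 2 volume

lemma integrable_fourier_sq (q : 𝓢(ℝ, ℂ)) : Integrable fun ξ => ‖𝓕 (q : ℝ → ℂ) ξ‖ ^ 2 :=
  (fourier_memLp_two q).integrable_norm_pow two_ne_zero

lemma integrable_energy (hκ : 1 ≤ κ) (q : 𝓢(ℝ, ℂ)) :
    Integrable fun ξ => 2 * κ / jb κ ξ ^ 2 * ‖𝓕 (q : ℝ → ℂ) ξ‖ ^ 2 := by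
  refine (integrable_fourier_sq q).bdd_mul (c := 2 * κ)
    (measurable_const.div ((measurable_jb κ).pow_const 2)).aestronglyMeasurable (ae_of_all _ fun ξ => ?_)
  have h1 := one_le_jb (le_abs.mpr (Or.inl hκ)) ξ
  rw [Real.norm_of_nonneg (by positivity)]
  exact div_le_self (by positivity) (one_le_pow₀ h1)

/-- The weight of the pairing is at most `jb κ ^ (2b-1)`, which gains a second factor `|κ| ^ (2b-1)`
in the quartic error. -/
lemma norm_pairF_le_rpow (hb0 : 0 ≤ b) (hb : b < 1 / 2) (hκ : 1 ≤ |κ|) (p f : L2) :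
    ‖pairF b κ p f‖ ≤ |κ| ^ (2 * b - 1) * ‖p‖ * ‖f‖ := by
  have h1 : ∀ ξ, ‖pw b κ ξ‖ ≤ |κ| ^ (2 * b - 1) := fun ξ => by
    have h0 := jb_pos hκ ξ
    rw [pw, norm_mul, norm_jw, norm_jw]
    calc jb 1 ξ ^ b * jb κ ξ ^ (-(1 - b)) ≤ jb κ ξ ^ b * jb κ ξ ^ (-(1 - b)) := by
          gcongr
          · exact jb_nonneg 1 ξ
          · exact jb_one_le hκ ξ
      _ = jb κ ξ ^ (2 * b - 1) := by rw [← Real.rpow_add h0]; ring_nf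
      _ ≤ |κ| ^ (2 * b - 1) :=
          Real.rpow_le_rpow_of_nonpos (by linarith) (abs_le_jb κ ξ) (by linarith)
  refine (norm_inner_le_norm _ _).trans ?_
  rw [LinearIsometry.norm_map]
  calc _ ≤ (|κ| ^ (2 * b - 1) * ‖f‖) * ‖p‖ := by
        gcongr; exact norm_mulOp_le (memLp_pw hb0 hb hκ) h1 f
    _ = _ := by ring

/-- Plancherel's identity: the real part of `1 / (2κ - 2πiξ)` is `2κ / jb κ ξ ^ 2`. Only the real
part of the conserved quantity is coercive. -/
lemma re_pairF_ricU (hb0 : 0 ≤ b) (hb : b < 1 / 2) (hκ : 1 ≤ κ) (q : 𝓢(ℝ, ℂ)) :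
    (pairF b κ (schw b q) (ricU b κ (schw b (rS σ q)))).re = σ / 2 * energy κ q := by
  have hκ' : 1 ≤ |κ| := le_abs.mpr (Or.inl hκ)
  have e1 : pairF b κ (schw b q) (ricU b κ (schw b (rS σ q))) =
      ∫ ξ, (σ / 2 : ℂ) * ((2 * κ + 2 * Real.pi * (-ξ : ℝ) * I : ℂ)⁻¹ * (‖𝓕 (q : ℝ → ℂ) ξ‖ ^ 2 : ℝ)) := by
    rw [pairF_eq hb0 hb hκ']
    refine integral_congr_ae ?_
    have h1 := ae_comp_neg (Lp.coeFn_smul (1 / 2 : ℂ) (mulOp (phs κ) (mulOp (rew b κ) (schw b (rS σ q)))))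
    have h2 := ae_comp_neg (mulOp_ae (memLp_phs hκ') (mulOp (rew b κ) (schw b (rS σ q))))
    have h3 := ae_comp_neg (rew_schw_ae hb0 hκ' (rS σ q))
    have h4 := schw_rep hb0 q
    have h5 := ae_comp_neg (schw_rep hb0 (rS σ q))
    have h6 := ae_comp_neg (reflC_ae (schw b q))
    have h7 := ae_comp_neg (Lp.coeFn_smul (σ : ℂ) (reflC (schw b q)))
    filter_upwards [h1, h2, h3, h4, h5, h6, h7] with ξ e1 e2 e3 e4 e5 e6 e7
    rw [ricU_apply, e1, Pi.smul_apply, e2, e3, ← e4, e5, schw_rS hb0, e7, Pi.smul_apply, e6, neg_neg, phs]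
    simp only [smul_eq_mul, jw_neg]
    have hw : jw κ (-(1 - b)) ξ * jw κ 1 ξ * jw κ (-b) ξ = 1 := by
      rw [← jw_add hκ', ← jw_add hκ', jw, show -(1 - b) + 1 + -b = 0 by ring, Real.rpow_zero, ofReal_one]
    have hn : ((‖𝓕 (q : ℝ → ℂ) ξ‖ ^ 2 : ℝ) : ℂ) = 𝓕 (q : ℝ → ℂ) ξ * (jw 1 b ξ * conj (schw b q ξ)) := by
      have : jw 1 b ξ * conj (schw b q ξ) = conj (𝓕 (q : ℝ → ℂ) ξ) := by
        rw [e4, map_mul, jw, conj_ofReal]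
      rw [this, mul_conj, normSq_eq_norm_sq]
    rw [hn, div_eq_mul_inv]
    linear_combination (σ / 2 * 𝓕 (q : ℝ → ℂ) ξ * (jw 1 b ξ * conj (schw b q ξ)) *
      (2 * κ + 2 * Real.pi * (-ξ : ℝ) * I : ℂ)⁻¹) * hw
  have hi : Integrable fun ξ : ℝ => (2 * κ + 2 * Real.pi * (-ξ : ℝ) * I : ℂ)⁻¹ *
      ((‖𝓕 (q : ℝ → ℂ) ξ‖ ^ 2 : ℝ) : ℂ) := by
    refine (integrable_fourier_sq q).ofReal.bdd_mul (c := 1)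
      (Measurable.aestronglyMeasurable (by fun_prop)) (ae_of_all _ fun ξ => ?_)
    rw [norm_inv, norm_two_mul_add]
    exact inv_le_one_of_one_le₀ (one_le_jb hκ' _)
  rw [e1, integral_const_mul, show (σ / 2 : ℂ) = ((σ / 2 : ℝ) : ℂ) by push_cast; rfl, re_ofReal_mul,
    energy, ← RCLike.re_eq_complex_re, ← integral_re hi]
  congr 1
  refine integral_congr_ae (ae_of_all _ fun ξ => ?_)
  simp only [RCLike.re_eq_complex_re]
  rw [re_mul_ofReal, inv_re, normSq_eq_norm_sq, norm_two_mul_add, jb_neg]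
  congr 2
  simp

/-- The conserved quantity is a perturbation of the energy. -/
lemma Adm.abs_energy_sub_le (h : Adm b η) (hκ : 1 ≤ κ) (hσ : σ = 1 ∨ σ = -1) {q : 𝓢(ℝ, ℂ)}
    (hq : ‖schw b q‖ ≤ η) :
    |energy κ q - 2 * σ * (pairF b κ (schw b q) (ric b κ η (schw b q) (schw b (rS σ q)))).re| ≤
      2 * ricC b * κ ^ (4 * b - 2) * ‖schw b q‖ ^ 4 := by
  have hκ' : 1 ≤ |κ| := le_abs.mpr (Or.inl hκ)
  have hκ0 : 0 < κ := by linarith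
  have hr' := norm_schw_rS (b := b) h.hb0.le hσ q
  have hr : ‖schw b (rS σ q)‖ ≤ η := by rwa [hr']
  set p := schw b q
  set f := ric b κ η p (schw b (rS σ q)) with hf
  have hfe := h.ric_eq hκ' hq hr
  rw [← hf] at hfe
  have hfn : ‖f‖ ≤ ‖p‖ := (h.norm_ric_le hκ' hq hr).trans_eq hr'
  -- By the fixed point equation, the linear term yields the energy and the cubic term the quartic
  -- error.
  have e1 : pairF b κ p f = pairF b κ p (ricU b κ (schw b (rS σ q))) - pairF b κ p (ricT b κ p f f) := by
    rw [pairF, pairF, pairF, ← inner_sub_left, ← map_sub, ← map_sub, ← hfe]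
  have hσ2 : σ * σ = 1 := by rcases hσ with rfl | rfl <;> norm_num
  have hσa : |σ| = 1 := by rcases hσ with rfl | rfl <;> simp
  have e2 : energy κ q - 2 * σ * (pairF b κ p f).re = 2 * σ * (pairF b κ p (ricT b κ p f f)).re := by
    rw [e1, sub_re, re_pairF_ricU h.hb0.le h.hb hκ]
    linear_combination (-energy κ q) * hσ2
  rw [e2, abs_mul, abs_mul, hσa, abs_two, mul_one]
  have h1 := norm_pairF_le_rpow h.hb0.le h.hb hκ' p (ricT b κ p f f)
  have h2 := norm_ricT_le h.hb0.le h.hb hκ' p f f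
  have hC := ricC_nonneg b
  rw [abs_of_pos hκ0] at h1 h2
  have h3 : ‖pairF b κ p (ricT b κ p f f)‖ ≤
      κ ^ (2 * b - 1) * ‖p‖ * (ricC b * κ ^ (2 * b - 1) * ‖p‖ * ‖p‖ * ‖p‖) := by
    refine h1.trans ?_
    gcongr
    exact h2.trans (by gcongr)
  have h4 : κ ^ (4 * b - 2) = κ ^ (2 * b - 1) * κ ^ (2 * b - 1) := by
    rw [← Real.rpow_add hκ0]; ring_nf
  rw [h4]
  have h5 := (abs_re_le_norm (pairF b κ p (ricT b κ p f f))).trans h3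
  linarith [h5]

lemma norm_sq_eq_integral (f : L2) : ‖f‖ ^ 2 = ∫ ξ, ‖f ξ‖ ^ 2 := by
  have hi : Integrable fun ξ => ‖f ξ‖ ^ 2 := (Lp.memLp f).integrable_norm_pow two_ne_zero
  rw [← ENNReal.ofReal_eq_ofReal_iff (by positivity) (integral_nonneg fun _ => by positivity),
    ← lintegral_enorm_sq_eq, ofReal_integral_eq_lintegral_ofReal hi (ae_of_all _ fun _ => by positivity)]
  simp only [enorm_sq_eq_ofReal]

/-- The multiplier of the energy times `jb κ ^ (2b')` is largest at low frequency, where the weight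
is comparable to `κ`. -/
lemma energy_le {b' : ℝ} (hb0 : 0 ≤ b') (hb : b' ≤ 1) (hκ : 1 ≤ κ) (q : 𝓢(ℝ, ℂ)) :
    energy κ q ≤ 2 * κ ^ (2 * b' - 1) * ‖schw b' q‖ ^ 2 := by
  have hκ' : 1 ≤ |κ| := le_abs.mpr (Or.inl hκ)
  have hκ0 : 0 < κ := by linarith
  have hi : Integrable fun ξ => ‖schw b' q ξ‖ ^ 2 := (Lp.memLp (schw b' q)).integrable_norm_pow two_ne_zero
  rw [norm_sq_eq_integral, energy, ← integral_const_mul]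
  refine integral_mono_ae (integrable_energy hκ q) (hi.const_mul _) ?_
  filter_upwards [schw_rep hb0 q] with ξ h2
  have hj := jb_pos hκ' ξ
  have hj1 := jb_nonneg 1 ξ
  rw [h2, norm_mul, norm_jw, mul_pow, ← mul_assoc]
  refine mul_le_mul_of_nonneg_right ?_ (by positivity)
  have h3 : (jb 1 ξ ^ b') ^ 2 ≤ jb κ ξ ^ (2 * b') := by
    rw [rpow_sq_eq hj1]
    exact Real.rpow_le_rpow hj1 (jb_one_le hκ' ξ) (by linarith)
  calc 2 * κ / jb κ ξ ^ 2 * (jb 1 ξ ^ b') ^ 2 ≤ 2 * κ / jb κ ξ ^ 2 * jb κ ξ ^ (2 * b') := by gcongr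
    _ = 2 * κ * jb κ ξ ^ (2 * b' - 2) := by
        rw [Real.rpow_sub hj, Real.rpow_two]; ring
    _ ≤ 2 * κ * κ ^ (2 * b' - 2) := by
        gcongr 2 * κ * ?_
        exact Real.rpow_le_rpow_of_nonpos hκ0 ((le_abs_self κ).trans (abs_le_jb κ ξ)) (by linarith)
    _ = 2 * κ ^ (2 * b' - 1) := by
        rw [mul_assoc, show (2 * b' - 1) = 1 + (2 * b' - 2) by ring, Real.rpow_add hκ0, Real.rpow_one]

/-- The norm is controlled by the energies at dyadic spectral parameters. -/
lemma ofReal_norm_sq_le {l : ℝ} (hl : 1 ≤ l) (hl2 : l ≤ 2) (hb0 : 0 ≤ b) (q : 𝓢(ℝ, ℂ)) :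
    ENNReal.ofReal (‖schw b q‖ ^ 2) ≤
      ∑' n : ℕ, ENNReal.ofReal (4 * (l * 2 ^ n) ^ (1 - 2 * b) * energy (l * 2 ^ n) q) := by
  have hk : ∀ n : ℕ, 1 ≤ l * 2 ^ n := fun n => one_le_mul_of_one_le_of_one_le hl (one_le_pow₀ one_le_two)
  have h1 : ∀ n, ENNReal.ofReal (4 * (l * 2 ^ n) ^ (1 - 2 * b) * energy (l * 2 ^ n) q) =
      ∫⁻ ξ, ENNReal.ofReal (4 * (l * 2 ^ n) ^ (1 - 2 * b) * (2 * (l * 2 ^ n) / jb (l * 2 ^ n) ξ ^ 2 *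
        ‖𝓕 (q : ℝ → ℂ) ξ‖ ^ 2)) := fun n => by
    have hn := hk n
    rw [energy, ← integral_const_mul, ofReal_integral_eq_lintegral_ofReal
      ((integrable_energy hn q).const_mul _) (ae_of_all _ fun ξ => by positivity)]
  have hm : Measurable (𝓕 (q : ℝ → ℂ)) := (continuous_fourier q.integrable).measurable
  rw [← lintegral_enorm_sq_eq]
  simp only [h1]
  rw [← lintegral_tsum fun n => by fun_prop]
  refine lintegral_mono_ae ?_
  filter_upwards [schw_ae hb0 q] with ξ h2
  rw [h2, enorm_sq_eq_ofReal, norm_mul, norm_jw, mul_pow, rpow_sq_eq (jb_nonneg 1 ξ)]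
  have hj := two_le_jb one_le_abs_one ξ
  have hl0 : 0 < l := by linarith
  -- A single dyadic parameter `k = l 2ⁿ` with `k ≤ jb 1 ξ ≤ 2k` suffices at each frequency: there
  -- `jb k ξ ^ 2 ≤ 8k²`, so the corresponding term already dominates the weight of H^(-b).
  obtain ⟨n, hn1, hn2⟩ := exists_nat_pow_near (x := jb 1 ξ / l) (y := 2)
    (by rw [le_div_iff₀ hl0]; linarith) one_lt_two
  rw [le_div_iff₀ hl0] at hn1
  rw [div_lt_iff₀ hl0] at hn2
  refine le_trans (ENNReal.ofReal_le_ofReal ?_) (ENNReal.le_tsum n)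
  rw [← mul_assoc]
  refine mul_le_mul_of_nonneg_right ?_ (by positivity)
  set k := l * 2 ^ n with hkdef
  have hk0 : 0 < k := by positivity
  have hkj : k ≤ jb 1 ξ := by rw [hkdef]; linarith
  have hjk : jb 1 ξ ≤ 2 * k := by rw [hkdef]; rw [pow_succ] at hn2; linarith
  have h3 : jb k ξ ^ 2 ≤ 8 * k ^ 2 := by
    have h4 := jb_sq 1 ξ
    have h5 : jb 1 ξ ^ 2 ≤ (2 * k) ^ 2 := pow_le_pow_left₀ (jb_nonneg _ _) hjk 2
    rw [jb_sq]; nlinarith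
  have h6 : 0 < jb k ξ ^ 2 := pow_pos (jb_pos (le_abs.mpr (Or.inl (hk n))) ξ) 2
  calc jb 1 ξ ^ (2 * -b) ≤ k ^ (2 * -b) := Real.rpow_le_rpow_of_nonpos hk0 hkj (by linarith)
    _ = k ^ (1 - 2 * b) * k⁻¹ := by
        rw [← Real.rpow_neg_one k, ← Real.rpow_add hk0]; ring_nf
    _ = 4 * k ^ (1 - 2 * b) * (2 * k / (8 * k ^ 2)) := by field_simp; norm_num
    _ ≤ 4 * k ^ (1 - 2 * b) * (2 * k / jb k ξ ^ 2) := by gcongr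

/-- The constants in the a priori bound. -/
def geoC (c : ℝ) : ℝ := ∑' n : ℕ, ((2 : ℝ) ^ (-c)) ^ n

lemma summable_geo {c : ℝ} (hc : 0 < c) : Summable fun n : ℕ => ((2 : ℝ) ^ (-c)) ^ n :=
  summable_geometric_of_lt_one (by positivity) (Real.rpow_lt_one_of_one_lt_of_neg one_lt_two (by linarith))

lemma dyadic_rpow_le {l c : ℝ} (hl : 1 ≤ l) (hc : 0 < c) (n : ℕ) :
    (l * 2 ^ n) ^ (-c) ≤ ((2 : ℝ) ^ (-c)) ^ n := by
  have h2 : (2 : ℝ) ^ n ≤ l * 2 ^ n := le_mul_of_one_le_left (by positivity) hl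
  refine (Real.rpow_le_rpow_of_nonpos (by positivity) h2 (by linarith)).trans_eq ?_
  rw [← Real.rpow_natCast, ← Real.rpow_natCast, ← Real.rpow_mul zero_le_two, ← Real.rpow_mul zero_le_two,
    mul_comm]

/-- After multiplication by `k ^ (1-2b)` the two terms carry the exponents `-(2b-2b')` and
`-(1-2b)`, and both dyadic sums converge because `b' < b < 1/2`. The strict inequality between `b'`
and `b` is the price of summing. -/
lemma norm_sq_le_of_energy_le {b' l X Y : ℝ} (hl : 1 ≤ l) (hl2 : l ≤ 2) (hb0 : 0 ≤ b) (hb : b < 1 / 2)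
    (hb' : b' < b) (hX : 0 ≤ X) (hY : 0 ≤ Y) {q : 𝓢(ℝ, ℂ)}
    (hE : ∀ n : ℕ, energy (l * 2 ^ n) q ≤ X * (l * 2 ^ n) ^ (2 * b' - 1) + Y * (l * 2 ^ n) ^ (4 * b - 2)) :
    ‖schw b q‖ ^ 2 ≤ 4 * X * geoC (2 * b - 2 * b') + 4 * Y * geoC (1 - 2 * b) := by
  have hs1 := (summable_geo (c := 2 * b - 2 * b') (by linarith)).mul_left (4 * X)
  have hs2 := (summable_geo (c := 1 - 2 * b) (by linarith)).mul_left (4 * Y)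
  have hb1 : ∀ n : ℕ, 4 * (l * 2 ^ n) ^ (1 - 2 * b) * energy (l * 2 ^ n) q ≤
      4 * X * ((2 : ℝ) ^ (-(2 * b - 2 * b'))) ^ n + 4 * Y * ((2 : ℝ) ^ (-(1 - 2 * b))) ^ n := fun n => by
    have hk0 : 0 < l * 2 ^ n := by positivity
    have h1 := dyadic_rpow_le hl (c := 2 * b - 2 * b') (by linarith) n
    have h2 := dyadic_rpow_le hl (c := 1 - 2 * b) (by linarith) n
    calc _ ≤ 4 * (l * 2 ^ n) ^ (1 - 2 * b) *
          (X * (l * 2 ^ n) ^ (2 * b' - 1) + Y * (l * 2 ^ n) ^ (4 * b - 2)) := by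
            gcongr; exact hE n
      _ = 4 * X * ((l * 2 ^ n) ^ (1 - 2 * b) * (l * 2 ^ n) ^ (2 * b' - 1)) +
          4 * Y * ((l * 2 ^ n) ^ (1 - 2 * b) * (l * 2 ^ n) ^ (4 * b - 2)) := by ring
      _ = 4 * X * (l * 2 ^ n) ^ (-(2 * b - 2 * b')) + 4 * Y * (l * 2 ^ n) ^ (-(1 - 2 * b)) := by
          rw [← Real.rpow_add hk0, ← Real.rpow_add hk0]; ring_nf
      _ ≤ _ := by gcongr
  have h0 : ∀ n : ℕ, 0 ≤ 4 * X * ((2 : ℝ) ^ (-(2 * b - 2 * b'))) ^ n +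
      4 * Y * ((2 : ℝ) ^ (-(1 - 2 * b))) ^ n := fun n => by positivity
  have h3 : ENNReal.ofReal (‖schw b q‖ ^ 2) ≤
      ENNReal.ofReal (4 * X * geoC (2 * b - 2 * b') + 4 * Y * geoC (1 - 2 * b)) := by
    rw [geoC, geoC, ← tsum_mul_left, ← tsum_mul_left, ← hs1.tsum_add hs2,
      ENNReal.ofReal_tsum_of_nonneg h0 (hs1.add hs2)]
    exact (ofReal_norm_sq_le hl hl2 hb0 q).trans
      (ENNReal.tsum_le_tsum fun n => ENNReal.ofReal_le_ofReal (hb1 n))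
  refine (ENNReal.ofReal_le_ofReal_iff ?_).mp h3
  rw [geoC, geoC, ← tsum_mul_left, ← tsum_mul_left, ← hs1.tsum_add hs2]
  exact tsum_nonneg h0

end

/-! ### The bootstrap argument -/

section
variable {b b' κ η σ : ℝ}

lemma norm_schw_le (hb0 : 0 ≤ b') (hb : b' ≤ b) (q : 𝓢(ℝ, ℂ)) : ‖schw b q‖ ≤ ‖schw b' q‖ := by
  refine Lp.norm_le_norm_of_ae_le ?_
  filter_upwards [schw_ae hb0 q, schw_ae (hb0.trans hb) q] with ξ h1 h2
  rw [h1, h2, norm_mul, norm_mul, norm_jw, norm_jw]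
  gcongr
  exact one_le_jb one_le_abs_one ξ

/-- The conservation law is not available at the parameter of the difference flow itself. If that
parameter is a power of two, the dyadic sequence starts at 3/2 instead of 1, and divisibility by 3
keeps the two apart. -/
lemma exists_dyadic_ne (κ : ℝ) : ∃ l : ℝ, 1 ≤ l ∧ l ≤ 2 ∧ ∀ n : ℕ, κ ≠ l * 2 ^ n := by
  by_cases h : ∀ n : ℕ, κ ≠ 1 * 2 ^ n
  · exact ⟨1, le_rfl, one_le_two, h⟩
  · push Not at h
    obtain ⟨m, hm⟩ := h
    refine ⟨3 / 2, by norm_num, by norm_num, fun n hn => ?_⟩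
    have h1 : (2 ^ (m + 1) : ℕ) = 3 * 2 ^ n := by
      have : (2 : ℝ) ^ (m + 1) = 3 * 2 ^ n := by rw [pow_succ]; linarith
      exact_mod_cast this
    have h2 : 3 ∣ 2 := Nat.prime_three.dvd_of_dvd_pow ⟨_, h1⟩
    omega

/-- A solution that is small initially remains small. -/
lemma Adm.apriori (h : Adm b η) (hb0 : 0 ≤ b') (hb : b' < b) :
    ∃ δ, 0 < δ ∧ δ ≤ η ∧ ∀ σ : ℝ, σ = 1 ∨ σ = -1 → ∀ (κ : ℝ) (V : 𝓢(ℝ, ℂ) → ℝ → ℂ)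
      (j : 𝓢(ℝ, ℂ) → ℝ → ℝ → ℂ), HasLax b η σ κ V j → ∀ (J : Set ℝ) (q : ℝ → 𝓢(ℝ, ℂ)),
      IsOpen J → IsPreconnected J → (0 : ℝ) ∈ J → ‖schw b' (q 0)‖ ≤ δ → IsSchwartzSolution V J q →
      ∀ t ∈ J, ‖schw b (q t)‖ < η := by
  have hg : ∀ c, 0 ≤ geoC c := fun c => tsum_nonneg fun n => by positivity
  set K₁ := 8 * geoC (2 * b - 2 * b') with hK₁
  set K₂ := 8 * ricC b * geoC (1 - 2 * b) with hK₂
  have hK₁0 : 0 ≤ K₁ := mul_nonneg (by norm_num) (hg _)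
  have hK₂0 : 0 ≤ K₂ := mul_nonneg (mul_nonneg (by norm_num) (ricC_nonneg b)) (hg _)
  -- The bootstrap radius: strictly below `η`, so that all constructions remain available on its
  -- closure, and small enough that `K₂ m ≤ 1/2` absorbs the quartic term.
  set m := min (min (η / 2) 1) (1 / (2 * (K₂ + 1))) with hm
  have hη := h.hη
  have hm0 : 0 < m := by positivity
  have hmη : m < η := ((min_le_left _ _).trans (min_le_left _ _)).trans_lt (half_lt_self hη)
  have hm1 : m ≤ 1 := (min_le_left _ _).trans (min_le_right _ _)
  have hmK : K₂ * m ≤ 1 / 2 := by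
    have h1 : m ≤ 1 / (2 * (K₂ + 1)) := min_le_right _ _
    rw [le_div_iff₀ (by positivity)] at h1
    linarith
  set N := K₁ + K₂ + 1 with hN
  have hN1 : 1 ≤ N := by rw [hN]; linarith
  set δ := m / (2 * N) with hδ
  have hδ0 : 0 < δ := by positivity
  have hδm : 2 * N * δ = m := by rw [hδ]; field_simp
  have hδm2 : 2 * δ ≤ m := by nlinarith
  refine ⟨δ, hδ0, by linarith, fun σ hσ κ V j hV J q hJo hJc h0J hq0 hsol => ?_⟩
  choose! v hv using hsol
  have hflow : ∀ t ∈ J, Flow q (v t) t := fun t ht => ⟨(hv t ht).1⟩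
  set M : ℝ → ℝ := fun t => ‖schw b (q t)‖ with hMdef
  have hMc : ∀ t ∈ J, ContinuousAt M t := fun t ht => ((hflow t ht).hasDerivAt (schw b)).continuousAt.norm
  set Φ : ℝ → ℝ → ℂ := fun ϰ t =>
    pairF b ϰ (schw b (q t)) (ric b ϰ η (schw b (q t)) (schw b (rS σ (q t)))) with hΦ
  have hM0 : M 0 ≤ δ := (norm_schw_le hb0 hb.le (q 0)).trans hq0
  have hder : ∀ ϰ : ℝ, 1 ≤ ϰ → κ ≠ ϰ → ∀ t ∈ J, M t < η → HasDerivAt (Φ ϰ) 0 t := fun ϰ hϰ hne t ht hMt => by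
    obtain ⟨A, B, C, c, hL, -⟩ := hV (q t) hMt (v t) (hv t ht).2 ϰ hϰ hne
    exact (h.conservation (le_abs.mpr (Or.inl hϰ)) (hflow t ht) ((hflow t ht).rS σ) hMt
      (by rwa [norm_schw_rS h.hb0.le hσ]) hL).2
  -- Smallness and the constancy of the conserved quantities are propagated together, since each is
  -- needed for the other. `U` is shown to be open and relatively closed in the connected set `J`.
  set U : Set ℝ := {t | t ∈ J ∧ M t < m ∧ ∀ ϰ : ℝ, 1 ≤ ϰ → κ ≠ ϰ → Φ ϰ t = Φ ϰ 0} with hU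
  have h0U : (0 : ℝ) ∈ U := ⟨h0J, by linarith, fun _ _ _ => rfl⟩
  have hUo : IsOpen U := by
    rw [isOpen_iff_mem_nhds]
    intro t ht
    have hnh : ∀ᶠ s in 𝓝 t, s ∈ J ∧ M s < m := by
      filter_upwards [hJo.mem_nhds ht.1, (hMc t ht.1).eventually_lt continuousAt_const ht.2.1]
        with s h1 h2 using ⟨h1, h2⟩
    obtain ⟨ε, hε, hball⟩ := Metric.eventually_nhds_iff_ball.mp hnh
    refine Filter.mem_of_superset (Metric.ball_mem_nhds t hε) fun s hs =>
      ⟨(hball s hs).1, (hball s hs).2, fun ϰ hϰ hne => ?_⟩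
    rw [← ht.2.2 ϰ hϰ hne]
    have hd := fun x (hx : x ∈ Metric.ball t ε) =>
      hder ϰ hϰ hne x (hball x hx).1 ((hball x hx).2.trans hmη)
    exact Metric.isOpen_ball.is_const_of_deriv_eq_zero (convex_ball t ε).isPreconnected
      (fun x hx => (hd x hx).differentiableAt.differentiableWithinAt) (fun x hx => (hd x hx).deriv)
      hs (Metric.mem_ball_self hε)
  have hUc : closure U ∩ J ⊆ U := by
    rintro t ⟨htc, htJ⟩
    have hne : (𝓝[U] t).NeBot := mem_closure_iff_nhdsWithin_neBot.mp htc
    have htend : Tendsto M (𝓝[U] t) (𝓝 (M t)) := (hMc t htJ).tendsto.mono_left nhdsWithin_le_nhds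
    have hev : ∀ᶠ s in 𝓝[U] t, M s ≤ m := by
      filter_upwards [self_mem_nhdsWithin] with s (hs : s ∈ U) using hs.2.1.le
    have hMt : M t ≤ m := le_of_tendsto htend hev
    have hΦt : ∀ ϰ : ℝ, 1 ≤ ϰ → κ ≠ ϰ → Φ ϰ t = Φ ϰ 0 := fun ϰ hϰ hneq => by
      have h1 := (hder ϰ hϰ hneq t htJ (hMt.trans_lt hmη)).continuousAt.tendsto.mono_left
        (nhdsWithin_le_nhds (s := U))
      refine tendsto_nhds_unique h1 (tendsto_const_nhds.congr' ?_)
      filter_upwards [self_mem_nhdsWithin] with s hs using (hs.2.2 ϰ hϰ hneq).symm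
    refine ⟨htJ, ?_, hΦt⟩
    -- On the closure smallness is known only with `≤ m`; comparing the energies at time `t` and at
    -- time 0 restores the strict inequality.
    obtain ⟨l, hl, hl2, hln⟩ := exists_dyadic_ne κ
    have hC := ricC_nonneg b
    have hMn : 0 ≤ M t := norm_nonneg _
    have hE : ∀ n : ℕ, energy (l * 2 ^ n) (q t) ≤ (2 * δ ^ 2) * (l * 2 ^ n) ^ (2 * b' - 1) +
        (2 * ricC b * (M t ^ 4 + δ ^ 4)) * (l * 2 ^ n) ^ (4 * b - 2) := fun n => by
      have hk : 1 ≤ l * 2 ^ n := one_le_mul_of_one_le_of_one_le hl (one_le_pow₀ one_le_two)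
      have e1 := (abs_le.mp (h.abs_energy_sub_le hk hσ (hMt.trans hmη.le))).2
      have e2 := (abs_le.mp (h.abs_energy_sub_le hk hσ (q := q 0) (by change M 0 ≤ η; linarith))).1
      have e3 : (pairF b (l * 2 ^ n) (schw b (q t)) _).re = _ := congrArg re (hΦt (l * 2 ^ n) hk (hln n))
      rw [e3] at e1
      have e4 := energy_le (b' := b') hb0 (by linarith [h.hb]) hk (q 0)
      have hk4 : 0 ≤ (l * 2 ^ n) ^ (4 * b - 2) := by positivity
      have hk5 : 0 ≤ (l * 2 ^ n) ^ (2 * b' - 1) := by positivity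
      have e5 : ‖schw b' (q 0)‖ ^ 2 ≤ δ ^ 2 := pow_le_pow_left₀ (norm_nonneg _) hq0 2
      have e6 : ‖schw b (q 0)‖ ^ 4 ≤ δ ^ 4 := pow_le_pow_left₀ (norm_nonneg _) hM0 4
      have e7 : 2 * (l * 2 ^ n) ^ (2 * b' - 1) * ‖schw b' (q 0)‖ ^ 2 ≤
          2 * (l * 2 ^ n) ^ (2 * b' - 1) * δ ^ 2 := by gcongr
      have e8 : 2 * ricC b * (l * 2 ^ n) ^ (4 * b - 2) * ‖schw b (q 0)‖ ^ 4 ≤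
          2 * ricC b * (l * 2 ^ n) ^ (4 * b - 2) * δ ^ 4 := by gcongr
      change _ ≤ _ * ‖schw b (q t)‖ ^ 4 at e1
      simp only [hΦ] at e1
      change _ ≤ 2 * δ ^ 2 * _ + 2 * ricC b * (‖schw b (q t)‖ ^ 4 + δ ^ 4) * _
      linarith
    have hfin := norm_sq_le_of_energy_le hl hl2 h.hb0.le h.hb hb (by positivity) (by positivity) hE
    have h1 : M t ^ 2 ≤ K₁ * δ ^ 2 + K₂ * (M t ^ 4 + δ ^ 4) := by
      refine hfin.trans_eq ?_
      rw [hK₁, hK₂]; ring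
    have h2 : K₂ * M t ^ 4 ≤ 1 / 2 * M t ^ 2 := by
      have : K₂ * M t ^ 2 ≤ 1 / 2 := by
        calc K₂ * M t ^ 2 ≤ K₂ * m ^ 2 := by gcongr
          _ ≤ K₂ * m := by
            gcongr
            nlinarith
          _ ≤ 1 / 2 := hmK
      calc K₂ * M t ^ 4 = (K₂ * M t ^ 2) * M t ^ 2 := by ring
        _ ≤ _ := by gcongr
    have h3 : δ ^ 4 ≤ δ ^ 2 := pow_le_pow_of_le_one hδ0.le (by linarith) (by norm_num)
    have h4 : K₂ * δ ^ 4 ≤ K₂ * δ ^ 2 := by gcongr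
    -- Half of `M t ^ 2` has been absorbed. The choice `2 N δ = m` makes the right side at most `m
    -- δ`, which is smaller than `m ^ 2`.
    have h5 : M t ^ 2 ≤ 2 * (K₁ + K₂) * δ ^ 2 := by linarith
    have h6 : 2 * (K₁ + K₂) * δ ^ 2 ≤ m * δ := by
      rw [← hδm, hN]; nlinarith [sq_nonneg δ]
    have h7 : M t ^ 2 < m ^ 2 := by nlinarith
    exact lt_of_pow_lt_pow_left₀ 2 hm0.le h7
  have hsub := hJc.subset_of_closure_inter_subset hUo ⟨0, h0J, h0U⟩ hUc
  exact fun t ht => (hsub ht).2.1.trans hmη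

/-- The conservation law along a solution that is small initially. -/
lemma Adm.conservationLaw (h : Adm b η) (hσ : σ = 1 ∨ σ = -1) {V : 𝓢(ℝ, ℂ) → ℝ → ℂ}
    {j : 𝓢(ℝ, ℂ) → ℝ → ℝ → ℂ} (hV : HasLax b η σ κ V j) {J : Set ℝ} {q : ℝ → 𝓢(ℝ, ℂ)}
    (hsmall : ∀ t ∈ J, ‖schw b (q t)‖ < η) (hsol : IsSchwartzSolution V J q) {ϰ : ℝ} (hϰ : 1 ≤ ϰ)
    (hne : κ ≠ ϰ) {t : ℝ} (ht : t ∈ J) :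
    DensityDefined σ (q t) ϰ ∧ (∀ k : ℝ, 1 ≤ |k| → HasGreen σ (q t) k) ∧
      ∀ x, ConservationLawAt (fun τ => rho σ (q τ) ϰ) (fun τ => j (q τ) ϰ) t x := by
  have hq := hsmall t ht
  have hr : ‖schw b (rS σ (q t))‖ ≤ η := by rw [norm_schw_rS h.hb0.le hσ]; exact hq.le
  have hϰ' : 1 ≤ |ϰ| := le_abs.mpr (Or.inl hϰ)
  have hrep := rep_schwartz' (σ := σ) h.hb0.le (q t)
  obtain ⟨v, hv1, hv2⟩ := hsol t ht
  obtain ⟨A, B, C, c, hL, hj⟩ := hV (q t) hq v hv2 ϰ hϰ hne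
  exact ⟨hrep.densityDefined h hϰ' hq.le hr, fun k hk => hrep.hasGreen h hk hq.le hr,
    fun x => h.conservationLawAt hϰ' hσ ⟨hv1⟩ hq hL hj x⟩

end

end AKNS

end

theorem corollary4p11 (s : ℝ) (hs : -(1 / 2) < s) (hs0 : s < 0) :
    ∃ δ : ℝ, 0 < δ ∧ ∀ σ : ℝ, σ = 1 ∨ σ = -1 →
      -- the integral of the density is the logarithmic perturbation determinant, on a ball of `H^s`
      (∀ q : 𝓢'(ℝ, ℂ), AKNS.sobolevNorm s q ≤ ENNReal.ofReal δ → ∀ κ : ℝ, 1 ≤ |κ| →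
        AKNS.DensityDefined σ q κ ∧
        (∀ m : ℕ, ∃ a : ℂ,
          AKNS.HasOpTrace ((AKNS.opLambda q κ * AKNS.opGamma σ q κ) ^ (m + 1)) a) ∧
        Summable (fun m => ‖AKNS.logDetTerm σ q κ m‖) ∧
        (let F₁ : ℝ → ℂ := fun x => AKNS.g21 σ q κ x / (2 + AKNS.gam σ q κ x)
         let F₂ : ℝ → ℂ := fun x => AKNS.g12 σ q κ x / (2 + AKNS.gam σ q κ x)
         (MemLp F₁ 2 (volume : Measure ℝ) ∧ AKNS.sobolevNorm (-s) (AKNS.ofL2 F₁) < ⊤) ∧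
         (MemLp F₂ 2 (volume : Measure ℝ) ∧ AKNS.sobolevNorm (-s) (AKNS.ofL2 F₂) < ⊤) ∧
         AKNS.logDet σ q κ =
           AKNS.dualPair q (AKNS.ofL2 F₁) - AKNS.dualPairR σ q (AKNS.ofL2 F₂))) ∧
      -- for Schwartz functions it is a classical integral
      (∀ q : 𝓢(ℝ, ℂ), AKNS.sobolevNorm s q ≤ ENNReal.ofReal δ → ∀ κ : ℝ, 1 ≤ |κ| →
        Integrable (AKNS.rho σ q κ) ∧ AKNS.logDet σ q κ = ∫ x, AKNS.rho σ q κ x) ∧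
      -- the microscopic conservation laws
      (∀ (J : Set ℝ) (q : ℝ → 𝓢(ℝ, ℂ)), IsOpen J → IsPreconnected J → (0 : ℝ) ∈ J →
        AKNS.sobolevNorm s (q 0) ≤ ENNReal.ofReal δ → ∀ ϰ : ℝ, 1 ≤ ϰ →
        (AKNS.IsSchwartzSolution (AKNS.fieldNLS σ) J q → ∀ t ∈ J,
          AKNS.DensityDefined σ (q t) ϰ ∧
          ∀ x, AKNS.ConservationLawAt (fun τ => AKNS.rho σ (q τ) ϰ)
            (fun τ => AKNS.jNLS σ (q τ) ϰ) t x) ∧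
        (AKNS.IsSchwartzSolution (AKNS.fieldMKdV σ) J q → ∀ t ∈ J,
          AKNS.DensityDefined σ (q t) ϰ ∧
          ∀ x, AKNS.ConservationLawAt (fun τ => AKNS.rho σ (q τ) ϰ)
            (fun τ => AKNS.jMKdV σ (q τ) ϰ) t x) ∧
        ∀ κ : ℝ, 1 ≤ κ → κ ≠ ϰ →
          (AKNS.IsSchwartzSolution (AKNS.fieldNLSdiff σ κ) J q → ∀ t ∈ J,
            AKNS.DensityDefined σ (q t) ϰ ∧ AKNS.HasGreen σ (q t) κ ∧ AKNS.HasGreen σ (q t) (-κ) ∧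
            ∀ x, AKNS.ConservationLawAt (fun τ => AKNS.rho σ (q τ) ϰ)
              (fun τ => AKNS.jNLSdiff σ (q τ) ϰ κ) t x) ∧
          (AKNS.IsSchwartzSolution (AKNS.fieldMKdVdiff σ κ) J q → ∀ t ∈ J,
            AKNS.DensityDefined σ (q t) ϰ ∧ AKNS.HasGreen σ (q t) κ ∧ AKNS.HasGreen σ (q t) (-κ) ∧
            ∀ x, AKNS.ConservationLawAt (fun τ => AKNS.rho σ (q τ) ϰ)
              (fun τ => AKNS.jMKdVdiff σ (q τ) ϰ κ) t x)) := by
  -- The fixed point and operator constructions work in H^(-b), slightly weaker than H^s; the gap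
  -- between `-s` and `b` is used up by the dyadic summation in the a priori bound.
  obtain ⟨b, hsb, hb⟩ := exists_between (show -s < 1 / 2 by linarith)
  have hb0 : 0 < b := by linarith
  obtain ⟨η, h⟩ := AKNS.exists_adm hb0 hb
  obtain ⟨δ, hδ, hδη, hap⟩ := h.apriori (b' := -s) (by linarith) hsb
  refine ⟨δ, hδ, fun σ hσ => ⟨fun q hq κ hκ => ?_, fun q hq κ hκ => ?_, fun J q hJ hJc h0 hq ϰ hϰ => ?_⟩⟩
  · obtain ⟨p, hp, hr⟩ := AKNS.exists_rep (b := b) σ (by linarith) hδ.le hq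
    have hpη := hp.trans hδη
    have hRη : ‖(σ : ℂ) • AKNS.reflC p‖ ≤ η := by rwa [AKNS.norm_smul_reflC hσ]
    have hκ' : 1 ≤ |-κ| := by rwa [abs_neg]
    refine ⟨hr.densityDefined h hκ hpη hRη, fun m => ⟨_, hr.hasOpTrace_pow h hκ hpη hRη m⟩, ?_, ?_⟩
    · simp only [hr.logDetTerm_eq h hκ hpη hRη]
      exact h.summable_ld hκ hpη hRη
    · simp only [fun x => (hr.quotient_eq h hκ hpη hRη x).1, fun x => (hr.quotient_eq h hκ hpη hRη x).2]
      refine ⟨⟨(AKNS.evF_spec hb hκ _).1, AKNS.sobolevNorm_evF_lt_top hb hκ (by linarith) (by linarith) _⟩,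
        ⟨(AKNS.evF_spec hb hκ' _).1, AKNS.sobolevNorm_evF_lt_top hb hκ' (by linarith) (by linarith) _⟩, ?_⟩
      rw [hr.logDet_eq h hκ hpη hRη]
      exact congrArg₂ (· - ·) (AKNS.pairing_eq hb0.le hb hκ hr.hq _).symm
        (AKNS.pairing_eq hb0.le hb hκ' hr.hr _).symm
  · obtain ⟨p, hp, hr⟩ := AKNS.exists_rep (b := b) σ (by linarith) hδ.le hq
    have hr' := AKNS.rep_schwartz' (σ := σ) hb0.le q
    have hqη : ‖AKNS.schw b q‖ ≤ η := by rw [← hr.unique hr']; exact hp.trans hδη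
    have hrη : ‖AKNS.schw b (AKNS.rS σ q)‖ ≤ η := by rwa [AKNS.norm_schw_rS hb0.le hσ]
    have hκ' : 1 ≤ |-κ| := by rwa [abs_neg]
    have e : AKNS.rho σ q κ = fun x => q x * AKNS.ricF b κ η (AKNS.schw b q) (AKNS.schw b (AKNS.rS σ q)) x -
        AKNS.rS σ q x * AKNS.ricF b (-κ) η (AKNS.schw b (AKNS.rS σ q)) (AKNS.schw b q) x := by
      funext x
      rw [hr'.rho_eq h hκ hqη hrη, AKNS.rS_apply]
    have i1 := AKNS.integrable_schwartz_mul q (h.continuous_ricF hκ (AKNS.schw b q) (AKNS.schw b (AKNS.rS σ q)))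
      (h.norm_ricF_le hκ hqη hrη)
    have i2 := AKNS.integrable_schwartz_mul (AKNS.rS σ q)
      (h.continuous_ricF hκ' (AKNS.schw b (AKNS.rS σ q)) (AKNS.schw b q)) (h.norm_ricF_le hκ' hrη hqη)
    rw [e]
    refine ⟨i1.sub i2, ?_⟩
    rw [integral_sub i1 i2, hr'.logDet_eq h hκ hqη hrη, AKNS.pairF_schw hb0.le hb hκ,
      AKNS.pairF_schw hb0.le hb hκ']
    rfl
  -- The initial data are measured with the exact weight `-s`, whereas the solution is controlled
  -- with the weight `b`.
  · obtain ⟨p, hp, hr⟩ := AKNS.exists_rep (b := -s) σ (by linarith) hδ.le hq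
    have hq0 : ‖AKNS.schw (-s) (q 0)‖ ≤ δ := by
      rw [← hr.unique (AKNS.rep_schwartz' (σ := σ) (by linarith) (q 0))]; exact hp
    have key := fun {κ : ℝ} {V} {j} (hV : AKNS.HasLax b η σ κ V j) (hne : κ ≠ ϰ)
        (hsol : AKNS.IsSchwartzSolution V J q) (t : ℝ) (ht : t ∈ J) =>
      h.conservationLaw hσ hV (hap σ hσ κ V j hV J q hJ hJc h0 hq0 hsol) hsol hϰ hne ht
    have hϰ0 : (0 : ℝ) ≠ ϰ := by intro e; linarith
    refine ⟨fun hsol t ht => ?_, fun hsol t ht => ?_, fun κ hκ hne => ⟨fun hsol t ht => ?_, fun hsol t ht => ?_⟩⟩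
    · obtain ⟨h1, -, h2⟩ := key (h.hasLax_nls hσ) hϰ0 hsol t ht
      exact ⟨h1, h2⟩
    · obtain ⟨h1, -, h2⟩ := key (h.hasLax_mkdv hσ) hϰ0 hsol t ht
      exact ⟨h1, h2⟩
    · obtain ⟨h1, h2, h3⟩ := key (h.hasLax_nlsDiff hσ hκ) hne hsol t ht
      exact ⟨h1, h2 κ (le_abs.mpr (Or.inl hκ)), h2 (-κ) (by rw [abs_neg]; exact le_abs.mpr (Or.inl hκ)), h3⟩
    · obtain ⟨h1, h2, h3⟩ := key (h.hasLax_mkdvDiff hσ hκ) hne hsol t ht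
      exact ⟨h1, h2 κ (le_abs.mpr (Or.inl hκ)), h2 (-κ) (by rw [abs_neg]; exact le_abs.mpr (Or.inl hκ)), h3⟩
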